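/- **Setting.** Let $\mathfrak g$ be a finite dimensional complex semisimple Lie algebra and $\mathfrak g'\subset\mathfrak g$ a reductive subalgebra, i.e. the adjoint representation of $\mathfrak g'$ on $\mathfrak g$ is completely reducible. Let $H\in\mathfrak g'$ be hyperbolic, i.e. $\operatorname{ad}(H)$ is a semisimple endomorphism of $\mathfrak g$ with real eigenvalues, and let $\mathfrak u_+$, $\mathfrak l$, $\mathfrak u_-$ be the sums of the eigenspaces of $\operatorname{ad}(H)$ with positive, zero and negative eigenvalues; thus $\mathfrak p=\mathfrak l+\mathfrak u_+$ is a $\mathfrak g'$-compatible parabolic subalgebra. Put $\mathfrak l'=\mathfrak l\cap\mathfrak g'$, $\mathfrak u'_+=\mathfrak u_+\cap\mathfrak g'$, $\mathfrak p'=\mathfrak p\cap\mathfrak g'=\mathfrak l'+\mathfrak u_+'$. Let $\mathfrak j'\ni H$ be a Cartan subalgebra of $\mathfrak g'$ and $\mathfrak j\supset\mathfrak j'$ a Cartan subalgebra of $\mathfrak g$. Fix positive systems $\Delta^+\subset\Delta(\mathfrak g,\mathfrak j)$ and $\Delta'^+\subset\Delta(\mathfrak g',\mathfrak j')$ all of whose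 root spaces lie in $\mathfrak p$, respectively $\mathfrak p'$. Let $\Lambda^+(\mathfrak l)$ be the set of $\lambda\in\mathfrak j^*$ with $\langle\lambda,\alpha^\vee\rangle\in\mathbb N$ for all $\alpha\in\Delta^+\cap\Delta(\mathfrak l,\mathfrak j)$, and let $F_\lambda$ be the finite dimensional simple $\mathfrak l$-module with highest weight $\lambda$; define $\Lambda^+(\mathfrak l')\subset\mathfrak j'^*$ and $F'_\delta$ in the same way for $\mathfrak l'$, $\mathfrak j'$, $\Delta'^+$. Inflating by letting $\mathfrak u_+$, $\mathfrak u'_+$ act by zero, put $M^{\mathfrak g}_{\mathfrak p}(\lambda)=U(\mathfrak g)\otimes_{U(\mathfrak p)}F_\lambda$ and $M^{\mathfrak g'}_{\mathfrak p'}(\delta)=U(\mathfrak g')\otimes_{U(\mathfrak p')}F'_\delta$. Let $\mathcal O^{\mathfrak p'}$ be the category of finitely generated $\mathfrak g'$-modules that are direct sums of $\mathfrak j'$-weight spaces and are locally finite under $\bigoplus_{\alpha\in\Delta'^+}\mathfrak g'_{\alpha}$ and under $\bigoplus_{\alpha\in\Delta'^+\cap\Delta(\mathfrak l',\mathfrak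 j')}\mathfrak g'_{-\alpha}$. Let $\mathfrak l'$ act on the symmetric algebra $S(\mathfrak u_- /\mathfrak u_-\cap\mathfrak g')$ by the derivations extending the adjoint action, and put $$m(\delta;\lambda)=\dim\operatorname{Hom}_{\mathfrak l'}\bigl(F'_\delta,\,F_\lambda|_{\mathfrak l'}\otimes S(\mathfrak u_- /\mathfrak u_-\cap\mathfrak g')\bigr).$$ **Theorem.** Let $\lambda\in\Lambda^+(\mathfrak l)$. 1. $m(\delta;\lambda)<\infty$ for all $\delta\in\Lambda^+(\mathfrak l')$. 2. In the (completed) Grothendieck group of $\mathcal O^{\mathfrak p'}$, $$M^{\mathfrak g}_{\mathfrak p}(\lambda)|_{\mathfrak g'}=\bigoplus_{\delta\in\Lambda^+(\mathfrak l')}m(\delta;\lambda)\,M^{\mathfrak g'}_{\mathfrak p'}(\delta).$$ Explicitly, 2. means the following. The $\mathfrak g'$-module $M^{\mathfrak g}_{\mathfrak p}(\lambda)|_{\mathfrak g'}$ is the union of an increasing sequence of submodules that belong to $\mathcal O^{\mathfrak p'}$; the modules $M^{\mathfrak g'}_{\mathfrak p'}(\delta)$ with $m(\delta;\lambda)\ne0$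 belong to $\mathcal O^{\mathfrak p'}$; and for every simple object $S$ of $\mathcal O^{\mathfrak p'}$ one has $$[M^{\mathfrak g}_{\mathfrak p}(\lambda)|_{\mathfrak g'}:S]=\sum_{\delta\in\Lambda^+(\mathfrak l')}m(\delta;\lambda)\,[M^{\mathfrak g'}_{\mathfrak p'}(\delta):S]<\infty,$$ where $[X:S]$ is the supremum of all $n$ for which there are submodules $A_1\subset B_1\subset A_2\subset B_2\subset\dots\subset A_n\subset B_n$ of $X$ with $B_i/A_i\simeq S$ for all $i$. -/

import Mathlib

open scoped TensorProduct

noncomputable section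

namespace BGG

universe u v w

/-! ### The symmetric algebra of a Lie module -/

section SymmetricAlgebraModule

variable {V : Type v} [AddCommGroup V] [Module ℂ V]

/-- The algebra homomorphism `S(V) → S(V)[ε]` with `v ↦ v + ε T v`. -/
def symDualHom (T : Module.End ℂ V) :
    SymmetricAlgebra ℂ V →ₐ[ℂ] TrivSqZeroExt (SymmetricAlgebra ℂ V) (SymmetricAlgebra ℂ V) :=
  SymmetricAlgebra.lift
    ((TrivSqZeroExt.inlAlgHom ℂ (SymmetricAlgebra ℂ V) (SymmetricAlgebra ℂ V)).toLinearMap ∘ₗ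
        SymmetricAlgebra.ι ℂ V +
      (TrivSqZeroExt.inrHom (SymmetricAlgebra ℂ V) (SymmetricAlgebra ℂ V)).restrictScalars ℂ ∘ₗ
        SymmetricAlgebra.ι ℂ V ∘ₗ T)

theorem fst_symDualHom (T : Module.End ℂ V) (s : SymmetricAlgebra ℂ V) :
    (symDualHom T s).fst = s := by
  have h : (TrivSqZeroExt.fstHom ℂ (SymmetricAlgebra ℂ V) (SymmetricAlgebra ℂ V)).comp
      (symDualHom T) = AlgHom.id ℂ _ := by
    apply SymmetricAlgebra.algHom_ext
    ext v
    simp [symDualHom]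
  exact congrArg (fun f => f s) h

/-- The derivation of `S(V)` that extends an endomorphism `T` of `V`. -/
def symDer (T : Module.End ℂ V) :
    Derivation ℂ (SymmetricAlgebra ℂ V) (SymmetricAlgebra ℂ V) :=
  Derivation.mk'
    ((TrivSqZeroExt.sndHom (SymmetricAlgebra ℂ V) (SymmetricAlgebra ℂ V)).restrictScalars ℂ ∘ₗ
      (symDualHom T).toLinearMap) (by
    intro a b
    simp [fst_symDualHom, mul_comm])

@[simp] theorem symDer_ι (T : Module.End ℂ V) (v : V) :
    symDer T (SymmetricAlgebra.ι ℂ V v) = SymmetricAlgebra.ι ℂ V (T v) := by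
  simp [symDer, symDualHom]

theorem symDer_ext {D₁ D₂ : Derivation ℂ (SymmetricAlgebra ℂ V) (SymmetricAlgebra ℂ V)}
    (h : ∀ v, D₁ (SymmetricAlgebra.ι ℂ V v) = D₂ (SymmetricAlgebra.ι ℂ V v)) : D₁ = D₂ := by
  ext s
  induction s using SymmetricAlgebra.induction with
  | algebraMap r => simp
  | ι x => exact h x
  | mul a b ha hb => simp [ha, hb]
  | add a b ha hb => simp [ha, hb]

variable {L : Type u} [LieRing L] [LieAlgebra ℂ L] [LieRingModule L V] [LieModule ℂ L V]

/-- A Lie algebra acting on `V` acts on `S(V)` by derivations. -/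
instance symLieRingModule : LieRingModule L (SymmetricAlgebra ℂ V) where
  bracket x s := symDer (LieModule.toEnd ℂ L V x) s
  add_lie x y s := by
    have h : symDer (LieModule.toEnd ℂ L V (x + y)) =
        symDer (LieModule.toEnd ℂ L V x) + symDer (LieModule.toEnd ℂ L V y) :=
      symDer_ext (by intro v; simp)
    simp only [h, Derivation.add_apply]
  lie_add x s t := map_add _ s t
  leibniz_lie x y s := by
    have h : symDer (LieModule.toEnd ℂ L V ⁅x, y⁆) =
        ⁅symDer (LieModule.toEnd ℂ L V x), symDer (LieModule.toEnd ℂ L V y)⁆ :=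
      symDer_ext (by intro v; simp [Derivation.commutator_apply])
    simp only [h, Derivation.commutator_apply, sub_add_cancel]

theorem sym_lie_def (x : L) (s : SymmetricAlgebra ℂ V) :
    ⁅x, s⁆ = symDer (LieModule.toEnd ℂ L V x) s := rfl

instance symLieModule : LieModule ℂ L (SymmetricAlgebra ℂ V) where
  smul_lie t x s := by
    have h : symDer (LieModule.toEnd ℂ L V (t • x)) =
        t • symDer (LieModule.toEnd ℂ L V x) :=
      symDer_ext (by intro v; simp)
    simp only [sym_lie_def, h, Derivation.smul_apply]
  lie_smul t x s := (symDer (LieModule.toEnd ℂ L V x)).map_smul t s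

end SymmetricAlgebraModule

/-! ### Pulling a module back along a homomorphism of Lie algebras -/

section Pullback

variable {L₁ : Type u} {L₂ : Type v} [LieRing L₁] [LieAlgebra ℂ L₁] [LieRing L₂] [LieAlgebra ℂ L₂]

/-- The `L₂`-module `M`, regarded as an `L₁`-module through `f : L₁ → L₂`. -/
def Pullback (_f : L₁ →ₗ⁅ℂ⁆ L₂) (M : Type w) : Type w := M

variable (f : L₁ →ₗ⁅ℂ⁆ L₂) (M : Type w) [AddCommGroup M] [Module ℂ M]
  [LieRingModule L₂ M] [LieModule ℂ L₂ M]

instance : AddCommGroup (Pullback f M) := inferInstanceAs (AddCommGroup M)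
instance : Module ℂ (Pullback f M) := inferInstanceAs (Module ℂ M)
instance : LieRingModule L₁ (Pullback f M) := LieRingModule.compLieHom M f
instance : LieModule ℂ L₁ (Pullback f M) := LieModule.compLieHom M f

end Pullback

/-! ### Modules over the enveloping algebra as Lie modules -/

section Enveloping

attribute [local instance] LieRing.ofAssociativeRing

variable {𝔞 : Type u} [LieRing 𝔞] [LieAlgebra ℂ 𝔞]
variable (X : Type v) [AddCommGroup X] [Module ℂ X] [Module (UniversalEnvelopingAlgebra ℂ 𝔞) X]
  [IsScalarTower ℂ (UniversalEnvelopingAlgebra ℂ 𝔞) X]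

/-- The action of `𝔞` on a `U(𝔞)`-module. -/
abbrev envLieRingModule : LieRingModule 𝔞 X where
  bracket x m := UniversalEnvelopingAlgebra.ι ℂ x • m
  add_lie x y m := by
    rw [map_add, add_smul]
  lie_add x m n := smul_add _ m n
  leibniz_lie x y m := by
    change UniversalEnvelopingAlgebra.ι ℂ x • UniversalEnvelopingAlgebra.ι ℂ y • m =
      UniversalEnvelopingAlgebra.ι ℂ ⁅x, y⁆ • m +
        UniversalEnvelopingAlgebra.ι ℂ y • UniversalEnvelopingAlgebra.ι ℂ x • m
    rw [LieHom.map_lie, LieRing.of_associative_ring_bracket, sub_smul, mul_smul, mul_smul,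
      sub_add_cancel]

theorem envLieModule :
    letI := envLieRingModule (𝔞 := 𝔞) X
    LieModule ℂ 𝔞 X :=
  letI := envLieRingModule (𝔞 := 𝔞) X
  { smul_lie := fun t x m => by
      change UniversalEnvelopingAlgebra.ι ℂ (t • x) • m = t • UniversalEnvelopingAlgebra.ι ℂ x • m
      rw [map_smul, smul_assoc]
    lie_smul := fun t x m => by
      change UniversalEnvelopingAlgebra.ι ℂ x • t • m = t • UniversalEnvelopingAlgebra.ι ℂ x • m
      rw [← algebraMap_smul (UniversalEnvelopingAlgebra ℂ 𝔞) t m, ← mul_smul,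
        ← Algebra.commutes, mul_smul, algebraMap_smul] }

end Enveloping

/-! ### Generalized Verma modules -/

section GenVerma

variable {𝔞 : Type u} [LieRing 𝔞] [LieAlgebra ℂ 𝔞]

/-- The relations `(y + z) ⊗ v = 1 ⊗ y v` for `y ∈ 𝔩`, `z ∈ 𝔲`, `v ∈ F`, closed under the left
action of `U(𝔞)`: they make the tensor product balanced over `U(𝔩 + 𝔲)`, where `F` is
inflated from `𝔩` to `𝔩 + 𝔲` by letting `𝔲` act by zero. -/
def genVermaRel (𝔩 : LieSubalgebra ℂ 𝔞) (𝔲 : Submodule ℂ 𝔞) (F : Type v) [AddCommGroup F]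
    [Module ℂ F] [LieRingModule 𝔩 F] :
    Submodule (UniversalEnvelopingAlgebra ℂ 𝔞) (UniversalEnvelopingAlgebra ℂ 𝔞 ⊗[ℂ] F) :=
  Submodule.span _ {t | ∃ (y : 𝔩) (z : 𝔞) (_ : z ∈ 𝔲) (v : F),
    t = UniversalEnvelopingAlgebra.ι ℂ ((y : 𝔞) + z) ⊗ₜ[ℂ] v - 1 ⊗ₜ[ℂ] ⁅y, v⁆}

/-- The generalized Verma module `U(𝔞) ⊗_{U(𝔭)} F` with `𝔭 = 𝔩 + 𝔲`. -/
def GenVerma (𝔩 : LieSubalgebra ℂ 𝔞) (𝔲 : Submodule ℂ 𝔞) (F : Type v) [AddCommGroup F]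
    [Module ℂ F] [LieRingModule 𝔩 F] : Type (max u v) :=
  (UniversalEnvelopingAlgebra ℂ 𝔞 ⊗[ℂ] F) ⧸ genVermaRel 𝔩 𝔲 F

variable (𝔩 : LieSubalgebra ℂ 𝔞) (𝔲 : Submodule ℂ 𝔞) (F : Type v) [AddCommGroup F]
  [Module ℂ F] [LieRingModule 𝔩 F]

instance : AddCommGroup (GenVerma 𝔩 𝔲 F) :=
  inferInstanceAs (AddCommGroup ((UniversalEnvelopingAlgebra ℂ 𝔞 ⊗[ℂ] F) ⧸ genVermaRel 𝔩 𝔲 F))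
instance : Module (UniversalEnvelopingAlgebra ℂ 𝔞) (GenVerma 𝔩 𝔲 F) :=
  inferInstanceAs (Module (UniversalEnvelopingAlgebra ℂ 𝔞)
    ((UniversalEnvelopingAlgebra ℂ 𝔞 ⊗[ℂ] F) ⧸ genVermaRel 𝔩 𝔲 F))
instance : Module ℂ (GenVerma 𝔩 𝔲 F) :=
  inferInstanceAs (Module ℂ ((UniversalEnvelopingAlgebra ℂ 𝔞 ⊗[ℂ] F) ⧸ genVermaRel 𝔩 𝔲 F))
instance : IsScalarTower ℂ (UniversalEnvelopingAlgebra ℂ 𝔞) (GenVerma 𝔩 𝔲 F) :=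
  inferInstanceAs (IsScalarTower ℂ (UniversalEnvelopingAlgebra ℂ 𝔞)
    ((UniversalEnvelopingAlgebra ℂ 𝔞 ⊗[ℂ] F) ⧸ genVermaRel 𝔩 𝔲 F))
instance : LieRingModule 𝔞 (GenVerma 𝔩 𝔲 F) := envLieRingModule (GenVerma 𝔩 𝔲 F)
instance : LieModule ℂ 𝔞 (GenVerma 𝔩 𝔲 F) := envLieModule (GenVerma 𝔩 𝔲 F)

end GenVerma

/-! ### Roots, positive systems, dominant weights -/

section Roots

variable {𝔞 : Type u} [LieRing 𝔞] [LieAlgebra ℂ 𝔞] (𝔧 : LieSubalgebra ℂ 𝔞)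

/-- The weight space `X_μ = {v | h v = μ(h) v for all h ∈ 𝔧}`. -/
abbrev wt (X : Type v) [AddCommGroup X] [Module ℂ X] [LieRingModule 𝔞 X] [LieModule ℂ 𝔞 X]
    (μ : Module.Dual ℂ 𝔧) : Submodule ℂ X :=
  (LieModule.weightSpace X (μ : 𝔧 → ℂ)).toSubmodule

/-- The set `Δ(𝔩, 𝔧)` of roots in a subalgebra `𝔩` (in particular for `𝔩 = ⊤`, the whole Lie
algebra). -/
def roots (𝔩 : LieSubalgebra ℂ 𝔞) : Set (Module.Dual ℂ 𝔧) :=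
  {α | α ≠ 0 ∧ wt 𝔧 𝔞 α ⊓ 𝔩.toSubmodule ≠ ⊥}

/-- `P` is a positive system of `Δ(𝔞, 𝔧)`. -/
structure IsPositiveSystem (P : Set (Module.Dual ℂ 𝔧)) : Prop where
  subset : P ⊆ roots 𝔧 ⊤
  xor_neg : ∀ α ∈ roots 𝔧 ⊤, Xor (α ∈ P) (-α ∈ P)
  add_mem : ∀ α ∈ P, ∀ β ∈ P, α + β ∈ roots 𝔧 ⊤ → α + β ∈ P

/-- `h` is the coroot `α^∨`: the element of `[𝔞_α, 𝔞_{-α}]` with `α(h) = 2`. -/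
def IsCoroot (α : Module.Dual ℂ 𝔧) (h : 𝔧) : Prop :=
  α h = 2 ∧ ∃ e ∈ wt 𝔧 𝔞 α, ∃ f ∈ wt 𝔧 𝔞 (-α), (h : 𝔞) = ⁅e, f⁆

/-- `Λ⁺(𝔩)`: the weights `λ` with `⟨λ, α^∨⟩ ∈ ℕ` for all `α ∈ Δ⁺(𝔩) = Δ⁺ ∩ Δ(𝔩)`. -/
def dominant (P : Set (Module.Dual ℂ 𝔧)) (𝔩 : LieSubalgebra ℂ 𝔞) : Set (Module.Dual ℂ 𝔧) :=
  {lam | ∀ α ∈ P ∩ roots 𝔧 𝔩, ∀ h : 𝔧, IsCoroot 𝔧 α h → ∃ n : ℕ, lam h = n}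

/-- The `𝔩`-module `F` has a highest weight vector of weight `λ` with respect to `Δ⁺(𝔩)`. For a
simple module `F` this says that `λ` is the highest weight of `F`. -/
def HasHighestWeight (P : Set (Module.Dual ℂ 𝔧)) (𝔩 : LieSubalgebra ℂ 𝔞)
    (lam : Module.Dual ℂ 𝔧) (F : Type v) [AddCommGroup F] [Module ℂ F] [LieRingModule 𝔩 F] :
    Prop :=
  ∃ v : F, v ≠ 0 ∧
    (∀ (x : 𝔩) (hx : (x : 𝔞) ∈ 𝔧), ⁅x, v⁆ = lam ⟨x, hx⟩ • v) ∧
    (∀ α ∈ P ∩ roots 𝔧 𝔩, ∀ x : 𝔩, (x : 𝔞) ∈ wt 𝔧 𝔞 α → ⁅x, v⁆ = 0)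

/-! ### Simple highest weight modules -/

/-- The left ideal of `U(𝔩)` generated by `𝔩_α` for `α ∈ Δ⁺(𝔩)` and by `h - λ(h)` for `h ∈ 𝔧`;
the quotient by it is the Verma module of `𝔩` with highest weight `λ`. -/
def vermaIdeal (P : Set (Module.Dual ℂ 𝔧)) (𝔩 : LieSubalgebra ℂ 𝔞) (lam : Module.Dual ℂ 𝔧) :
    Submodule (UniversalEnvelopingAlgebra ℂ 𝔩) (UniversalEnvelopingAlgebra ℂ 𝔩) :=
  Submodule.span _
    ({t | ∃ α ∈ P ∩ roots 𝔧 𝔩, ∃ x : 𝔩, (x : 𝔞) ∈ wt 𝔧 𝔞 α ∧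
        t = UniversalEnvelopingAlgebra.ι ℂ x} ∪
     {t | ∃ (x : 𝔩) (hx : (x : 𝔞) ∈ 𝔧),
        t = UniversalEnvelopingAlgebra.ι ℂ x - algebraMap ℂ _ (lam ⟨x, hx⟩)})

/-- The sum of all proper left ideals that contain `vermaIdeal`; it corresponds to the largest
proper submodule of the Verma module. -/
def maxIdeal (P : Set (Module.Dual ℂ 𝔧)) (𝔩 : LieSubalgebra ℂ 𝔞) (lam : Module.Dual ℂ 𝔧) :
    Submodule (UniversalEnvelopingAlgebra ℂ 𝔩) (UniversalEnvelopingAlgebra ℂ 𝔩) :=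
  sSup {J | vermaIdeal 𝔧 P 𝔩 lam ≤ J ∧ J ≠ ⊤}

/-- The simple `𝔩`-module with highest weight `λ`: the quotient of the Verma module of `𝔩` by its
largest proper submodule. It is finite dimensional when `λ ∈ Λ⁺(𝔩)`. -/
def SimpleHW (P : Set (Module.Dual ℂ 𝔧)) (𝔩 : LieSubalgebra ℂ 𝔞) (lam : Module.Dual ℂ 𝔧) :
    Type u :=
  UniversalEnvelopingAlgebra ℂ 𝔩 ⧸ maxIdeal 𝔧 P 𝔩 lam

variable (P : Set (Module.Dual ℂ 𝔧)) (𝔩 : LieSubalgebra ℂ 𝔞) (lam : Module.Dual ℂ 𝔧)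

instance : AddCommGroup (SimpleHW 𝔧 P 𝔩 lam) :=
  inferInstanceAs (AddCommGroup (UniversalEnvelopingAlgebra ℂ 𝔩 ⧸ maxIdeal 𝔧 P 𝔩 lam))
instance : Module (UniversalEnvelopingAlgebra ℂ 𝔩) (SimpleHW 𝔧 P 𝔩 lam) :=
  inferInstanceAs (Module (UniversalEnvelopingAlgebra ℂ 𝔩)
    (UniversalEnvelopingAlgebra ℂ 𝔩 ⧸ maxIdeal 𝔧 P 𝔩 lam))
instance : Module ℂ (SimpleHW 𝔧 P 𝔩 lam) :=
  inferInstanceAs (Module ℂ (UniversalEnvelopingAlgebra ℂ 𝔩 ⧸ maxIdeal 𝔧 P 𝔩 lam))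
instance : IsScalarTower ℂ (UniversalEnvelopingAlgebra ℂ 𝔩) (SimpleHW 𝔧 P 𝔩 lam) :=
  inferInstanceAs (IsScalarTower ℂ (UniversalEnvelopingAlgebra ℂ 𝔩)
    (UniversalEnvelopingAlgebra ℂ 𝔩 ⧸ maxIdeal 𝔧 P 𝔩 lam))
instance : LieRingModule 𝔩 (SimpleHW 𝔧 P 𝔩 lam) := envLieRingModule (SimpleHW 𝔧 P 𝔩 lam)
instance : LieModule ℂ 𝔩 (SimpleHW 𝔧 P 𝔩 lam) := envLieModule (SimpleHW 𝔧 P 𝔩 lam)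

end Roots

/-! ### The parabolic category `𝒪` and its Grothendieck group -/

section CategoryO

variable {𝔞 : Type u} [LieRing 𝔞] [LieAlgebra ℂ 𝔞]

/-- Every vector of `X` lies in a finite dimensional subspace that is stable under `𝔰 ⊆ 𝔞`. -/
def IsLocallyFinite (𝔰 : Submodule ℂ 𝔞) (X : Type v) [AddCommGroup X] [Module ℂ X]
    [LieRingModule 𝔞 X] : Prop :=
  ∀ v : X, ∃ W : Submodule ℂ X, v ∈ W ∧ FiniteDimensional ℂ W ∧
    ∀ x ∈ 𝔰, ∀ w ∈ W, ⁅x, w⁆ ∈ W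

/-- `X` is an object of the parabolic BGG category `𝒪^𝔭`, where `𝔩 ⊇ 𝔧` is the Levi part of the
parabolic subalgebra `𝔭`, which is standard with respect to the positive system `P`. -/
structure IsInO (𝔧 : LieSubalgebra ℂ 𝔞) (P : Set (Module.Dual ℂ 𝔧)) (𝔩 : LieSubalgebra ℂ 𝔞)
    (X : Type v) [AddCommGroup X] [Module ℂ X] [LieRingModule 𝔞 X] [LieModule ℂ 𝔞 X] : Prop where
  finitely_generated : ∃ s : Finset X, LieSubmodule.lieSpan ℂ 𝔞 (s : Set X) = ⊤
  weight_module : ⨆ μ : Module.Dual ℂ 𝔧, wt 𝔧 X μ = ⊤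
  locally_finite : IsLocallyFinite (⨆ α ∈ P, wt 𝔧 𝔞 α) X
  levi_locally_finite : IsLocallyFinite (⨆ α ∈ P ∩ roots 𝔧 𝔩, wt 𝔧 𝔞 (-α)) X

/-- For submodules `A ≤ B` of `X`, the subquotient `B / A` is isomorphic to `S`. -/
def IsSubquotientIso {X : Type v} [AddCommGroup X] [Module ℂ X] [LieRingModule 𝔞 X]
    [LieModule ℂ 𝔞 X] (A B : LieSubmodule ℂ 𝔞 X)
    (S : Type w) [AddCommGroup S] [Module ℂ S] [LieRingModule 𝔞 S] [LieModule ℂ 𝔞 S] : Prop :=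
  A ≤ B ∧ ∃ f : B →ₗ⁅ℂ, 𝔞⁆ S, Function.Surjective f ∧ ∀ b : B, f b = 0 ↔ (b : X) ∈ A

/-- The multiplicity `[X : S]` of a simple module `S` as a subquotient of `X`: the supremum of the
numbers `n` for which there are submodules `A₁ ⊆ B₁ ⊆ A₂ ⊆ B₂ ⊆ ⋯ ⊆ Aₙ ⊆ Bₙ` of `X` with
`Bᵢ / Aᵢ ≃ S` for all `i`. -/
def jhMult (𝔞 : Type u) [LieRing 𝔞] [LieAlgebra ℂ 𝔞]
    (X : Type v) [AddCommGroup X] [Module ℂ X] [LieRingModule 𝔞 X] [LieModule ℂ 𝔞 X]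
    (S : Type w) [AddCommGroup S] [Module ℂ S] [LieRingModule 𝔞 S] [LieModule ℂ 𝔞 S] : ℕ∞ :=
  ⨆ (n : ℕ) (_ : ∃ A B : Fin n → LieSubmodule ℂ 𝔞 X,
    (∀ i, IsSubquotientIso (A i) (B i) S) ∧ ∀ i j, i < j → B i ≤ A j), (n : ℕ∞)

/-- The identity `[X] = ∑ᵢ cᵢ [Yᵢ]` in the Grothendieck group of `𝒪^𝔭`. Since objects of `𝒪^𝔭` have
finite length, this group is free on the simple objects, and the class of an object has the
multiplicities `[X : S]` of the simple objects `S` as its coordinates. As `X` need not be finitely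
generated and the sum may be infinite, the identity is one of families of coordinates that may have
infinite support, i.e. it takes place in the completion of the Grothendieck group. It includes that
`X` is the union of an increasing sequence of objects of `𝒪^𝔭`, that the modules `Yᵢ` which occur
are objects of `𝒪^𝔭`, and that all coordinates of `[X]` are finite. -/
structure GrothendieckIdentity (𝔧 : LieSubalgebra ℂ 𝔞) (P : Set (Module.Dual ℂ 𝔧))
    (𝔩 : LieSubalgebra ℂ 𝔞)
    (X : Type v) [AddCommGroup X] [Module ℂ X] [LieRingModule 𝔞 X] [LieModule ℂ 𝔞 X]
    {I : Type u} (c : I → ℕ) (Y : I → Type w) [∀ i, AddCommGroup (Y i)] [∀ i, Module ℂ (Y i)]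
    [∀ i, LieRingModule 𝔞 (Y i)] [∀ i, LieModule ℂ 𝔞 (Y i)] : Prop where
  exhaustion : ∃ U : ℕ → LieSubmodule ℂ 𝔞 X, Monotone U ∧ (⨆ k, U k) = ⊤ ∧
    ∀ k, IsInO 𝔧 P 𝔩 (U k)
  summand_mem : ∀ i, c i ≠ 0 → IsInO 𝔧 P 𝔩 (Y i)
  class_finite : ∀ (S : Type u) [AddCommGroup S] [Module ℂ S] [LieRingModule 𝔞 S]
    [LieModule ℂ 𝔞 S], LieModule.IsIrreducible ℂ 𝔞 S → IsInO 𝔧 P 𝔩 S → jhMult 𝔞 X S ≠ ⊤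
  class_eq : ∀ (S : Type u) [AddCommGroup S] [Module ℂ S] [LieRingModule 𝔞 S]
    [LieModule ℂ 𝔞 S], LieModule.IsIrreducible ℂ 𝔞 S → IsInO 𝔧 P 𝔩 S →
      HasSum (fun i => (c i : ℕ∞) * jhMult 𝔞 (Y i) S) (jhMult 𝔞 X S)

end CategoryO

/-! ### The parabolic subalgebra of a hyperbolic element -/

section Hyperbolic

variable {𝔤 : Type u} [LieRing 𝔤] [LieAlgebra ℂ 𝔤]

/-- `H` is hyperbolic: `ad H` is semisimple with real eigenvalues. -/
def IsHyperbolic (H : 𝔤) : Prop :=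
  (LieAlgebra.ad ℂ 𝔤 H).IsSemisimple ∧
    ∀ c : ℂ, (LieAlgebra.ad ℂ 𝔤 H).HasEigenvalue c → c.im = 0

/-- `𝔲₊(H)`: the sum of the eigenspaces of `ad H` with positive eigenvalue. -/
def nilPlus (H : 𝔤) : Submodule ℂ 𝔤 :=
  ⨆ (c : ℝ) (_ : 0 < c), (LieAlgebra.ad ℂ 𝔤 H).eigenspace (c : ℂ)

/-- `𝔲₋(H)`: the sum of the eigenspaces of `ad H` with negative eigenvalue. -/
def nilMinus (H : 𝔤) : Submodule ℂ 𝔤 :=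
  ⨆ (c : ℝ) (_ : c < 0), (LieAlgebra.ad ℂ 𝔤 H).eigenspace (c : ℂ)

/-- `𝔩(H)`: the eigenspace of `ad H` with eigenvalue zero. -/
def levi (H : 𝔤) : LieSubalgebra ℂ 𝔤 where
  __ := (LieAlgebra.ad ℂ 𝔤 H).eigenspace 0
  lie_mem' {x y} hx hy := by
    have hx' : ⁅H, x⁆ = 0 := by simpa using hx
    have hy' : ⁅H, y⁆ = 0 := by simpa using hy
    simp [leibniz_lie H x y, hx', hy']

theorem mem_levi {H x : 𝔤} : x ∈ levi H ↔ ⁅H, x⁆ = 0 := by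
  change x ∈ (LieAlgebra.ad ℂ 𝔤 H).eigenspace 0 ↔ _
  simp

/-- `𝔭(H) = 𝔩(H) + 𝔲₊(H)`. -/
def parabolic (H : 𝔤) : Submodule ℂ 𝔤 := (levi H).toSubmodule ⊔ nilPlus H

theorem lie_mem_nilMinus {H x y : 𝔤} (hx : x ∈ levi H) (hy : y ∈ nilMinus H) :
    ⁅x, y⁆ ∈ nilMinus H := by
  have hx' := mem_levi.1 hx
  have key : nilMinus H ≤ (nilMinus H).comap (LieAlgebra.ad ℂ 𝔤 x) := by
    refine iSup₂_le fun c hc y hy => ?_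
    refine Submodule.mem_iSup_of_mem c (Submodule.mem_iSup_of_mem hc ?_)
    rw [Module.End.mem_eigenspace_iff] at hy ⊢
    simp only [LieAlgebra.ad_apply] at hy ⊢
    rw [leibniz_lie, hx', hy, zero_lie, zero_add, lie_smul]
  exact key hy

variable (𝔤' : LieSubalgebra ℂ 𝔤)

/-- `𝔤'` is a reductive subalgebra of `𝔤`: the adjoint representation of `𝔤'` on `𝔤` is
completely reducible. -/
def IsReductiveSubalgebra : Prop := ComplementedLattice (LieSubmodule ℂ 𝔤' 𝔤)

variable (H : 𝔤')

/-- `𝔩' = 𝔩(H) ∩ 𝔤'`, as a subalgebra of `𝔤'`. -/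
def levi' : LieSubalgebra ℂ 𝔤' := (levi (H : 𝔤)).comap 𝔤'.incl

/-- `𝔲₊' = 𝔲₊(H) ∩ 𝔤'`, as a subspace of `𝔤'`. -/
def nilPlus' : Submodule ℂ 𝔤' := (nilPlus (H : 𝔤)).comap 𝔤'.toSubmodule.subtype

/-- `𝔭' = 𝔭(H) ∩ 𝔤'`, as a subspace of `𝔤'`. -/
def parabolic' : Submodule ℂ 𝔤' := (parabolic (H : 𝔤)).comap 𝔤'.toSubmodule.subtype

/-- The inclusion of `𝔩'` into `𝔩`. -/
def leviIncl : levi' 𝔤' H →ₗ⁅ℂ⁆ levi (H : 𝔤) where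
  toFun x := ⟨((x : 𝔤') : 𝔤), x.2⟩
  map_add' _ _ := rfl
  map_smul' _ _ := rfl
  map_lie' := rfl

/-- `𝔲₋(H)` as an `𝔩'`-submodule of `𝔤`. -/
def nilMinusModule : LieSubmodule ℂ (levi' 𝔤' H) 𝔤 where
  __ := nilMinus (H : 𝔤)
  lie_mem {x _} hm := lie_mem_nilMinus (x := ((x : 𝔤') : 𝔤)) x.2 hm

/-- `𝔤'` as an `𝔩'`-submodule of `𝔤`. -/
def subModule : LieSubmodule ℂ (levi' 𝔤' H) 𝔤 where
  __ := 𝔤'.toSubmodule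
  lie_mem {x _} hm := 𝔤'.lie_mem (x : 𝔤').2 hm

/-- The `𝔩'`-module `𝔲₋ / (𝔲₋ ∩ 𝔤')`. -/
abbrev NilQuotient : Type u :=
  nilMinusModule 𝔤' H ⧸ (subModule 𝔤' H).comap (nilMinusModule 𝔤' H).incl

/-- `Hom_{𝔩'}(F'_δ, F|_{𝔩'} ⊗ S(𝔲₋ / 𝔲₋ ∩ 𝔤'))`. -/
abbrev BranchingHom (𝔧' : LieSubalgebra ℂ 𝔤') (P' : Set (Module.Dual ℂ 𝔧'))
    (δ : Module.Dual ℂ 𝔧') (F : Type v) [AddCommGroup F] [Module ℂ F]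
    [LieRingModule (levi (H : 𝔤)) F] [LieModule ℂ (levi (H : 𝔤)) F] : Type (max u v) :=
  SimpleHW 𝔧' P' (levi' 𝔤' H) δ →ₗ⁅ℂ, levi' 𝔤' H⁆
    Pullback (leviIncl 𝔤' H) F ⊗[ℂ] SymmetricAlgebra ℂ (NilQuotient 𝔤' H)

/-- The multiplicity `m(δ; λ)`, for `F = F_λ`. -/
def mult (𝔧' : LieSubalgebra ℂ 𝔤') (P' : Set (Module.Dual ℂ 𝔧'))
    (δ : Module.Dual ℂ 𝔧') (F : Type v) [AddCommGroup F] [Module ℂ F]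
    [LieRingModule (levi (H : 𝔤)) F] [LieModule ℂ (levi (H : 𝔤)) F] : ℕ :=
  Module.finrank ℂ (BranchingHom 𝔤' H 𝔧' P' δ F)

end Hyperbolic

end BGG

end

/-!
The element `H` grades everything in sight: the height of a `𝔧'`-weight `μ` is the real part of
`μ(H)`. The raising part of `𝔤'` increases it, the lowering part decreases it, and all level spaces
of the generalized Verma module are finite dimensional, so all multiplicities can be computed level
by level.

The first input is a Poincaré–Birkhoff–Witt theorem. It is needed only for Lie algebras with a
faithful finite dimensional representation, where the independence of ordered monomials follows
from the action by matrix vector fields (`linearIndependent_omon`). Choosing a basis of `𝔲₋` that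
starts with a basis of `𝔲₋ ∩ 𝔤'` and continues with weight vectors, the restriction of
`U(𝔤) ⊗_{U(𝔭)} F` to `𝔤'` is free over the lowering part, on the monomials in the remaining basis
vectors applied to a weight basis of `F` (`exists_isLoweringFree`). The weights of these generators
are those of `F ⊗ S(𝔲₋ / 𝔲₋ ∩ 𝔤')` (`exists_basis_tensor_symmetricAlgebra`). Generalized Verma
modules of `𝔤'` are free in the same sense, on a weight basis of the inducing module.

The submodules generated by the weight spaces of height at least `c` form a filtration. The
subquotient at a height `c` is the module induced from the part of height `c` of
`F ⊗ S(𝔲₋ / 𝔲₋ ∩ 𝔤')`: both `𝔩'`-modules have the same weight multiplicities, they are completely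
reducible, and finite dimensional completely reducible modules are determined by their weight
multiplicities (`exists_equiv_of_finrank_eq`, `jhMult_heightSpan`). Complete reducibility over the
reductive algebra `𝔩'` is Weyl's theorem, proved with Casimir elements
(`IsSplitReductive.exists_projection`); the root vectors it needs come from the nondegenerate trace
forms provided by the complete reducibility of `𝔤` over `𝔤'` (`exists_opposite_root_vector`). Thus
each level is a finite direct sum of simple highest weight modules `F'_δ`, with multiplicities
`m(δ; λ)`.

Composition multiplicities, defined by chains of submodules, are additive in short exact sequences
(`jhMult_add`). For a simple `S` with a weight `μ`, only subquotients of height at least that of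
`μ` contribute, so the sum is finite and the filtration yields the identity
(`hasSum_heightSpan`, `IsLoweringFree.grothendieckIdentity`). Finiteness of `m(δ; λ)` is the finite
dimensionality of the weight spaces of `F ⊗ S(𝔲₋ / 𝔲₋ ∩ 𝔤')` (`IsLoweringFree.finite_hom`).
-/


open scoped TensorProduct

noncomputable section

namespace BGG

set_option linter.unusedSectionVars false

/-! ### Simultaneous eigenspaces -/

section SimEig

variable {ι κ I X Y : Type*} [AddCommGroup X] [Module ℂ X] [AddCommGroup Y] [Module ℂ Y]

/-- The simultaneous eigenspace of a family of operators for the system of eigenvalues `χ`. -/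
def simEig (T : ι → Module.End ℂ X) (χ : ι → ℂ) : Submodule ℂ X :=
  ⨅ i, LinearMap.ker (T i - χ i • 1)

theorem mem_simEig {T : ι → Module.End ℂ X} {χ : ι → ℂ} {v : X} :
    v ∈ simEig T χ ↔ ∀ i, T i v = χ i • v := by
  simp [simEig, Submodule.mem_iInf, sub_eq_zero]

variable {T : ι → Module.End ℂ X} {T' : ι → Module.End ℂ Y} {χ : κ → ι → ℂ}

/-- A stable subspace contains the components of its elements. -/
theorem mem_of_sum_mem (hχ : Function.Injective χ) {N : Submodule ℂ X}
    (hN : ∀ i, ∀ v ∈ N, T i v ∈ N) (s : Finset κ) (v : κ → X)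
    (hv : ∀ k ∈ s, v k ∈ simEig T (χ k)) (h : ∑ k ∈ s, v k ∈ N) : ∀ k ∈ s, v k ∈ N := by
  classical
  induction s using Finset.induction_on generalizing v with
  | empty => simp
  | insert a s ha ih =>
    have key : ∀ k ∈ s, v k ∈ N := by
      intro k hk
      have hka : k ≠ a := fun e => ha (e ▸ hk)
      obtain ⟨i, hi⟩ := Function.ne_iff.1 (hχ.ne hka)
      have h1 : ∑ j ∈ s, (χ j i - χ a i) • v j ∈ N := by
        have h2 : T i (∑ k ∈ insert a s, v k) - χ a i • ∑ k ∈ insert a s, v k ∈ N :=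
          N.sub_mem (hN i _ h) (N.smul_mem _ h)
        -- `T i - χ a i` removes the component `a` and rescales the others, so that induction applies.
        have h3 : T i (∑ k ∈ insert a s, v k) - χ a i • ∑ k ∈ insert a s, v k =
            ∑ j ∈ s, (χ j i - χ a i) • v j := by
          rw [map_sum, Finset.smul_sum, ← Finset.sum_sub_distrib, Finset.sum_insert ha,
            mem_simEig.1 (hv a (Finset.mem_insert_self a s)) i, sub_self, zero_add]
          refine Finset.sum_congr rfl fun j hj => ?_
          rw [mem_simEig.1 (hv j (Finset.mem_insert_of_mem hj)) i, sub_smul]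
        rwa [h3] at h2
      have h4 := ih (fun j => (χ j i - χ a i) • v j)
        (fun j hj => Submodule.smul_mem _ _ (hv j (Finset.mem_insert_of_mem hj))) h1 k hk
      exact (Submodule.smul_mem_iff _ (sub_ne_zero.2 hi)).1 h4
    intro k hk
    rcases Finset.mem_insert.1 hk with rfl | hk
    · rw [Finset.sum_insert ha] at h
      exact (Submodule.add_mem_iff_left _ (N.sum_mem key)).1 h
    · exact key k hk

theorem exists_sum_of_mem_iSup {p : κ → Submodule ℂ X} {Ω : Set κ} {v : X}
    (hv : v ∈ ⨆ k ∈ Ω, p k) :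
    ∃ (s : Finset κ) (u : κ → X), (∀ k ∈ s, k ∈ Ω) ∧ (∀ k, u k ∈ p k) ∧ ∑ k ∈ s, u k = v := by
  classical
  obtain ⟨f, hf, hs⟩ := (Submodule.mem_iSup_iff_exists_finsupp _ _).1 hv
  refine ⟨f.support, f, ?_, fun k => ?_, hs⟩
  · intro k hk
    by_contra hkΩ
    have := hf k
    simp [hkΩ] at this
    simp [this] at hk
  · have := hf k
    by_cases hkΩ : k ∈ Ω
    · simpa [hkΩ] using this
    · simp only [hkΩ, iSup_false, Submodule.mem_bot] at this
      simp [this]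

theorem exists_sum_of_iSup_eq_top {p : κ → Submodule ℂ X} (hp : ⨆ k, p k = ⊤) (v : X) :
    ∃ (s : Finset κ) (u : κ → X), (∀ k, u k ∈ p k) ∧ ∑ k ∈ s, u k = v := by
  have : v ∈ ⨆ k ∈ (Set.univ : Set κ), p k := by simp [hp]
  obtain ⟨s, u, -, h1, h2⟩ := exists_sum_of_mem_iSup this
  exact ⟨s, u, h1, h2⟩

/-- The component of weight `k` of a sum of weight vectors that is itself of weight `k`. -/
theorem eq_component (hχ : Function.Injective χ) [DecidableEq κ] (s : Finset κ) (u : κ → X)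
    (hu : ∀ k, u k ∈ simEig T (χ k)) {k : κ} {v : X} (hv : v ∈ simEig T (χ k))
    (h : ∑ j ∈ s, u j = v) : v = if k ∈ s then u k else 0 := by
  have h1 := mem_of_sum_mem (T := T) hχ (N := ⊥) (by simp) (insert k s)
    (fun j => (if j ∈ s then u j else 0) - if j = k then v else 0) (by
      intro j _
      refine Submodule.sub_mem _ ?_ ?_
      · split_ifs
        · exact hu j
        · exact Submodule.zero_mem _
      · split_ifs with hj
        · exact hj ▸ hv
        · exact Submodule.zero_mem _) (by
      rw [Submodule.mem_bot, Finset.sum_sub_distrib, Finset.sum_ite_eq' (insert k s) k,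
        if_pos (Finset.mem_insert_self k s), sub_eq_zero, ← h, Finset.sum_ite_mem]
      congr 1
      ext j
      simpa using fun h => Or.inr h) k (Finset.mem_insert_self k s)
  rw [Submodule.mem_bot, if_pos rfl, sub_eq_zero] at h1
  exact h1.symm

/-- The sum of the eigenspaces in `Ω` is spanned by those elements of a spanning family of
eigenvectors whose eigenvalues are in `Ω`. -/
theorem iSup_simEig_eq_span (hχ : Function.Injective χ) {g : I → X} {w : I → κ}
    (hg : ∀ i, g i ∈ simEig T (χ (w i))) (hspan : Submodule.span ℂ (Set.range g) = ⊤)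
    (Ω : Set κ) :
    ⨆ k ∈ Ω, simEig T (χ k) = Submodule.span ℂ (g '' {i | w i ∈ Ω}) := by
  classical
  apply le_antisymm
  · refine iSup₂_le fun k hk v hv => ?_
    have hv' : v ∈ Submodule.span ℂ (Set.range g) := hspan ▸ Submodule.mem_top
    obtain ⟨c, rfl⟩ := (Finsupp.mem_span_range_iff_exists_finsupp).1 hv'
    have h2 : ∀ k, ∑ i ∈ c.support with w i = k, c i • g i ∈ simEig T (χ k) := by
      intro k
      refine Submodule.sum_mem _ fun i hi => Submodule.smul_mem _ _ ?_
      have := (Finset.mem_filter.1 hi).2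
      exact this ▸ hg i
    have h1 := eq_component (T := T) hχ (c.support.image w)
      (fun k => ∑ i ∈ c.support with w i = k, c i • g i) h2 hv
      (Finset.sum_fiberwise_of_maps_to (fun i hi => Finset.mem_image_of_mem w hi) _)
    rw [h1]
    split_ifs
    · refine Submodule.sum_mem _ fun i hi => Submodule.smul_mem _ _ (Submodule.subset_span ?_)
      exact ⟨i, by simpa [(Finset.mem_filter.1 hi).2] using hk, rfl⟩
    · exact Submodule.zero_mem _
  · rw [Submodule.span_le]
    rintro _ ⟨i, hi, rfl⟩
    exact Submodule.mem_iSup_of_mem (w i) (Submodule.mem_iSup_of_mem hi (hg i))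

theorem iSup_simEig_of_span {g : I → X} {w : I → κ}
    (hg : ∀ i, g i ∈ simEig T (χ (w i))) (hspan : Submodule.span ℂ (Set.range g) = ⊤) :
    ⨆ k, simEig T (χ k) = ⊤ := by
  rw [eq_top_iff, ← hspan, Submodule.span_le]
  rintro _ ⟨i, rfl⟩
  exact Submodule.mem_iSup_of_mem (w i) (hg i)

theorem simEig_eq_span (hχ : Function.Injective χ) {g : I → X} {w : I → κ}
    (hg : ∀ i, g i ∈ simEig T (χ (w i))) (hspan : Submodule.span ℂ (Set.range g) = ⊤) (k : κ) :
    simEig T (χ k) = Submodule.span ℂ (g '' {i | w i = k}) := by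
  simpa using iSup_simEig_eq_span hχ hg hspan {k}

theorem finrank_simEig_of_basis (hχ : Function.Injective χ) (g : Module.Basis I ℂ X) {w : I → κ}
    (hg : ∀ i, g i ∈ simEig T (χ (w i))) (k : κ) :
    Module.finrank ℂ (simEig T (χ k)) = Nat.card {i | w i = k} := by
  rw [simEig_eq_span hχ hg g.span_eq, Set.image_eq_range]
  exact Module.finrank_eq_nat_card_basis
    (Module.Basis.span (g.linearIndependent.comp (Subtype.val : {i | w i = k} → I)
      Subtype.val_injective))

theorem map_mem_simEig {q : X →ₗ[ℂ] Y} (hq : ∀ i v, q (T i v) = T' i (q v)) {χ : ι → ℂ} {v : X}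
    (hv : v ∈ simEig T χ) : q v ∈ simEig T' χ := by
  rw [mem_simEig] at hv ⊢
  intro i
  rw [← hq, hv, map_smul]

theorem mem_simEig_of_injective {q : X →ₗ[ℂ] Y} (hq : ∀ i v, q (T i v) = T' i (q v))
    (hinj : Function.Injective q) {χ : ι → ℂ} {v : X} :
    q v ∈ simEig T' χ ↔ v ∈ simEig T χ := by
  refine ⟨fun hv => ?_, map_mem_simEig hq⟩
  rw [mem_simEig] at hv ⊢
  intro i
  apply hinj
  rw [hq, hv, map_smul]

theorem iSup_simEig_of_surjective {q : X →ₗ[ℂ] Y} (hq : ∀ i v, q (T i v) = T' i (q v))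
    (hsurj : Function.Surjective q) (h : ⨆ k, simEig T (χ k) = ⊤) :
    ⨆ k, simEig T' (χ k) = ⊤ := by
  rw [eq_top_iff, ← LinearMap.range_eq_top.2 hsurj, LinearMap.range_eq_map, ← h, Submodule.map_iSup]
  refine iSup_mono fun k => ?_
  rintro _ ⟨v, hv, rfl⟩
  exact map_mem_simEig hq hv

theorem iSup_simEig_of_injective (hχ : Function.Injective χ) {q : X →ₗ[ℂ] Y}
    (hq : ∀ i v, q (T i v) = T' i (q v))
    (hinj : Function.Injective q) (h : ⨆ k, simEig T' (χ k) = ⊤) :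
    ⨆ k, simEig T (χ k) = ⊤ := by
  rw [eq_top_iff]
  intro v _
  obtain ⟨s, u, hu, hs⟩ := exists_sum_of_iSup_eq_top h (q v)
  have h1 := mem_of_sum_mem (T := T') hχ (N := LinearMap.range q) (by
    rintro i _ ⟨w, rfl⟩
    exact ⟨T i w, hq i w⟩) s u (fun k _ => hu k) (by rw [hs]; exact ⟨v, rfl⟩)
  have h2 : ∀ k ∈ s, ∃ x ∈ simEig T (χ k), q x = u k := by
    intro k hk
    obtain ⟨x, hx⟩ := h1 k hk
    exact ⟨x, (mem_simEig_of_injective hq hinj).1 (hx ▸ hu k), hx⟩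
  choose! x hx hqx using h2
  have : v = ∑ k ∈ s, x k := by
    apply hinj
    rw [map_sum, ← hs]
    exact Finset.sum_congr rfl fun k hk => (hqx k hk).symm
  rw [this]
  exact Submodule.sum_mem _ fun k hk => Submodule.mem_iSup_of_mem k (hx k hk)

/-- Eigenvectors lift along surjections of spaces that are sums of eigenspaces. -/
theorem exists_lift_simEig (hχ : Function.Injective χ) {q : X →ₗ[ℂ] Y}
    (hq : ∀ i v, q (T i v) = T' i (q v))
    (hsurj : Function.Surjective q) (h : ⨆ k, simEig T (χ k) = ⊤) {k : κ} {y : Y}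
    (hy : y ∈ simEig T' (χ k)) : ∃ x ∈ simEig T (χ k), q x = y := by
  classical
  obtain ⟨v, rfl⟩ := hsurj y
  obtain ⟨s, u, hu, rfl⟩ := exists_sum_of_iSup_eq_top h v
  rw [map_sum] at hy ⊢
  have := eq_component (T := T') hχ s (fun k => q (u k)) (fun k => map_mem_simEig hq (hu k)) hy rfl
  rw [this]
  split_ifs
  · exact ⟨u k, hu k, rfl⟩
  · exact ⟨0, Submodule.zero_mem _, map_zero q⟩

end SimEig

/-! ### Additivity of multiplicities -/

section Multiplicity

variable {𝔞 : Type*} [LieRing 𝔞] [LieAlgebra ℂ 𝔞]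
variable {X : Type*} [AddCommGroup X] [Module ℂ X] [LieRingModule 𝔞 X] [LieModule ℂ 𝔞 X]
variable {Y : Type*} [AddCommGroup Y] [Module ℂ Y] [LieRingModule 𝔞 Y] [LieModule ℂ 𝔞 Y]
variable {Z : Type*} [AddCommGroup Z] [Module ℂ Z] [LieRingModule 𝔞 Z] [LieModule ℂ 𝔞 Z]
variable (S : Type*) [AddCommGroup S] [Module ℂ S] [LieRingModule 𝔞 S] [LieModule ℂ 𝔞 S]

/-- `HasChain S n C` says that there is a chain `A₁ ≤ B₁ ≤ ⋯ ≤ Aₙ ≤ Bₙ ≤ C` with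
`Bᵢ / Aᵢ ≃ S`. -/
def HasChain : ℕ → LieSubmodule ℂ 𝔞 X → Prop
  | 0, _ => True
  | n + 1, C => ∃ A B, HasChain n A ∧ IsSubquotientIso A B S ∧ B ≤ C

variable {S}

theorem HasChain.mono {n : ℕ} {C D : LieSubmodule ℂ 𝔞 X} (h : HasChain S n C) (hCD : C ≤ D) :
    HasChain S n D := by
  cases n with
  | zero => trivial
  | succ n =>
    obtain ⟨A, B, h1, h2, h3⟩ := h
    exact ⟨A, B, h1, h2, h3.trans hCD⟩

variable (S) in
/-- The recursive description of chains agrees with the indexed families that define the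
multiplicity. -/
theorem hasChain_iff (n : ℕ) (C : LieSubmodule ℂ 𝔞 X) :
    HasChain S n C ↔ ∃ A B : Fin n → LieSubmodule ℂ 𝔞 X,
      (∀ i, IsSubquotientIso (A i) (B i) S) ∧ (∀ i j, i < j → B i ≤ A j) ∧ ∀ i, B i ≤ C := by
  induction n generalizing C with
  | zero => simp [HasChain]
  | succ n ih =>
    constructor
    · rintro ⟨A', B', h1, h2, h3⟩
      obtain ⟨A, B, hA, hAB, hB⟩ := (ih A').1 h1
      refine ⟨Fin.snoc (α := fun _ => LieSubmodule ℂ 𝔞 X) A A',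
        Fin.snoc (α := fun _ => LieSubmodule ℂ 𝔞 X) B B', ?_, ?_, ?_⟩
      · intro i
        induction i using Fin.lastCases with
        | last => simpa using h2
        | cast i => simpa using hA i
      · intro i j hij
        induction i using Fin.lastCases with
        | last => exact absurd hij (not_lt.2 (Fin.le_last j))
        | cast i =>
          induction j using Fin.lastCases with
          | last => simpa using hB i
          | cast j => simpa using hAB i j (by simpa using hij)
      · intro i
        induction i using Fin.lastCases with
        | last => simpa using h3
        | cast i => simpa using ((hB i).trans h2.1).trans h3
    · rintro ⟨A, B, hA, hAB, hB⟩
      refine ⟨A (Fin.last n), B (Fin.last n), (ih _).2 ⟨fun i => A i.castSucc,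
        fun i => B i.castSucc, fun i => hA _, fun i j hij => hAB _ _ (by simpa using hij),
        fun i => hAB _ _ (Fin.castSucc_lt_last i)⟩, hA _, hB _⟩

variable (X S) in
theorem jhMult_eq : jhMult 𝔞 X S =
    ⨆ (n : ℕ) (_ : HasChain S n (⊤ : LieSubmodule ℂ 𝔞 X)), (n : ℕ∞) := by
  simp [jhMult, hasChain_iff]

theorem comap_mono' {f : X →ₗ⁅ℂ, 𝔞⁆ Y} {A B : LieSubmodule ℂ 𝔞 Y} (h : A ≤ B) :
    A.comap f ≤ B.comap f := fun _ hx => h hx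

/-- A module `Z` that maps onto `S` and, compatibly, to `X` exhibits `S` as a subquotient. -/
theorem isSubquotientIso_of (k : Z →ₗ⁅ℂ, 𝔞⁆ X) (g : Z →ₗ⁅ℂ, 𝔞⁆ S)
    (hg : Function.Surjective g) {A B : LieSubmodule ℂ 𝔞 X} (hB : ∀ b, b ∈ B ↔ ∃ z, k z = b)
    (hA : A ≤ B) (h : ∀ z, g z = 0 ↔ k z ∈ A) : IsSubquotientIso A B S := by
  have hk : ∀ b : B, ∃ z, k z = b := fun b => (hB b).1 b.2
  choose s hs using hk
  have key : ∀ z (b : B), k z = b → g (s b) = g z := by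
    intro z b hz
    rw [← sub_eq_zero, ← map_sub, h, map_sub, hs, hz, sub_self]
    exact A.zero_mem
  refine ⟨hA,
    { toFun := fun b => g (s b)
      map_add' := fun a b => ?_
      map_smul' := fun t a => ?_
      map_lie' := fun {x a} => ?_ }, ?_, ?_⟩
  · rw [← map_add]; exact key _ _ (by rw [map_add, hs, hs]; rfl)
  · rw [RingHom.id_apply, ← map_smul]; exact key _ _ (by rw [map_smul, hs]; rfl)
  · rw [← LieModuleHom.map_lie]; exact key _ _ (by rw [LieModuleHom.map_lie, hs]; rfl)
  · intro t
    obtain ⟨z, rfl⟩ := hg t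
    exact ⟨⟨k z, (hB _).2 ⟨z, rfl⟩⟩, key z _ rfl⟩
  · intro b
    change g (s b) = 0 ↔ _
    rw [h, hs]

theorem IsSubquotientIso.map {i : X →ₗ⁅ℂ, 𝔞⁆ Y} (hi : Function.Injective i)
    {A B : LieSubmodule ℂ 𝔞 X} (h : IsSubquotientIso A B S) :
    IsSubquotientIso (A.map i) (B.map i) S := by
  obtain ⟨hAB, f, hf, hfA⟩ := h
  refine isSubquotientIso_of (i.comp B.incl) f hf (fun b => ?_) (LieSubmodule.map_mono hAB)
    (fun z => ?_)
  · simp [LieSubmodule.mem_map]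
  · rw [hfA, LieSubmodule.mem_map]
    refine ⟨fun hz => ⟨z, hz, rfl⟩, fun ⟨a, ha, hz⟩ => ?_⟩
    rwa [← show a = (z : X) from hi hz]

theorem IsSubquotientIso.comap {p : X →ₗ⁅ℂ, 𝔞⁆ Y} (hp : Function.Surjective p)
    {A B : LieSubmodule ℂ 𝔞 Y} (h : IsSubquotientIso A B S) :
    IsSubquotientIso (A.comap p) (B.comap p) S := by
  obtain ⟨hAB, f, hf, hfA⟩ := h
  let q : (B.comap p) →ₗ⁅ℂ, 𝔞⁆ B :=
    { toFun := fun z => ⟨p z, z.2⟩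
      map_add' := fun _ _ => Subtype.ext (map_add p _ _)
      map_smul' := fun _ _ => Subtype.ext (map_smul p _ _)
      map_lie' := fun {_ _} => Subtype.ext (LieModuleHom.map_lie p _ _) }
  refine isSubquotientIso_of (B.comap p).incl (f.comp q) ?_ (fun b => ?_)
    (comap_mono' hAB) (fun z => ?_)
  · intro s
    obtain ⟨b, rfl⟩ := hf s
    obtain ⟨x, hx⟩ := hp b
    exact ⟨⟨x, by simp [hx]⟩, congrArg f (Subtype.ext hx)⟩
  · simp
  · exact (hfA (q z)).trans Iff.rfl

theorem HasChain.map {i : X →ₗ⁅ℂ, 𝔞⁆ Y} (hi : Function.Injective i) {n : ℕ}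
    {C : LieSubmodule ℂ 𝔞 X} (h : HasChain S n C) : HasChain S n (C.map i) := by
  induction n generalizing C with
  | zero => trivial
  | succ n ih =>
    obtain ⟨A, B, h1, h2, h3⟩ := h
    exact ⟨A.map i, B.map i, ih h1, h2.map hi, LieSubmodule.map_mono h3⟩

/-- A subquotient of `X` that is simple occurs either in a submodule or in the quotient by it. -/
theorem IsSubquotientIso.dichotomy [LieModule.IsIrreducible ℂ 𝔞 S]
    {i : Y →ₗ⁅ℂ, 𝔞⁆ X} {p : X →ₗ⁅ℂ, 𝔞⁆ Z}
    (hip : ∀ x, p x = 0 ↔ ∃ y, i y = x) {A B : LieSubmodule ℂ 𝔞 X} (h : IsSubquotientIso A B S) :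
    IsSubquotientIso (A.comap i) (B.comap i) S ∨ IsSubquotientIso (A.map p) (B.map p) S := by
  obtain ⟨hAB, f, hf, hfA⟩ := h
  let q : (B.comap i) →ₗ⁅ℂ, 𝔞⁆ B :=
    { toFun := fun z => ⟨i z, z.2⟩
      map_add' := fun _ _ => Subtype.ext (map_add i _ _)
      map_smul' := fun _ _ => Subtype.ext (map_smul i _ _)
      map_lie' := fun {_ _} => Subtype.ext (LieModuleHom.map_lie i _ _) }
  -- The part of `B` coming from `Y` has image `0` or `S` in the simple module `S`.
  rcases eq_bot_or_eq_top (f.comp q).range with h0 | h0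
  · right
    refine isSubquotientIso_of (p.comp B.incl) f hf (fun b => ?_) (LieSubmodule.map_mono hAB)
      (fun z => ?_)
    · simp [LieSubmodule.mem_map]
    · rw [hfA, LieSubmodule.mem_map]
      refine ⟨fun hz => ⟨z, hz, rfl⟩, fun ⟨a, ha, hz⟩ => ?_⟩
      obtain ⟨y, hy⟩ := (hip ((z : X) - a)).1 (by
        rw [map_sub, sub_eq_zero]; exact hz.symm)
      have hyB : y ∈ B.comap i := by
        rw [LieSubmodule.mem_comap, hy]
        exact B.sub_mem z.2 (hAB ha)
      have h1 : (f.comp q) ⟨y, hyB⟩ = 0 := by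
        have : (f.comp q) ⟨y, hyB⟩ ∈ (f.comp q).range := ⟨_, rfl⟩
        rwa [h0, LieSubmodule.mem_bot] at this
      have h2 : i y ∈ A := (hfA (q ⟨y, hyB⟩)).1 h1
      rw [hy] at h2
      simpa using A.add_mem h2 ha
  · left
    refine isSubquotientIso_of (B.comap i).incl (f.comp q) ?_ (fun b => ?_)
      (comap_mono' hAB) (fun z => ?_)
    · intro s
      have : s ∈ (f.comp q).range := h0 ▸ LieSubmodule.mem_top s
      exact (LieModuleHom.mem_range _ _).1 this
    · simp
    · exact (hfA (q z)).trans Iff.rfl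

variable (S) in
/-- Multiplicities are additive in short exact sequences. -/
theorem jhMult_add [LieModule.IsIrreducible ℂ 𝔞 S] (i : Y →ₗ⁅ℂ, 𝔞⁆ X) (p : X →ₗ⁅ℂ, 𝔞⁆ Z)
    (hi : Function.Injective i) (hp : Function.Surjective p)
    (hip : ∀ x, p x = 0 ↔ ∃ y, i y = x) :
    jhMult 𝔞 X S = jhMult 𝔞 Y S + jhMult 𝔞 Z S := by
  have split : ∀ (n : ℕ) (C : LieSubmodule ℂ 𝔞 X), HasChain S n C →
      ∃ a b, a + b = n ∧ HasChain S a (C.comap i) ∧ HasChain S b (C.map p) := by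
    intro n
    induction n with
    | zero => exact fun C _ => ⟨0, 0, rfl, trivial, trivial⟩
    | succ n ih =>
      rintro C ⟨A, B, h1, h2, h3⟩
      obtain ⟨a, b, rfl, ha, hb⟩ := ih A h1
      rcases h2.dichotomy hip with h4 | h4
      · exact ⟨a + 1, b, by ring, ⟨_, _, ha, h4, comap_mono' h3⟩,
          hb.mono (LieSubmodule.map_mono (h2.1.trans h3))⟩
      · exact ⟨a, b + 1, by ring, ha.mono (comap_mono' (h2.1.trans h3)),
          ⟨_, _, hb, h4, LieSubmodule.map_mono h3⟩⟩
  have join : ∀ (a : ℕ), HasChain S a (⊤ : LieSubmodule ℂ 𝔞 Y) → ∀ (b : ℕ)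
      (D : LieSubmodule ℂ 𝔞 Z), HasChain S b D → HasChain S (a + b) (D.comap p) := by
    intro a ha b
    induction b with
    | zero =>
      intro D _
      refine (ha.map hi).mono ?_
      rintro x hx
      obtain ⟨y, -, rfl⟩ := (LieSubmodule.mem_map _).1 hx
      rw [LieSubmodule.mem_comap, (hip (i y)).2 ⟨y, rfl⟩]
      exact D.zero_mem
    | succ b ih =>
      rintro D ⟨A, B, h1, h2, h3⟩
      exact ⟨_, _, ih A h1, h2.comap hp, comap_mono' h3⟩
  rw [jhMult_eq, jhMult_eq, jhMult_eq]
  apply le_antisymm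
  · refine iSup₂_le fun n hn => ?_
    obtain ⟨a, b, rfl, ha, hb⟩ := split n ⊤ hn
    rw [Nat.cast_add]
    exact add_le_add (le_iSup₂_of_le a (ha.mono le_top) le_rfl)
      (le_iSup₂_of_le b (hb.mono le_top) le_rfl)
  · rw [ENat.biSup_add' ⟨0, trivial⟩]
    refine iSup₂_le fun a ha => ?_
    rw [ENat.add_biSup' ⟨0, trivial⟩]
    refine iSup₂_le fun b hb => ?_
    exact le_iSup₂_of_le (a + b) ((join a ha b ⊤ hb).mono le_top) (by simp)

variable {𝔧 : LieSubalgebra ℂ 𝔞}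

theorem wt_eq_simEig (μ : Module.Dual ℂ 𝔧) :
    wt 𝔧 X μ = simEig (fun x : 𝔧 => LieModule.toEnd ℂ 𝔞 X x) (fun x => μ x) := by
  ext v
  simp only [mem_simEig, LieModule.toEnd_apply_apply]
  exact LieModule.mem_weightSpace _ _

theorem mem_wt {μ : Module.Dual ℂ 𝔧} {v : X} :
    v ∈ wt 𝔧 X μ ↔ ∀ x : 𝔧, ⁅(x : 𝔞), v⁆ = μ x • v :=
  LieModule.mem_weightSpace _ _

theorem dual_injective : Function.Injective (fun (μ : Module.Dual ℂ 𝔧) (x : 𝔧) => μ x) :=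
  fun _ _ h => LinearMap.ext (congrFun h)

/-- The length of a chain is bounded by the dimension of a weight space in which `S` is nonzero. -/
theorem HasChain.le_finrank (hX : ⨆ μ, wt 𝔧 X μ = ⊤) {μ : Module.Dual ℂ 𝔧} (hS : wt 𝔧 S μ ≠ ⊥)
    [FiniteDimensional ℂ (wt 𝔧 X μ)] {n : ℕ} {C : LieSubmodule ℂ 𝔞 X} (h : HasChain S n C) :
    n ≤ Module.finrank ℂ (C.toSubmodule ⊓ wt 𝔧 X μ : Submodule ℂ X) := by
  have fd : ∀ C : LieSubmodule ℂ 𝔞 X,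
      FiniteDimensional ℂ (C.toSubmodule ⊓ wt 𝔧 X μ : Submodule ℂ X) :=
    fun C => Submodule.finiteDimensional_of_le inf_le_right
  induction n generalizing C with
  | zero => simp
  | succ n ih =>
    obtain ⟨A, B, h1, ⟨hAB, f, hf, hfA⟩, h3⟩ := h
    refine (Nat.succ_le_succ (ih h1)).trans (Nat.succ_le_of_lt ?_)
    obtain ⟨s, hs, hs0⟩ := Submodule.exists_mem_ne_zero_of_ne_bot hS
    have hB : ⨆ μ : Module.Dual ℂ 𝔧,
        simEig (fun x : 𝔧 => LieModule.toEnd ℂ 𝔞 B x) (fun x => μ x) = ⊤ :=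
      iSup_simEig_of_injective dual_injective (q := B.toSubmodule.subtype)
        (T' := fun x : 𝔧 => LieModule.toEnd ℂ 𝔞 X x) (fun _ _ => rfl)
        B.toSubmodule.injective_subtype (by simpa only [wt_eq_simEig] using hX)
    obtain ⟨b, hb, rfl⟩ := exists_lift_simEig (T' := fun x : 𝔧 => LieModule.toEnd ℂ 𝔞 S x)
      dual_injective (q := (f : B →ₗ[ℂ] S)) (fun x v => f.map_lie _ _) hf hB
      (by rwa [wt_eq_simEig] at hs)
    have hb' : (b : X) ∈ wt 𝔧 X μ := by
      rw [wt_eq_simEig]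
      exact map_mem_simEig (q := B.toSubmodule.subtype) (fun _ _ => rfl) hb
    have := fd C
    apply Submodule.finrank_lt_finrank_of_lt
    refine lt_of_le_of_ne (inf_le_inf_right _ (hAB.trans h3)) fun e => hs0 ?_
    have h4 : (b : X) ∈ (C.toSubmodule ⊓ wt 𝔧 X μ : Submodule ℂ X) := ⟨h3 b.2, hb'⟩
    rw [← e] at h4
    exact (hfA b).2 h4.1

/-- A simple module with a weight `μ` occurs at most `dim X_μ` times, since weight spaces are exact. -/
theorem jhMult_le_finrank (hX : ⨆ μ, wt 𝔧 X μ = ⊤) {μ : Module.Dual ℂ 𝔧} (hS : wt 𝔧 S μ ≠ ⊥)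
    [FiniteDimensional ℂ (wt 𝔧 X μ)] : jhMult 𝔞 X S ≤ Module.finrank ℂ (wt 𝔧 X μ) := by
  rw [jhMult_eq]
  refine iSup₂_le fun n hn => ?_
  have := hn.le_finrank hX hS
  rw [LieSubmodule.top_toSubmodule, top_inf_eq] at this
  exact_mod_cast this

end Multiplicity

/-! ### Ordered monomials -/

section OrderedMonomials

variable {A B : Type*} [Ring A] [Algebra ℂ A] [Ring B] [Algebra ℂ B] {n : ℕ}

/-- The ordered monomial `y₁^{a₁} ⋯ yₙ^{aₙ}`. -/
def omon (y : Fin n → A) (a : Fin n → ℕ) : A := (List.ofFn fun i => y i ^ a i).prod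

theorem map_omon (f : A →ₐ[ℂ] B) (y : Fin n → A) (a : Fin n → ℕ) :
    f (omon y a) = omon (fun i => f (y i)) a := by
  simp [omon, map_list_prod, List.map_ofFn, Function.comp_def]

theorem omon_zero (y : Fin n → A) : omon y 0 = 1 := by
  simp [omon]

theorem omon_append {m : ℕ} (y : Fin m → A) (z : Fin n → A) (a : Fin m → ℕ) (b : Fin n → ℕ) :
    omon (Fin.append y z) (Fin.append a b) = omon y a * omon z b := by
  have : (fun i => Fin.append y z i ^ Fin.append a b i) =
      Fin.append (fun i => y i ^ a i) (fun i => z i ^ b i) := by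
    ext i
    induction i using Fin.addCases <;> simp
  rw [omon, this, List.ofFn_fin_append, List.prod_append, omon, omon]

/-- The nondecreasing word with `aᵢ` letters `i`. -/
def sortedWord (a : Fin n → ℕ) : List (Fin n) := (List.ofFn fun i => List.replicate (a i) i).flatten

theorem prod_sortedWord (y : Fin n → A) (a : Fin n → ℕ) :
    ((sortedWord a).map y).prod = omon y a := by
  simp [sortedWord, omon, List.map_flatten, List.prod_flatten, List.map_ofFn, Function.comp_def]

theorem count_sortedWord (a : Fin n → ℕ) (i : Fin n) : (sortedWord a).count i = a i := by
  simp [sortedWord, List.count_flatten, List.map_ofFn, Function.comp_def, List.sum_ofFn,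
    List.count_replicate]

theorem length_sortedWord (a : Fin n → ℕ) : (sortedWord a).length = ∑ i, a i := by
  simp [sortedWord, List.length_flatten, List.map_ofFn, Function.comp_def, List.sum_ofFn]

theorem perm_sortedWord (w : List (Fin n)) : w.Perm (sortedWord fun i => w.count i) :=
  List.perm_iff_count.2 fun i => (count_sortedWord (fun i => w.count i) i).symm

/-- The span of the words of length at most `k`. -/
def wordSpan (y : Fin n → A) (k : ℕ) : Submodule ℂ A :=
  Submodule.span ℂ {t | ∃ w : List (Fin n), w.length ≤ k ∧ t = (w.map y).prod}

theorem mul_mem_wordSpan (y : Fin n → A) (k : ℕ) (i : Fin n) {t : A} (ht : t ∈ wordSpan y k) :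
    y i * t ∈ wordSpan y (k + 1) := by
  induction ht using Submodule.span_induction with
  | mem t ht =>
    obtain ⟨w, hw, rfl⟩ := ht
    exact Submodule.subset_span ⟨i :: w, by simpa using hw, by simp⟩
  | zero => simp
  | add s t _ _ hs ht => rw [mul_add]; exact Submodule.add_mem _ hs ht
  | smul c t _ ht => rw [mul_smul_comm]; exact Submodule.smul_mem _ _ ht

variable {y : Fin n → A}
  (hy : ∀ i j, y i * y j - y j * y i ∈ Submodule.span ℂ (Set.range y))

include hy in
/-- Reordering a word changes its value only by a combination of shorter words. -/
theorem sub_mem_wordSpan_of_perm {w w' : List (Fin n)} (h : w.Perm w') (k : ℕ)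
    (hk : w.length ≤ k + 1) : (w.map y).prod - (w'.map y).prod ∈ wordSpan y k := by
  induction h generalizing k with
  | nil => simp
  | @cons i l l' hl ih =>
    rw [List.map_cons, List.map_cons, List.prod_cons, List.prod_cons, ← mul_sub]
    cases k with
    | zero =>
      have h1 : l = [] := by simpa using hk
      subst h1
      have h2 : l' = [] := by simpa using hl.symm
      simp [h2]
    | succ k => exact mul_mem_wordSpan y k i (ih k (by simpa using hk))
  | swap i j l =>
    simp only [List.map_cons, List.prod_cons]
    rw [← mul_assoc, ← mul_assoc, ← sub_mul]
    have h1 : ∀ t ∈ Submodule.span ℂ (Set.range y), t * (l.map y).prod ∈ wordSpan y k := by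
      intro t ht
      induction ht using Submodule.span_induction with
      | mem t ht =>
        obtain ⟨i, rfl⟩ := ht
        refine Submodule.subset_span ⟨i :: l, ?_, by simp⟩
        simp only [List.length_cons] at hk ⊢
        omega
      | zero => simp
      | add s t _ _ hs ht => rw [add_mul]; exact Submodule.add_mem _ hs ht
      | smul c t _ ht => rw [smul_mul_assoc]; exact Submodule.smul_mem _ _ ht
    exact h1 _ (hy _ _)
  | trans h1 _ ih1 ih2 =>
    rw [← sub_add_sub_cancel]
    exact Submodule.add_mem _ (ih1 k hk) (ih2 k (h1.length_eq ▸ hk))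

include hy in
/-- The straightening algorithm: every word is a combination of ordered monomials. -/
theorem wordSpan_le (k : ℕ) : wordSpan y k ≤ Submodule.span ℂ (Set.range (omon y)) := by
  induction k with
  | zero =>
    refine Submodule.span_le.2 ?_
    rintro _ ⟨w, hw, rfl⟩
    have : w = [] := by simpa using hw
    exact Submodule.subset_span ⟨0, by simp [this, omon_zero]⟩
  | succ k ih =>
    refine Submodule.span_le.2 ?_
    rintro _ ⟨w, hw, rfl⟩
    have h1 := ih (sub_mem_wordSpan_of_perm hy (perm_sortedWord w) k hw)
    rw [prod_sortedWord] at h1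
    simpa using Submodule.add_mem _ h1 (Submodule.subset_span ⟨fun i => w.count i, rfl⟩)

include hy in
/-- The span of the ordered monomials is stable under left multiplication by the letters, if
commutators of letters are linear combinations of letters. -/
theorem mul_mem_span_omon (i : Fin n) {t : A} (ht : t ∈ Submodule.span ℂ (Set.range (omon y))) :
    y i * t ∈ Submodule.span ℂ (Set.range (omon y)) := by
  induction ht using Submodule.span_induction with
  | mem t ht =>
    obtain ⟨a, rfl⟩ := ht
    refine wordSpan_le hy _ (mul_mem_wordSpan y (∑ i, a i) i (Submodule.subset_span
      ⟨sortedWord a, (length_sortedWord a).le, (prod_sortedWord y a).symm⟩))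
  | zero => simp
  | add s t _ _ hs ht => rw [mul_add]; exact Submodule.add_mem _ hs ht
  | smul c t _ ht => rw [mul_smul_comm]; exact Submodule.smul_mem _ _ ht

end OrderedMonomials

/-! ### The enveloping algebra: spanning -/

section Enveloping

attribute [local instance] LieRing.ofAssociativeRing
open UniversalEnvelopingAlgebra

variable {𝔞 : Type*} [LieRing 𝔞] [LieAlgebra ℂ 𝔞]

theorem env_adjoin_eq_top (s : Subalgebra ℂ (UniversalEnvelopingAlgebra ℂ 𝔞))
    (hs : ∀ x, ι ℂ x ∈ s) : s = ⊤ := by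
  let f : 𝔞 →ₗ⁅ℂ⁆ s :=
    { toFun := fun x => ⟨ι ℂ x, hs x⟩
      map_add' := fun _ _ => Subtype.ext (map_add _ _ _)
      map_smul' := fun _ _ => Subtype.ext (map_smul _ _ _)
      map_lie' := fun {_ _} => Subtype.ext (LieHom.map_lie _ _ _) }
  have h : s.val.comp (lift ℂ f) = AlgHom.id ℂ _ := by
    apply hom_ext
    ext x
    change ((lift ℂ f (ι ℂ x) : s) : UniversalEnvelopingAlgebra ℂ 𝔞) = ι ℂ x
    rw [lift_ι_apply]
    rfl
  rw [eq_top_iff]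
  intro u _
  have : ((lift ℂ f u : s) : UniversalEnvelopingAlgebra ℂ 𝔞) = u := congrArg (fun g => g u) h
  exact this ▸ (lift ℂ f u).2

/-- A subspace of a `U(𝔞)`-module that is stable under `𝔞` is stable under `U(𝔞)`. -/
theorem env_smul_mem {X : Type*} [AddCommGroup X] [Module ℂ X]
    [Module (UniversalEnvelopingAlgebra ℂ 𝔞) X]
    [IsScalarTower ℂ (UniversalEnvelopingAlgebra ℂ 𝔞) X] {N : Submodule ℂ X}
    (hN : ∀ (x : 𝔞), ∀ v ∈ N, ι ℂ x • v ∈ N) (u : UniversalEnvelopingAlgebra ℂ 𝔞) {v : X}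
    (hv : v ∈ N) : u • v ∈ N := by
  let s : Subalgebra ℂ (UniversalEnvelopingAlgebra ℂ 𝔞) :=
    { carrier := {u | ∀ v ∈ N, u • v ∈ N}
      mul_mem' := fun {a b} ha hb v hv => by rw [mul_smul]; exact ha _ (hb v hv)
      add_mem' := fun {a b} ha hb v hv => by rw [add_smul]; exact N.add_mem (ha v hv) (hb v hv)
      algebraMap_mem' := fun c v hv => by rw [algebraMap_smul]; exact N.smul_mem c hv }
  have h : u ∈ s := by
    rw [env_adjoin_eq_top s hN]
    trivial
  exact h v hv

/-- A subspace of `U(𝔞)` that contains `1` and is stable under left multiplication by `𝔞` is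
everything. -/
theorem env_eq_top {N : Submodule ℂ (UniversalEnvelopingAlgebra ℂ 𝔞)} (h1 : 1 ∈ N)
    (hN : ∀ (x : 𝔞), ∀ v ∈ N, ι ℂ x * v ∈ N) : N = ⊤ := by
  rw [eq_top_iff]
  intro u _
  simpa using env_smul_mem hN u h1

theorem ι_commutator_mem_span {n : ℕ} {y : Fin n → 𝔞}
    (hy : ∀ i j, ⁅y i, y j⁆ ∈ Submodule.span ℂ (Set.range y)) (i j : Fin n) :
    ι ℂ (y i) * ι ℂ (y j) - ι ℂ (y j) * ι ℂ (y i) ∈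
      Submodule.span ℂ (Set.range fun i => ι ℂ (y i)) := by
  have h := Submodule.mem_map_of_mem (f := (ι ℂ : 𝔞 →ₗ⁅ℂ⁆ _).toLinearMap) (hy i j)
  rw [Submodule.map_span, ← Set.range_comp] at h
  have h2 : (ι ℂ : 𝔞 →ₗ⁅ℂ⁆ _) ⁅y i, y j⁆ = ι ℂ (y i) * ι ℂ (y j) - ι ℂ (y j) * ι ℂ (y i) := by
    rw [LieHom.map_lie, LieRing.of_associative_ring_bracket]
  rw [← h2]
  exact h

/-- The ordered monomials in a spanning family of `𝔞` span `U(𝔞)`. -/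
theorem span_omon_eq_top {n : ℕ} {y : Fin n → 𝔞} (hy : Submodule.span ℂ (Set.range y) = ⊤) :
    Submodule.span ℂ (Set.range (omon fun i => ι ℂ (y i))) = ⊤ := by
  apply env_eq_top
  · exact Submodule.subset_span ⟨0, omon_zero _⟩
  · intro x v hv
    have hx : x ∈ Submodule.span ℂ (Set.range y) := hy ▸ Submodule.mem_top
    induction hx using Submodule.span_induction with
    | mem x hx =>
      obtain ⟨i, rfl⟩ := hx
      exact mul_mem_span_omon (ι_commutator_mem_span fun i j => hy ▸ Submodule.mem_top) i hv
    | zero => simp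
    | add a b _ _ ha hb => rw [map_add, add_mul]; exact Submodule.add_mem _ ha hb
    | smul c a _ ha => rw [map_smul, smul_mul_assoc]; exact Submodule.smul_mem _ _ ha

end Enveloping

/-! ### The enveloping algebra: linear independence -/

section Independence

attribute [local instance] LieRing.ofAssociativeRing
open UniversalEnvelopingAlgebra MvPolynomial

variable {R : Type*} [CommRing R] [Algebra ℂ R]

theorem derivation_mem_pow (d : Derivation ℂ R R) (I : Ideal R) (k : ℕ) :
    ∀ f ∈ I ^ (k + 1), d f ∈ I ^ k := by
  induction k with
  | zero => simp
  | succ k ih =>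
    intro f hf
    rw [pow_succ'] at hf
    induction hf using Submodule.mul_induction_on' with
    | mem_mul_mem a ha b hb =>
      rw [Derivation.leibniz, smul_eq_mul, smul_eq_mul]
      refine Ideal.add_mem _ ?_ (Ideal.mul_mem_right _ _ hb)
      rw [pow_succ']
      exact Ideal.mul_mem_mul ha (ih b hb)
    | add a _ b _ ha hb => rw [map_add]; exact Ideal.add_mem _ ha hb

/-- The chain rule. -/
theorem derivation_aeval {n : ℕ} (d : Derivation ℂ R R) (ξ : Fin n → R) (p : MvPolynomial (Fin n) ℂ) :
    d (aeval ξ p) = ∑ i, aeval ξ (pderiv i p) * d (ξ i) := by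
  induction p using MvPolynomial.induction_on with
  | C c => simp
  | add p q hp hq => simp [hp, hq, add_mul, Finset.sum_add_distrib]
  | mul_X p j hp =>
    simp only [map_mul, aeval_X, Derivation.leibniz, hp, smul_eq_mul, map_add, pderiv_X, add_mul,
      Finset.sum_add_distrib, Finset.mul_sum]
    congr 1
    · rw [Finset.sum_eq_single j]
      · simp
      · intro i _ hij
        simp [hij.symm]
      · simp
    · exact Finset.sum_congr rfl fun i _ => by ring

theorem aeval_mem_pow {n : ℕ} {I : Ideal R} {ξ : Fin n → R} (hξ : ∀ i, ξ i ∈ I)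
    {p : MvPolynomial (Fin n) ℂ} {k : ℕ} (hp : p.IsHomogeneous k) : aeval ξ p ∈ I ^ k := by
  rw [aeval_def, eval₂_eq']
  refine Ideal.sum_mem _ fun s hs => Ideal.mul_mem_left _ _ ?_
  have h1 : ∑ i, s i = k := by
    have := hp (mem_support_iff.1 hs)
    simpa [Finsupp.weight_apply, Finsupp.sum_fintype] using this
  rw [← h1, ← Finset.prod_pow_eq_pow_sum]
  exact Ideal.prod_mem_prod fun i _ => Ideal.pow_mem_pow (hξ i) _

/-- The iterated partial derivative along a word. -/
def wordDeriv {n : ℕ} (w : List (Fin n)) :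
    MvPolynomial (Fin n) ℂ →ₗ[ℂ] MvPolynomial (Fin n) ℂ :=
  (w.map fun i => ((pderiv i).toLinearMap : Module.End ℂ (MvPolynomial (Fin n) ℂ))).prod

theorem wordDeriv_cons {n : ℕ} (i : Fin n) (w : List (Fin n)) (p : MvPolynomial (Fin n) ℂ) :
    wordDeriv (i :: w) p = pderiv i (wordDeriv w p) := by
  simp [wordDeriv]

theorem sum_map_single {n : ℕ} (w : List (Fin n)) (i : Fin n) :
    (w.map fun i => (Finsupp.single i 1 : Fin n →₀ ℕ)).sum i = w.count i := by
  induction w with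
  | nil => simp
  | cons k w ih => simp [ih, Finsupp.single_apply, List.count_cons, add_comm]

theorem wordDeriv_monomial {n : ℕ} (w : List (Fin n)) (s : Fin n →₀ ℕ) :
    ∃ c : ℂ, wordDeriv w (monomial s 1) = monomial (s - (w.map fun i => (Finsupp.single i 1 : Fin n →₀ ℕ)).sum) c ∧
      (c ≠ 0 ↔ ∀ i, w.count i ≤ s i) := by
  induction w with
  | nil => exact ⟨1, by simp [wordDeriv], by simp⟩
  | cons j w ih =>
    obtain ⟨c, hc, hc'⟩ := ih
    refine ⟨c * ((s - (w.map fun i => (Finsupp.single i 1 : Fin n →₀ ℕ)).sum) j : ℕ), ?_, ?_⟩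
    · rw [wordDeriv_cons, hc, pderiv_monomial, List.map_cons, List.sum_cons, add_comm,
        tsub_add_eq_tsub_tsub]
    · rw [mul_ne_zero_iff, hc', Nat.cast_ne_zero, Finsupp.tsub_apply, sum_map_single, Nat.sub_ne_zero_iff_lt]
      simp only [List.count_cons]
      constructor
      · rintro ⟨h1, h2⟩ i
        by_cases h : j = i
        · subst h; simpa using h2
        · simpa [h] using h1 i
      · intro h
        refine ⟨fun i => (Nat.le_add_right _ _).trans (h i), ?_⟩
        have := h j
        simp at this
        omega

/-- Among the ordered derivatives of order at most the degree of `x^s`, only `∂^s` has a nonzero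
value on `x^s` at the origin. -/
theorem constantCoeff_wordDeriv {n : ℕ} (a : Fin n → ℕ) (s : Fin n →₀ ℕ) (h : ∑ i, a i ≤ ∑ i, s i) :
    constantCoeff (wordDeriv (sortedWord a) (monomial s 1)) ≠ 0 ↔ a = s := by
  obtain ⟨c, hc, hc'⟩ := wordDeriv_monomial (sortedWord a) s
  rw [hc, constantCoeff_eq, coeff_monomial]
  simp only [count_sortedWord] at hc'
  constructor
  · intro h1
    rw [ite_ne_right_iff] at h1
    have h2 := hc'.1 h1.2
    funext i
    by_contra hne
    have : ∑ i, a i < ∑ i, s i :=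
      Finset.sum_lt_sum (fun i _ => h2 i) ⟨i, Finset.mem_univ i, lt_of_le_of_ne (h2 i) hne⟩
    have h3 := DFunLike.congr_fun h1.1 i
    rw [Finsupp.tsub_apply, sum_map_single, count_sortedWord] at h3
    have h4 := h2 i
    simp at h3
    omega
  · rintro rfl
    rw [ite_ne_right_iff]
    refine ⟨?_, hc'.2 fun i => le_rfl⟩
    ext i
    simp [sum_map_single, count_sortedWord]

variable {𝔞 : Type*} [LieRing 𝔞] [LieAlgebra ℂ 𝔞]

/-- If `𝔞` acts on a commutative algebra by derivations, and the vectors `yⱼ` have a dual family of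
functions `ξᵢ` at a point `ε`, then the ordered monomials in the `yⱼ` are linearly independent in
`U(𝔞)`: the top order part of the differential operator given by a monomial is visible on the
monomials in the `ξᵢ`. -/
theorem linearIndependent_omon_of_derivations {n : ℕ} (y : Fin n → 𝔞)
    (D : 𝔞 → Derivation ℂ R R) (φ : 𝔞 →ₗ⁅ℂ⁆ Module.End ℂ R) (hφ : ∀ x f, φ x f = D x f)
    (ε : R →ₐ[ℂ] ℂ) (ξ : Fin n → R) (hξ : ∀ i, ε (ξ i) = 0)
    (hdual : ∀ i j, ε (D (y j) (ξ i)) = if i = j then 1 else 0) :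
    LinearIndependent ℂ (omon fun i => (ι ℂ (y i) : UniversalEnvelopingAlgebra ℂ 𝔞)) := by
  set I : Ideal R := RingHom.ker ε with hI
  have hξI : ∀ i, ξ i ∈ I := hξ
  -- one derivative acts on leading terms as a partial derivative
  have step : ∀ j k (p : MvPolynomial (Fin n) ℂ), p.IsHomogeneous (k + 1) →
      D (y j) (aeval ξ p) - aeval ξ (pderiv j p) ∈ I ^ (k + 1) := by
    intro j k p hp
    have h1 : aeval ξ (pderiv j p) = ∑ i, aeval ξ (pderiv i p) * (if i = j then 1 else 0) := by
      simp
    rw [derivation_aeval, h1, ← Finset.sum_sub_distrib]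
    refine Ideal.sum_mem _ fun i _ => ?_
    rw [← mul_sub, pow_succ]
    refine Ideal.mul_mem_mul (aeval_mem_pow hξI (by simpa using hp.pderiv)) ?_
    rw [hI, RingHom.mem_ker, map_sub, hdual]
    split_ifs <;> simp
  have hom : ∀ (w : List (Fin n)) d (p : MvPolynomial (Fin n) ℂ), p.IsHomogeneous d →
      (wordDeriv w p).IsHomogeneous (d - w.length) := by
    intro w d p hp
    induction w with
    | nil => simpa [wordDeriv] using hp
    | cons j w ih =>
      rw [wordDeriv_cons, List.length_cons, ← Nat.sub_sub]
      exact ih.pderiv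
  let act : List (Fin n) → Module.End ℂ R := fun w => (w.map fun i => φ (y i)).prod
  -- a word of derivatives acts on leading terms as the corresponding partial derivative: every
  -- correction has higher order at the point `ε`
  have lead : ∀ (w : List (Fin n)) d (p : MvPolynomial (Fin n) ℂ), p.IsHomogeneous d →
      w.length ≤ d → act w (aeval ξ p) - aeval ξ (wordDeriv w p) ∈ I ^ (d - w.length + 1) := by
    intro w d p hp hw
    induction w with
    | nil => simp [act, wordDeriv]
    | cons j w ih =>
      obtain ⟨k, hk⟩ : ∃ k, d - w.length = k + 1 := ⟨d - w.length - 1, by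
        simp only [List.length_cons] at hw; omega⟩
      have h1 := ih (by simp only [List.length_cons] at hw; omega)
      have h2 := hom w d p hp
      rw [hk] at h1 h2
      have h3 : d - (j :: w).length + 1 = k + 1 := by
        simp only [List.length_cons] at hw ⊢; omega
      rw [h3, wordDeriv_cons]
      have h4 : act (j :: w) (aeval ξ p) = D (y j) (act w (aeval ξ p)) := by
        simp [act, hφ]
      rw [h4]
      have h5 := Ideal.add_mem _ (derivation_mem_pow (D (y j)) I (k + 1) _ h1) (step j k _ h2)
      rw [map_sub] at h5
      simpa using h5
  have eval : ∀ (w : List (Fin n)) d (p : MvPolynomial (Fin n) ℂ), p.IsHomogeneous d →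
      w.length ≤ d → ε (act w (aeval ξ p)) = constantCoeff (wordDeriv w p) := by
    intro w d p hp hw
    have h1 := Ideal.pow_le_self (Nat.succ_ne_zero _) (lead w d p hp hw)
    rw [hI, RingHom.mem_ker, map_sub, sub_eq_zero] at h1
    rw [h1, ← AlgHom.comp_apply, comp_aeval]
    have : (fun i => ε (ξ i)) = 0 := funext hξ
    rw [this]
    simp [aeval_zero]
  rw [linearIndependent_iff]
  intro c hc
  by_contra hne
  -- A relation is tested on the monomial in the `ξᵢ` whose exponent `s` is one of maximal degree in
  -- the relation: at `ε` only the term of exponent `s` contributes.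
  obtain ⟨s, hs, hmax⟩ := c.support.exists_max_image (fun a => ∑ i, a i)
    (Finsupp.support_nonempty_iff.2 hne)
  have hom_s : (monomial (Finsupp.equivFunOnFinite.symm s) (1 : ℂ)).IsHomogeneous (∑ i, s i) :=
    isHomogeneous_monomial _ (by simp [Finsupp.degree_eq_sum])
  have h1 := congrArg (fun u => ε ((lift ℂ φ u)
    (aeval ξ (monomial (Finsupp.equivFunOnFinite.symm s) (1 : ℂ))))) hc
  simp only [map_zero, LinearMap.zero_apply] at h1
  rw [Finsupp.linearCombination_apply, Finsupp.sum, map_sum, LinearMap.sum_apply, map_sum,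
    Finset.sum_eq_single s] at h1
  · rw [map_smul, LinearMap.smul_apply, map_smul, smul_eq_mul, mul_eq_zero] at h1
    rcases h1 with h1 | h1
    · exact Finsupp.mem_support_iff.1 hs h1
    · rw [map_omon] at h1
      simp only [lift_ι_apply] at h1
      rw [← prod_sortedWord] at h1
      replace h1 := (eval _ _ _ hom_s (length_sortedWord s).le).symm.trans h1
      exact (constantCoeff_wordDeriv s (Finsupp.equivFunOnFinite.symm s) (by simp)).2 rfl h1
  · intro a ha has
    rw [map_smul, LinearMap.smul_apply, map_smul, smul_eq_mul, mul_eq_zero]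
    right
    rw [map_omon]
    simp only [lift_ι_apply]
    rw [← prod_sortedWord]
    refine (eval _ _ _ hom_s ((length_sortedWord a).le.trans (hmax a ha))).trans ?_
    by_contra h2
    exact has ((constantCoeff_wordDeriv a (Finsupp.equivFunOnFinite.symm s) (by
      simpa using hmax a ha)).1 h2)
  · intro h; exact absurd hs h

end Independence

/-! ### The Poincaré–Birkhoff–Witt theorem for linear Lie algebras -/

section PBW

attribute [local instance] LieRing.ofAssociativeRing
open UniversalEnvelopingAlgebra MvPolynomial

variable {𝔞 : Type*} [LieRing 𝔞] [LieAlgebra ℂ 𝔞]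

/-- The vector field on the space of `κ × κ` matrices given by right multiplication by `A`. -/
def matrixField {κ : Type*} [Fintype κ] (A : Matrix κ κ ℂ) :
    Derivation ℂ (MvPolynomial (κ × κ) ℂ) (MvPolynomial (κ × κ) ℂ) :=
  mkDerivation ℂ fun p => ∑ k, C (A k p.2) * X (p.1, k)

theorem matrixField_X {κ : Type*} [Fintype κ] (A : Matrix κ κ ℂ) (p : κ × κ) :
    matrixField A (X p) = ∑ k, C (A k p.2) * X (p.1, k) := mkDerivation_X _ _ _

theorem matrixField_matrixField {κ : Type*} [Fintype κ] (A B : Matrix κ κ ℂ) (p : κ × κ) :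
    matrixField A (matrixField B (X p)) = matrixField (A * B) (X p) := by
  have h : ∀ k, matrixField A (C (B k p.2) * X (p.1, k)) =
      ∑ l, C (A l k * B k p.2) * X (p.1, l) := by
    intro k
    rw [Derivation.leibniz, derivation_C, smul_zero, add_zero, matrixField_X, smul_eq_mul,
      Finset.mul_sum]
    refine Finset.sum_congr rfl fun l _ => ?_
    rw [C_mul]; ring
  rw [matrixField_X, map_sum, matrixField_X, Finset.sum_congr rfl fun k _ => h k, Finset.sum_comm]
  refine Finset.sum_congr rfl fun l _ => ?_
  rw [← Finset.sum_mul, ← map_sum, Matrix.mul_apply]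

/-- The vector fields of right multiplication represent the Lie algebra of matrices. -/
theorem matrixField_lie {κ : Type*} [Fintype κ] (A B : Matrix κ κ ℂ) :
    matrixField (A * B - B * A) = ⁅matrixField A, matrixField B⁆ := by
  refine derivation_ext fun p => ?_
  rw [Derivation.commutator_apply, matrixField_matrixField, matrixField_matrixField, matrixField_X,
    matrixField_X, matrixField_X, ← Finset.sum_sub_distrib]
  refine Finset.sum_congr rfl fun l _ => ?_
  rw [Matrix.sub_apply, C_sub, sub_mul]

/-- The Poincaré–Birkhoff–Witt theorem for a Lie algebra with a faithful finite dimensional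
representation. -/
theorem linearIndependent_omon {n : ℕ} (y : Fin n → 𝔞) (hy : LinearIndependent ℂ y)
    {κ : Type*} [Fintype κ] [DecidableEq κ] (ρ : 𝔞 →ₗ⁅ℂ⁆ Matrix κ κ ℂ)
    (hρ : Function.Injective ρ) :
    LinearIndependent ℂ (omon fun i => (ι ℂ (y i) : UniversalEnvelopingAlgebra ℂ 𝔞)) := by
  classical
  have hy' : LinearIndependent ℂ fun i => ρ (y i) :=
    hy.map' (ρ : 𝔞 →ₗ[ℂ] Matrix κ κ ℂ) (LinearMap.ker_eq_bot.2 hρ)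
  -- coordinate functions on matrices that are dual to the vectors `y i`
  obtain ⟨ℓ, hℓ⟩ : ∃ ℓ : Fin n → (Matrix κ κ ℂ →ₗ[ℂ] ℂ), ∀ i j, ℓ i (ρ (y j)) = if i = j then 1 else 0 := by
    let b := Module.Basis.extend hy'.linearIndepOn_id
    have hb : ∀ i, ∃ k, b k = ρ (y i) := fun i =>
      ⟨⟨ρ (y i), Module.Basis.subset_extend hy'.linearIndepOn_id ⟨i, rfl⟩⟩, by simp [b]⟩
    choose k hk using hb
    refine ⟨fun i => b.coord (k i), fun i j => ?_⟩
    rw [← hk j, Module.Basis.coord_apply, Module.Basis.repr_self, Finsupp.single_apply]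
    have : k j = k i ↔ i = j := by
      refine ⟨fun h => hy'.injective ?_, fun h => h ▸ rfl⟩
      rw [← hk, ← hk, h]
    simp [this]
  -- the point is the identity matrix, where the vector field of `A` has the value `A`
  let ε : MvPolynomial (κ × κ) ℂ →ₐ[ℂ] ℂ := aeval fun p => (1 : Matrix κ κ ℂ) p.1 p.2
  let ξ : Fin n → MvPolynomial (κ × κ) ℂ := fun i =>
    ∑ p : κ × κ, C (ℓ i (Matrix.single p.1 p.2 1)) * (X p - C ((1 : Matrix κ κ ℂ) p.1 p.2))
  let φ : 𝔞 →ₗ⁅ℂ⁆ Module.End ℂ (MvPolynomial (κ × κ) ℂ) :=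
    { toFun := fun x => (matrixField (ρ x)).toLinearMap
      map_add' := fun x z => by
        have : matrixField (ρ (x + z)) = matrixField (ρ x) + matrixField (ρ z) :=
          derivation_ext fun p => by
            simp [matrixField_X, add_mul, Finset.sum_add_distrib]
        rw [this]; rfl
      map_smul' := fun c x => by
        have : matrixField (ρ (c • x)) = c • matrixField (ρ x) :=
          derivation_ext fun p => by
            simp [matrixField_X, Finset.smul_sum, MvPolynomial.smul_eq_C_mul, mul_assoc]
        rw [this]; rfl
      map_lie' := fun {x z} => by
        have : matrixField (ρ ⁅x, z⁆) = ⁅matrixField (ρ x), matrixField (ρ z)⁆ := by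
          rw [LieHom.map_lie, LieRing.of_associative_ring_bracket, matrixField_lie]
        rw [this]; rfl }
  refine linearIndependent_omon_of_derivations y (fun x => matrixField (ρ x)) φ (fun _ _ => rfl) ε ξ
    (fun i => ?_) (fun i j => ?_)
  · simp [ξ, ε]
  · have h1 : ∀ p : κ × κ, ε (matrixField (ρ (y j)) (X p)) = ρ (y j) p.1 p.2 := by
      intro p
      simp [matrixField_X, ε, Matrix.one_apply]
    have h2 : ε (matrixField (ρ (y j)) (ξ i)) =
        ∑ p : κ × κ, ℓ i (Matrix.single p.1 p.2 1) * ρ (y j) p.1 p.2 := by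
      simp only [ξ, map_sum, Derivation.leibniz, smul_eq_mul, derivation_C, mul_zero, add_zero,
        map_sub, sub_zero, map_mul, h1]
      simp [ε]
    rw [h2, ← hℓ i j]
    conv_rhs => rw [Matrix.matrix_eq_sum_single (ρ (y j))]
    rw [map_sum, Fintype.sum_prod_type]
    refine Finset.sum_congr rfl fun a _ => ?_
    rw [map_sum]
    refine Finset.sum_congr rfl fun b _ => ?_
    rw [mul_comm, ← smul_eq_mul, ← map_smul, Matrix.smul_single, smul_eq_mul, mul_one]

end PBW

/-! ### Generalized Verma modules -/

section GenVermaTheory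

attribute [local instance] LieRing.ofAssociativeRing
open UniversalEnvelopingAlgebra

section Basic

variable {𝔞 : Type*} [LieRing 𝔞] [LieAlgebra ℂ 𝔞]

variable (𝔩 : LieSubalgebra ℂ 𝔞) (𝔲 : Submodule ℂ 𝔞) (F : Type*) [AddCommGroup F]
  [Module ℂ F] [LieRingModule 𝔩 F] [LieModule ℂ 𝔩 F]
variable {X : Type*} [AddCommGroup X] [Module ℂ X] [LieRingModule 𝔞 X] [LieModule ℂ 𝔞 X]

/-- The quotient map from `U(𝔞) ⊗ F` to `U(𝔞) ⊗_{U(𝔭)} F`. -/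
def GenVerma.mkL : UniversalEnvelopingAlgebra ℂ 𝔞 ⊗[ℂ] F →ₗ[UniversalEnvelopingAlgebra ℂ 𝔞]
    GenVerma 𝔩 𝔲 F :=
  (genVermaRel 𝔩 𝔲 F).mkQ

/-- The canonical map `F → U(𝔞) ⊗_{U(𝔭)} F`. -/
def GenVerma.of : F →ₗ[ℂ] GenVerma 𝔩 𝔲 F :=
  ((GenVerma.mkL 𝔩 𝔲 F).restrictScalars ℂ) ∘ₗ TensorProduct.mk ℂ _ F 1

variable {𝔩 𝔲 F}

theorem GenVerma.mk_tmul (u : UniversalEnvelopingAlgebra ℂ 𝔞) (f : F) :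
    GenVerma.mkL 𝔩 𝔲 F (u ⊗ₜ f) = u • GenVerma.of 𝔩 𝔲 F f := by
  have : GenVerma.mkL 𝔩 𝔲 F (u • ((1 : UniversalEnvelopingAlgebra ℂ 𝔞) ⊗ₜ[ℂ] f)) =
    u • GenVerma.of 𝔩 𝔲 F f := map_smul _ u _
  rwa [TensorProduct.smul_tmul', smul_eq_mul, mul_one] at this

theorem GenVerma.mkL_eq_zero {t : UniversalEnvelopingAlgebra ℂ 𝔞 ⊗[ℂ] F} :
    GenVerma.mkL 𝔩 𝔲 F t = 0 ↔ t ∈ genVermaRel 𝔩 𝔲 F :=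
  Submodule.Quotient.mk_eq_zero _

theorem GenVerma.mkL_surjective : Function.Surjective (GenVerma.mkL 𝔩 𝔲 F) :=
  (genVermaRel 𝔩 𝔲 F).mkQ_surjective

theorem GenVerma.induction {p : GenVerma 𝔩 𝔲 F → Prop} (h0 : p 0)
    (hs : ∀ (u : UniversalEnvelopingAlgebra ℂ 𝔞) f, p (u • GenVerma.of 𝔩 𝔲 F f)) (ha : ∀ a b, p a → p b → p (a + b))
    (m : GenVerma 𝔩 𝔲 F) : p m := by
  obtain ⟨t, rfl⟩ := GenVerma.mkL_surjective m
  induction t using TensorProduct.induction_on with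
  | zero => rwa [map_zero]
  | tmul u f => rw [GenVerma.mk_tmul]; exact hs u f
  | add s t hs ht => rw [map_add]; exact ha _ _ hs ht

theorem GenVerma.lie_def (x : 𝔞) (m : GenVerma 𝔩 𝔲 F) : ⁅x, m⁆ = ι ℂ x • m := rfl

/-- The relation of the tensor product over `U(𝔭)`: on the image of `F`, the subalgebra `𝔭 = 𝔩 + 𝔲`
acts through its quotient `𝔩`. -/
theorem GenVerma.lie_of_add (y : 𝔩) {z : 𝔞} (hz : z ∈ 𝔲) (f : F) :
    ⁅(y : 𝔞) + z, GenVerma.of 𝔩 𝔲 F f⁆ = GenVerma.of 𝔩 𝔲 F ⁅y, f⁆ := by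
  rw [GenVerma.lie_def, ← GenVerma.mk_tmul, ← sub_eq_zero]
  have h : GenVerma.mkL 𝔩 𝔲 F (ι ℂ ((y : 𝔞) + z) ⊗ₜ[ℂ] f - 1 ⊗ₜ[ℂ] ⁅y, f⁆) = 0 :=
    GenVerma.mkL_eq_zero.2 (Submodule.subset_span ⟨y, z, hz, f, rfl⟩)
  rw [map_sub] at h
  exact h

theorem GenVerma.lie_of (y : 𝔩) (f : F) :
    ⁅(y : 𝔞), GenVerma.of 𝔩 𝔲 F f⁆ = GenVerma.of 𝔩 𝔲 F ⁅y, f⁆ := by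
  simpa using GenVerma.lie_of_add y 𝔲.zero_mem f

theorem GenVerma.lie_of_nil {z : 𝔞} (hz : z ∈ 𝔲) (f : F) :
    ⁅z, GenVerma.of 𝔩 𝔲 F f⁆ = 0 := by
  simpa using GenVerma.lie_of_add (0 : 𝔩) hz f

/-- A subspace stable under `𝔞` that contains the image of `F` is everything. -/
theorem GenVerma.eq_top {N : Submodule ℂ (GenVerma 𝔩 𝔲 F)}
    (hN : ∀ (x : 𝔞), ∀ v ∈ N, ⁅x, v⁆ ∈ N) (hF : ∀ f, GenVerma.of 𝔩 𝔲 F f ∈ N) : N = ⊤ := by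
  rw [eq_top_iff]
  intro v _
  exact GenVerma.induction (p := fun v => v ∈ N) N.zero_mem
    (fun u f => env_smul_mem hN u (hF f)) (fun _ _ => N.add_mem) v

theorem GenVerma.lieSubmodule_eq_top {N : LieSubmodule ℂ 𝔞 (GenVerma 𝔩 𝔲 F)}
    (hF : ∀ f, GenVerma.of 𝔩 𝔲 F f ∈ N) : N = ⊤ := by
  rw [← LieSubmodule.toSubmodule_eq_top]
  exact GenVerma.eq_top (fun x v hv => N.lie_mem hv) hF

theorem GenVerma.hom_ext {f g : GenVerma 𝔩 𝔲 F →ₗ⁅ℂ, 𝔞⁆ X}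
    (h : ∀ v, f (GenVerma.of 𝔩 𝔲 F v) = g (GenVerma.of 𝔩 𝔲 F v)) (m : GenVerma 𝔩 𝔲 F) :
    f m = g m := by
  have : (f - g).ker = ⊤ := GenVerma.lieSubmodule_eq_top fun v => by
    rw [LieModuleHom.mem_ker, LieModuleHom.sub_apply, h, sub_self]
  have hm : m ∈ (f - g).ker := this ▸ LieSubmodule.mem_top m
  rwa [LieModuleHom.mem_ker, LieModuleHom.sub_apply, sub_eq_zero] at hm

/-- Linear maps out of `U(𝔞) ⊗_{U(𝔭)} F` are linear maps out of `U(𝔞) ⊗ F` that are balanced. -/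
theorem GenVerma.exists_desc {W : Type*} [AddCommGroup W] [Module ℂ W]
    (L : UniversalEnvelopingAlgebra ℂ 𝔞 →ₗ[ℂ] F →ₗ[ℂ] W)
    (h : ∀ u (y : 𝔩), ∀ z ∈ 𝔲, ∀ f, L (u * ι ℂ ((y : 𝔞) + z)) f = L u ⁅y, f⁆) :
    ∃ M : GenVerma 𝔩 𝔲 F →ₗ[ℂ] W, ∀ u f, M (u • GenVerma.of 𝔩 𝔲 F f) = L u f := by
  let L' := TensorProduct.lift L
  have key : ∀ t ∈ genVermaRel 𝔩 𝔲 F, ∀ u : UniversalEnvelopingAlgebra ℂ 𝔞, L' (u • t) = 0 := by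
    intro t ht
    induction ht using Submodule.span_induction with
    | mem t ht =>
      obtain ⟨y, z, hz, f, rfl⟩ := ht
      intro u
      rw [smul_sub, TensorProduct.smul_tmul', TensorProduct.smul_tmul', map_sub,
        TensorProduct.lift.tmul, TensorProduct.lift.tmul, smul_eq_mul, smul_eq_mul, mul_one, h u y z hz,
        sub_self]
    | zero => simp
    | add s t _ _ hs ht => intro u; rw [smul_add, map_add, hs, ht, add_zero]
    | smul r t _ ht => intro u; rw [← mul_smul]; exact ht _
  refine ⟨(((genVermaRel 𝔩 𝔲 F).restrictScalars ℂ).liftQ L' fun t ht => by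
    simpa using key t ht 1) ∘ₗ
    (Submodule.Quotient.restrictScalarsEquiv ℂ (genVermaRel 𝔩 𝔲 F)).symm.toLinearMap, fun u f => ?_⟩
  rw [← GenVerma.mk_tmul]
  rfl

/-- The universal property of generalized Verma modules. -/
theorem GenVerma.exists_lift (g : F →ₗ[ℂ] X) (hg : ∀ (y : 𝔩) f, g ⁅y, f⁆ = ⁅(y : 𝔞), g f⁆)
    (hg' : ∀ z ∈ 𝔲, ∀ f, ⁅z, g f⁆ = 0) :
    ∃ M : GenVerma 𝔩 𝔲 F →ₗ⁅ℂ, 𝔞⁆ X, ∀ f, M (GenVerma.of 𝔩 𝔲 F f) = g f := by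
  let r : UniversalEnvelopingAlgebra ℂ 𝔞 →ₐ[ℂ] Module.End ℂ X := lift ℂ (LieModule.toEnd ℂ 𝔞 X)
  have hr : ∀ x v, r (ι ℂ x) v = ⁅x, v⁆ := fun x v => by
    simp only [r, lift_ι_apply, LieModule.toEnd_apply_apply]
  obtain ⟨M, hM⟩ := GenVerma.exists_desc (𝔩 := 𝔩) (𝔲 := 𝔲) (F := F)
    (LinearMap.lcomp ℂ X g ∘ₗ r.toLinearMap) (fun u y z hz f => by
      change r (u * ι ℂ ((y : 𝔞) + z)) (g f) = r u (g ⁅y, f⁆)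
      rw [map_mul, Module.End.mul_apply, hr, add_lie, hg' z hz, add_zero, hg])
  have hM' : ∀ u f, M (u • GenVerma.of 𝔩 𝔲 F f) = r u (g f) := hM
  refine ⟨{ M with map_lie' := fun {x m} => ?_ }, fun f => ?_⟩
  · change M ⁅x, m⁆ = ⁅x, M m⁆
    refine GenVerma.induction (p := fun m => M ⁅x, m⁆ = ⁅x, M m⁆) ?_ (fun u f => ?_)
      (fun s t hs ht => ?_) m
    · rw [lie_zero, map_zero, lie_zero]
    · rw [GenVerma.lie_def, ← mul_smul, hM', hM', map_mul, Module.End.mul_apply, hr]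
    · rw [lie_add, map_add, hs, ht, map_add, lie_add]
  · change M _ = _
    simpa using hM' 1 f

theorem omon_smul_eq {n : ℕ} (y : Fin n → 𝔞) (a : Fin n → ℕ) (m : GenVerma 𝔩 𝔲 F) :
    omon (fun i => (ι ℂ (y i) : UniversalEnvelopingAlgebra ℂ 𝔞)) a • m =
      omon (fun i => LieModule.toEnd ℂ 𝔞 (GenVerma 𝔩 𝔲 F) (y i)) a m := by
  let r : UniversalEnvelopingAlgebra ℂ 𝔞 →ₐ[ℂ] Module.End ℂ (GenVerma 𝔩 𝔲 F) :=
    Algebra.lsmul ℂ ℂ (GenVerma 𝔩 𝔲 F)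
  have : r (omon (fun i => (ι ℂ (y i) : UniversalEnvelopingAlgebra ℂ 𝔞)) a) =
      omon (fun i => LieModule.toEnd ℂ 𝔞 (GenVerma 𝔩 𝔲 F) (y i)) a := map_omon r _ _
  rw [← this]
  rfl

/-- If `𝔞` is spanned by the `yᵢ` and by elements of `𝔩 + 𝔲`, then `U(𝔞) ⊗_{U(𝔭)} F` is spanned by
the vectors `y^a ⊗ f`. -/
theorem GenVerma.span_omon {m r : ℕ} {y : Fin m → 𝔞} {z : Fin r → 𝔞}
    (hyz : Submodule.span ℂ (Set.range (Fin.append y z)) = ⊤)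
    (hz : ∀ i, z i ∈ 𝔩.toSubmodule ⊔ 𝔲) :
    Submodule.span ℂ (Set.range fun p : (Fin m → ℕ) × F =>
      omon (fun i => LieModule.toEnd ℂ 𝔞 (GenVerma 𝔩 𝔲 F) (y i)) p.1 (GenVerma.of 𝔩 𝔲 F p.2)) =
      ⊤ := by
  set N := Submodule.span ℂ (Set.range fun p : (Fin m → ℕ) × F =>
      omon (fun i => LieModule.toEnd ℂ 𝔞 (GenVerma 𝔩 𝔲 F) (y i)) p.1 (GenVerma.of 𝔩 𝔲 F p.2))
  have hz' : ∀ i f, ∃ f', ⁅z i, GenVerma.of 𝔩 𝔲 F f⁆ = GenVerma.of 𝔩 𝔲 F f' := by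
    intro i f
    obtain ⟨y, hy, u, hu, hyu⟩ := Submodule.mem_sup.1 (hz i)
    exact ⟨⁅(⟨y, hy⟩ : 𝔩), f⁆, by rw [← hyu]; exact GenVerma.lie_of_add ⟨y, hy⟩ hu f⟩
  have hw : ∀ (w : List (Fin r)) f, ∃ f', ((w.map fun i => (ι ℂ (z i) :
      UniversalEnvelopingAlgebra ℂ 𝔞)).prod) • GenVerma.of 𝔩 𝔲 F f = GenVerma.of 𝔩 𝔲 F f' := by
    intro w f
    induction w with
    | nil => exact ⟨f, by simp⟩
    | cons i w ih =>
      obtain ⟨f', hf'⟩ := ih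
      obtain ⟨f'', hf''⟩ := hz' i f'
      exact ⟨f'', by rw [List.map_cons, List.prod_cons, mul_smul, hf', ← GenVerma.lie_def, hf'']⟩
  have hu : ∀ (u : UniversalEnvelopingAlgebra ℂ 𝔞) f, u • GenVerma.of 𝔩 𝔲 F f ∈ N := by
    intro u f
    have hu : u ∈ Submodule.span ℂ (Set.range (omon fun i => (ι ℂ (Fin.append y z i) :
        UniversalEnvelopingAlgebra ℂ 𝔞))) := by
      rw [span_omon_eq_top hyz]; trivial
    induction hu using Submodule.span_induction with
    | mem u hu =>
      obtain ⟨c, rfl⟩ := hu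
      have h1 : (fun i => (ι ℂ (Fin.append y z i) : UniversalEnvelopingAlgebra ℂ 𝔞)) =
          Fin.append (fun i => ι ℂ (y i)) (fun i => ι ℂ (z i)) := by
        ext i
        induction i using Fin.addCases <;> simp
      have h2 : c = Fin.append (fun i => c (Fin.castAdd r i)) (fun i => c (Fin.natAdd m i)) := by
        ext i
        induction i using Fin.addCases <;> simp
      rw [h1, h2, omon_append, mul_smul, ← prod_sortedWord (fun i => ι ℂ (z i))]
      obtain ⟨f', hf'⟩ := hw (sortedWord fun i => c (Fin.natAdd m i)) f
      rw [hf', omon_smul_eq]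
      exact Submodule.subset_span ⟨(_, f'), rfl⟩
    | zero => rw [zero_smul]; exact N.zero_mem
    | add u v _ _ hu hv => rw [add_smul]; exact N.add_mem hu hv
    | smul c u _ hu => rw [smul_assoc]; exact N.smul_mem c hu
  rw [eq_top_iff]
  intro v _
  exact GenVerma.induction (p := fun v => v ∈ N) N.zero_mem hu (fun _ _ => N.add_mem) v

/-- If the ordered monomials in a basis `y, z` of `𝔞` are linearly independent in `U(𝔞)`, where `z`
is a basis of the subalgebra `𝔭 = 𝔩 + 𝔲`, then `U(𝔞) ⊗_{U(𝔭)} F` is a direct sum of copies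
`y^a ⊗ F` of `F`. -/
theorem GenVerma.exists_coords (𝔭 : LieSubalgebra ℂ 𝔞) (π : 𝔭 →ₗ⁅ℂ⁆ 𝔩)
    (hπ : ∀ (y : 𝔩), ∀ z ∈ 𝔲, ∃ x : 𝔭, (x : 𝔞) = (y : 𝔞) + z ∧ π x = y)
    {m r : ℕ} {y : Fin m → 𝔞} {z : Fin r → 𝔭}
    (hyz : Submodule.span ℂ (Set.range (Fin.append y fun i => (z i : 𝔞))) = ⊤)
    (hz : Submodule.span ℂ (Set.range z) = ⊤)
    (hind : LinearIndependent ℂ (omon fun i => (ι ℂ (Fin.append y (fun i => (z i : 𝔞)) i) :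
      UniversalEnvelopingAlgebra ℂ 𝔞))) :
    ∃ M : GenVerma 𝔩 𝔲 F →ₗ[ℂ] ((Fin m → ℕ) →₀ F), ∀ a f,
      M (omon (fun i => LieModule.toEnd ℂ 𝔞 (GenVerma 𝔩 𝔲 F) (y i)) a (GenVerma.of 𝔩 𝔲 F f)) =
        Finsupp.single a f := by
  have happ : (fun i => (ι ℂ (Fin.append y (fun i => (z i : 𝔞)) i) :
      UniversalEnvelopingAlgebra ℂ 𝔞)) =
      Fin.append (fun i => ι ℂ (y i)) (fun i => ι ℂ (z i : 𝔞)) := by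
    ext i
    induction i using Fin.addCases <;> simp
  let B := Module.Basis.mk hind (span_omon_eq_top hyz).ge
  have hB : ∀ a b, B (Fin.append a b) = omon (fun i => ι ℂ (y i)) a * omon (fun i => ι ℂ (z i : 𝔞)) b := by
    intro a b
    rw [Module.Basis.mk_apply, happ, omon_append]
  have hBspan : Submodule.span ℂ (Set.range fun p : (Fin m → ℕ) × (Fin r → ℕ) =>
      omon (fun i => (ι ℂ (y i) : UniversalEnvelopingAlgebra ℂ 𝔞)) p.1 *
        omon (fun i => ι ℂ (z i : 𝔞)) p.2) = ⊤ := by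
    rw [eq_top_iff, ← B.span_eq, Submodule.span_le]
    rintro _ ⟨c, rfl⟩
    refine Submodule.subset_span ⟨(fun i => c (Fin.castAdd r i), fun i => c (Fin.natAdd m i)), ?_⟩
    refine (hB _ _).symm.trans ?_
    congr 1
    ext i
    induction i using Fin.addCases <;> simp
  let ψ : UniversalEnvelopingAlgebra ℂ 𝔭 →ₐ[ℂ] Module.End ℂ F :=
    lift ℂ ((LieModule.toEnd ℂ 𝔩 F).comp π)
  have hψ : ∀ x f, ψ (ι ℂ x) f = ⁅π x, f⁆ := fun x f => by
    simp only [ψ, lift_ι_apply, LieHom.comp_apply, LieModule.toEnd_apply_apply]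
  let j : UniversalEnvelopingAlgebra ℂ 𝔭 →ₐ[ℂ] UniversalEnvelopingAlgebra ℂ 𝔞 :=
    lift ℂ ((ι ℂ).comp 𝔭.incl)
  have hj : ∀ x : 𝔭, j (ι ℂ x) = ι ℂ (x : 𝔞) := fun x => by
    simp only [j, lift_ι_apply, LieHom.comp_apply]
    rfl
  -- `L` sends `y^a z^b` and `f` to the element `z^b f` in the copy `a` of `F`. It is defined on the
  -- Poincaré–Birkhoff–Witt basis, and it is balanced because it is compatible with right
  -- multiplication by `U(𝔭)`.
  let L : UniversalEnvelopingAlgebra ℂ 𝔞 →ₗ[ℂ] F →ₗ[ℂ] ((Fin m → ℕ) →₀ F) :=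
    B.constr ℂ fun c => Finsupp.lsingle (fun i => c (Fin.castAdd r i)) ∘ₗ
      ψ (omon (fun i => ι ℂ (z i)) fun i => c (Fin.natAdd m i))
  have hL : ∀ a (w : UniversalEnvelopingAlgebra ℂ 𝔭),
      L (omon (fun i => ι ℂ (y i)) a * j w) = Finsupp.lsingle a ∘ₗ ψ w := by
    intro a w
    have hw : w ∈ Submodule.span ℂ (Set.range (omon fun i => (ι ℂ (z i) :
        UniversalEnvelopingAlgebra ℂ 𝔭))) := by
      rw [span_omon_eq_top hz]; trivial
    induction hw using Submodule.span_induction with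
    | mem w hw =>
      obtain ⟨b, rfl⟩ := hw
      have h1 : j (omon (fun i => ι ℂ (z i)) b) = omon (fun i => ι ℂ (z i : 𝔞)) b := by
        rw [map_omon]
        simp only [hj]
      rw [h1, ← hB, Module.Basis.constr_basis]
      simp
    | zero => simp
    | add u v _ _ hu hv =>
      rw [map_add, mul_add, map_add, hu, hv, map_add, LinearMap.comp_add]
    | smul c u _ hu =>
      rw [map_smul, mul_smul_comm, map_smul, hu, map_smul, LinearMap.comp_smul]
  obtain ⟨M, hM⟩ := GenVerma.exists_desc (𝔩 := 𝔩) (𝔲 := 𝔲) (F := F) L (by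
    intro u y' z' hz' f
    obtain ⟨x, hx, hx'⟩ := hπ y' z' hz'
    have hu : u ∈ Submodule.span ℂ (Set.range fun p : (Fin m → ℕ) × (Fin r → ℕ) =>
      omon (fun i => (ι ℂ (y i) : UniversalEnvelopingAlgebra ℂ 𝔞)) p.1 *
        omon (fun i => ι ℂ (z i : 𝔞)) p.2) := by rw [hBspan]; trivial
    induction hu using Submodule.span_induction with
    | mem u hu =>
      obtain ⟨⟨a, b⟩, rfl⟩ := hu
      have h1 : omon (fun i => ι ℂ (z i : 𝔞)) b = j (omon (fun i => ι ℂ (z i)) b) := by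
        rw [map_omon]
        simp only [hj]
      simp only [h1]
      rw [← hx, ← hj, mul_assoc, ← map_mul, hL, hL]
      simp only [LinearMap.comp_apply, map_mul, Module.End.mul_apply, hψ, hx']
    | zero => simp
    | add u v _ _ hu hv => 
      rw [add_mul, map_add L, LinearMap.add_apply, hu, hv, map_add L, LinearMap.add_apply]
    | smul c u _ hu => simp only [smul_mul_assoc, map_smul, LinearMap.smul_apply, hu])
  refine ⟨M, fun a f => ?_⟩
  rw [← omon_smul_eq, hM]
  have := hL a 1
  rw [map_one, mul_one] at this
  rw [this]
  simp

end Basic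

end GenVermaTheory

/-! ### Bases of generalized Verma modules -/

section GenVermaBasis

attribute [local instance] LieRing.ofAssociativeRing
open UniversalEnvelopingAlgebra LieModule

variable {𝔞 : Type*} [LieRing 𝔞] [LieAlgebra ℂ 𝔞]

/-- The projection of a semidirect sum `𝔩 + 𝔲` to `𝔩`. -/
theorem exists_levi_projection {𝔩 : LieSubalgebra ℂ 𝔞} {𝔲 : Submodule ℂ 𝔞}
    (h1 : ∀ x ∈ 𝔩, ∀ z ∈ 𝔲, ⁅x, z⁆ ∈ 𝔲) (h2 : ∀ z ∈ 𝔲, ∀ w ∈ 𝔲, ⁅z, w⁆ ∈ 𝔲)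
    (hd : Disjoint 𝔩.toSubmodule 𝔲) :
    ∃ (𝔭 : LieSubalgebra ℂ 𝔞) (π : 𝔭 →ₗ⁅ℂ⁆ 𝔩), 𝔭.toSubmodule = 𝔩.toSubmodule ⊔ 𝔲 ∧
      ∀ (y : 𝔩), ∀ z ∈ 𝔲, ∃ x : 𝔭, (x : 𝔞) = (y : 𝔞) + z ∧ π x = y := by
  have uniq : ∀ (y y' : 𝔩), ∀ z ∈ 𝔲, ∀ z' ∈ 𝔲, (y : 𝔞) + z = (y' : 𝔞) + z' → y = y' := by
    intro y y' z hz z' hz' h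
    have h3 : (y : 𝔞) - y' = z' - z := by
      rw [sub_eq_sub_iff_add_eq_add, h, add_comm]
    have h4 : (y : 𝔞) - y' = 0 := Submodule.disjoint_def.1 hd _ (𝔩.sub_mem y.2 y'.2)
      (h3 ▸ 𝔲.sub_mem hz' hz)
    exact Subtype.ext (sub_eq_zero.1 h4)
  have hbr : ∀ (y y' : 𝔩), ∀ z ∈ 𝔲, ∀ z' ∈ 𝔲, ∃ w ∈ 𝔲,
      ⁅(y : 𝔞) + z, (y' : 𝔞) + z'⁆ = (⁅y, y'⁆ : 𝔩) + w := by
    intro y y' z hz z' hz'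
    refine ⟨⁅(y : 𝔞), z'⁆ + (⁅z, (y' : 𝔞)⁆ + ⁅z, z'⁆), add_mem (h1 _ y.2 _ hz') (add_mem ?_
      (h2 _ hz _ hz')), ?_⟩
    · rw [← lie_skew]
      exact neg_mem (h1 _ y'.2 _ hz)
    · rw [add_lie, lie_add, lie_add, LieSubalgebra.coe_bracket, add_assoc]
  let 𝔭 : LieSubalgebra ℂ 𝔞 :=
    { 𝔩.toSubmodule ⊔ 𝔲 with
      lie_mem' := by
        rintro x x' hx hx'
        obtain ⟨y, hy, z, hz, rfl⟩ := Submodule.mem_sup.1 hx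
        obtain ⟨y', hy', z', hz', rfl⟩ := Submodule.mem_sup.1 hx'
        obtain ⟨w, hw, h⟩ := hbr ⟨y, hy⟩ ⟨y', hy'⟩ z hz z' hz'
        exact h ▸ Submodule.add_mem_sup (⁅(⟨y, hy⟩ : 𝔩), ⟨y', hy'⟩⁆ : 𝔩).2 hw }
  have hdec : ∀ x : 𝔭, ∃ y : 𝔩, ∃ z ∈ 𝔲, (y : 𝔞) + z = x := fun x => by
    obtain ⟨y, hy, z, hz, h⟩ := Submodule.mem_sup.1 x.2
    exact ⟨⟨y, hy⟩, z, hz, h⟩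
  choose p n hn hpn using hdec
  have hp : ∀ (x : 𝔭) (y : 𝔩), ∀ z ∈ 𝔲, (x : 𝔞) = (y : 𝔞) + z → p x = y := fun x y z hz h =>
    uniq _ _ _ (hn x) _ hz ((hpn x).trans h)
  have hadd : ∀ a b, p (a + b) = p a + p b := fun a b => by
    refine hp _ _ _ (add_mem (hn a) (hn b)) ?_
    change (a : 𝔞) + b = ((p a : 𝔞) + p b) + (n a + n b)
    rw [← hpn a, ← hpn b]
    abel
  have hsmul : ∀ (c : ℂ) a, p (c • a) = c • p a := fun c a => by
    refine hp _ _ _ (Submodule.smul_mem _ c (hn a)) ?_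
    change c • (a : 𝔞) = c • (p a : 𝔞) + c • n a
    rw [← smul_add, hpn a]
  have hlie : ∀ a b, p ⁅a, b⁆ = ⁅p a, p b⁆ := fun a b => by
    obtain ⟨w, hw, h⟩ := hbr (p a) (p b) _ (hn a) _ (hn b)
    refine hp _ _ w hw ?_
    rw [LieSubalgebra.coe_bracket, ← hpn a, ← hpn b, h]
  let π : 𝔭 →ₗ⁅ℂ⁆ 𝔩 :=
    { toFun := p
      map_add' := hadd
      map_smul' := hsmul
      map_lie' := hlie _ _ }
  exact ⟨𝔭, π, rfl, fun y z hz =>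
      ⟨⟨(y : 𝔞) + z, Submodule.add_mem_sup y.2 hz⟩, rfl, hp _ y z hz rfl⟩⟩

theorem linearIndependent_append {R V : Type*} [Ring R] [AddCommGroup V] [Module R V] {m r : ℕ}
    {y : Fin m → V} {z : Fin r → V} (hy : LinearIndependent R y) (hz : LinearIndependent R z)
    (hd : Disjoint (Submodule.span R (Set.range y)) (Submodule.span R (Set.range z))) :
    LinearIndependent R (Fin.append y z) := by
  rw [← linearIndependent_equiv finSumFinEquiv]
  convert hy.sum_type hz hd using 1
  ext i
  rcases i with i | i <;> simp

theorem span_range_append {R V : Type*} [Ring R] [AddCommGroup V] [Module R V] {m r : ℕ}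
    (y : Fin m → V) (z : Fin r → V) : Submodule.span R (Set.range (Fin.append y z)) =
      Submodule.span R (Set.range y) ⊔ Submodule.span R (Set.range z) := by
  rw [← Submodule.span_union]
  congr 1
  ext x
  constructor
  · rintro ⟨i, rfl⟩
    induction i using Fin.addCases with
    | left i => exact Or.inl ⟨i, by simp⟩
    | right i => exact Or.inr ⟨i, by simp⟩
  · rintro (⟨i, rfl⟩ | ⟨i, rfl⟩)
    · exact ⟨Fin.castAdd r i, by simp⟩
    · exact ⟨Fin.natAdd m i, by simp⟩

variable {𝔩 : LieSubalgebra ℂ 𝔞} {𝔲 : Submodule ℂ 𝔞} {F : Type*} [AddCommGroup F] [Module ℂ F]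
  [LieRingModule 𝔩 F] [LieModule ℂ 𝔩 F]

/-- By the Poincaré–Birkhoff–Witt theorem, `U(𝔞) ⊗_{U(𝔭)} F` is a direct sum of copies of `F`
indexed by the ordered monomials in a basis `y` of a complement of `𝔭 = 𝔩 + 𝔲`. -/
theorem GenVerma.exists_coords_of_isCompl [FiniteDimensional ℂ 𝔞]
    (h1 : ∀ x ∈ 𝔩, ∀ z ∈ 𝔲, ⁅x, z⁆ ∈ 𝔲) (h2 : ∀ z ∈ 𝔲, ∀ w ∈ 𝔲, ⁅z, w⁆ ∈ 𝔲)
    (hd : Disjoint 𝔩.toSubmodule 𝔲) {m : ℕ} {y : Fin m → 𝔞} (hy : LinearIndependent ℂ y)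
    (hc : IsCompl (Submodule.span ℂ (Set.range y)) (𝔩.toSubmodule ⊔ 𝔲))
    {κ : Type*} [Fintype κ] [DecidableEq κ] (ρ : 𝔞 →ₗ⁅ℂ⁆ Matrix κ κ ℂ)
    (hρ : Function.Injective ρ) :
    ∃ M : GenVerma 𝔩 𝔲 F →ₗ[ℂ] ((Fin m → ℕ) →₀ F), ∀ a f,
      M (omon (fun i => LieModule.toEnd ℂ 𝔞 (GenVerma 𝔩 𝔲 F) (y i)) a (GenVerma.of 𝔩 𝔲 F f)) =
        Finsupp.single a f := by
  obtain ⟨𝔭, π, h𝔭, hπ⟩ := exists_levi_projection h1 h2 hd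
  let b := Module.finBasis ℂ 𝔭
  have hspan : Submodule.span ℂ (Set.range fun i => (b i : 𝔞)) = 𝔩.toSubmodule ⊔ 𝔲 := by
    rw [← h𝔭, ← Submodule.range_subtype 𝔭.toSubmodule, ← Submodule.map_top, ← b.span_eq,
      Submodule.map_span, ← Set.range_comp]
    rfl
  have hind : LinearIndependent ℂ fun i => (b i : 𝔞) :=
    b.linearIndependent.map' 𝔭.toSubmodule.subtype (Submodule.ker_subtype _)
  refine GenVerma.exists_coords 𝔭 π hπ (y := y) (z := b) ?_ b.span_eq
    (linearIndependent_omon _ (linearIndependent_append hy hind ?_) ρ hρ)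
  · rw [span_range_append, hspan, hc.sup_eq_top]
  · rw [hspan]
    exact hc.disjoint

/-- The images of linearly independent vectors under ordered monomials are linearly independent. -/
theorem GenVerma.linearIndependent_omon {m : ℕ} {y : Fin m → 𝔞}
    {M : GenVerma 𝔩 𝔲 F →ₗ[ℂ] ((Fin m → ℕ) →₀ F)} (hM : ∀ a f,
      M (omon (fun i => LieModule.toEnd ℂ 𝔞 (GenVerma 𝔩 𝔲 F) (y i)) a (GenVerma.of 𝔩 𝔲 F f)) =
        Finsupp.single a f) {J : Type*} {f : J → F} (hf : LinearIndependent ℂ f) :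
    LinearIndependent ℂ fun p : (Fin m → ℕ) × J =>
      omon (fun i => LieModule.toEnd ℂ 𝔞 (GenVerma 𝔩 𝔲 F) (y i)) p.1
        (GenVerma.of 𝔩 𝔲 F (f p.2)) := by
  refine LinearIndependent.of_comp M ?_
  have h := Finsupp.linearIndependent_single (R := ℂ) (fun _ : Fin m → ℕ => f) fun _ => hf
  have h' := h.comp (fun p : (Fin m → ℕ) × J => ⟨p.1, p.2⟩) fun p q hpq => by
    rcases p with ⟨a, j⟩
    rcases q with ⟨b, k⟩
    simp at hpq
    exact Prod.ext hpq.1 hpq.2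
  convert h' using 1
  funext p
  exact hM p.1 (f p.2)

end GenVermaBasis

/-! ### Trace forms of irreducible modules -/

section TraceForm

open LieModule LieAlgebra

attribute [local instance] LieRing.ofAssociativeRing

variable {L V : Type*} [LieRing L] [LieAlgebra ℂ L] [AddCommGroup V] [Module ℂ V]
  [LieRingModule L V] [LieModule ℂ L V] [FiniteDimensional ℂ V]

/-- The trace form of a faithful simple module is nondegenerate. Its kernel is an ideal, whose derived
algebra acts nilpotently by Cartan's criterion, hence by zero on the simple module. So the kernel
is abelian and lies in the radical, which acts by scalars, and scalars of square trace zero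
vanish. -/
theorem traceForm_ker_eq_bot_of_isFaithful [FiniteDimensional ℂ L] [IsIrreducible ℂ L V]
    [IsFaithful ℂ L V] (x : L) (hx : traceForm ℂ L V x = 0) : x = 0 := by
  have _i := nontrivial_of_isIrreducible ℂ L V
  let I : LieIdeal ℂ L :=
    { (traceForm ℂ L V).ker with
      lie_mem := fun {y z} hz => by
        change traceForm ℂ L V ⁅y, z⁆ = 0
        replace hz : traceForm ℂ L V z = 0 := hz
        ext w
        rw [← lie_skew, map_neg, LinearMap.neg_apply, traceForm_apply_lie_apply, hz]
        simp }
  have hI : ∀ y ∈ I, ∀ z, traceForm ℂ L V y z = 0 := fun y hy z => by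
    have : traceForm ℂ L V y = 0 := hy
    rw [this, LinearMap.zero_apply]
  have hIV : traceForm ℂ I V = 0 := by
    ext y z
    exact hI y.1 y.2 z.1
  have hnil := isNilpotent_derivedSeries_of_traceForm_eq_zero hIV
  -- the vectors killed by the derived ideal form a nonzero submodule
  let N : LieSubmodule ℂ L V :=
    { carrier := {v | ∀ y ∈ ⁅I, I⁆, ⁅y, v⁆ = 0}
      add_mem' := fun ha hb y hy => by rw [lie_add, ha y hy, hb y hy, add_zero]
      zero_mem' := fun y _ => lie_zero y
      smul_mem' := fun c v hv y hy => by rw [lie_smul, hv y hy, smul_zero]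
      lie_mem := fun {z v} hv y hy => by
        rw [leibniz_lie, hv y hy, lie_zero, add_zero]
        refine hv _ ?_
        rw [← lie_skew]
        exact neg_mem (lie_mem_right ℂ L _ _ _ hy) }
  have hN : N ≠ ⊥ := by
    have hnt := nontrivial_max_triv_of_isNilpotent ℂ (derivedSeries ℂ I 1) V
    obtain ⟨⟨v, hv⟩, hv0⟩ := exists_ne (0 : maxTrivSubmodule ℂ (derivedSeries ℂ I 1) V)
    intro hbot
    have hvN : v ∈ N := by
      intro y hy
      have hyI : y ∈ I := LieSubmodule.lie_le_left I I hy
      refine hv ⟨⟨y, hyI⟩, ?_⟩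
      rw [LieIdeal.derivedSeries_eq_derivedSeriesOfIdeal_comap, LieIdeal.mem_comap]
      exact hy
    rw [hbot, LieSubmodule.mem_bot] at hvN
    exact hv0 (Subtype.ext hvN)
  have hN' : N = ⊤ := (eq_bot_or_eq_top N).resolve_left hN
  have habel : IsLieAbelian I := by
    refine ⟨fun y z => Subtype.ext ?_⟩
    change ⁅(y : L), (z : L)⁆ = 0
    rw [← toEnd_eq_zero_iff (R := ℂ) (L := L) (M := V)]
    ext v
    have hv : v ∈ N := hN' ▸ LieSubmodule.mem_top v
    exact hv _ (LieSubmodule.lie_mem_lie y.2 z.2)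
  have hrad : I ≤ radical ℂ L := (LieIdeal.solvable_iff_le_radical ℂ L I).1 inferInstance
  obtain ⟨hc, hc'⟩ := hasCentralRadical_and_of_isIrreducible_of_isFaithful ℂ L V
  have hxI : x ∈ I := hx
  have hxc := (hc' x).1 (hc.radical_eq_center ▸ hrad hxI)
  obtain ⟨t, ht⟩ := Submodule.mem_span_singleton.1 hxc
  have h1 : traceForm ℂ L V x x = 0 := hI x hxI x
  rw [traceForm_apply_apply, ← ht, LinearMap.smul_comp, LinearMap.comp_smul, map_smul, map_smul,
    LinearMap.id_comp, LinearMap.trace_id] at h1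
  have hV : (Module.finrank ℂ V : ℂ) ≠ 0 := by
    exact_mod_cast (Module.finrank_pos (R := ℂ) (M := V)).ne'
  have ht0 : t = 0 := by simpa [hV] using h1
  rw [← toEnd_eq_zero_iff (R := ℂ) (L := L) (M := V), ← ht, ht0, zero_smul]

/-- On a simple module, an element in the kernel of the trace form acts by zero: pass to the image of
`L` in the endomorphisms, which acts faithfully. -/
theorem toEnd_eq_zero_of_traceForm_eq_zero [IsIrreducible ℂ L V] (x : L)
    (hx : traceForm ℂ L V x = 0) : toEnd ℂ L V x = 0 := by
  let A := (toEnd ℂ L V).range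
  have hirr : IsIrreducible ℂ A V := by
    have := nontrivial_of_isIrreducible ℂ L V
    refine IsIrreducible.mk fun N hN => ?_
    let N' : LieSubmodule ℂ L V :=
      { N with lie_mem := fun {y v} hv => N.lie_mem (x := (⟨toEnd ℂ L V y, y, rfl⟩ : A)) hv }
    have : N' = ⊤ := (eq_bot_or_eq_top N').resolve_left fun h => hN (by
      rw [LieSubmodule.eq_bot_iff] at h ⊢
      exact h)
    rw [eq_top_iff]
    intro v _
    have hv : v ∈ N' := this ▸ LieSubmodule.mem_top v
    exact hv
  have := traceForm_ker_eq_bot_of_isFaithful (L := A) (V := V) ⟨toEnd ℂ L V x, x, rfl⟩ (by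
    ext ⟨_, y, rfl⟩
    exact congrArg (fun f => f y) hx)
  exact congrArg Subtype.val this

/-- An operator that shifts the eigenvalues of `T` by a nonzero constant has trace zero. -/
theorem trace_eq_zero_of_commutator {T A : Module.End ℂ V} {c : ℂ} (hc : c ≠ 0)
    (h : T * A - A * T = c • A) : LinearMap.trace ℂ V A = 0 := by
  have := congrArg (LinearMap.trace ℂ V) h
  rw [map_sub, LinearMap.trace_mul_comm, sub_self, map_smul, smul_eq_mul] at this
  exact (mul_eq_zero.1 this.symm).resolve_left hc

end TraceForm

/-! ### Weight vectors and coroots -/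

section Coroots

open LieModule LieAlgebra

attribute [local instance] LieRing.ofAssociativeRing

variable {𝔞 : Type*} [LieRing 𝔞] [LieAlgebra ℂ 𝔞] {𝔧 : LieSubalgebra ℂ 𝔞}
variable {X : Type*} [AddCommGroup X] [Module ℂ X] [LieRingModule 𝔞 X] [LieModule ℂ 𝔞 X]

theorem lie_mem_wt {α μ : Module.Dual ℂ 𝔧} {e : 𝔞} {v : X} (he : e ∈ wt 𝔧 𝔞 α)
    (hv : v ∈ wt 𝔧 X μ) : ⁅e, v⁆ ∈ wt 𝔧 X (α + μ) := by
  rw [mem_wt] at he hv ⊢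
  intro x
  rw [leibniz_lie, he, hv, smul_lie, lie_smul, LinearMap.add_apply, add_smul]

/-- A property of elements of a weight module that is closed under sums holds if it holds for weight
vectors. -/
theorem wt_induction (h : ⨆ μ, wt 𝔧 X μ = ⊤) {p : X → Prop} (h0 : p 0)
    (hadd : ∀ x y, p x → p y → p (x + y)) (hw : ∀ μ, ∀ v ∈ wt 𝔧 X μ, p v) (v : X) : p v := by
  have hv : v ∈ ⨆ μ, wt 𝔧 X μ := h ▸ Submodule.mem_top
  induction hv using Submodule.iSup_induction' with
  | mem μ v hv => exact hw μ v hv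
  | zero => exact h0
  | add x y _ _ hx hy => exact hadd x y hx hy

theorem isIrreducible_of_isAtom {V : LieSubmodule ℂ 𝔞 X} (hV : IsAtom V) :
    IsIrreducible ℂ 𝔞 V := by
  have : Nontrivial V := (LieSubmodule.nontrivial_iff_ne_bot ℂ 𝔞 X).2 hV.1
  refine IsIrreducible.mk fun N hN => ?_
  have hle : N.map V.incl ≤ V := by
    rw [LieSubmodule.map_le_iff_le_comap]
    exact fun x _ => x.2
  have hne : N.map V.incl ≠ ⊥ := by
    intro h
    refine hN ((LieSubmodule.eq_bot_iff _).2 fun x hx => Subtype.ext ?_)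
    exact (LieSubmodule.eq_bot_iff _).1 h _ (LieSubmodule.mem_map_of_mem hx)
  rw [eq_top_iff]
  intro x _
  have hx : (x : X) ∈ N.map V.incl := by
    rw [(hV.le_iff_eq hne).1 hle]
    exact x.2
  obtain ⟨y, hy, hyx⟩ := (LieSubmodule.mem_map _).1 hx
  rwa [← Subtype.ext hyx]

/-- If `𝔞` acts faithfully on a completely reducible module `W` whose weights for `𝔧` are
semisimple, then every root vector has an opposite root vector with which it spans a copy of
`𝔰𝔩₂`. This comes from the trace form of a simple summand of `W` on which the root vector does not
act by zero. -/
theorem exists_opposite_root_vector {W : Type*} [AddCommGroup W] [Module ℂ W] [LieRingModule 𝔞 W]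
    [LieModule ℂ 𝔞 W] [FiniteDimensional ℂ W] [ComplementedLattice (LieSubmodule ℂ 𝔞 W)]
    [IsFaithful ℂ 𝔞 W] (hW : ⨆ μ, wt 𝔧 W μ = ⊤) (h𝔞 : ⨆ μ, wt 𝔧 𝔞 μ = ⊤)
    (h0 : wt 𝔧 𝔞 0 = 𝔧.toSubmodule) {α : Module.Dual ℂ 𝔧} (hα : α ≠ 0) {e : 𝔞}
    (he : e ∈ wt 𝔧 𝔞 α) (he0 : e ≠ 0) :
    ∃ f ∈ wt 𝔧 𝔞 (-α), ∃ h : 𝔧, (h : 𝔞) = ⁅e, f⁆ ∧ α h ≠ 0 := by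
  obtain ⟨V, hV, heV⟩ : ∃ V : LieSubmodule ℂ 𝔞 W, IsAtom V ∧ ∃ v ∈ V, ⁅e, v⁆ ≠ 0 := by
    by_contra! hcon
    have h1 : (⊤ : LieSubmodule ℂ 𝔞 W).toSubmodule ≤ (toEnd ℂ 𝔞 W e).ker := by
      rw [← sSup_atoms_eq_top, LieSubmodule.sSup_toSubmodule]
      refine sSup_le ?_
      rintro _ ⟨V, hV, rfl⟩ v hv
      exact hcon V hV v hv
    exact he0 ((isFaithful_iff' ℂ 𝔞 W).1 inferInstance e fun m => h1 (Submodule.mem_top (x := m)))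
  have hirr := isIrreducible_of_isAtom hV
  have he1 : toEnd ℂ 𝔞 V e ≠ 0 := by
    obtain ⟨v, hv, hev⟩ := heV
    intro h
    exact hev (congrArg Subtype.val (congrArg (fun g => g ⟨v, hv⟩) h))
  -- by weights, the trace form on `V` pairs the root space of `α` only with that of `-α`
  obtain ⟨β, f, hf, hfe⟩ : ∃ β, ∃ f ∈ wt 𝔧 𝔞 β, traceForm ℂ 𝔞 V e f ≠ 0 := by
    by_contra! hcon
    refine he1 (toEnd_eq_zero_of_traceForm_eq_zero e (LinearMap.ext fun y => ?_))
    refine wt_induction (𝔧 := 𝔧) (X := 𝔞) h𝔞 (p := fun y => traceForm ℂ 𝔞 V e y = 0) (map_zero _)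
      (fun x y hx hy => ?_) (fun μ v hv => hcon μ v hv) y
    rw [map_add, hx, hy, add_zero]
  have hβ : β = -α := by
    by_contra hne
    have hne' : α + β ≠ 0 := fun h => hne (eq_neg_of_add_eq_zero_right h)
    obtain ⟨t, ht⟩ : ∃ t, (α + β) t ≠ 0 := by
      by_contra! h
      exact hne' (LinearMap.ext h)
    refine hfe (trace_eq_zero_of_commutator (T := toEnd ℂ 𝔞 V t) ht ?_)
    ext v
    have h1 := (mem_wt.1 he) t
    have h2 := (mem_wt.1 hf) t
    change (((⁅(t : 𝔞), ⁅e, ⁅f, v⁆⁆⁆ - ⁅e, ⁅f, ⁅(t : 𝔞), v⁆⁆⁆ : V)) : W) =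
      (((α + β) t • ⁅e, ⁅f, v⁆⁆ : V) : W)
    congr 1
    rw [leibniz_lie (t : 𝔞) e, h1, leibniz_lie (t : 𝔞) f, h2, smul_lie, lie_add, smul_lie, lie_smul,
      LinearMap.add_apply, add_smul]
    abel
  subst hβ
  have hh : ⁅e, f⁆ ∈ 𝔧 := by
    have := lie_mem_wt he hf
    rw [add_neg_cancel, h0] at this
    exact this
  refine ⟨f, hf, ⟨_, hh⟩, rfl, fun hαh => hfe ?_⟩
  set h := ⁅e, f⁆ with hdef
  have hhe : ⁅h, e⁆ = 0 := by rw [mem_wt.1 he ⟨h, hh⟩, hαh, zero_smul]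
  have hhf : ⁅h, f⁆ = 0 := by
    rw [mem_wt.1 hf ⟨h, hh⟩, LinearMap.neg_apply, hαh, neg_zero, zero_smul]
  -- If `α` vanishes on `h = ⁅e, f⁆`, then `e` and `f` commute with `h`, so `h` is a commutator on each
  -- of its eigenspaces and has trace zero there; hence it has no nonzero eigenvalue.
  have heig : ∀ c : ℂ, c ≠ 0 → (toEnd ℂ 𝔞 W h).eigenspace c = ⊥ := by
    intro c hc
    set E := (toEnd ℂ 𝔞 W h).eigenspace c
    have hE : ∀ v, v ∈ E ↔ ⁅h, v⁆ = c • v := fun v => Module.End.mem_eigenspace_iff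
    have hmaps : ∀ x : 𝔞, ⁅h, x⁆ = 0 → ∀ v ∈ E, toEnd ℂ 𝔞 W x v ∈ E := by
      intro x hx v hv
      rw [hE] at hv ⊢
      rw [toEnd_apply_apply, leibniz_lie, hx, zero_lie, zero_add, hv, lie_smul]
    have h1 : (c • 1 : Module.End ℂ E) =
        (toEnd ℂ 𝔞 W e).restrict (hmaps e hhe) * (toEnd ℂ 𝔞 W f).restrict (hmaps f hhf) -
        (toEnd ℂ 𝔞 W f).restrict (hmaps f hhf) * (toEnd ℂ 𝔞 W e).restrict (hmaps e hhe) := by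
      ext v
      change c • (v : W) = ⁅e, ⁅f, (v : W)⁆⁆ - ⁅f, ⁅e, (v : W)⁆⁆
      rw [← (hE v).1 v.2, hdef, lie_lie]
    have h2 := congrArg (LinearMap.trace ℂ E) h1
    rw [map_sub, LinearMap.trace_mul_comm, sub_self, map_smul, LinearMap.trace_one, smul_eq_mul] at h2
    have h3 := (mul_eq_zero.1 h2).resolve_left hc
    exact Submodule.finrank_eq_zero.1 (by exact_mod_cast h3)
  have hhz : h = 0 := by
    refine (isFaithful_iff' ℂ 𝔞 W).1 inferInstance h fun m => ?_
    refine wt_induction (𝔧 := 𝔧) (X := W) hW (p := fun m => ⁅h, m⁆ = 0) (lie_zero _)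
      (fun x y hx hy => by rw [lie_add, hx, hy, add_zero]) (fun μ v hv => ?_) m
    have h1 := mem_wt.1 hv ⟨h, hh⟩
    by_cases hμ : μ ⟨h, hh⟩ = 0
    · change ⁅h, v⁆ = 0
      rw [h1, hμ, zero_smul]
    · have : v ∈ (toEnd ℂ 𝔞 W h).eigenspace (μ ⟨h, hh⟩) := Module.End.mem_eigenspace_iff.2 h1
      rw [heig _ hμ, Submodule.mem_bot] at this
      change ⁅h, v⁆ = 0
      rw [this, lie_zero]
  -- Then `h = 0`, and invariance of the trace form, `α t • tr(e f) = tr(t h) = 0`, contradicts the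
  -- choice of `f`.
  obtain ⟨t, ht⟩ : ∃ t, α t ≠ 0 := by
    by_contra! h
    exact hα (LinearMap.ext h)
  have h1 := traceForm_apply_lie_apply ℂ 𝔞 V t e f
  rw [mem_wt.1 he t, ← hdef, hhz, map_zero, map_smul, LinearMap.smul_apply] at h1
  exact (smul_eq_zero.1 h1).resolve_left ht

end Coroots

/-! ### Complete reducibility of finite dimensional weight modules -/

section WeightBasis

variable {ι κ X : Type*} [AddCommGroup X] [Module ℂ X] {T : ι → Module.End ℂ X} {χ : κ → ι → ℂ}

theorem exists_basis_simEig (h : ⨆ k, simEig T (χ k) = ⊤) :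
    ∃ (s : Set X) (b : Module.Basis s ℂ X) (w : s → κ), ∀ i, b i ∈ simEig T (χ (w i)) := by
  let S : Set X := {v | ∃ k, v ∈ simEig T (χ k)}
  have hS : ⊤ ≤ Submodule.span ℂ S := by
    rw [← h]
    exact iSup_le fun k v hv => Submodule.subset_span ⟨k, hv⟩
  let b := Module.Basis.ofSpan hS
  have hb : ∀ i, ∃ k, b i ∈ simEig T (χ k) := fun i => Module.Basis.ofSpan_subset hS ⟨i, rfl⟩
  choose w hw using hb
  exact ⟨_, b, w, hw⟩

end WeightBasis

section Weyl

open LieModule LieAlgebra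

attribute [local instance] LieRing.ofAssociativeRing

section WeightModules

variable {L : Type*} [LieRing L] [LieAlgebra ℂ L] {𝔥 : LieSubalgebra ℂ L}
variable {X Y : Type*} [AddCommGroup X] [Module ℂ X] [LieRingModule L X] [LieModule ℂ L X]
  [AddCommGroup Y] [Module ℂ Y] [LieRingModule L Y] [LieModule ℂ L Y]

theorem iSup_wt_of_injective (f : X →ₗ⁅ℂ, L⁆ Y) (hf : Function.Injective f)
    (h : ⨆ μ, wt 𝔥 Y μ = ⊤) : ⨆ μ, wt 𝔥 X μ = ⊤ := by
  simp only [wt_eq_simEig] at h ⊢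
  exact iSup_simEig_of_injective (dual_injective (𝔧 := 𝔥)) (q := (f : X →ₗ[ℂ] Y))
    (fun i v => f.map_lie _ _) hf h

theorem iSup_wt_of_surjective (f : X →ₗ⁅ℂ, L⁆ Y) (hf : Function.Surjective f)
    (h : ⨆ μ, wt 𝔥 X μ = ⊤) : ⨆ μ, wt 𝔥 Y μ = ⊤ := by
  simp only [wt_eq_simEig] at h ⊢
  exact iSup_simEig_of_surjective (q := (f : X →ₗ[ℂ] Y)) (fun i v => f.map_lie _ _) hf h

theorem exists_basis_wt (h : ⨆ μ, wt 𝔥 X μ = ⊤) :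
    ∃ (s : Set X) (b : Module.Basis s ℂ X) (w : s → Module.Dual ℂ 𝔥), ∀ i, b i ∈ wt 𝔥 X (w i) := by
  simp only [wt_eq_simEig] at h ⊢
  exact exists_basis_simEig h

theorem iSup_wt_hom [FiniteDimensional ℂ X] (hX : ⨆ μ, wt 𝔥 X μ = ⊤) (hY : ⨆ μ, wt 𝔥 Y μ = ⊤) :
    ⨆ μ, wt 𝔥 (X →ₗ[ℂ] Y) μ = ⊤ := by
  obtain ⟨s, b, w, hb⟩ := exists_basis_wt hX
  have := Module.Finite.finite_basis b
  have := Fintype.ofFinite s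
  rw [eq_top_iff]
  intro φ _
  have hφ : φ = ∑ i, (b.coord i).smulRight (φ (b i)) := by
    refine b.ext fun j => ?_
    rw [LinearMap.sum_apply, Finset.sum_eq_single j]
    · simp
    · intro i _ hij
      simp [hij.symm]
    · simp
  rw [hφ]
  refine Submodule.sum_mem _ fun i _ => ?_
  refine wt_induction (𝔧 := 𝔥) hY
    (p := fun y => (b.coord i).smulRight y ∈ ⨆ μ, wt 𝔥 (X →ₗ[ℂ] Y) μ) ?_ ?_ ?_ (φ (b i))
  · rw [LinearMap.smulRight_zero]; exact Submodule.zero_mem _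
  · intro x y hx hy
    convert Submodule.add_mem _ hx hy using 1
    ext v
    simp
  · intro ν y hy
    refine Submodule.mem_iSup_of_mem (ν - w i) (mem_wt.2 fun x => b.ext fun j => ?_)
    rw [LieHom.lie_apply, mem_wt.1 (hb j), LinearMap.smul_apply]
    simp only [LinearMap.smulRight_apply, map_smul, Module.Basis.coord_apply,
      Module.Basis.repr_self, lie_smul, LinearMap.sub_apply]
    rw [mem_wt.1 hy]
    by_cases hij : j = i
    · subst hij; simp [sub_smul]
    · simp [hij]

end WeightModules

section Casimir

variable {A E : Type*} [LieRing A] [LieAlgebra ℂ A] [FiniteDimensional ℂ A] [AddCommGroup E]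
  [Module ℂ E] [LieRingModule A E] [LieModule ℂ A E]

/-- The Casimir operator of a nondegenerate invariant symmetric form on `A`. -/
theorem exists_casimir (B : LinearMap.BilinForm ℂ A) (hB : B.Nondegenerate)
    (hsymm : ∀ x y, B x y = B y x) (hinv : ∀ x y z, B ⁅x, y⁆ z = B x ⁅y, z⁆) :
    ∃ (n : ℕ) (b b' : Fin n → A), n = Module.finrank ℂ A ∧ (∀ i, B (b i) (b' i) = 1) ∧
      ∀ (x : A) (v : E), ∑ i, ⁅b i, ⁅b' i, ⁅x, v⁆⁆⁆ = ⁅x, ∑ i, ⁅b i, ⁅b' i, v⁆⁆⁆ := by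
  let b := Module.finBasis ℂ A
  let b' := B.dualBasis hB b
  have hbb : ∀ i j, B (b' i) (b j) = if j = i then 1 else 0 := fun i j =>
    LinearMap.BilinForm.apply_dualBasis_left hB b i j
  have hb : ∀ x, x = ∑ i, B (b' i) x • b i := by
    intro x
    have h : ∀ i, B (b' i) x = b.repr x i := fun i => by
      have : B (b' i) (∑ j, b.repr x j • b j) = b.repr x i := by simp [hbb, -Module.Basis.sum_repr]
      rwa [b.sum_repr] at this
    simp only [h, b.sum_repr]
  have hb' : ∀ x, x = ∑ i, B x (b i) • b' i := by
    intro x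
    have h : ∀ i, B x (b i) = b'.repr x i := fun i => by
      have : B (∑ j, b'.repr x j • b' j) (b i) = b'.repr x i := by
        simp [hbb, LinearMap.sum_apply, -Module.Basis.sum_repr]
      rwa [b'.sum_repr] at this
    simp only [h, b'.sum_repr]
  refine ⟨_, b, b', rfl, fun i => by rw [hsymm, hbb, if_pos rfl], fun x v => ?_⟩
  rw [lie_sum, ← sub_eq_zero, ← Finset.sum_sub_distrib]
  have h1 : ∀ i, ⁅b i, ⁅b' i, ⁅x, v⁆⁆⁆ - ⁅x, ⁅b i, ⁅b' i, v⁆⁆⁆ =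
      -⁅⁅x, b i⁆, ⁅b' i, v⁆⁆ - ⁅b i, ⁅⁅x, b' i⁆, v⁆⁆ := by
    intro i
    rw [leibniz_lie x (b i), leibniz_lie x (b' i) v, lie_add]
    abel
  have h2 : ∀ i, ⁅⁅x, b i⁆, ⁅b' i, v⁆⁆ = ∑ j, B (b' j) ⁅x, b i⁆ • ⁅b j, ⁅b' i, v⁆⁆ := by
    intro i
    conv_lhs => rw [hb ⁅x, b i⁆]
    simp only [sum_lie, smul_lie]
  have h3 : ∀ i, ⁅b i, ⁅⁅x, b' i⁆, v⁆⁆ = ∑ j, B ⁅x, b' i⁆ (b j) • ⁅b i, ⁅b' j, v⁆⁆ := by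
    intro i
    conv_lhs => rw [hb' ⁅x, b' i⁆]
    simp only [sum_lie, smul_lie, lie_sum, lie_smul]
  simp only [h1, h2, h3]
  rw [Finset.sum_sub_distrib, Finset.sum_neg_distrib, sub_eq_zero, neg_eq_iff_add_eq_zero,
    Finset.sum_comm, ← Finset.sum_add_distrib]
  refine Finset.sum_eq_zero fun i _ => ?_
  rw [← Finset.sum_add_distrib]
  refine Finset.sum_eq_zero fun j _ => ?_
  rw [← add_smul, ← hinv, ← lie_skew (b' i) x, map_neg, LinearMap.neg_apply, neg_add_cancel,
    zero_smul]

/-- If `A` maps `E` to a simple submodule `E₀` with nondegenerate trace form, then `E` is the sum of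
`E₀` and its invariants. The Casimir operator of the trace form maps `E` to `E₀`, and it is
invertible on `E₀` because its trace there is `dim A ≠ 0`. -/
theorem sup_maxTriv_eq_top_of_traceForm [FiniteDimensional ℂ E] {E₀ : LieSubmodule ℂ A E}
    [IsIrreducible ℂ A E₀] (hE : ∀ (x : A) (v : E), ⁅x, v⁆ ∈ E₀)
    (hB : ∀ x, traceForm ℂ A E₀ x = 0 → x = 0) (hA : Nontrivial A) (v : E) :
    ∃ v₀ ∈ E₀, ∀ x : A, ⁅x, v - v₀⁆ = 0 := by
  obtain ⟨n, b, b', hn, hbb, hc⟩ := exists_casimir (E := E) (traceForm ℂ A E₀) (by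
      refine (LinearMap.IsRefl.nondegenerate_iff_separatingLeft ?_).2 ?_
      · exact (traceForm_isSymm ℂ A E₀).isRefl
      · intro x hx
        exact hB x (LinearMap.ext hx))
    (traceForm_comm ℂ A E₀) (traceForm_apply_lie_apply ℂ A E₀)
  let c : E →ₗ[ℂ] E := ∑ i, toEnd ℂ A E (b i) * toEnd ℂ A E (b' i)
  have hcv : ∀ v, c v = ∑ i, ⁅b i, ⁅b' i, v⁆⁆ := fun v => by
    simp [c, LinearMap.sum_apply]
  have hcx : ∀ (x : A) v, c ⁅x, v⁆ = ⁅x, c v⁆ := fun x v => by rw [hcv, hcv, hc]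
  have hcE : ∀ v, c v ∈ E₀ := fun v => by
    rw [hcv]
    exact sum_mem fun i _ => hE _ _
  let c₀ : E₀ →ₗ⁅ℂ, A⁆ E₀ :=
    { c.restrict (p := E₀.toSubmodule) (q := E₀.toSubmodule) (fun v _ => hcE v) with
      map_lie' := fun {x v} => Subtype.ext (hcx x v) }
  have hc₀ : ∀ v, ((c₀ v : E₀) : E) = c v := fun v => rfl
  have htr : LinearMap.trace ℂ E₀ (c₀ : E₀ →ₗ[ℂ] E₀) = n := by
    have : (c₀ : E₀ →ₗ[ℂ] E₀) = ∑ i, toEnd ℂ A E₀ (b i) ∘ₗ toEnd ℂ A E₀ (b' i) := by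
      ext v
      change c (v : E) = _
      rw [hcv]
      simp [LinearMap.sum_apply]
    rw [this, map_sum]
    calc _ = ∑ i, traceForm ℂ A E₀ (b i) (b' i) := rfl
      _ = n := by simp [hbb]
  have hne : c₀ ≠ 0 := by
    intro h
    rw [h] at htr
    have h1 : (LinearMap.trace ℂ E₀) ((0 : E₀ →ₗ⁅ℂ, A⁆ E₀) : E₀ →ₗ[ℂ] E₀) = 0 := map_zero _
    rw [h1, hn] at htr
    exact (Module.finrank_pos (R := ℂ) (M := A)).ne' (by exact_mod_cast htr.symm)
  have hker : c₀.ker = ⊥ := by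
    refine (eq_bot_or_eq_top _).resolve_right fun h => hne ?_
    ext v
    have : v ∈ c₀.ker := h ▸ LieSubmodule.mem_top v
    exact congrArg Subtype.val (LieModuleHom.mem_ker.1 this)
  have hinj : Function.Injective c₀ := (LieModuleHom.ker_eq_bot c₀).1 hker
  have hsurj : Function.Surjective (c₀ : E₀ →ₗ[ℂ] E₀) :=
    LinearMap.injective_iff_surjective.1 hinj
  obtain ⟨v₀, hv₀⟩ := hsurj ⟨c v, hcE v⟩
  have hv₀' : c v₀ = c v := congrArg Subtype.val hv₀
  refine ⟨v₀, v₀.2, fun x => ?_⟩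
  have h1 : c₀ ⟨⁅x, v - v₀⁆, hE _ _⟩ = 0 := Subtype.ext (by
    rw [hc₀]
    change c ⁅x, v - v₀⁆ = 0
    rw [hcx, map_sub, hv₀', sub_self, lie_zero])
  exact congrArg Subtype.val (hinj (h1.trans (map_zero c₀).symm))

end Casimir

section WeylTheorem

variable {L : Type*} [LieRing L] [LieAlgebra ℂ L] {𝔥 : LieSubalgebra ℂ L}

/-- `𝔥` is a split toral subalgebra of `L`, equal to its own centralizer, and each root vector is
part of a copy of `𝔰𝔩₂`. -/
structure IsSplitReductive (𝔥 : LieSubalgebra ℂ L) : Prop where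
  iSup_wt : ⨆ α, wt 𝔥 L α = ⊤
  wt_zero : wt 𝔥 L 0 = 𝔥.toSubmodule
  opposite : ∀ α : Module.Dual ℂ 𝔥, α ≠ 0 → ∀ e ∈ wt 𝔥 L α, e ≠ 0 →
    ∃ f ∈ wt 𝔥 L (-α), ∃ h : 𝔥, (h : L) = ⁅e, f⁆ ∧ α h ≠ 0

variable {E : Type*} [AddCommGroup E] [Module ℂ E] [LieRingModule L E] [LieModule ℂ L E]

/-- If `L` maps `E` to `E₀`, then an element that kills `E₀` kills `E`. Such elements form an ideal, so
it is enough to consider elements of `𝔥` and root vectors. -/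
theorem IsSplitReductive.lie_eq_zero (hL : IsSplitReductive 𝔥) (hE : ⨆ μ, wt 𝔥 E μ = ⊤)
    {E₀ : LieSubmodule ℂ L E} (hE₀ : ∀ (x : L) (v : E), ⁅x, v⁆ ∈ E₀) {r : L}
    (hr : ∀ v ∈ E₀, ⁅r, v⁆ = 0) (v : E) : ⁅r, v⁆ = 0 := by
  let K : Submodule ℂ L :=
    { carrier := {r | ∀ v ∈ E₀, ⁅r, v⁆ = 0}
      add_mem' := fun ha hb v hv => by rw [add_lie, ha v hv, hb v hv, add_zero]
      zero_mem' := fun v _ => zero_lie v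
      smul_mem' := fun c x hx v hv => by rw [smul_lie, hx v hv, smul_zero] }
  have hK : ∀ (x : L), ∀ r ∈ K, ⁅x, r⁆ ∈ K := fun x r hr v hv => by
    rw [lie_lie, hr v hv, hr _ (E₀.lie_mem hv), lie_zero, sub_self]
  have key0 : ∀ h : 𝔥, (h : L) ∈ K → ∀ v : E, ⁅(h : L), v⁆ = 0 := by
    intro h hh v
    refine wt_induction (𝔧 := 𝔥) hE (p := fun v => ⁅(h : L), v⁆ = 0) (lie_zero _)
      (fun x y hx hy => by rw [lie_add, hx, hy, add_zero]) (fun μ v hv => ?_) v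
    have h1 := mem_wt.1 hv h
    -- `h` maps `v` to `E₀`, which it kills, so that `μ(h)² v = 0`
    have h2 := hh _ (hE₀ h v)
    rw [h1, lie_smul, h1, smul_smul, smul_eq_zero] at h2
    rcases h2 with h2 | h2
    · rw [h1, mul_self_eq_zero.1 h2, zero_smul]
    · rw [h2, lie_zero]
  have key : ∀ α, ∀ r ∈ wt 𝔥 L α, r ∈ K → ∀ v : E, ⁅r, v⁆ = 0 := by
    intro α r hrα hrK v
    by_cases hα : α = 0
    · subst hα
      rw [hL.wt_zero] at hrα
      exact key0 ⟨r, hrα⟩ hrK v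
    · by_cases hr0 : r = 0
      · rw [hr0, zero_lie]
      obtain ⟨f, hf, h, hh, hαh⟩ := hL.opposite α hα r hrα hr0
      have hhK : (h : L) ∈ K := by
        rw [hh, ← lie_skew]
        exact K.neg_mem (hK f r hrK)
      -- the coroot `h` kills `E` and acts on `⁅r, v⁆` by `α(h) ≠ 0`
      have h1 := key0 h hhK ⁅r, v⁆
      rw [leibniz_lie, mem_wt.1 hrα, key0 h hhK v, lie_zero, add_zero, smul_lie] at h1
      exact (smul_eq_zero.1 h1).resolve_left hαh
  obtain ⟨s, u, hu, hus⟩ := exists_sum_of_iSup_eq_top hL.iSup_wt r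
  have h1 : ∀ α ∈ s, u α ∈ K := by
    refine mem_of_sum_mem (N := K) (T := fun x : 𝔥 => toEnd ℂ L L x) (dual_injective (𝔧 := 𝔥))
      (fun x r hr => hK x r hr) s u (fun α _ => ?_) ?_
    · rw [← wt_eq_simEig]; exact hu α
    · rw [hus]; exact hr
  rw [← hus, sum_lie]
  exact Finset.sum_eq_zero fun α hα => key α _ (hu α) (h1 α hα) v

/-- The case of a simple `E₀`: the image of `L` in the endomorphisms of `E` acts faithfully on `E₀`, so
the trace form of `E₀` is nondegenerate on it. -/
theorem IsSplitReductive.exists_invariant_of_isAtom (hL : IsSplitReductive 𝔥)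
    [FiniteDimensional ℂ E] (hE : ⨆ μ, wt 𝔥 E μ = ⊤)
    {E₀ : LieSubmodule ℂ L E} (hatom : IsAtom E₀) (hE₀ : ∀ (x : L) (v : E), ⁅x, v⁆ ∈ E₀) (v : E) :
    ∃ v₀ ∈ E₀, ∀ x : L, ⁅x, v - v₀⁆ = 0 := by
  have hirr := isIrreducible_of_isAtom hatom
  let A := (toEnd ℂ L E).range
  by_cases hA : Nontrivial A
  · let E₁ : LieSubmodule ℂ A E :=
      { E₀ with
        lie_mem := fun {y v} hv => by
          obtain ⟨_, y, rfl⟩ := y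
          exact E₀.lie_mem hv }
    have hirr₁ : IsIrreducible ℂ A E₁ := by
      have : Nontrivial E₁ := nontrivial_of_isIrreducible ℂ L E₀
      refine IsIrreducible.mk fun N hN => ?_
      let N' : LieSubmodule ℂ L E₀ :=
        { N with lie_mem := fun {y v} hv => N.lie_mem (x := (⟨toEnd ℂ L E y, y, rfl⟩ : A)) hv }
      have : N' = ⊤ := (eq_bot_or_eq_top N').resolve_left fun h => hN (by
        rw [LieSubmodule.eq_bot_iff] at h ⊢
        exact h)
      rw [eq_top_iff]
      intro v _
      have hv : v ∈ N' := this ▸ LieSubmodule.mem_top v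
      exact hv
    obtain ⟨v₀, hv₀, h⟩ := sup_maxTriv_eq_top_of_traceForm (A := A) (E := E) (E₀ := E₁)
      (fun x v => by
        obtain ⟨_, x, rfl⟩ := x
        exact hE₀ x v) (fun x hx => by
        obtain ⟨_, x, rfl⟩ := x
        have h1 : traceForm ℂ L E₀ x = 0 := by
          ext y
          exact congrArg (fun f => f (⟨toEnd ℂ L E y, y, rfl⟩ : A)) hx
        have h2 := toEnd_eq_zero_of_traceForm_eq_zero x h1
        refine Subtype.ext (LinearMap.ext fun v => ?_)
        exact hL.lie_eq_zero hE hE₀ (r := x) (fun w hw =>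
          congrArg Subtype.val (congrArg (fun f => f ⟨w, hw⟩) h2)) v) hA v
    exact ⟨v₀, hv₀, fun x => h ⟨toEnd ℂ L E x, x, rfl⟩⟩
  · refine ⟨0, zero_mem _, fun x => ?_⟩
    rw [not_nontrivial_iff_subsingleton] at hA
    have : (⟨toEnd ℂ L E x, x, rfl⟩ : A) = 0 := Subsingleton.elim _ _
    rw [sub_zero]
    exact congrArg (fun f => f v) (congrArg Subtype.val this)

/-- If `L` maps `E` to `E₀`, then every vector of `E` is congruent modulo `E₀` to an invariant one. By
induction on the dimension this reduces to simple `E₀`. -/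
theorem IsSplitReductive.exists_invariant (hL : IsSplitReductive 𝔥)
    [FiniteDimensional ℂ E] (hE : ⨆ μ, wt 𝔥 E μ = ⊤)
    {E₀ : LieSubmodule ℂ L E} (hE₀ : ∀ (x : L) (v : E), ⁅x, v⁆ ∈ E₀) (v : E) :
    ∃ v₀ ∈ E₀, ∀ x : L, ⁅x, v - v₀⁆ = 0 := by
  induction hn : Module.finrank ℂ E using Nat.strong_induction_on generalizing E with
  | _ n ih =>
  subst hn
  rcases eq_or_ne E₀ ⊥ with rfl | hbot
  · exact ⟨0, zero_mem _, fun x => by rw [sub_zero]; exact (LieSubmodule.mem_bot _).1 (hE₀ x v)⟩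
  obtain ⟨E₁, hatom, hle⟩ := (eq_bot_or_exists_atom_le E₀).resolve_left hbot
  -- Modulo the simple submodule `E₁` an invariant representative exists by induction.
  let q := LieSubmodule.Quotient.mk' E₁
  have hq : Function.Surjective q := LieSubmodule.Quotient.surjective_mk' E₁
  have hlt : Module.finrank ℂ (E ⧸ E₁) < Module.finrank ℂ E := by
    have h1 := Submodule.finrank_quotient_add_finrank E₁.toSubmodule
    have : Nontrivial E₁ := (LieSubmodule.nontrivial_iff_ne_bot ℂ L E).2 hatom.1
    have h2 : 0 < Module.finrank ℂ E₁ := Module.finrank_pos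
    change Module.finrank ℂ (E ⧸ E₁) + Module.finrank ℂ E₁ = _ at h1
    omega
  obtain ⟨w, hw, hvw⟩ := ih _ hlt (E := E ⧸ E₁) (iSup_wt_of_surjective q hq hE)
    (E₀ := E₀.map q) (fun x v => by
      obtain ⟨v, rfl⟩ := hq v
      rw [← LieModuleHom.map_lie]
      exact LieSubmodule.mem_map_of_mem (hE₀ x v)) (q v) rfl
  obtain ⟨w, hwE, rfl⟩ := (LieSubmodule.mem_map _).1 hw
  let E₂ : LieSubmodule ℂ L E :=
    { carrier := {u | ∀ x : L, ⁅x, u⁆ ∈ E₁}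
      add_mem' := fun ha hb x => by rw [lie_add]; exact add_mem (ha x) (hb x)
      zero_mem' := fun x => by rw [lie_zero]; exact zero_mem _
      smul_mem' := fun c u hu x => by rw [lie_smul]; exact E₁.smul_mem c (hu x)
      lie_mem := fun {y u} hu x => E₁.lie_mem (hu y) }
  have hle₂ : E₁ ≤ E₂ := fun u hu x => E₁.lie_mem hu
  have hv₂ : v - w ∈ E₂ := fun x => by
    have h := hvw x
    rw [← map_sub, ← LieModuleHom.map_lie] at h
    exact (LieSubmodule.Quotient.mk_eq_zero E₁).1 h
  have hatom₂ : IsAtom (E₁.comap E₂.incl) := by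
    refine ⟨fun h => ?_, fun N hN => ?_⟩
    · refine hatom.1 ((LieSubmodule.eq_bot_iff _).2 fun u hu => ?_)
      exact congrArg Subtype.val ((LieSubmodule.eq_bot_iff _).1 h ⟨u, hle₂ hu⟩ hu)
    · by_contra hne
      have h1 : N.map E₂.incl ≤ E₁ := LieSubmodule.map_le_iff_le_comap.2 hN.le
      have h2 : N.map E₂.incl ≠ ⊥ := fun h => hne ((LieSubmodule.eq_bot_iff _).2 fun u hu =>
        Subtype.ext ((LieSubmodule.eq_bot_iff _).1 h _ (LieSubmodule.mem_map_of_mem hu)))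
      have h3 := (hatom.le_iff_eq h2).1 h1
      refine hN.not_ge fun u hu => ?_
      have hu' : (u : E) ∈ N.map E₂.incl := h3 ▸ hu
      obtain ⟨y, hy, hyu⟩ := (LieSubmodule.mem_map _).1 hu'
      rwa [← Subtype.ext hyu]
  obtain ⟨t, ht, hvt⟩ := hL.exists_invariant_of_isAtom (E := E₂)
    (iSup_wt_of_injective E₂.incl Subtype.val_injective hE) hatom₂ (fun x u => u.2 x) ⟨v - w, hv₂⟩
  refine ⟨w + t, add_mem hwE (hle ht), fun x => ?_⟩
  rw [← sub_sub]
  exact congrArg Subtype.val (hvt x)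

/-- Weyl's theorem for finite dimensional weight modules: an invariant complement is the kernel of
an equivariant projection, i.e. of an invariant vector in `Hom(E, W)`. -/
theorem IsSplitReductive.exists_projection (hL : IsSplitReductive 𝔥) [FiniteDimensional ℂ E]
    (hE : ⨆ μ, wt 𝔥 E μ = ⊤) (W : LieSubmodule ℂ L E) :
    ∃ (p : E →ₗ⁅ℂ, L⁆ W), ∀ w : W, p w = w := by
  let Φ : LieSubmodule ℂ L (E →ₗ[ℂ] W) :=
    { carrier := {φ | ∃ c : ℂ, ∀ w : W, φ w = c • w}
      add_mem' := fun ⟨c, hc⟩ ⟨d, hd⟩ => ⟨c + d, fun w => by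
        rw [LinearMap.add_apply, hc, hd, add_smul]⟩
      zero_mem' := ⟨0, fun w => by rw [LinearMap.zero_apply, zero_smul]⟩
      smul_mem' := fun a _ ⟨c, hc⟩ => ⟨a * c, fun w => by
        rw [LinearMap.smul_apply, hc, smul_smul]⟩
      lie_mem := fun {x φ} ⟨c, hc⟩ => ⟨0, fun w => by
        rw [LieHom.lie_apply, hc, ← LieSubmodule.coe_bracket, hc, lie_smul, sub_self, zero_smul]⟩ }
  let Φ₀ : LieSubmodule ℂ L Φ :=
    { carrier := {φ | ∀ w : W, φ.1 w = 0}
      add_mem' := fun {φ ψ} hφ hψ w => by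
        change φ.1 w + ψ.1 w = 0
        rw [hφ, hψ, add_zero]
      zero_mem' := fun w => rfl
      smul_mem' := fun a φ hφ w => by
        change a • φ.1 w = 0
        rw [hφ, smul_zero]
      lie_mem := fun {x φ} hφ w => by
        change ⁅x, φ.1 w⁆ - φ.1 ⁅x, (w : E)⁆ = 0
        rw [hφ, lie_zero, ← LieSubmodule.coe_bracket, hφ, sub_self] }
  have hW := iSup_wt_of_injective (𝔥 := 𝔥) W.incl Subtype.val_injective hE
  have hΦ := iSup_wt_of_injective (𝔥 := 𝔥) Φ.incl Subtype.val_injective (iSup_wt_hom hE hW)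
  obtain ⟨g, hg⟩ := W.toSubmodule.exists_isCompl
  let φ : Φ := ⟨W.toSubmodule.projectionOnto g hg, 1, fun w => by
    rw [one_smul]
    exact Submodule.projectionOnto_apply_left hg w⟩
  obtain ⟨ψ, hψ, h⟩ := hL.exists_invariant (E := Φ) hΦ (E₀ := Φ₀) (fun x φ w => by
    obtain ⟨φ, c, hc⟩ := φ
    change ⁅x, φ w⁆ - φ ⁅x, (w : E)⁆ = 0
    rw [hc, ← LieSubmodule.coe_bracket, hc, lie_smul, sub_self]) φ
  refine ⟨{ φ.1 - ψ.1 with map_lie' := fun {x v} => ?_ }, fun w => ?_⟩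
  · have h1 : ⁅x, (φ - ψ).1 v⁆ - (φ - ψ).1 ⁅x, v⁆ = 0 :=
      congrArg (fun f => f v) (congrArg Subtype.val (h x))
    exact (sub_eq_zero.1 h1).symm
  · change φ.1 w - ψ.1 w = w
    rw [hψ, sub_zero]
    exact Submodule.projectionOnto_apply_left hg w

end WeylTheorem

end Weyl

/-! ### Standard parabolic subalgebras -/

section Standard

open LieModule LieAlgebra

attribute [local instance] LieRing.ofAssociativeRing

universe u

/-- If `L = n + b` and `W` is stable under `b`, then the submodule generated by `W` lies in every
subspace that contains `W` and is stable under `n`, though `n` need not be a subalgebra. The least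
such subspace is stable under `L`, because the set of its elements that `L` maps into it has the
same closure properties. -/
theorem lieSpan_le_of_stable {L X : Type*} [LieRing L] [LieAlgebra ℂ L] [AddCommGroup X]
    [Module ℂ X] [LieRingModule L X] [LieModule ℂ L X] {n b : Submodule ℂ L} (hnb : n ⊔ b = ⊤)
    {W Z : Submodule ℂ X} (hW : ∀ x ∈ b, ∀ w ∈ W, ⁅x, w⁆ ∈ W) (hWZ : W ≤ Z)
    (hZ : ∀ y ∈ n, ∀ z ∈ Z, ⁅y, z⁆ ∈ Z) :
    (LieSubmodule.lieSpan ℂ L (W : Set X)).toSubmodule ≤ Z := by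
  let S : Set (Submodule ℂ X) := {Z | W ≤ Z ∧ ∀ y ∈ n, ∀ z ∈ Z, ⁅y, z⁆ ∈ Z}
  let N := sInf S
  have hWN : W ≤ N := le_sInf fun _ h => h.1
  have hnN : ∀ y ∈ n, ∀ z ∈ N, ⁅y, z⁆ ∈ N := fun y hy z hz =>
    Submodule.mem_sInf.2 fun Z h => h.2 y hy z (Submodule.mem_sInf.1 hz Z h)
  let N' : Submodule ℂ X :=
    { carrier := {v | v ∈ N ∧ ∀ x : L, ⁅x, v⁆ ∈ N}
      add_mem' := fun ha hb => ⟨N.add_mem ha.1 hb.1, fun x => by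
        rw [lie_add]; exact N.add_mem (ha.2 x) (hb.2 x)⟩
      zero_mem' := ⟨N.zero_mem, fun x => by rw [lie_zero]; exact N.zero_mem⟩
      smul_mem' := fun c v hv => ⟨N.smul_mem c hv.1, fun x => by
        rw [lie_smul]; exact N.smul_mem c (hv.2 x)⟩ }
  have hNN' : N ≤ N' := by
    refine sInf_le ⟨fun w hw => ⟨hWN hw, fun x => ?_⟩, fun y hy v hv => ⟨hv.2 y, fun x => ?_⟩⟩
    · obtain ⟨y, hy, z, hz, rfl⟩ := Submodule.mem_sup.1 (hnb ▸ Submodule.mem_top : x ∈ n ⊔ b)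
      rw [add_lie]
      exact N.add_mem (hnN y hy w (hWN hw)) (hWN (hW z hz w hw))
    · rw [leibniz_lie]
      exact N.add_mem (hv.2 _) (hnN y hy _ (hv.2 x))
  let M : LieSubmodule ℂ L X := { N with lie_mem := fun {x v} hv => (hNN' hv).2 x }
  have hM : LieSubmodule.lieSpan ℂ L (W : Set X) ≤ M := LieSubmodule.lieSpan_le.2 hWN
  exact le_trans (show _ ≤ N from hM) (sInf_le ⟨hWZ, hZ⟩)

variable {𝔞 : Type u} [LieRing 𝔞] [LieAlgebra ℂ 𝔞]

/-- The data `(𝔧, P, 𝔩, 𝔲, H)` of a standard parabolic subalgebra `𝔩 + 𝔲` of a reductive Lie algebra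
`𝔞`, defined by an element `H` of the Cartan subalgebra `𝔧`. The last condition, which always holds by
Ado's theorem, gives access to the Poincaré–Birkhoff–Witt theorem. -/
structure IsStandard (𝔧 : LieSubalgebra ℂ 𝔞) (P : Set (Module.Dual ℂ 𝔧)) (𝔩 : LieSubalgebra ℂ 𝔞)
    (𝔲 : Submodule ℂ 𝔞) (H : 𝔧) : Prop where
  split : IsSplitReductive 𝔧
  mem_levi : ∀ x, x ∈ 𝔩 ↔ ⁅(H : 𝔞), x⁆ = 0
  nil_eq : 𝔲 = ⨆ α ∈ {α : Module.Dual ℂ 𝔧 | 0 < (α H).re}, wt 𝔧 𝔞 α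
  im_eq_zero : ∀ α ∈ roots 𝔧 ⊤, (α H).im = 0
  pos : IsPositiveSystem 𝔧 P
  pos_re : ∀ α ∈ P, 0 ≤ (α H).re
  exists_rep : ∃ (n : ℕ) (ρ : 𝔞 →ₗ⁅ℂ⁆ Matrix (Fin n) (Fin n) ℂ), Function.Injective ρ

variable {𝔧 : LieSubalgebra ℂ 𝔞} {P : Set (Module.Dual ℂ 𝔧)} {𝔩 : LieSubalgebra ℂ 𝔞}
  {𝔲 : Submodule ℂ 𝔞} {H : 𝔧}

theorem mem_roots_top {α : Module.Dual ℂ 𝔧} : α ∈ roots 𝔧 ⊤ ↔ α ≠ 0 ∧ wt 𝔧 𝔞 α ≠ ⊥ := by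
  simp [roots]

namespace IsStandard

variable (hD : IsStandard 𝔧 P 𝔩 𝔲 H)
include hD

theorem toral_le : 𝔧 ≤ 𝔩 := by
  intro x hx
  rw [hD.mem_levi]
  have hx0 : x ∈ wt 𝔧 𝔞 0 := by rw [hD.split.wt_zero]; exact hx
  simpa using mem_wt.1 hx0 H

theorem toral_lie (h k : 𝔧) : ⁅(h : 𝔞), (k : 𝔞)⁆ = 0 := by
  have hx0 : (k : 𝔞) ∈ wt 𝔧 𝔞 0 := by rw [hD.split.wt_zero]; exact k.2
  simpa using mem_wt.1 hx0 h

theorem wt_le_levi {α : Module.Dual ℂ 𝔧} (hα : α H = 0) {x : 𝔞} (hx : x ∈ wt 𝔧 𝔞 α) : x ∈ 𝔩 := by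
  rw [hD.mem_levi, mem_wt.1 hx H, hα, zero_smul]

/-- The roots of `𝔩` are the roots of `𝔞` that vanish on `H`. -/
theorem root_levi {α : Module.Dual ℂ 𝔧} : α ∈ roots 𝔧 𝔩 ↔ α ∈ roots 𝔧 ⊤ ∧ α H = 0 := by
  rw [mem_roots_top]
  constructor
  · rintro ⟨h0, h⟩
    obtain ⟨x, ⟨hx, hx𝔩⟩, hx0⟩ := (Submodule.ne_bot_iff _).1 h
    refine ⟨⟨h0, (Submodule.ne_bot_iff _).2 ⟨x, hx, hx0⟩⟩, ?_⟩
    have h1 := mem_wt.1 hx H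
    rw [(hD.mem_levi x).1 hx𝔩] at h1
    exact (smul_eq_zero.1 h1.symm).resolve_right hx0
  · rintro ⟨⟨h0, h⟩, hα⟩
    obtain ⟨x, hx, hx0⟩ := (Submodule.ne_bot_iff _).1 h
    exact ⟨h0, (Submodule.ne_bot_iff _).2 ⟨x, ⟨hx, hD.wt_le_levi hα hx⟩, hx0⟩⟩

theorem neg_mem_roots {α : Module.Dual ℂ 𝔧} (hα : α ∈ roots 𝔧 ⊤) : -α ∈ roots 𝔧 ⊤ := by
  rw [mem_roots_top] at hα ⊢
  obtain ⟨e, he, he0⟩ := (Submodule.ne_bot_iff _).1 hα.2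
  obtain ⟨f, hf, h, hh, hαh⟩ := hD.split.opposite α hα.1 e he he0
  refine ⟨neg_ne_zero.2 hα.1, (Submodule.ne_bot_iff _).2 ⟨f, hf, fun hf0 => hαh ?_⟩⟩
  rw [hf0, lie_zero] at hh
  rw [show h = 0 from Subtype.ext hh, map_zero]

theorem ne_zero_of_pos {α : Module.Dual ℂ 𝔧} (hα : α ∈ P) : α ≠ 0 :=
  (mem_roots_top.1 (hD.pos.subset hα)).1

/-- A root vector is part of an `𝔰𝔩₂`-triple. -/
theorem exists_sl2 {α : Module.Dual ℂ 𝔧} (h0 : α ≠ 0) {e : 𝔞} (he : e ∈ wt 𝔧 𝔞 α) (he0 : e ≠ 0) :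
    ∃ f ∈ wt 𝔧 𝔞 (-α), ∃ h : 𝔧, α h = 2 ∧ (h : 𝔞) = ⁅e, f⁆ ∧ IsSl2Triple (h : 𝔞) e f := by
  obtain ⟨f, hf, h, hh, hαh⟩ := hD.split.opposite α h0 e he he0
  have hf' : (2 / α h) • f ∈ wt 𝔧 𝔞 (-α) := Submodule.smul_mem _ _ hf
  have h2 : α ((2 / α h) • h) = 2 := by
    rw [map_smul, smul_eq_mul, div_mul_cancel₀ _ hαh]
  have hh' : (((2 / α h) • h : 𝔧) : 𝔞) = ⁅e, (2 / α h) • f⁆ := by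
    rw [lie_smul, ← hh]; rfl
  refine ⟨_, hf', (2 / α h) • h, h2, hh', ⟨?_, hh'.symm, ?_, ?_⟩⟩
  · intro hz
    have : (2 / α h) • h = 0 := Subtype.ext hz
    rw [this, map_zero] at h2
    norm_num at h2
  · rw [mem_wt.1 he, h2]
    exact ofNat_smul_eq_nsmul ℂ 2 e
  · rw [mem_wt.1 hf', LinearMap.neg_apply, h2, neg_smul]
    congr 1
    exact ofNat_smul_eq_nsmul ℂ 2 _

/-- A nonempty sum of positive roots does not vanish: otherwise it can be shortened, by adding two
roots to a root, until it pairs positively with the coroot of one of its members. -/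
theorem sum_ne_zero [FiniteDimensional ℂ 𝔞] (s : Multiset (Module.Dual ℂ 𝔧)) (hs : ∀ α ∈ s, α ∈ P)
    (h0 : s.sum = 0) : s = 0 := by
  induction hn : s.card using Nat.strong_induction_on generalizing s with
  | _ n ih =>
  subst hn
  by_contra hne
  obtain ⟨α, hα⟩ := Multiset.exists_mem_of_ne_zero hne
  obtain ⟨s, rfl⟩ := Multiset.exists_cons_of_mem hα
  have hαP := hs α hα
  obtain ⟨hα0, hαr⟩ := mem_roots_top.1 (hD.pos.subset hαP)
  obtain ⟨e, he, he0⟩ := (Submodule.ne_bot_iff _).1 hαr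
  obtain ⟨f, hf, h, hαh, hef, ht⟩ := hD.exists_sl2 hα0 he he0
  -- If `α + β` is a root, it is positive and replaces `α` and `β` in the sum. Otherwise a root vector
  -- for `β` is primitive for the `𝔰𝔩₂`-triple of `α`.
  have key : ∀ β ∈ s, ∃ k : ℕ, β h = k := by
    intro β hβ
    have hβP := hs β (Multiset.mem_cons_of_mem hβ)
    obtain ⟨hβ0, hβr⟩ := mem_roots_top.1 (hD.pos.subset hβP)
    by_cases hαβ : wt 𝔧 𝔞 (α + β) = ⊥
    · obtain ⟨x, hx, hx0⟩ := (Submodule.ne_bot_iff _).1 hβr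
      have hp : IsSl2Triple.HasPrimitiveVectorWith ht x (β h) :=
        { ne_zero := hx0
          lie_h := mem_wt.1 hx h
          lie_e := by
            have := lie_mem_wt he hx
            rwa [hαβ, Submodule.mem_bot] at this }
      exact hp.exists_nat
    · exfalso
      have hab0 : α + β ≠ 0 := by
        intro hz
        have h1 := hD.pos.xor_neg α (hD.pos.subset hαP)
        rw [← eq_neg_of_add_eq_zero_right hz] at h1
        rcases h1 with h1 | h1
        · exact h1.2 hβP
        · exact h1.2 hαP
      have habP := hD.pos.add_mem α hαP β hβP (mem_roots_top.2 ⟨hab0, hαβ⟩)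
      obtain ⟨t, rfl⟩ := Multiset.exists_cons_of_mem hβ
      have := ih (Multiset.card ((α + β) ::ₘ t)) (by simp) ((α + β) ::ₘ t) (by
        intro γ hγ
        rcases Multiset.mem_cons.1 hγ with rfl | hγ
        · exact habP
        · exact hs γ (Multiset.mem_cons_of_mem (Multiset.mem_cons_of_mem hγ))) (by
        simpa [add_assoc] using h0) rfl
      exact Multiset.cons_ne_zero this
  have hsum : ∃ k : ℕ, s.sum h = k := by
    clear h0 ih hs hα hne
    induction s using Multiset.induction_on with
    | empty => exact ⟨0, by simp⟩
    | cons β s ih =>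
      obtain ⟨k, hk⟩ := ih fun β hβ => key β (Multiset.mem_cons_of_mem hβ)
      obtain ⟨l, hl⟩ := key β (Multiset.mem_cons_self β s)
      exact ⟨l + k, by rw [Multiset.sum_cons, LinearMap.add_apply, hk, hl]; push_cast; rfl⟩
  obtain ⟨k, hk⟩ := hsum
  have h1 := congrArg (fun φ => φ h) h0
  simp only [Multiset.sum_cons, LinearMap.add_apply, hαh, hk, LinearMap.zero_apply] at h1
  have : ((2 + k : ℕ) : ℂ) = 0 := by push_cast; exact h1
  exact absurd (Nat.cast_eq_zero.1 this) (by omega)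

end IsStandard

end Standard

/-! ### Weights of modules over the Levi subalgebra -/

section LeviWeights

open LieModule LieAlgebra

attribute [local instance] LieRing.ofAssociativeRing

universe u

section General

variable {ι κ X : Type*} [AddCommGroup X] [Module ℂ X] {T : ι → Module.End ℂ X} {χ : κ → ι → ℂ}

/-- A stable subspace contains the component of weight `k` of an element whose other components have
weights in `Ω ∌ k`. -/
theorem mem_of_add_mem (hχ : Function.Injective χ) {N : Submodule ℂ X}
    (hN : ∀ i, ∀ v ∈ N, T i v ∈ N) {k : κ} {Ω : Set κ} (hk : k ∉ Ω) {a z : X}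
    (ha : a ∈ simEig T (χ k)) (hz : z ∈ ⨆ l ∈ Ω, simEig T (χ l)) (h : a + z ∈ N) : a ∈ N := by
  classical
  obtain ⟨s, w, hs, hw, rfl⟩ := exists_sum_of_mem_iSup hz
  have hks : k ∉ s := fun h => hk (hs k h)
  have h1 := mem_of_sum_mem hχ hN (insert k s) (Function.update w k a) (fun l hl => by
    rcases Finset.mem_insert.1 hl with rfl | hl
    · rwa [Function.update_self]
    · rw [Function.update_of_ne (ne_of_mem_of_not_mem hl hks)]
      exact hw l) (by
    rw [Finset.sum_insert hks, Function.update_self]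
    convert h using 2
    refine Finset.sum_congr rfl fun l hl => ?_
    rw [Function.update_of_ne (ne_of_mem_of_not_mem hl hks)]) k (Finset.mem_insert_self k s)
  rwa [Function.update_self] at h1

theorem eq_zero_of_mem_iSup_simEig (hχ : Function.Injective χ) {k : κ} {Ω : Set κ} (hk : k ∉ Ω)
    {a : X} (ha : a ∈ simEig T (χ k)) (hz : a ∈ ⨆ l ∈ Ω, simEig T (χ l)) : a = 0 := by
  have := mem_of_add_mem hχ (N := ⊥) (fun i v hv => by
    rw [(Submodule.mem_bot ℂ).1 hv, map_zero]; exact Submodule.zero_mem _) hk ha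
    (Submodule.neg_mem _ hz) (by rw [add_neg_cancel]; exact Submodule.zero_mem _)
  exact (Submodule.mem_bot ℂ).1 this

theorem finite_setOf_simEig_ne_bot (hχ : Function.Injective χ) [FiniteDimensional ℂ X]
    (h : ⨆ k, simEig T (χ k) = ⊤) : {k | simEig T (χ k) ≠ ⊥}.Finite := by
  obtain ⟨s, b, w, hb⟩ := exists_basis_simEig h
  have := Module.Finite.finite_basis b
  refine (Set.finite_range w).subset fun k hk => ?_
  by_contra hcon
  refine hk ?_
  rw [simEig_eq_span hχ hb b.span_eq, Submodule.span_eq_bot]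
  rintro _ ⟨i, hi, rfl⟩
  exact absurd ⟨i, hi⟩ hcon

theorem lie_mem_of_mem_span {L X : Type*} [LieRing L] [LieAlgebra ℂ L] [AddCommGroup X]
    [Module ℂ X] [LieRingModule L X] [LieModule ℂ L X] {s : Set L} {W Z : Submodule ℂ X}
    (h : ∀ x ∈ s, ∀ w ∈ W, ⁅x, w⁆ ∈ Z) : ∀ x ∈ Submodule.span ℂ s, ∀ w ∈ W, ⁅x, w⁆ ∈ Z := by
  intro x hx w hw
  induction hx using Submodule.span_induction with
  | mem x hx => exact h x hx w hw
  | zero => rw [zero_lie]; exact Z.zero_mem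
  | add x y _ _ hx hy => rw [add_lie]; exact Z.add_mem hx hy
  | smul c x _ hx => rw [smul_lie]; exact Z.smul_mem c hx

end General

variable {𝔞 : Type u} [LieRing 𝔞] [LieAlgebra ℂ 𝔞]
variable {𝔧 : LieSubalgebra ℂ 𝔞} {P : Set (Module.Dual ℂ 𝔧)} {𝔩 : LieSubalgebra ℂ 𝔞}
  {𝔲 : Submodule ℂ 𝔞} {H : 𝔧}
variable {V V' : Type*} [AddCommGroup V] [Module ℂ V] [LieRingModule 𝔩 V] [LieModule ℂ 𝔩 V]
  [AddCommGroup V'] [Module ℂ V'] [LieRingModule 𝔩 V'] [LieModule ℂ 𝔩 V']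

variable (𝔧 𝔩 V) in
/-- The weight space `V_μ` of an `𝔩`-module `V` for a weight `μ` of the Cartan subalgebra
`𝔧 ⊆ 𝔩`. -/
def lwt (μ : Module.Dual ℂ 𝔧) : Submodule ℂ V :=
  simEig (fun x : {x : 𝔩 // (x : 𝔞) ∈ 𝔧} => toEnd ℂ 𝔩 V x) (fun x => μ ⟨x.1, x.2⟩)

theorem mem_lwt {μ : Module.Dual ℂ 𝔧} {v : V} :
    v ∈ lwt 𝔧 𝔩 V μ ↔ ∀ (x : 𝔩) (hx : (x : 𝔞) ∈ 𝔧), ⁅x, v⁆ = μ ⟨x, hx⟩ • v := by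
  rw [lwt, mem_simEig]
  exact ⟨fun h x hx => h ⟨x, hx⟩, fun h x => h x.1 x.2⟩

theorem lwt_injective (h : 𝔧 ≤ 𝔩) : Function.Injective
    fun (μ : Module.Dual ℂ 𝔧) (x : {x : 𝔩 // (x : 𝔞) ∈ 𝔧}) => μ ⟨x.1, x.2⟩ :=
  fun _ _ hμ => LinearMap.ext fun x => congrFun hμ ⟨⟨x, h x.2⟩, x.2⟩

theorem lie_mem_lwt {α μ : Module.Dual ℂ 𝔧} {x : 𝔩} (hx : (x : 𝔞) ∈ wt 𝔧 𝔞 α) {v : V}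
    (hv : v ∈ lwt 𝔧 𝔩 V μ) : ⁅x, v⁆ ∈ lwt 𝔧 𝔩 V (α + μ) := by
  rw [mem_lwt] at hv ⊢
  intro y hy
  have h1 : ⁅y, x⁆ = α ⟨y, hy⟩ • x := Subtype.ext (mem_wt.1 hx ⟨y, hy⟩)
  rw [leibniz_lie, h1, hv y hy, smul_lie, lie_smul, LinearMap.add_apply, add_smul]

theorem iSup_lwt_of_injective (h : 𝔧 ≤ 𝔩) (f : V →ₗ⁅ℂ, 𝔩⁆ V') (hf : Function.Injective f)
    (hV : ⨆ μ, lwt 𝔧 𝔩 V' μ = ⊤) : ⨆ μ, lwt 𝔧 𝔩 V μ = ⊤ :=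
  iSup_simEig_of_injective (lwt_injective h) (q := (f : V →ₗ[ℂ] V')) (fun _ _ => f.map_lie _ _) hf hV

theorem iSup_lwt_of_surjective (f : V →ₗ⁅ℂ, 𝔩⁆ V') (hf : Function.Surjective f)
    (hV : ⨆ μ, lwt 𝔧 𝔩 V μ = ⊤) : ⨆ μ, lwt 𝔧 𝔩 V' μ = ⊤ :=
  iSup_simEig_of_surjective (q := (f : V →ₗ[ℂ] V')) (fun _ _ => f.map_lie _ _) hf hV

theorem map_mem_lwt (f : V →ₗ⁅ℂ, 𝔩⁆ V') {μ : Module.Dual ℂ 𝔧} {v : V} (hv : v ∈ lwt 𝔧 𝔩 V μ) :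
    f v ∈ lwt 𝔧 𝔩 V' μ :=
  map_mem_simEig (q := (f : V →ₗ[ℂ] V')) (fun _ _ => f.map_lie _ _) hv

/-- The sums of nonempty families of positive roots. -/
def posSums (P : Set (Module.Dual ℂ 𝔧)) : Set (Module.Dual ℂ 𝔧) :=
  {s | ∃ m : Multiset (Module.Dual ℂ 𝔧), m ≠ 0 ∧ (∀ α ∈ m, α ∈ P) ∧ m.sum = s}

theorem mem_posSums {α : Module.Dual ℂ 𝔧} (hα : α ∈ P) : α ∈ posSums P :=
  ⟨{α}, by simp, by simpa, by simp⟩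

theorem posSums_add {s t : Module.Dual ℂ 𝔧} (hs : s ∈ posSums P) (ht : t ∈ posSums P) :
    s + t ∈ posSums P := by
  obtain ⟨m, hm, hmP, rfl⟩ := hs
  obtain ⟨n, hn, hnP, rfl⟩ := ht
  refine ⟨m + n, fun h => hm (by simp_all), fun α hα => ?_, by simp⟩
  rcases Multiset.mem_add.1 hα with hα | hα
  · exact hmP α hα
  · exact hnP α hα

variable (P 𝔩) in
/-- `v` is a vector of weight `δ` that is killed by the positive root vectors of `𝔩`. -/
def IsSingular (δ : Module.Dual ℂ 𝔧) (v : V) : Prop :=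
  v ∈ lwt 𝔧 𝔩 V δ ∧ ∀ α ∈ P ∩ roots 𝔧 𝔩, ∀ x : 𝔩, (x : 𝔞) ∈ wt 𝔧 𝔞 α → ⁅x, v⁆ = 0

theorem IsSingular.map (f : V →ₗ⁅ℂ, 𝔩⁆ V') {δ : Module.Dual ℂ 𝔧} {v : V} (hv : IsSingular P 𝔩 δ v) :
    IsSingular P 𝔩 δ (f v) :=
  ⟨map_mem_lwt f hv.1, fun α hα x hx => by rw [← f.map_lie, hv.2 α hα x hx, map_zero]⟩

namespace IsStandard

variable (hD : IsStandard 𝔧 P 𝔩 𝔲 H)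
include hD

theorem zero_notMem_posSums [FiniteDimensional ℂ 𝔞] : (0 : Module.Dual ℂ 𝔧) ∉ posSums P := by
  rintro ⟨m, hm, hmP, h0⟩
  exact hm (hD.sum_ne_zero m hmP h0)

/-- The triangular decomposition of the Levi subalgebra. -/
theorem levi_eq_span : Submodule.span ℂ {x : 𝔩 | ∃ α ∈ P ∩ roots 𝔧 𝔩, (x : 𝔞) ∈ wt 𝔧 𝔞 (-α)} ⊔
    Submodule.span ℂ ({x : 𝔩 | (x : 𝔞) ∈ 𝔧} ∪ {x : 𝔩 | ∃ α ∈ P ∩ roots 𝔧 𝔩, (x : 𝔞) ∈ wt 𝔧 𝔞 α}) =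
      ⊤ := by
  rw [← Submodule.span_union, eq_top_iff]
  rintro x -
  set S := Submodule.span ℂ ({x : 𝔩 | ∃ α ∈ P ∩ roots 𝔧 𝔩, (x : 𝔞) ∈ wt 𝔧 𝔞 (-α)} ∪
    ({x : 𝔩 | (x : 𝔞) ∈ 𝔧} ∪ {x : 𝔩 | ∃ α ∈ P ∩ roots 𝔧 𝔩, (x : 𝔞) ∈ wt 𝔧 𝔞 α}))
  obtain ⟨s, w, hw, hsx⟩ := exists_sum_of_iSup_eq_top hD.split.iSup_wt (x : 𝔞)
  have h1 : ∀ α ∈ s, w α ∈ 𝔩 := by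
    refine mem_of_sum_mem (N := 𝔩.toSubmodule) (T := fun x : 𝔧 => toEnd ℂ 𝔞 𝔞 x)
      (dual_injective (𝔧 := 𝔧)) (fun h y hy => 𝔩.lie_mem (hD.toral_le h.2) hy) s w
      (fun α _ => ?_) ?_
    · rw [← wt_eq_simEig]; exact hw α
    · rw [hsx]; exact x.2
  have h2 : x = ∑ α ∈ s.attach, ⟨w α, h1 α α.2⟩ := by
    refine Subtype.ext ?_
    rw [AddSubmonoidClass.coe_finsetSum, ← hsx]
    exact (Finset.sum_attach s w).symm
  rw [h2]
  refine Submodule.sum_mem _ fun α _ => ?_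
  rcases eq_or_ne (w α) 0 with h0 | h0
  · convert S.zero_mem using 1
    exact Subtype.ext h0
  rcases eq_or_ne (α : Module.Dual ℂ 𝔧) 0 with hα | hα
  · refine Submodule.subset_span (Or.inr (Or.inl ?_))
    have := hw α
    rw [hα, hD.split.wt_zero] at this
    change w α ∈ 𝔧
    rwa [hα]
  have hr : (α : Module.Dual ℂ 𝔧) ∈ roots 𝔧 𝔩 :=
    ⟨hα, (Submodule.ne_bot_iff _).2 ⟨w α, ⟨hw α, h1 α α.2⟩, h0⟩⟩
  have hr' := hD.root_levi.1 hr
  rcases hD.pos.xor_neg α hr'.1 with h | h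
  · exact Submodule.subset_span (Or.inr (Or.inr ⟨α, ⟨h.1, hr⟩, hw α⟩))
  · refine Submodule.subset_span (Or.inl ⟨-α, ⟨h.1, ?_⟩, by rw [neg_neg]; exact hw α⟩)
    exact hD.root_levi.2 ⟨hD.neg_mem_roots hr'.1, by rw [LinearMap.neg_apply, hr'.2, neg_zero]⟩

/-- A module generated by a singular vector `v` of weight `δ` is spanned by `v` and by weight spaces
for weights lower than `δ`. -/
theorem span_sup_eq_top {δ : Module.Dual ℂ 𝔧} {v : V} (hv : IsSingular P 𝔩 δ v)
    (hspan : LieSubmodule.lieSpan ℂ 𝔩 {v} = ⊤) :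
    Submodule.span ℂ {v} ⊔ ⨆ μ ∈ {μ | δ - μ ∈ posSums P}, lwt 𝔧 𝔩 V μ = ⊤ := by
  set Z := Submodule.span ℂ {v} ⊔ ⨆ μ ∈ {μ | δ - μ ∈ posSums P}, lwt 𝔧 𝔩 V μ
  have hZ : ∀ {μ w}, w ∈ lwt 𝔧 𝔩 V μ → δ - μ ∈ posSums P → w ∈ Z := fun {μ w} hw hμ =>
    Submodule.mem_sup_right (Submodule.mem_iSup_of_mem μ (Submodule.mem_iSup_of_mem hμ hw))
  rw [eq_top_iff, ← LieSubmodule.top_toSubmodule (R := ℂ) (L := 𝔩), ← hspan]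
  have h1 := lieSpan_le_of_stable hD.levi_eq_span (W := Submodule.span ℂ {v}) (Z := Z)
    (lie_mem_of_mem_span (by
      rintro x (hx | ⟨α, hα, hx⟩) w hw
      · obtain ⟨c, rfl⟩ := Submodule.mem_span_singleton.1 hw
        rw [lie_smul, mem_lwt.1 hv.1 x hx]
        exact Submodule.smul_mem _ _ (Submodule.smul_mem _ _ (Submodule.mem_span_singleton_self v))
      · obtain ⟨c, rfl⟩ := Submodule.mem_span_singleton.1 hw
        rw [lie_smul, hv.2 α hα x hx, smul_zero]
        exact Submodule.zero_mem _)) le_sup_left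
    (lie_mem_of_mem_span (by
      rintro x ⟨α, hα, hx⟩ w hw
      have hle : Z ≤ Z.comap (toEnd ℂ 𝔩 V x) := by
        refine sup_le ?_ (iSup₂_le fun μ hμ w hw => ?_)
        · rw [Submodule.span_le, Set.singleton_subset_iff]
          refine hZ (lie_mem_lwt hx hv.1) ?_
          rw [neg_add_eq_sub, sub_sub_cancel]
          exact mem_posSums hα.1
        · refine hZ (lie_mem_lwt hx hw) ?_
          rw [neg_add_eq_sub, sub_sub_eq_add_sub, add_comm, add_sub_assoc]
          exact posSums_add (mem_posSums hα.1) hμ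
      exact hle hw))
  refine le_trans ?_ h1
  exact LieSubmodule.lieSpan_mono (Set.singleton_subset_iff.2 (Submodule.mem_span_singleton_self v))

theorem lwt_eq_span [FiniteDimensional ℂ 𝔞] {δ : Module.Dual ℂ 𝔧} {v : V}
    (hv : IsSingular P 𝔩 δ v) (hspan : LieSubmodule.lieSpan ℂ 𝔩 {v} = ⊤) :
    lwt 𝔧 𝔩 V δ = Submodule.span ℂ {v} := by
  refine le_antisymm (fun w hw => ?_) ?_
  · have h1 : w ∈ Submodule.span ℂ {v} ⊔ ⨆ μ ∈ {μ | δ - μ ∈ posSums P}, lwt 𝔧 𝔩 V μ := by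
      rw [hD.span_sup_eq_top hv hspan]; trivial
    obtain ⟨a, ha, z, hz, rfl⟩ := Submodule.mem_sup.1 h1
    have ha' : a ∈ lwt 𝔧 𝔩 V δ := by
      obtain ⟨c, rfl⟩ := Submodule.mem_span_singleton.1 ha
      exact Submodule.smul_mem _ _ hv.1
    have hz0 : z = 0 := eq_zero_of_mem_iSup_simEig (lwt_injective hD.toral_le) (k := δ)
      (Ω := {μ | δ - μ ∈ posSums P}) (by
        simpa using hD.zero_notMem_posSums) (by
        have := Submodule.sub_mem _ hw ha'
        rwa [add_sub_cancel_left] at this) hz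
    rwa [hz0, add_zero]
  · rw [Submodule.span_le, Set.singleton_subset_iff]
    exact hv.1

theorem lwt_ne_bot_of_singular {δ μ : Module.Dual ℂ 𝔧} {v : V} (hv : IsSingular P 𝔩 δ v)
    (hspan : LieSubmodule.lieSpan ℂ 𝔩 {v} = ⊤) (hμ : lwt 𝔧 𝔩 V μ ≠ ⊥) :
    μ = δ ∨ δ - μ ∈ posSums P := by
  by_contra! hcon
  refine hμ ((Submodule.eq_bot_iff _).2 fun w hw => ?_)
  refine eq_zero_of_mem_iSup_simEig (lwt_injective hD.toral_le) (k := μ)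
      (Ω := {μ | μ = δ ∨ δ - μ ∈ posSums P}) (by
        simpa using hcon) hw ?_
  have h1 : w ∈ Submodule.span ℂ {v} ⊔ ⨆ μ ∈ {μ | δ - μ ∈ posSums P}, lwt 𝔧 𝔩 V μ := by
    rw [hD.span_sup_eq_top hv hspan]; trivial
  refine (sup_le ?_ ?_ : Submodule.span ℂ {v} ⊔ ⨆ μ ∈ {μ | δ - μ ∈ posSums P}, lwt 𝔧 𝔩 V μ ≤ _) h1
  · rw [Submodule.span_le, Set.singleton_subset_iff]
    exact Submodule.mem_iSup_of_mem δ (Submodule.mem_iSup_of_mem (Or.inl rfl) hv.1)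
  · exact biSup_mono fun μ hμ => Or.inr hμ

/-- A nonzero finite dimensional weight module has a maximal weight. -/
theorem exists_maximal_weight [FiniteDimensional ℂ 𝔞] [FiniteDimensional ℂ V] [Nontrivial V]
    (hV : ⨆ μ, lwt 𝔧 𝔩 V μ = ⊤) :
    ∃ δ, lwt 𝔧 𝔩 V δ ≠ ⊥ ∧ ∀ s ∈ posSums P, lwt 𝔧 𝔩 V (δ + s) = ⊥ := by
  let Φ := {μ : Module.Dual ℂ 𝔧 | lwt 𝔧 𝔩 V μ ≠ ⊥}
  have hfin : Finite Φ := finite_setOf_simEig_ne_bot (lwt_injective hD.toral_le) hV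
  let r : Φ → Φ → Prop := fun μ ν => μ.1 - ν.1 ∈ posSums P
  have : IsTrans Φ r := ⟨fun a b c hab hbc => by
    have := posSums_add hab hbc
    rwa [sub_add_sub_cancel] at this⟩
  have : Std.Irrefl r := ⟨fun a ha => hD.zero_notMem_posSums (by simpa [r] using ha)⟩
  have hwf : WellFounded r := Finite.wellFounded_of_trans_of_irrefl r
  obtain ⟨μ, hμ⟩ : Φ.Nonempty := by
    by_contra hcon
    rw [Set.not_nonempty_iff_eq_empty] at hcon
    have h1 : ∀ μ, lwt 𝔧 𝔩 V μ = ⊥ := fun μ => by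
      by_contra hμ
      exact (hcon ▸ (show μ ∈ Φ from hμ) : μ ∈ (∅ : Set _))
    simp only [h1, iSup_bot] at hV
    exact bot_ne_top hV
  obtain ⟨δ, -, hδ⟩ := hwf.has_min Set.univ ⟨⟨μ, hμ⟩, trivial⟩
  refine ⟨δ, δ.2, fun s hs => ?_⟩
  by_contra hcon
  exact hδ ⟨δ + s, hcon⟩ trivial (by simpa [r] using hs)

theorem isSingular_of_maximal {δ : Module.Dual ℂ 𝔧} {v : V} (hv : v ∈ lwt 𝔧 𝔩 V δ)
    (hδ : ∀ s ∈ posSums P, lwt 𝔧 𝔩 V (δ + s) = ⊥) : IsSingular P 𝔩 δ v := by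
  refine ⟨hv, fun α hα x hx => ?_⟩
  have := lie_mem_lwt hx hv
  rwa [add_comm, hδ α (mem_posSums hα.1), Submodule.mem_bot] at this

/-- The weight of a singular vector in a finite dimensional module is dominant, by the representation
theory of `𝔰𝔩₂`. -/
theorem mem_dominant [FiniteDimensional ℂ V] {δ : Module.Dual ℂ 𝔧} {v : V}
    (hv : IsSingular P 𝔩 δ v) (hv0 : v ≠ 0) : δ ∈ dominant 𝔧 P 𝔩 := by
  rintro α hα h ⟨hαh, e, he, f, hf, hef⟩
  have hαH := (hD.root_levi.1 hα.2).2
  have he𝔩 := hD.wt_le_levi hαH he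
  have hf𝔩 := hD.wt_le_levi (α := -α) (by rw [LinearMap.neg_apply, hαH, neg_zero]) hf
  have ht : IsSl2Triple (⟨h, hD.toral_le h.2⟩ : 𝔩) ⟨e, he𝔩⟩ ⟨f, hf𝔩⟩ := by
    refine ⟨?_, Subtype.ext hef.symm, Subtype.ext ?_, Subtype.ext ?_⟩
    · intro hz
      have : h = 0 := Subtype.ext (congrArg (fun x : 𝔩 => (x : 𝔞)) hz)
      rw [this, map_zero] at hαh
      norm_num at hαh
    · change ⁅(h : 𝔞), e⁆ = 2 • e
      rw [mem_wt.1 he, hαh]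
      exact ofNat_smul_eq_nsmul ℂ 2 e
    · change ⁅(h : 𝔞), f⁆ = -(2 • f)
      rw [mem_wt.1 hf, LinearMap.neg_apply, hαh, neg_smul]
      congr 1
      exact ofNat_smul_eq_nsmul ℂ 2 _
  have hp : IsSl2Triple.HasPrimitiveVectorWith ht v (δ h) :=
    { ne_zero := hv0
      lie_h := mem_lwt.1 hv.1 _ h.2
      lie_e := hv.2 α hα _ he }
  exact hp.exists_nat

end IsStandard

end LeviWeights

/-! ### Verma modules of the Levi subalgebra -/

section LeviVerma

open LieModule LieAlgebra

attribute [local instance] LieRing.ofAssociativeRing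

universe u

/-- Sums of eigenspaces for disjoint sets of eigenvalues are independent. -/
theorem disjoint_iSup_simEig {ι κ X : Type*} [AddCommGroup X] [Module ℂ X]
    {T : ι → Module.End ℂ X} {χ : κ → ι → ℂ} (hχ : Function.Injective χ)
    {Ω Ω' : Set κ} (hd : Disjoint Ω Ω') :
    Disjoint (⨆ k ∈ Ω, simEig T (χ k)) (⨆ k ∈ Ω', simEig T (χ k)) := by
  have hstab : ∀ i, ∀ v ∈ ⨆ k ∈ Ω', simEig T (χ k), T i v ∈ ⨆ k ∈ Ω', simEig T (χ k) := by
    intro i v hv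
    have hle : ⨆ k ∈ Ω', simEig T (χ k) ≤ (⨆ k ∈ Ω', simEig T (χ k)).comap (T i) :=
      iSup₂_le fun k hk v hv => Submodule.mem_iSup_of_mem k (Submodule.mem_iSup_of_mem hk (by
        rw [mem_simEig] at hv ⊢
        intro j
        rw [hv i, map_smul, hv j, smul_comm]))
    exact hle hv
  rw [Submodule.disjoint_def]
  intro v hv hv'
  obtain ⟨s, w, hs, hw, rfl⟩ := exists_sum_of_mem_iSup hv
  have h1 := mem_of_sum_mem hχ hstab s w (fun k _ => hw k) hv'
  exact Finset.sum_eq_zero fun k hk => eq_zero_of_mem_iSup_simEig hχ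
    (Set.disjoint_left.1 hd (hs k hk)) (hw k) (h1 k hk)

variable {𝔞 : Type u} [LieRing 𝔞] [LieAlgebra ℂ 𝔞]
variable {𝔧 : LieSubalgebra ℂ 𝔞} {P : Set (Module.Dual ℂ 𝔧)} {𝔩 : LieSubalgebra ℂ 𝔞}
  {𝔲 : Submodule ℂ 𝔞} {H : 𝔧}

/-- The line on which the abelian Lie algebra `K` acts by the character `δ`. -/
theorem exists_character_module {K : Type*} [LieRing K] [LieAlgebra ℂ K]
    (hK : ∀ x y : K, ⁅x, y⁆ = 0) (δ : Module.Dual ℂ K) :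
    ∃ (F : Type) (_ : AddCommGroup F) (_ : Module ℂ F) (_ : LieRingModule K F)
      (_ : LieModule ℂ K F) (f : F), f ≠ 0 ∧ ∀ x : K, ⁅x, f⁆ = δ x • f := by
  let r : K →ₗ⁅ℂ⁆ Module.End ℂ ℂ :=
    { δ.smulRight (1 : Module.End ℂ ℂ) with
      map_lie' := fun {x y} => by
        rw [LieRing.of_associative_ring_bracket, hK]
        ext
        simp [mul_comm] }
  exact ⟨Pullback r ℂ, inferInstance, inferInstance, inferInstance, inferInstance, (1 : ℂ),
    one_ne_zero (α := ℂ), fun x => rfl⟩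

namespace IsStandard

variable (hD : IsStandard 𝔧 P 𝔩 𝔲 H)
include hD

theorem mem_lwt_self {α : Module.Dual ℂ 𝔧} {x : 𝔩} :
    x ∈ lwt 𝔧 𝔩 𝔩 α ↔ (x : 𝔞) ∈ wt 𝔧 𝔞 α := by
  rw [mem_lwt, mem_wt]
  refine ⟨fun h y => ?_, fun h y hy => Subtype.ext (h ⟨y, hy⟩)⟩
  exact congrArg Subtype.val (h ⟨y, hD.toral_le y.2⟩ y.2)

theorem lwt_self_zero : lwt 𝔧 𝔩 𝔩 0 = (𝔧.comap 𝔩.incl).toSubmodule := by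
  ext x
  rw [hD.mem_lwt_self, hD.split.wt_zero]
  rfl

theorem neg_notMem {α : Module.Dual ℂ 𝔧} (hα : α ∈ P) : -α ∉ P := by
  rcases hD.pos.xor_neg α (hD.pos.subset hα) with h | h
  · exact h.2
  · exact absurd hα h.2

/-- The sum of the positive root spaces of the Levi subalgebra is a subalgebra. -/
theorem lie_mem_posPart {x y : 𝔩} (hx : x ∈ ⨆ α ∈ P ∩ roots 𝔧 𝔩, lwt 𝔧 𝔩 𝔩 α)
    (hy : y ∈ ⨆ α ∈ P ∩ roots 𝔧 𝔩, lwt 𝔧 𝔩 𝔩 α) :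
    ⁅x, y⁆ ∈ ⨆ α ∈ P ∩ roots 𝔧 𝔩, lwt 𝔧 𝔩 𝔩 α := by
  set N := ⨆ α ∈ P ∩ roots 𝔧 𝔩, lwt 𝔧 𝔩 𝔩 α with hN
  have h1 : N ≤ (N.comap ((toEnd ℂ 𝔩 𝔩 : 𝔩 →ₗ[ℂ] Module.End ℂ 𝔩).flip y)) := by
    refine iSup₂_le fun α hα x hx => ?_
    have h2 : N ≤ N.comap (toEnd ℂ 𝔩 𝔩 x) := by
      refine iSup₂_le fun β hβ y hy => ?_
      change ⁅x, y⁆ ∈ N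
      have h3 : ⁅x, y⁆ ∈ lwt 𝔧 𝔩 𝔩 (α + β) := lie_mem_lwt (hD.mem_lwt_self.1 hx) hy
      by_cases h0 : ⁅x, y⁆ = 0
      · rw [h0]
        exact zero_mem _
      · have hne : α + β ≠ 0 := fun h =>
          hD.neg_notMem hα.1 ((neg_eq_of_add_eq_zero_right h) ▸ hβ.1)
        have hr : α + β ∈ roots 𝔧 𝔩 := ⟨hne, (Submodule.ne_bot_iff _).2
          ⟨(⁅x, y⁆ : 𝔩), ⟨hD.mem_lwt_self.1 h3, (⁅x, y⁆ : 𝔩).2⟩, fun h => h0 (Subtype.ext h)⟩⟩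
        exact Submodule.mem_iSup_of_mem (α + β) (Submodule.mem_iSup_of_mem
          ⟨hD.pos.add_mem α hα.1 β hβ.1 (hD.root_levi.1 hr).1, hr⟩ h3)
    exact h2 hy
  exact h1 hx

theorem lie_toral_mem_posPart {x y : 𝔩} (hx : x ∈ 𝔧.comap 𝔩.incl)
    (hy : y ∈ ⨆ α ∈ P ∩ roots 𝔧 𝔩, lwt 𝔧 𝔩 𝔩 α) :
    ⁅x, y⁆ ∈ ⨆ α ∈ P ∩ roots 𝔧 𝔩, lwt 𝔧 𝔩 𝔩 α := by
  have h1 : ⨆ α ∈ P ∩ roots 𝔧 𝔩, lwt 𝔧 𝔩 𝔩 α ≤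
      (⨆ α ∈ P ∩ roots 𝔧 𝔩, lwt 𝔧 𝔩 𝔩 α).comap (toEnd ℂ 𝔩 𝔩 x) := by
    refine iSup₂_le fun α hα y hy => Submodule.mem_iSup_of_mem α (Submodule.mem_iSup_of_mem hα ?_)
    rw [toEnd_apply_apply, mem_lwt.1 hy x hx]
    exact Submodule.smul_mem _ _ hy
  exact h1 hy

/-- The negative root spaces are a complement of the Borel subalgebra of the Levi subalgebra. -/
theorem isCompl_negPart : IsCompl (⨆ α ∈ {α | -α ∈ P ∩ roots 𝔧 𝔩}, lwt 𝔧 𝔩 𝔩 α)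
    ((𝔧.comap 𝔩.incl).toSubmodule ⊔ ⨆ α ∈ P ∩ roots 𝔧 𝔩, lwt 𝔧 𝔩 𝔩 α) := by
  rw [← hD.lwt_self_zero, ← iSup_insert]
  refine ⟨disjoint_iSup_simEig (lwt_injective hD.toral_le) ?_, ?_⟩
  · rw [Set.disjoint_left]
    rintro α hα (rfl | hα')
    · exact hD.ne_zero_of_pos hα.1 neg_zero
    · exact hD.neg_notMem hα'.1 hα.1
  · rw [codisjoint_iff, eq_top_iff, ← hD.levi_eq_span]
    refine sup_le_sup (Submodule.span_le.2 ?_) (Submodule.span_le.2 ?_)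
    · rintro x ⟨α, hα, hx⟩
      exact Submodule.mem_iSup_of_mem (-α) (Submodule.mem_iSup_of_mem
        (by rw [Set.mem_ofPred_eq, neg_neg]; exact hα) (hD.mem_lwt_self.2 hx))
    · rintro x (hx | ⟨α, hα, hx⟩)
      · refine Submodule.mem_iSup_of_mem 0 (Submodule.mem_iSup_of_mem (Set.mem_insert _ _) ?_)
        rw [hD.lwt_self_zero]
        exact hx
      · exact Submodule.mem_iSup_of_mem α (Submodule.mem_iSup_of_mem (Set.mem_insert_of_mem _ hα)
          (hD.mem_lwt_self.2 hx))

/-- The Verma module of the Levi subalgebra has a nonzero singular vector, by the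
Poincaré–Birkhoff–Witt theorem. -/
theorem exists_isSingular [FiniteDimensional ℂ 𝔞] (δ : Module.Dual ℂ 𝔧) :
    ∃ (M : Type u) (_ : AddCommGroup M) (_ : Module ℂ M) (_ : LieRingModule 𝔩 M)
      (_ : LieModule ℂ 𝔩 M) (v : M), IsSingular P 𝔩 δ v ∧ v ≠ 0 := by
  set K := 𝔧.comap 𝔩.incl with hK
  set N : Submodule ℂ 𝔩 := ⨆ α ∈ P ∩ roots 𝔧 𝔩, lwt 𝔧 𝔩 𝔩 α with hN
  obtain ⟨n, ρ, hρ⟩ := hD.exists_rep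
  obtain ⟨F, _, _, _, _, f, hf0, hf⟩ := exists_character_module (K := K)
    (fun x y => Subtype.ext (Subtype.ext (hD.toral_lie ⟨_, x.2⟩ ⟨_, y.2⟩)))
    (δ ∘ₗ { toFun := fun x => ⟨((x : 𝔩) : 𝔞), x.2⟩
            map_add' := fun _ _ => rfl
            map_smul' := fun _ _ => rfl })
  have hc := hD.isCompl_negPart
  set N' : Submodule ℂ 𝔩 := ⨆ α ∈ {α | -α ∈ P ∩ roots 𝔧 𝔩}, lwt 𝔧 𝔩 𝔩 α
  let b := Module.finBasis ℂ N'
  have hspan : Submodule.span ℂ (Set.range fun i => (b i : 𝔩)) = N' := by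
    conv_rhs => rw [← Submodule.range_subtype N', ← Submodule.map_top, ← b.span_eq,
      Submodule.map_span, ← Set.range_comp]
    rfl
  have hd : Disjoint K.toSubmodule N := by
    have := disjoint_iSup_simEig (T := fun x : {x : 𝔩 // (x : 𝔞) ∈ 𝔧} => toEnd ℂ 𝔩 𝔩 x)
      (lwt_injective hD.toral_le) (Ω := {0})
      (Ω' := P ∩ roots 𝔧 𝔩) (Set.disjoint_left.2 (by
        rintro α rfl hα
        exact hD.ne_zero_of_pos hα.1 rfl))
    rw [iSup_singleton] at this
    rw [hK, ← hD.lwt_self_zero]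
    exact this
  obtain ⟨M, hM⟩ := GenVerma.exists_coords_of_isCompl (F := F) (𝔩 := K) (𝔲 := N)
    (fun x hx z hz => hD.lie_toral_mem_posPart hx hz) (fun z hz w hw => hD.lie_mem_posPart hz hw)
    hd (y := fun i => (b i : 𝔩))
    (b.linearIndependent.map' N'.subtype (Submodule.ker_subtype _)) (by rw [hspan]; exact hc)
    (ρ.comp 𝔩.incl) (hρ.comp Subtype.val_injective)
  refine ⟨GenVerma K N F, inferInstance, inferInstance, inferInstance, inferInstance,
    GenVerma.of K N F f, ⟨mem_lwt.2 fun x hx => ?_, fun α hα x hx => ?_⟩, fun h0 => hf0 ?_⟩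
  · have h1 := GenVerma.lie_of (𝔲 := N) (⟨x, hx⟩ : K) f
    rw [hf, map_smul] at h1
    exact h1
  · exact GenVerma.lie_of_nil (Submodule.mem_iSup_of_mem α (Submodule.mem_iSup_of_mem hα
      (hD.mem_lwt_self.2 hx))) f
  · have h1 := hM 0 f
    rw [h0, map_zero, map_zero] at h1
    exact Finsupp.single_eq_zero.1 h1.symm

end IsStandard

end LeviVerma

/-! ### Simple highest weight modules -/

section SimpleModules

open LieModule LieAlgebra UniversalEnvelopingAlgebra

attribute [local instance] LieRing.ofAssociativeRing

universe u

section Irreducible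

variable {L X Y : Type*} [LieRing L] [LieAlgebra ℂ L] [AddCommGroup X] [Module ℂ X]
  [LieRingModule L X] [LieModule ℂ L X] [AddCommGroup Y] [Module ℂ Y]
  [LieRingModule L Y] [LieModule ℂ L Y]

theorem injective_of_ne_zero [IsIrreducible ℂ L X] {f : X →ₗ⁅ℂ, L⁆ Y} (hf : f ≠ 0) :
    Function.Injective f := by
  refine (LieModuleHom.ker_eq_bot f).1 ((eq_bot_or_eq_top _).resolve_right fun h => hf ?_)
  ext v
  exact LieModuleHom.mem_ker.1 (h ▸ LieSubmodule.mem_top v : v ∈ f.ker)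

theorem surjective_of_ne_zero [IsIrreducible ℂ L Y] {f : X →ₗ⁅ℂ, L⁆ Y} (hf : f ≠ 0) :
    Function.Surjective f := by
  have h : f.range = ⊤ := (eq_bot_or_eq_top _).resolve_left fun h => hf (by
    ext v
    have : f v ∈ f.range := (LieModuleHom.mem_range f _).2 ⟨v, rfl⟩
    rw [h] at this
    exact (LieSubmodule.mem_bot _).1 this)
  intro y
  exact (LieModuleHom.mem_range f y).1 (h ▸ LieSubmodule.mem_top y)

/-- An equivariant bijection is an isomorphism. -/
def equivOfBijective (f : X →ₗ⁅ℂ, L⁆ Y) (hf : Function.Bijective f) : X ≃ₗ⁅ℂ, L⁆ Y :=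
  { LinearEquiv.ofBijective (f : X →ₗ[ℂ] Y) hf with map_lie' := f.map_lie _ _ }

/-- The action of the enveloping algebra on a module. -/
def envAct (L X : Type*) [LieRing L] [LieAlgebra ℂ L] [AddCommGroup X] [Module ℂ X]
    [LieRingModule L X] [LieModule ℂ L X] : UniversalEnvelopingAlgebra ℂ L →ₐ[ℂ] Module.End ℂ X :=
  lift ℂ (toEnd ℂ L X)

@[simp] theorem envAct_ι (x : L) (v : X) : envAct L X (ι ℂ x) v = ⁅x, v⁆ := by
  simp only [envAct, lift_ι_apply, toEnd_apply_apply]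

end Irreducible

variable {𝔞 : Type u} [LieRing 𝔞] [LieAlgebra ℂ 𝔞]
variable {𝔧 : LieSubalgebra ℂ 𝔞} {P : Set (Module.Dual ℂ 𝔧)} {𝔩 : LieSubalgebra ℂ 𝔞}
  {𝔲 : Submodule ℂ 𝔞} {H : 𝔧} {δ : Module.Dual ℂ 𝔧}
variable {V : Type*} [AddCommGroup V] [Module ℂ V] [LieRingModule 𝔩 V] [LieModule ℂ 𝔩 V]

theorem IsSingular.envAct_eq_zero {v : V} (hv : IsSingular P 𝔩 δ v)
    {u : UniversalEnvelopingAlgebra ℂ 𝔩} (hu : u ∈ vermaIdeal 𝔧 P 𝔩 δ) : envAct 𝔩 V u v = 0 := by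
  induction hu using Submodule.span_induction with
  | mem u hu =>
    rcases hu with ⟨α, hα, x, hx, rfl⟩ | ⟨x, hx, rfl⟩
    · rw [envAct_ι, hv.2 α hα x hx]
    · rw [map_sub, LinearMap.sub_apply, envAct_ι, mem_lwt.1 hv.1 x hx, AlgHom.commutes,
        Module.algebraMap_end_apply, sub_self]
  | zero => rw [map_zero, LinearMap.zero_apply]
  | add a b _ _ ha hb => rw [map_add, LinearMap.add_apply, ha, hb, add_zero]
  | smul r a _ ha => rw [smul_eq_mul, map_mul, Module.End.mul_apply, ha, map_zero]

theorem vermaIdeal_ne_top {v : V} (hv : IsSingular P 𝔩 δ v) (hv0 : v ≠ 0) :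
    vermaIdeal 𝔧 P 𝔩 δ ≠ ⊤ := by
  intro h
  have := hv.envAct_eq_zero (u := 1) (h ▸ trivial)
  rw [map_one] at this
  exact hv0 this

/-- The highest weight vector of `SimpleHW`. -/
def SimpleHW.gen (𝔧 : LieSubalgebra ℂ 𝔞) (P : Set (Module.Dual ℂ 𝔧)) (𝔩 : LieSubalgebra ℂ 𝔞)
    (δ : Module.Dual ℂ 𝔧) : SimpleHW 𝔧 P 𝔩 δ :=
  (maxIdeal 𝔧 P 𝔩 δ).mkQ 1

namespace SimpleHW

/-- The quotient map from the enveloping algebra to `SimpleHW`. -/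
def mkL (𝔧 : LieSubalgebra ℂ 𝔞) (P : Set (Module.Dual ℂ 𝔧)) (𝔩 : LieSubalgebra ℂ 𝔞)
    (δ : Module.Dual ℂ 𝔧) : UniversalEnvelopingAlgebra ℂ 𝔩 →ₗ[UniversalEnvelopingAlgebra ℂ 𝔩]
    SimpleHW 𝔧 P 𝔩 δ :=
  (maxIdeal 𝔧 P 𝔩 δ).mkQ

theorem mkL_surjective : Function.Surjective (mkL 𝔧 P 𝔩 δ) := (maxIdeal 𝔧 P 𝔩 δ).mkQ_surjective

theorem mkL_eq_zero {u} : mkL 𝔧 P 𝔩 δ u = 0 ↔ u ∈ maxIdeal 𝔧 P 𝔩 δ :=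
  Submodule.Quotient.mk_eq_zero _

theorem mkL_one : mkL 𝔧 P 𝔩 δ 1 = gen 𝔧 P 𝔩 δ := rfl

theorem lie_def (x : 𝔩) (v : SimpleHW 𝔧 P 𝔩 δ) : ⁅x, v⁆ = ι ℂ x • v := rfl

theorem lie_mkL (x : 𝔩) (u) : ⁅x, mkL 𝔧 P 𝔩 δ u⁆ = mkL 𝔧 P 𝔩 δ (ι ℂ x * u) := by
  rw [lie_def, ← smul_eq_mul, map_smul]

theorem mem_of_gen_mem {N : Submodule ℂ (SimpleHW 𝔧 P 𝔩 δ)} (hN : ∀ (x : 𝔩), ∀ v ∈ N, ⁅x, v⁆ ∈ N)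
    (h : gen 𝔧 P 𝔩 δ ∈ N) : N = ⊤ := by
  rw [eq_top_iff]
  intro v _
  obtain ⟨u, rfl⟩ := mkL_surjective v
  have := env_smul_mem (N := N) hN u h
  rwa [← mkL_one, ← map_smul, smul_eq_mul, mul_one] at this

theorem lieSpan_gen : LieSubmodule.lieSpan ℂ 𝔩 {gen 𝔧 P 𝔩 δ} = ⊤ := by
  rw [← LieSubmodule.toSubmodule_eq_top]
  exact mem_of_gen_mem (fun x v hv => LieSubmodule.lie_mem _ hv)
    (LieSubmodule.subset_lieSpan (Set.mem_singleton _))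

theorem hom_ext {f g : SimpleHW 𝔧 P 𝔩 δ →ₗ⁅ℂ, 𝔩⁆ V}
    (h : f (gen 𝔧 P 𝔩 δ) = g (gen 𝔧 P 𝔩 δ)) : f = g := by
  have hN : ((f : SimpleHW 𝔧 P 𝔩 δ →ₗ[ℂ] V) - g).ker = ⊤ := mem_of_gen_mem (fun x v hv => by
    rw [LinearMap.mem_ker, LinearMap.sub_apply, sub_eq_zero] at hv ⊢
    change f ⁅x, v⁆ = g ⁅x, v⁆
    rw [f.map_lie, g.map_lie]
    exact congrArg _ hv) (by
    rw [LinearMap.mem_ker, LinearMap.sub_apply, sub_eq_zero]; exact h)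
  ext v
  have : v ∈ ((f : SimpleHW 𝔧 P 𝔩 δ →ₗ[ℂ] V) - g).ker := hN ▸ trivial
  rw [LinearMap.mem_ker, LinearMap.sub_apply, sub_eq_zero] at this
  exact this

theorem exists_hom {v : V} (hv : ∀ u ∈ maxIdeal 𝔧 P 𝔩 δ, envAct 𝔩 V u v = 0) :
    ∃ f : SimpleHW 𝔧 P 𝔩 δ →ₗ⁅ℂ, 𝔩⁆ V, f (gen 𝔧 P 𝔩 δ) = v := by
  let g : UniversalEnvelopingAlgebra ℂ 𝔩 →ₗ[ℂ] V := (LinearMap.applyₗ v) ∘ₗ (envAct 𝔩 V).toLinearMap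
  have hg : ∀ u, g u = envAct 𝔩 V u v := fun u => rfl
  let f : SimpleHW 𝔧 P 𝔩 δ →ₗ[ℂ] V :=
    (((maxIdeal 𝔧 P 𝔩 δ).restrictScalars ℂ).liftQ g fun u hu => hv u hu) ∘ₗ
    (Submodule.Quotient.restrictScalarsEquiv ℂ (maxIdeal 𝔧 P 𝔩 δ)).symm.toLinearMap
  have hf : ∀ u, f (mkL 𝔧 P 𝔩 δ u) = envAct 𝔩 V u v := fun u => rfl
  refine ⟨{ f with map_lie' := fun {x m} => ?_ }, ?_⟩
  · change f ⁅x, m⁆ = ⁅x, f m⁆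
    obtain ⟨u, rfl⟩ := mkL_surjective m
    rw [lie_mkL, hf, hf, map_mul, Module.End.mul_apply, envAct_ι]
  · change f _ = v
    rw [← mkL_one, hf, map_one]
    rfl

theorem isSingular_gen (h : vermaIdeal 𝔧 P 𝔩 δ ≤ maxIdeal 𝔧 P 𝔩 δ) :
    IsSingular P 𝔩 δ (gen 𝔧 P 𝔩 δ) := by
  refine ⟨mem_lwt.2 fun x hx => ?_, fun α hα x hx => ?_⟩
  · have h1 : mkL 𝔧 P 𝔩 δ (ι ℂ x - algebraMap ℂ _ (δ ⟨x, hx⟩)) = 0 :=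
      mkL_eq_zero.2 (h (Submodule.subset_span (Or.inr ⟨x, hx, rfl⟩)))
    rw [← mkL_one, lie_mkL, mul_one, ← sub_eq_zero, ← h1, map_sub]
    congr 1
    rw [← algebraMap_smul (UniversalEnvelopingAlgebra ℂ 𝔩), ← map_smul, smul_eq_mul, mul_one]
  · rw [← mkL_one, lie_mkL, mul_one, mkL_eq_zero]
    exact h (Submodule.subset_span (Or.inl ⟨α, hα, x, hx, rfl⟩))

end SimpleHW

namespace IsStandard

variable [FiniteDimensional ℂ 𝔞] (hD : IsStandard 𝔧 P 𝔩 𝔲 H)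
include hD

theorem verma_ne_top (δ) : vermaIdeal 𝔧 P 𝔩 δ ≠ ⊤ := by
  obtain ⟨M, _, _, _, _, v, hv, hv0⟩ := hD.exists_isSingular δ
  exact vermaIdeal_ne_top hv hv0

theorem vermaIdeal_le_maxIdeal (δ) : vermaIdeal 𝔧 P 𝔩 δ ≤ maxIdeal 𝔧 P 𝔩 δ :=
  le_sSup ⟨le_rfl, hD.verma_ne_top δ⟩

/-- The Verma module has a largest proper submodule, because its highest weight space is a line
which no proper submodule can meet. -/
theorem maxIdeal_ne_top (δ) : maxIdeal 𝔧 P 𝔩 δ ≠ ⊤ := by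
  let U := UniversalEnvelopingAlgebra ℂ 𝔩
  let I := vermaIdeal 𝔧 P 𝔩 δ
  let M := U ⧸ I
  let : LieRingModule 𝔩 M := envLieRingModule M
  have : LieModule ℂ 𝔩 M := envLieModule M
  have hlie : ∀ (x : 𝔩) (u : U), ⁅x, I.mkQ u⁆ = I.mkQ (ι ℂ x * u) := fun x u => by
    rw [← smul_eq_mul, map_smul]; rfl
  have hsmul : ∀ (c : ℂ) (u : U), I.mkQ (c • u) = c • I.mkQ u := fun c u => rfl
  have h1 : I.mkQ 1 ≠ 0 := fun h => hD.verma_ne_top δ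
    (Ideal.eq_top_of_isUnit_mem I ((Submodule.Quotient.mk_eq_zero I).1 h) isUnit_one)
  have hsing : IsSingular P 𝔩 δ (I.mkQ 1) := by
    refine ⟨mem_lwt.2 fun x hx => ?_, fun α hα x hx => ?_⟩
    · rw [hlie, ← hsmul, ← sub_eq_zero, ← map_sub, mul_one, ← Algebra.algebraMap_eq_smul_one]
      exact (Submodule.Quotient.mk_eq_zero I).2 (Submodule.subset_span (Or.inr ⟨x, hx, rfl⟩))
    · rw [hlie, mul_one]
      exact (Submodule.Quotient.mk_eq_zero I).2 (Submodule.subset_span (Or.inl ⟨α, hα, x, hx, rfl⟩))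
  have hspan : LieSubmodule.lieSpan ℂ 𝔩 {I.mkQ (1 : U)} = ⊤ := by
    rw [eq_top_iff]
    intro v _
    obtain ⟨u, rfl⟩ := I.mkQ_surjective v
    have := env_smul_mem (N := (LieSubmodule.lieSpan ℂ 𝔩 {I.mkQ (1 : U)}).toSubmodule)
      (fun x v hv => LieSubmodule.lie_mem _ hv) u
      (LieSubmodule.subset_lieSpan (Set.mem_singleton (I.mkQ (1 : U))))
    rwa [← map_smul, smul_eq_mul, mul_one] at this
  have hΩ : δ ∉ {μ | δ - μ ∈ posSums P} := by simpa using hD.zero_notMem_posSums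
  -- proper submodules lie in the sum of the lower weight spaces, hence so does their sum
  have key : ∀ u ∈ maxIdeal 𝔧 P 𝔩 δ,
      I.mkQ u ∈ ⨆ μ ∈ {μ | δ - μ ∈ posSums P}, lwt 𝔧 𝔩 M μ := by
    intro u hu
    rw [maxIdeal, sSup_eq_iSup'] at hu
    refine Submodule.iSup_induction (motive := fun u => I.mkQ u ∈ ⨆ μ ∈ {μ | δ - μ ∈ posSums P},
      lwt 𝔧 𝔩 M μ) _ hu ?_ (by rw [map_zero]; exact Submodule.zero_mem _)
      (fun a b ha hb => by rw [map_add]; exact Submodule.add_mem _ ha hb)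
    rintro ⟨J, hIJ, hJ⟩ u hu
    have hu' : I.mkQ u ∈ Submodule.span ℂ {I.mkQ 1} ⊔
        ⨆ μ ∈ {μ | δ - μ ∈ posSums P}, lwt 𝔧 𝔩 M μ := by
      rw [hD.span_sup_eq_top hsing hspan]; trivial
    obtain ⟨a, ha, z, hz, haz⟩ := Submodule.mem_sup.1 hu'
    obtain ⟨c, rfl⟩ := Submodule.mem_span_singleton.1 ha
    let N : Submodule ℂ M := (J.map I.mkQ).restrictScalars ℂ
    have hcN : c • I.mkQ 1 ∈ N := by
      refine mem_of_add_mem (T := fun x : {x : 𝔩 // (x : 𝔞) ∈ 𝔧} => toEnd ℂ 𝔩 M x)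
        (lwt_injective hD.toral_le) (N := N) ?_ hΩ (Submodule.smul_mem _ c hsing.1) hz ?_
      · rintro x _ ⟨v, hv, rfl⟩
        exact ⟨ι ℂ x.1 * v, J.smul_mem _ hv, (hlie _ _).symm⟩
      · rw [haz]; exact ⟨u, hu, rfl⟩
    have hc : c = 0 := by
      by_contra hc
      have h1N : I.mkQ 1 ∈ N := by
        have := N.smul_mem c⁻¹ hcN
        rwa [smul_smul, inv_mul_cancel₀ hc, one_smul] at this
      obtain ⟨j, hj, hj1⟩ := h1N
      have h2 : j - 1 ∈ I := (Submodule.Quotient.eq I).1 hj1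
      refine hJ (Ideal.eq_top_of_isUnit_mem J ?_ isUnit_one)
      have := J.sub_mem hj (hIJ h2)
      rwa [sub_sub_cancel] at this
    rw [hc, zero_smul, zero_add] at haz
    rwa [← haz]
  intro htop
  exact h1 (eq_zero_of_mem_iSup_simEig (lwt_injective hD.toral_le) hΩ hsing.1
    (key 1 (htop ▸ trivial)))

theorem isSingular_gen (δ) : IsSingular P 𝔩 δ (SimpleHW.gen 𝔧 P 𝔩 δ) :=
  SimpleHW.isSingular_gen (hD.vermaIdeal_le_maxIdeal δ)

theorem gen_ne_zero (δ) : SimpleHW.gen 𝔧 P 𝔩 δ ≠ 0 := fun h =>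
  hD.maxIdeal_ne_top δ (Ideal.eq_top_of_isUnit_mem _
    (SimpleHW.mkL_eq_zero.1 (SimpleHW.mkL_one.trans h)) isUnit_one)

theorem simpleHW_isIrreducible (δ) : IsIrreducible ℂ 𝔩 (SimpleHW 𝔧 P 𝔩 δ) := by
  have : Nontrivial (SimpleHW 𝔧 P 𝔩 δ) := ⟨_, _, hD.gen_ne_zero δ⟩
  refine IsIrreducible.mk fun N hN => ?_
  by_contra htop
  let J : Submodule (UniversalEnvelopingAlgebra ℂ 𝔩) (UniversalEnvelopingAlgebra ℂ 𝔩) :=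
    { carrier := {u | SimpleHW.mkL 𝔧 P 𝔩 δ u ∈ N}
      add_mem' := fun ha hb => by
        simp only [Set.mem_ofPred_eq, map_add] at ha hb ⊢
        exact add_mem ha hb
      zero_mem' := by simp only [Set.mem_ofPred_eq, map_zero]; exact zero_mem _
      smul_mem' := fun r a ha => by
        simp only [Set.mem_ofPred_eq, map_smul] at ha ⊢
        exact env_smul_mem (N := N.toSubmodule) (fun x v hv => N.lie_mem hv) r ha }
  have hJ : J ≠ ⊤ := fun h => htop (by
    rw [← LieSubmodule.toSubmodule_eq_top]
    refine SimpleHW.mem_of_gen_mem (fun x v hv => N.lie_mem hv) ?_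
    have : (1 : UniversalEnvelopingAlgebra ℂ 𝔩) ∈ J := h ▸ trivial
    exact this)
  have hle : J ≤ maxIdeal 𝔧 P 𝔩 δ := le_sSup ⟨fun u hu => by
    change SimpleHW.mkL 𝔧 P 𝔩 δ u ∈ N
    rw [SimpleHW.mkL_eq_zero.2 (hD.vermaIdeal_le_maxIdeal δ hu)]
    exact zero_mem _, hJ⟩
  refine hN ((LieSubmodule.eq_bot_iff _).2 fun v hv => ?_)
  obtain ⟨u, rfl⟩ := SimpleHW.mkL_surjective v
  exact SimpleHW.mkL_eq_zero.2 (hle hv)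

/-- A simple module with a highest weight vector is determined by its highest weight. -/
theorem exists_equiv [IsIrreducible ℂ 𝔩 V] {v : V} (hv : IsSingular P 𝔩 δ v) (hv0 : v ≠ 0) :
    Nonempty (SimpleHW 𝔧 P 𝔩 δ ≃ₗ⁅ℂ, 𝔩⁆ V) := by
  let K : Submodule (UniversalEnvelopingAlgebra ℂ 𝔩) (UniversalEnvelopingAlgebra ℂ 𝔩) :=
    { carrier := {u | envAct 𝔩 V u v = 0}
      add_mem' := fun ha hb => by
        simp only [Set.mem_ofPred_eq, map_add, LinearMap.add_apply] at ha hb ⊢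
        rw [ha, hb, add_zero]
      zero_mem' := by simp only [Set.mem_ofPred_eq, map_zero, LinearMap.zero_apply]
      smul_mem' := fun r a ha => by
        simp only [Set.mem_ofPred_eq, smul_eq_mul, map_mul, Module.End.mul_apply] at ha ⊢
        rw [ha, map_zero] }
  have hK : K ≤ maxIdeal 𝔧 P 𝔩 δ := le_sSup ⟨fun u hu => hv.envAct_eq_zero hu, fun h => by
    have : (1 : UniversalEnvelopingAlgebra ℂ 𝔩) ∈ K := h ▸ trivial
    change envAct 𝔩 V 1 v = 0 at this
    rw [map_one] at this
    exact hv0 this⟩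
  have hmax : ∀ u ∈ maxIdeal 𝔧 P 𝔩 δ, envAct 𝔩 V u v = 0 := by
    by_contra! hcon
    obtain ⟨u₀, hu₀, hu₀v⟩ := hcon
    let N : LieSubmodule ℂ 𝔩 V :=
      { carrier := {w | ∃ u ∈ maxIdeal 𝔧 P 𝔩 δ, envAct 𝔩 V u v = w}
        add_mem' := by
          rintro _ _ ⟨a, ha, rfl⟩ ⟨b, hb, rfl⟩
          exact ⟨a + b, add_mem ha hb, by rw [map_add, LinearMap.add_apply]⟩
        zero_mem' := ⟨0, zero_mem _, by rw [map_zero, LinearMap.zero_apply]⟩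
        smul_mem' := by
          rintro c _ ⟨a, ha, rfl⟩
          exact ⟨c • a, Submodule.smul_of_tower_mem _ c ha, by rw [map_smul, LinearMap.smul_apply]⟩
        lie_mem := by
          rintro x _ ⟨a, ha, rfl⟩
          exact ⟨ι ℂ x * a, Submodule.smul_mem _ _ ha, by
            rw [map_mul, Module.End.mul_apply, envAct_ι]⟩ }
    have hN : N = ⊤ := (eq_bot_or_eq_top N).resolve_left fun h =>
      hu₀v ((LieSubmodule.eq_bot_iff _).1 h _ ⟨u₀, hu₀, rfl⟩)
    obtain ⟨u, hu, huv⟩ : v ∈ N := hN ▸ LieSubmodule.mem_top v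
    have h1 : 1 - u ∈ K := by
      change envAct 𝔩 V (1 - u) v = 0
      rw [map_sub, map_one, LinearMap.sub_apply, huv, Module.End.one_apply, sub_self]
    have h2 := add_mem (hK h1) hu
    rw [sub_add_cancel] at h2
    exact hD.maxIdeal_ne_top δ (Ideal.eq_top_of_isUnit_mem _ h2 isUnit_one)
  obtain ⟨f, hf⟩ := SimpleHW.exists_hom hmax
  have := hD.simpleHW_isIrreducible δ
  have hf0 : f ≠ 0 := fun h => hv0 (by rw [← hf, h]; rfl)
  exact ⟨equivOfBijective f ⟨injective_of_ne_zero hf0, surjective_of_ne_zero hf0⟩⟩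

theorem simpleHW_lwt (δ) : lwt 𝔧 𝔩 (SimpleHW 𝔧 P 𝔩 δ) δ = Submodule.span ℂ {SimpleHW.gen 𝔧 P 𝔩 δ} :=
  hD.lwt_eq_span (hD.isSingular_gen δ) SimpleHW.lieSpan_gen

/-- Evaluation at the highest weight vector. -/
theorem exists_eval_injective (δ) (V : Type*) [AddCommGroup V] [Module ℂ V] [LieRingModule 𝔩 V]
    [LieModule ℂ 𝔩 V] : ∃ e : (SimpleHW 𝔧 P 𝔩 δ →ₗ⁅ℂ, 𝔩⁆ V) →ₗ[ℂ] lwt 𝔧 𝔩 V δ,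
      Function.Injective e :=
  ⟨{ toFun := fun f => ⟨f (SimpleHW.gen 𝔧 P 𝔩 δ), ((hD.isSingular_gen δ).map f).1⟩
     map_add' := fun _ _ => rfl
     map_smul' := fun _ _ => rfl }, fun _ _ h => SimpleHW.hom_ext (congrArg Subtype.val h)⟩

theorem finrank_hom_self (δ) :
    Module.finrank ℂ (SimpleHW 𝔧 P 𝔩 δ →ₗ⁅ℂ, 𝔩⁆ SimpleHW 𝔧 P 𝔩 δ) = 1 := by
  obtain ⟨e, he⟩ := hD.exists_eval_injective δ (SimpleHW 𝔧 P 𝔩 δ)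
  have hfin : FiniteDimensional ℂ (lwt 𝔧 𝔩 (SimpleHW 𝔧 P 𝔩 δ) δ) := by
    rw [hD.simpleHW_lwt]; infer_instance
  have h1 := LinearMap.finrank_le_finrank_of_injective he
  rw [hD.simpleHW_lwt, finrank_span_singleton (hD.gen_ne_zero δ)] at h1
  have := Module.Finite.of_injective e he
  have : Nontrivial (SimpleHW 𝔧 P 𝔩 δ →ₗ⁅ℂ, 𝔩⁆ SimpleHW 𝔧 P 𝔩 δ) :=
    ⟨LieModuleHom.id, 0, fun h => hD.gen_ne_zero δ (congrArg (fun f => f (SimpleHW.gen 𝔧 P 𝔩 δ)) h)⟩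
  have h2 : 0 < Module.finrank ℂ (SimpleHW 𝔧 P 𝔩 δ →ₗ⁅ℂ, 𝔩⁆ SimpleHW 𝔧 P 𝔩 δ) :=
    Module.finrank_pos
  omega

theorem hom_eq_zero {δ δ' : Module.Dual ℂ 𝔧} (hne : δ ≠ δ')
    (f : SimpleHW 𝔧 P 𝔩 δ →ₗ⁅ℂ, 𝔩⁆ SimpleHW 𝔧 P 𝔩 δ') : f = 0 := by
  have := hD.simpleHW_isIrreducible δ
  have := hD.simpleHW_isIrreducible δ'
  by_contra hf
  let e := equivOfBijective f ⟨injective_of_ne_zero hf, surjective_of_ne_zero hf⟩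
  have key : ∀ {δ δ'} (e : SimpleHW 𝔧 P 𝔩 δ ≃ₗ⁅ℂ, 𝔩⁆ SimpleHW 𝔧 P 𝔩 δ'),
      δ = δ' ∨ δ' - δ ∈ posSums P := by
    intro δ δ' e
    refine hD.lwt_ne_bot_of_singular (hD.isSingular_gen δ') SimpleHW.lieSpan_gen
      ((Submodule.ne_bot_iff _).2 ⟨e (SimpleHW.gen 𝔧 P 𝔩 δ), ?_, ?_⟩)
    · exact ((hD.isSingular_gen δ).map e.toLieModuleHom).1
    · exact fun h => hD.gen_ne_zero δ (e.injective (h.trans (map_zero e.toLieModuleHom).symm))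
  have h1 := (key e).resolve_left hne
  have h2 := (key e.symm).resolve_left hne.symm
  have h3 := posSums_add h1 h2
  rw [sub_add_sub_cancel, sub_self] at h3
  exact hD.zero_notMem_posSums h3

end IsStandard

end SimpleModules

/-! ### Decomposition of finite dimensional modules over the Levi subalgebra -/

section Decomposition

open LieModule LieAlgebra

attribute [local instance] LieRing.ofAssociativeRing

universe u

theorem jhMult_eq_zero_of_subsingleton {𝔞 : Type*} [LieRing 𝔞] [LieAlgebra ℂ 𝔞]
    (X S : Type*) [AddCommGroup X] [Module ℂ X] [LieRingModule 𝔞 X] [LieModule ℂ 𝔞 X]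
    [AddCommGroup S] [Module ℂ S] [LieRingModule 𝔞 S] [LieModule ℂ 𝔞 S] [Nontrivial S]
    [Subsingleton X] : jhMult 𝔞 X S = 0 := by
  simp only [jhMult, ENat.iSup_eq_zero, Nat.cast_eq_zero]
  rintro n ⟨A, B, h, -⟩
  by_contra hn
  obtain ⟨-, f, hf, -⟩ := h ⟨0, Nat.pos_of_ne_zero hn⟩
  exact not_subsingleton S hf.subsingleton

variable {𝔞 : Type u} [LieRing 𝔞] [LieAlgebra ℂ 𝔞]
variable {𝔧 : LieSubalgebra ℂ 𝔞} {P : Set (Module.Dual ℂ 𝔧)} {𝔩 : LieSubalgebra ℂ 𝔞}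
  {𝔲 : Submodule ℂ 𝔞} {H : 𝔧} {δ : Module.Dual ℂ 𝔧}

/-- An equivariant map `F → F'` induces a map of generalized Verma modules. -/
theorem GenVerma.exists_map {F F' : Type*} [AddCommGroup F] [Module ℂ F] [LieRingModule 𝔩 F]
    [LieModule ℂ 𝔩 F] [AddCommGroup F'] [Module ℂ F'] [LieRingModule 𝔩 F'] [LieModule ℂ 𝔩 F']
    (f : F →ₗ⁅ℂ, 𝔩⁆ F') : ∃ M : GenVerma 𝔩 𝔲 F →ₗ⁅ℂ, 𝔞⁆ GenVerma 𝔩 𝔲 F',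
      ∀ v, M (GenVerma.of 𝔩 𝔲 F v) = GenVerma.of 𝔩 𝔲 F' (f v) :=
  GenVerma.exists_lift (GenVerma.of 𝔩 𝔲 F' ∘ₗ (f : F →ₗ[ℂ] F')) (fun y v =>
    (congrArg _ (f.map_lie y v)).trans (GenVerma.lie_of y (f v)).symm) (fun _ hz _ => GenVerma.lie_of_nil hz _)

section Split

variable {V S : Type*} [AddCommGroup V] [Module ℂ V] [LieRingModule 𝔩 V] [LieModule ℂ 𝔩 V]
  [AddCommGroup S] [Module ℂ S] [LieRingModule 𝔩 S] [LieModule ℂ 𝔩 S]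

/-- The projection to the kernel of a split surjection. -/
def splitKer (i : S →ₗ⁅ℂ, 𝔩⁆ V) (p : V →ₗ⁅ℂ, 𝔩⁆ S) (h : ∀ s, p (i s) = s) : V →ₗ⁅ℂ, 𝔩⁆ p.ker where
  toFun v := ⟨v - i (p v), by rw [LieModuleHom.mem_ker, map_sub, h, sub_self]⟩
  map_add' v w := Subtype.ext (by
    change v + w - i (p (v + w)) = (v - i (p v)) + (w - i (p w))
    rw [map_add, map_add]; abel)
  map_smul' c v := Subtype.ext (by
    change c • v - i (p (c • v)) = c • (v - i (p v))
    rw [map_smul, map_smul, smul_sub])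
  map_lie' {x v} := Subtype.ext (by
    change ⁅x, v⁆ - i (p ⁅x, v⁆) = ⁅x, v - i (p v)⁆
    rw [p.map_lie, i.map_lie, lie_sub])

theorem coe_splitKer (i : S →ₗ⁅ℂ, 𝔩⁆ V) (p : V →ₗ⁅ℂ, 𝔩⁆ S) (h : ∀ s, p (i s) = s) (v : V) :
    (splitKer i p h v : V) = v - i (p v) := rfl

theorem splitKer_ker (i : S →ₗ⁅ℂ, 𝔩⁆ V) (p : V →ₗ⁅ℂ, 𝔩⁆ S) (h : ∀ s, p (i s) = s) (v : p.ker) :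
    splitKer i p h v = v := Subtype.ext (by
  rw [coe_splitKer, LieModuleHom.mem_ker.1 v.2, map_zero, sub_zero])

theorem finrank_hom_of_split {X : Type*} [AddCommGroup X] [Module ℂ X] [LieRingModule 𝔩 X]
    [LieModule ℂ 𝔩 X] (i : S →ₗ⁅ℂ, 𝔩⁆ V) (p : V →ₗ⁅ℂ, 𝔩⁆ S) (h : ∀ s, p (i s) = s)
    [Module.Finite ℂ (X →ₗ⁅ℂ, 𝔩⁆ p.ker)] [Module.Finite ℂ (X →ₗ⁅ℂ, 𝔩⁆ S)] :
    Module.finrank ℂ (X →ₗ⁅ℂ, 𝔩⁆ V) =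
      Module.finrank ℂ (X →ₗ⁅ℂ, 𝔩⁆ p.ker) + Module.finrank ℂ (X →ₗ⁅ℂ, 𝔩⁆ S) := by
  rw [← Module.finrank_prod]
  refine LinearEquiv.finrank_eq
    { toFun := fun f => ((splitKer i p h).comp f, p.comp f)
      map_add' := fun f g => by
        refine Prod.ext ?_ ?_
        · ext x
          exact congrArg Subtype.val (map_add (splitKer i p h) (f x) (g x))
        · ext x
          exact map_add p (f x) (g x)
      map_smul' := fun c f => by
        refine Prod.ext ?_ ?_
        · ext x
          exact congrArg Subtype.val (map_smul (splitKer i p h) c (f x))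
        · ext x
          exact map_smul p c (f x)
      invFun := fun fg => p.ker.incl.comp fg.1 + i.comp fg.2
      left_inv := fun f => by
        ext x
        change (f x - i (p (f x))) + i (p (f x)) = f x
        abel
      right_inv := fun ⟨f, g⟩ => by
        have h1 : ∀ x, p (f x) = 0 := fun x => LieModuleHom.mem_ker.1 (f x).2
        refine Prod.ext ?_ ?_
        · ext x
          change (f x : V) + i (g x) - i (p (f x + i (g x))) = f x
          rw [map_add, h1, zero_add, h, add_sub_cancel_right]
        · ext x
          change p (f x + i (g x)) = g x
          rw [map_add, h1, zero_add, h] }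

theorem finrank_lwt_of_split [FiniteDimensional ℂ V] (i : S →ₗ⁅ℂ, 𝔩⁆ V) (p : V →ₗ⁅ℂ, 𝔩⁆ S)
    (h : ∀ s, p (i s) = s) (μ : Module.Dual ℂ 𝔧) :
    Module.finrank ℂ (lwt 𝔧 𝔩 V μ) =
      Module.finrank ℂ (lwt 𝔧 𝔩 p.ker μ) + Module.finrank ℂ (lwt 𝔧 𝔩 S μ) := by
  have hi : Function.Injective i := fun x y hxy => by rw [← h x, hxy, h]
  have : FiniteDimensional ℂ S := Module.Finite.of_injective (i : S →ₗ[ℂ] V) hi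
  rw [← Module.finrank_prod]
  refine LinearEquiv.finrank_eq
    { toFun := fun v => (⟨splitKer i p h v, map_mem_lwt _ v.2⟩, ⟨p v, map_mem_lwt p v.2⟩)
      map_add' := fun v w => Prod.ext (Subtype.ext (map_add (splitKer i p h) _ _))
        (Subtype.ext (map_add p _ _))
      map_smul' := fun c v => Prod.ext (Subtype.ext (map_smul (splitKer i p h) c _))
        (Subtype.ext (map_smul p c _))
      invFun := fun vw => ⟨((vw.1 : p.ker) : V) + i vw.2,
        Submodule.add_mem _ (map_mem_lwt p.ker.incl vw.1.2) (map_mem_lwt i vw.2.2)⟩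
      left_inv := fun v => Subtype.ext (by
        change ((v : V) - i (p v)) + i (p v) = v
        abel)
      right_inv := fun ⟨f, g⟩ => by
        have h1 : p ((f : p.ker) : V) = 0 := LieModuleHom.mem_ker.1 (f : p.ker).2
        refine Prod.ext (Subtype.ext (Subtype.ext ?_)) (Subtype.ext ?_)
        · change ((f : p.ker) : V) + i g - i (p ((f : p.ker) + i g)) = (f : p.ker)
          rw [map_add, h1, zero_add, h, add_sub_cancel_right]
        · change p ((f : p.ker) + i g) = g
          rw [map_add, h1, zero_add, h] }

/-- Induction is additive: a split exact sequence `ker p → V → S` induces a split exact sequence of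
generalized Verma modules. -/
theorem jhMult_genVerma_of_split (T : Type*) [AddCommGroup T] [Module ℂ T] [LieRingModule 𝔞 T]
    [LieModule ℂ 𝔞 T] [IsIrreducible ℂ 𝔞 T]
    (i : S →ₗ⁅ℂ, 𝔩⁆ V) (p : V →ₗ⁅ℂ, 𝔩⁆ S) (h : ∀ s, p (i s) = s) :
    jhMult 𝔞 (GenVerma 𝔩 𝔲 V) T =
      jhMult 𝔞 (GenVerma 𝔩 𝔲 p.ker) T + jhMult 𝔞 (GenVerma 𝔩 𝔲 S) T := by
  obtain ⟨I, hI⟩ := GenVerma.exists_map (𝔲 := 𝔲) i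
  obtain ⟨Q, hQ⟩ := GenVerma.exists_map (𝔲 := 𝔲) p
  obtain ⟨J, hJ⟩ := GenVerma.exists_map (𝔲 := 𝔲) p.ker.incl
  obtain ⟨R, hR⟩ := GenVerma.exists_map (𝔲 := 𝔲) (splitKer i p h)
  have hQI : ∀ x, Q (I x) = x := fun x =>
    GenVerma.hom_ext (f := Q.comp I) (g := LieModuleHom.id) (fun v => by
      rw [LieModuleHom.comp_apply, hI, hQ, h]; rfl) x
  have hRJ : ∀ x, R (J x) = x := fun x =>
    GenVerma.hom_ext (f := R.comp J) (g := LieModuleHom.id) (fun v => by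
      rw [LieModuleHom.comp_apply, hJ, hR, LieSubmodule.incl_apply, splitKer_ker]; rfl) x
  have hQJ : ∀ x, Q (J x) = 0 := fun x =>
    GenVerma.hom_ext (f := Q.comp J) (g := 0) (fun v => by
      rw [LieModuleHom.comp_apply, hJ, hQ, LieSubmodule.incl_apply, LieModuleHom.mem_ker.1 v.2,
        map_zero]; rfl) x
  have hsum : ∀ x, J (R x) + I (Q x) = x := fun x =>
    GenVerma.hom_ext (f := J.comp R + I.comp Q) (g := LieModuleHom.id) (fun v => by
      rw [LieModuleHom.add_apply, LieModuleHom.comp_apply, LieModuleHom.comp_apply, hR, hQ, hJ, hI,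
        ← map_add, LieSubmodule.incl_apply, coe_splitKer, sub_add_cancel]; rfl) x
  refine jhMult_add T J Q (fun x y hxy => ?_) (fun y => ⟨I y, hQI y⟩) fun x => ⟨fun hx => ?_, ?_⟩
  · rw [← hRJ x, hxy, hRJ]
  · refine ⟨R x, ?_⟩
    have := hsum x
    rwa [hx, map_zero, add_zero] at this
  · rintro ⟨y, rfl⟩
    exact hQJ y

end Split

namespace IsStandard

variable (hD : IsStandard 𝔧 P 𝔩 𝔲 H)
include hD

/-- The Levi subalgebra is reductive, with the same Cartan subalgebra. -/
theorem levi_split : IsSplitReductive (𝔧.comap 𝔩.incl) := by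
  let e : 𝔧 →ₗ[ℂ] 𝔧.comap 𝔩.incl :=
    { toFun := fun x => ⟨⟨x, hD.toral_le x.2⟩, x.2⟩
      map_add' := fun _ _ => rfl
      map_smul' := fun _ _ => rfl }
  let r : 𝔧.comap 𝔩.incl →ₗ[ℂ] 𝔧 :=
    { toFun := fun x => ⟨((x : 𝔩) : 𝔞), x.2⟩
      map_add' := fun _ _ => rfl
      map_smul' := fun _ _ => rfl }
  have h1 : ∀ (α : Module.Dual ℂ 𝔧) (x : 𝔩), (x : 𝔞) ∈ wt 𝔧 𝔞 α →
      x ∈ wt (𝔧.comap 𝔩.incl) 𝔩 (α ∘ₗ r) := fun α x hx =>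
    mem_wt.2 fun y => Subtype.ext (mem_wt.1 hx (r y))
  have h2 : ∀ (α : Module.Dual ℂ (𝔧.comap 𝔩.incl)) (x : 𝔩), x ∈ wt (𝔧.comap 𝔩.incl) 𝔩 α →
      (x : 𝔞) ∈ wt 𝔧 𝔞 (α ∘ₗ e) := fun α x hx =>
    mem_wt.2 fun y => congrArg Subtype.val (mem_wt.1 hx (e y))
  refine ⟨?_, ?_, ?_⟩
  · rw [eq_top_iff, ← hD.levi_eq_span, ← Submodule.span_union, Submodule.span_le]
    rintro x (⟨α, -, hx⟩ | hx | ⟨α, -, hx⟩)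
    · exact Submodule.mem_iSup_of_mem _ (h1 _ x hx)
    · refine Submodule.mem_iSup_of_mem _ (h1 0 x ?_)
      rw [hD.split.wt_zero]
      exact hx
    · exact Submodule.mem_iSup_of_mem _ (h1 _ x hx)
  · ext x
    constructor
    · intro hx
      have := h2 0 x hx
      rw [LinearMap.zero_comp, hD.split.wt_zero] at this
      exact this
    · intro hx
      have : (x : 𝔞) ∈ wt 𝔧 𝔞 0 := by rw [hD.split.wt_zero]; exact hx
      have := h1 0 x this
      rwa [LinearMap.zero_comp] at this
  · intro α hα x hx hx0
    have hα' : α ∘ₗ e ≠ 0 := fun h => hα (LinearMap.ext fun y => congrArg (fun φ => φ (r y)) h)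
    have hx' := h2 α x hx
    have hx0' : (x : 𝔞) ≠ 0 := fun h => hx0 (Subtype.ext h)
    obtain ⟨f, hf, h, hh, hαh⟩ := hD.split.opposite _ hα' x hx' hx0'
    have hαH : (α ∘ₗ e) H = 0 := by
      have h3 := mem_wt.1 hx' H
      rw [(hD.mem_levi x).1 x.2] at h3
      exact (smul_eq_zero.1 h3.symm).resolve_right hx0'
    have hf𝔩 : f ∈ 𝔩 := hD.wt_le_levi (α := -(α ∘ₗ e)) (by
      rw [LinearMap.neg_apply, hαH, neg_zero]) hf
    have heq : (-(α ∘ₗ e)) ∘ₗ r = -α := LinearMap.ext fun y => rfl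
    have hf' := h1 _ ⟨f, hf𝔩⟩ hf
    rw [heq] at hf'
    exact ⟨⟨f, hf𝔩⟩, hf', e h, Subtype.ext hh, hαh⟩

variable {V : Type*} [AddCommGroup V] [Module ℂ V] [LieRingModule 𝔩 V] [LieModule ℂ 𝔩 V]
  [FiniteDimensional ℂ V]

/-- A finite dimensional weight module over the Levi subalgebra is completely reducible. -/
theorem exists_projection (hV : ⨆ μ, lwt 𝔧 𝔩 V μ = ⊤) (W : LieSubmodule ℂ 𝔩 V) :
    ∃ (p : V →ₗ⁅ℂ, 𝔩⁆ W), ∀ w : W, p w = w := by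
  refine hD.levi_split.exists_projection ?_ W
  rw [eq_top_iff, ← hV]
  refine iSup_le fun μ v hv => ?_
  refine Submodule.mem_iSup_of_mem (μ ∘ₗ ({ toFun := fun x => ⟨((x : 𝔩) : 𝔞), x.2⟩
                                            map_add' := fun _ _ => rfl
                                            map_smul' := fun _ _ => rfl } :
    𝔧.comap 𝔩.incl →ₗ[ℂ] 𝔧)) (mem_wt.2 fun x => mem_lwt.1 hv x x.2)

variable [FiniteDimensional ℂ 𝔞]

theorem hom_finite (δ) : Module.Finite ℂ (SimpleHW 𝔧 P 𝔩 δ →ₗ⁅ℂ, 𝔩⁆ V) := by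
  obtain ⟨e, he⟩ := hD.exists_eval_injective δ V
  exact Module.Finite.of_injective e he

/-- A finite dimensional highest weight module is simple, by complete reducibility. -/
theorem isIrreducible_of_singular (hV : ⨆ μ, lwt 𝔧 𝔩 V μ = ⊤) {v : V}
    (hv : IsSingular P 𝔩 δ v) (hv0 : v ≠ 0) (hspan : LieSubmodule.lieSpan ℂ 𝔩 {v} = ⊤) :
    IsIrreducible ℂ 𝔩 V := by
  have : Nontrivial V := ⟨v, 0, hv0⟩
  refine IsIrreducible.mk fun N hN => ?_
  obtain ⟨p, hp⟩ := hD.exists_projection hV N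
  have h1 : N.incl (p v) ∈ lwt 𝔧 𝔩 V δ := map_mem_lwt (N.incl.comp p) hv.1
  rw [hD.lwt_eq_span hv hspan] at h1
  obtain ⟨c, hc⟩ := Submodule.mem_span_singleton.1 h1
  have hvN : c ≠ 0 → v ∈ N := fun hc0 => by
    have : c • v ∈ N := by rw [hc]; exact (p v).2
    have := N.smul_mem c⁻¹ this
    rwa [smul_smul, inv_mul_cancel₀ hc0, one_smul] at this
  by_cases hc0 : c = 0
  · exfalso
    rw [hc0, zero_smul] at hc
    have hker : p.ker = ⊤ := by
      rw [eq_top_iff, ← hspan, LieSubmodule.lieSpan_le, Set.singleton_subset_iff]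
      exact LieModuleHom.mem_ker.2 (Subtype.ext hc.symm)
    refine hN ((LieSubmodule.eq_bot_iff _).2 fun w hw => ?_)
    have h2 := LieModuleHom.mem_ker.1 (hker ▸ LieSubmodule.mem_top w : w ∈ p.ker)
    have h3 := hp ⟨w, hw⟩
    rw [h2] at h3
    exact (congrArg Subtype.val h3).symm
  · rw [eq_top_iff, ← hspan, LieSubmodule.lieSpan_le, Set.singleton_subset_iff]
    exact hvN hc0

/-- A maximal weight of a finite dimensional module splits off a simple highest weight module. -/
theorem exists_split (hV : ⨆ μ, lwt 𝔧 𝔩 V μ = ⊤) (h0 : lwt 𝔧 𝔩 V δ ≠ ⊥)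
    (hδ : ∀ s ∈ posSums P, lwt 𝔧 𝔩 V (δ + s) = ⊥) :
    δ ∈ dominant 𝔧 P 𝔩 ∧ ∃ (i : SimpleHW 𝔧 P 𝔩 δ →ₗ⁅ℂ, 𝔩⁆ V) (p : V →ₗ⁅ℂ, 𝔩⁆ SimpleHW 𝔧 P 𝔩 δ),
      ∀ s, p (i s) = s := by
  obtain ⟨v, hv, hv0⟩ := (Submodule.ne_bot_iff _).1 h0
  have hvs := hD.isSingular_of_maximal hv hδ
  refine ⟨hD.mem_dominant hvs hv0, ?_⟩
  let N := LieSubmodule.lieSpan ℂ 𝔩 {v}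
  have hvN : v ∈ N := LieSubmodule.subset_lieSpan (Set.mem_singleton v)
  have hvs' : IsSingular P 𝔩 δ (⟨v, hvN⟩ : N) :=
    ⟨mem_lwt.2 fun x hx => Subtype.ext (mem_lwt.1 hv x hx), fun α hα x hx =>
      Subtype.ext (hvs.2 α hα x hx)⟩
  have hv0' : (⟨v, hvN⟩ : N) ≠ 0 := fun h => hv0 (congrArg Subtype.val h)
  have hspan : LieSubmodule.lieSpan ℂ 𝔩 {(⟨v, hvN⟩ : N)} = ⊤ := by
    rw [eq_top_iff]
    rintro w -
    have h1 : N ≤ (LieSubmodule.lieSpan ℂ 𝔩 {(⟨v, hvN⟩ : N)}).map N.incl := by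
      rw [LieSubmodule.lieSpan_le, Set.singleton_subset_iff]
      exact LieSubmodule.mem_map_of_mem (f := N.incl)
        (LieSubmodule.subset_lieSpan (Set.mem_singleton (⟨v, hvN⟩ : N)))
    obtain ⟨w', hw', hww'⟩ := (LieSubmodule.mem_map _).1 (h1 w.2)
    rwa [← Subtype.ext hww']
  have hN := iSup_lwt_of_injective hD.toral_le N.incl Subtype.val_injective hV
  have := hD.isIrreducible_of_singular hN hvs' hv0' hspan
  obtain ⟨e⟩ := hD.exists_equiv hvs' hv0'
  obtain ⟨p, hp⟩ := hD.exists_projection hV N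
  refine ⟨N.incl.comp e.toLieModuleHom, e.symm.toLieModuleHom.comp p, fun s => ?_⟩
  change e.symm (p (e s : N)) = s
  rw [hp]
  exact e.symm_apply_apply s

/-- The multiplicities in `U(𝔞) ⊗_{U(𝔭)} V` for a finite dimensional `𝔩`-module `V`, by induction
on the dimension: a simple module of maximal weight splits off from `V`. -/
theorem hasSum_jhMult (T : Type*) [AddCommGroup T] [Module ℂ T] [LieRingModule 𝔞 T]
    [LieModule ℂ 𝔞 T] [IsIrreducible ℂ 𝔞 T] (hV : ⨆ μ, lwt 𝔧 𝔩 V μ = ⊤) :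
    HasSum (fun δ : dominant 𝔧 P 𝔩 =>
      (Module.finrank ℂ (SimpleHW 𝔧 P 𝔩 δ.1 →ₗ⁅ℂ, 𝔩⁆ V) : ℕ∞) *
        jhMult 𝔞 (GenVerma 𝔩 𝔲 (SimpleHW 𝔧 P 𝔩 δ.1)) T) (jhMult 𝔞 (GenVerma 𝔩 𝔲 V) T) := by
  induction hn : Module.finrank ℂ V using Nat.strong_induction_on generalizing V with
  | _ n ih =>
  subst hn
  have hT : Nontrivial T := nontrivial_of_isIrreducible ℂ 𝔞 T
  rcases subsingleton_or_nontrivial V with hsub | hnt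
  · have h1 : Subsingleton (GenVerma 𝔩 𝔲 V) := by
      have : (⊥ : LieSubmodule ℂ 𝔞 (GenVerma 𝔩 𝔲 V)) = ⊤ :=
        GenVerma.lieSubmodule_eq_top fun f => by
          rw [Subsingleton.elim f 0, map_zero]
          exact zero_mem _
      refine ⟨fun a b => ?_⟩
      have h : ∀ a : GenVerma 𝔩 𝔲 V, a = 0 := fun a =>
        (LieSubmodule.mem_bot a).1 (this ▸ LieSubmodule.mem_top a)
      rw [h a, h b]
    have h2 : ∀ δ : dominant 𝔧 P 𝔩, Module.finrank ℂ (SimpleHW 𝔧 P 𝔩 δ.1 →ₗ⁅ℂ, 𝔩⁆ V) = 0 := by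
      intro δ
      have : Subsingleton (SimpleHW 𝔧 P 𝔩 δ.1 →ₗ⁅ℂ, 𝔩⁆ V) :=
        ⟨fun f g => LieModuleHom.ext fun x => Subsingleton.elim _ _⟩
      exact Module.finrank_zero_of_subsingleton
    simp only [h2, Nat.cast_zero, zero_mul, jhMult_eq_zero_of_subsingleton]
    exact hasSum_zero
  · obtain ⟨δ₀, h0, hmax⟩ := hD.exists_maximal_weight hV
    obtain ⟨hdom, i, p, hip⟩ := hD.exists_split hV h0 hmax
    have hi : Function.Injective i := fun x y h => by rw [← hip x, h, hip]
    have hS : FiniteDimensional ℂ (SimpleHW 𝔧 P 𝔩 δ₀) :=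
      Module.Finite.of_injective (i : SimpleHW 𝔧 P 𝔩 δ₀ →ₗ[ℂ] V) hi
    have hlt : Module.finrank ℂ p.ker < Module.finrank ℂ V := by
      refine Submodule.finrank_lt (s := p.ker.toSubmodule) fun h => hD.gen_ne_zero δ₀ ?_
      rw [← hip (SimpleHW.gen 𝔧 P 𝔩 δ₀)]
      exact LieModuleHom.mem_ker.1
        (h ▸ Submodule.mem_top : i (SimpleHW.gen 𝔧 P 𝔩 δ₀) ∈ p.ker.toSubmodule)
    have h1 := ih _ hlt (V := p.ker)
      (iSup_lwt_of_injective hD.toral_le p.ker.incl Subtype.val_injective hV) rfl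
    have h2 : HasSum (fun δ : dominant 𝔧 P 𝔩 =>
        (Module.finrank ℂ (SimpleHW 𝔧 P 𝔩 δ.1 →ₗ⁅ℂ, 𝔩⁆ SimpleHW 𝔧 P 𝔩 δ₀) : ℕ∞) *
        jhMult 𝔞 (GenVerma 𝔩 𝔲 (SimpleHW 𝔧 P 𝔩 δ.1)) T)
        (jhMult 𝔞 (GenVerma 𝔩 𝔲 (SimpleHW 𝔧 P 𝔩 δ₀)) T) := by
      convert hasSum_single (⟨δ₀, hdom⟩ : dominant 𝔧 P 𝔩) ?_ using 1
      · rw [hD.finrank_hom_self, Nat.cast_one, one_mul]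
      · intro δ hδ
        have : Subsingleton (SimpleHW 𝔧 P 𝔩 δ.1 →ₗ⁅ℂ, 𝔩⁆ SimpleHW 𝔧 P 𝔩 δ₀) :=
          ⟨fun f g => by
            have hne : δ.1 ≠ δ₀ := fun h => hδ (Subtype.ext h)
            rw [hD.hom_eq_zero hne f, hD.hom_eq_zero hne g]⟩
        rw [Module.finrank_zero_of_subsingleton, Nat.cast_zero, zero_mul]
    rw [jhMult_genVerma_of_split T i p hip]
    convert h1.add h2 using 2 with δ
    have := hD.hom_finite (V := p.ker) δ.1
    have := hD.hom_finite (V := SimpleHW 𝔧 P 𝔩 δ₀) δ.1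
    rw [finrank_hom_of_split i p hip, Nat.cast_add, add_mul]

/-- Finite dimensional weight modules with the same weight multiplicities are isomorphic: a common
maximal weight splits the same simple module off from both. -/
theorem exists_equiv_of_finrank_eq {V' : Type*} [AddCommGroup V'] [Module ℂ V']
    [LieRingModule 𝔩 V'] [LieModule ℂ 𝔩 V'] [FiniteDimensional ℂ V']
    (hV : ⨆ μ, lwt 𝔧 𝔩 V μ = ⊤) (hV' : ⨆ μ, lwt 𝔧 𝔩 V' μ = ⊤)
    (h : ∀ μ, Module.finrank ℂ (lwt 𝔧 𝔩 V μ) = Module.finrank ℂ (lwt 𝔧 𝔩 V' μ)) :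
    Nonempty (V ≃ₗ⁅ℂ, 𝔩⁆ V') := by
  induction hn : Module.finrank ℂ V using Nat.strong_induction_on generalizing V V' with
  | _ n ih =>
  subst hn
  have hbot : ∀ μ, lwt 𝔧 𝔩 V μ = ⊥ ↔ lwt 𝔧 𝔩 V' μ = ⊥ := fun μ => by
    rw [← Submodule.finrank_eq_zero, h, Submodule.finrank_eq_zero]
  rcases subsingleton_or_nontrivial V with hsub | hnt
  · have h1 : ∀ μ, lwt 𝔧 𝔩 V' μ = ⊥ := fun μ => (hbot μ).1 (Subsingleton.elim _ _)
    simp only [h1, iSup_bot] at hV'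
    have : Subsingleton V' := (Submodule.subsingleton_iff ℂ).1 (subsingleton_of_bot_eq_top hV')
    exact ⟨equivOfBijective 0 ⟨fun _ _ _ => Subsingleton.elim _ _, fun y => ⟨0, Subsingleton.elim _ _⟩⟩⟩
  · obtain ⟨δ₀, h0, hmax⟩ := hD.exists_maximal_weight hV
    obtain ⟨hdom, i, p, hip⟩ := hD.exists_split hV h0 hmax
    obtain ⟨-, i', p', hip'⟩ := hD.exists_split hV' (fun h => h0 ((hbot _).2 h))
      (fun s hs => (hbot _).1 (hmax s hs))
    have hlt : Module.finrank ℂ p.ker < Module.finrank ℂ V := by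
      refine Submodule.finrank_lt (s := p.ker.toSubmodule) fun h => hD.gen_ne_zero δ₀ ?_
      rw [← hip (SimpleHW.gen 𝔧 P 𝔩 δ₀)]
      exact LieModuleHom.mem_ker.1
        (h ▸ Submodule.mem_top : i (SimpleHW.gen 𝔧 P 𝔩 δ₀) ∈ p.ker.toSubmodule)
    obtain ⟨e⟩ := ih _ hlt (V := p.ker) (V' := p'.ker)
      (iSup_lwt_of_injective hD.toral_le p.ker.incl Subtype.val_injective hV)
      (iSup_lwt_of_injective hD.toral_le p'.ker.incl Subtype.val_injective hV')
      (fun μ => Nat.add_right_cancel ((finrank_lwt_of_split i p hip μ).symm.trans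
        ((h μ).trans (finrank_lwt_of_split i' p' hip' μ)))) rfl
    let F : V →ₗ⁅ℂ, 𝔩⁆ V' := p'.ker.incl.comp (e.toLieModuleHom.comp (splitKer i p hip)) + i'.comp p
    have hF : ∀ v, F v = (e (splitKer i p hip v) : V') + i' (p v) := fun v => rfl
    have hp'e : ∀ c : p.ker, p' (e c : V') = 0 := fun c => LieModuleHom.mem_ker.1 (e c).2
    refine ⟨equivOfBijective F ⟨?_, fun v' => ?_⟩⟩
    · rw [← LieModuleHom.ker_eq_bot, LieSubmodule.eq_bot_iff]
      intro v hv
      rw [LieModuleHom.mem_ker, hF] at hv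
      have h1 : p v = 0 := by
        have := congrArg p' hv
        rwa [map_add, hp'e, zero_add, hip', map_zero] at this
      rw [h1, map_zero, add_zero] at hv
      have h2 : splitKer i p hip v = 0 := e.injective
        ((Subtype.ext hv).trans (map_zero e.toLieModuleHom).symm)
      have h3 := congrArg Subtype.val h2
      rwa [coe_splitKer, h1, map_zero, sub_zero] at h3
    · refine ⟨(e.symm (splitKer i' p' hip' v') : V) + i (p' v'), ?_⟩
      have h1 : p (e.symm (splitKer i' p' hip' v') : V) = 0 := LieModuleHom.mem_ker.1 (e.symm _).2
      have h2 : splitKer i p hip ((e.symm (splitKer i' p' hip' v') : V) + i (p' v')) =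
          e.symm (splitKer i' p' hip' v') := Subtype.ext (by
        rw [coe_splitKer, map_add, h1, zero_add, hip, add_sub_cancel_right])
      rw [hF, h2, map_add, h1, zero_add, hip]
      have h3 : e (e.symm (splitKer i' p' hip' v')) = splitKer i' p' hip' v' := e.apply_symm_apply _
      rw [h3, coe_splitKer, sub_add_cancel]

end IsStandard

end Decomposition

/-! ### Modules with finitely many weights above each height -/

section Heights

open LieModule LieAlgebra

attribute [local instance] LieRing.ofAssociativeRing

universe u

theorem lieSpan_coe_preimage {L X : Type*} [LieRing L] [LieAlgebra ℂ L] [AddCommGroup X]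
    [Module ℂ X] [LieRingModule L X] [LieModule ℂ L X] (S : Set X) :
    LieSubmodule.lieSpan ℂ L ((↑) ⁻¹' S : Set (LieSubmodule.lieSpan ℂ L S)) = ⊤ := by
  set N := LieSubmodule.lieSpan ℂ L S
  rw [eq_top_iff]
  rintro w -
  have h1 : N ≤ (LieSubmodule.lieSpan ℂ L ((↑) ⁻¹' S : Set N)).map N.incl := by
    rw [LieSubmodule.lieSpan_le]
    intro s hs
    exact LieSubmodule.mem_map_of_mem (f := N.incl) (LieSubmodule.subset_lieSpan
      (show (⟨s, LieSubmodule.subset_lieSpan hs⟩ : N) ∈ ((↑) ⁻¹' S : Set N) from hs))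
  obtain ⟨w', hw', hww'⟩ := (LieSubmodule.mem_map _).1 (h1 w.2)
  rwa [← Subtype.ext hww']

theorem finite_setOf_sum_le {m : ℕ} {e : Fin m → ℝ} (he : ∀ i, 0 < e i) (K : ℝ) :
    {a : Fin m → ℕ | ∑ i, a i * e i ≤ K}.Finite := by
  refine (Set.finite_Iic (fun i => ⌊K / e i⌋₊ : Fin m → ℕ)).subset fun a ha i => ?_
  refine Nat.le_floor ?_
  rw [le_div_iff₀ (he i)]
  refine le_trans ?_ ha
  exact Finset.single_le_sum (f := fun i => (a i : ℝ) * e i)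
    (fun j _ => mul_nonneg (Nat.cast_nonneg _) (he j).le) (Finset.mem_univ i)

variable {𝔞 : Type u} [LieRing 𝔞] [LieAlgebra ℂ 𝔞]
variable {𝔧 : LieSubalgebra ℂ 𝔞} {P : Set (Module.Dual ℂ 𝔧)} {𝔩 : LieSubalgebra ℂ 𝔞}
  {𝔲 : Submodule ℂ 𝔞} {H : 𝔧}
variable {X Y : Type*} [AddCommGroup X] [Module ℂ X] [LieRingModule 𝔞 X] [LieModule ℂ 𝔞 X]
  [AddCommGroup Y] [Module ℂ Y] [LieRingModule 𝔞 Y] [LieModule ℂ 𝔞 Y]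

variable (X) in
/-- The sum of the weight spaces whose weights have height in `T`, where the height of `μ` is the
real part of `μ(H)`. -/
def heightPart (H : 𝔧) (T : Set ℝ) : Submodule ℂ X :=
  ⨆ μ ∈ {μ : Module.Dual ℂ 𝔧 | (μ H).re ∈ T}, wt 𝔧 X μ

theorem wt_le_heightPart {T : Set ℝ} {μ : Module.Dual ℂ 𝔧} (hμ : (μ H).re ∈ T) {v : X}
    (hv : v ∈ wt 𝔧 X μ) : v ∈ heightPart X H T :=
  Submodule.mem_iSup_of_mem μ (Submodule.mem_iSup_of_mem hμ hv)

theorem heightPart_le {T : Set ℝ} {N : Submodule ℂ X}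
    (h : ∀ μ : Module.Dual ℂ 𝔧, (μ H).re ∈ T → wt 𝔧 X μ ≤ N) : heightPart X H T ≤ N :=
  iSup₂_le h

theorem heightPart_eq_span {I : Type*} {g : I → X} {w : I → Module.Dual ℂ 𝔧}
    (hg : ∀ i, g i ∈ wt 𝔧 X (w i)) (hspan : Submodule.span ℂ (Set.range g) = ⊤) (T : Set ℝ) :
    heightPart X H T = Submodule.span ℂ (g '' {i | (w i H).re ∈ T}) := by
  simp only [heightPart, wt_eq_simEig] at hg ⊢
  exact iSup_simEig_eq_span (dual_injective (𝔧 := 𝔧)) hg hspan _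

theorem lie_mem_heightPart {α : Module.Dual ℂ 𝔧} {x : 𝔞} (hx : x ∈ wt 𝔧 𝔞 α) {T T' : Set ℝ}
    (h : ∀ t ∈ T, (α H).re + t ∈ T') {v : X} (hv : v ∈ heightPart X H T) :
    ⁅x, v⁆ ∈ heightPart X H T' := by
  have : heightPart X H T ≤ (heightPart X H T').comap (toEnd ℂ 𝔞 X x) :=
    heightPart_le fun μ hμ v hv => wt_le_heightPart (by
      rw [LinearMap.add_apply, Complex.add_re]; exact h _ hμ) (lie_mem_wt hx hv)
  exact this hv

theorem iSup_wt_of_span {I : Type*} {g : I → X} {w : I → Module.Dual ℂ 𝔧}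
    (hg : ∀ i, g i ∈ wt 𝔧 X (w i)) (hspan : Submodule.span ℂ (Set.range g) = ⊤) :
    ⨆ μ, wt 𝔧 X μ = ⊤ := by
  simp only [wt_eq_simEig] at hg ⊢
  exact iSup_simEig_of_span hg hspan

theorem wt_eq_span {I : Type*} {g : I → X} {w : I → Module.Dual ℂ 𝔧}
    (hg : ∀ i, g i ∈ wt 𝔧 X (w i)) (hspan : Submodule.span ℂ (Set.range g) = ⊤)
    (μ : Module.Dual ℂ 𝔧) : wt 𝔧 X μ = Submodule.span ℂ (g '' {i | w i = μ}) := by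
  simp only [wt_eq_simEig] at hg ⊢
  exact simEig_eq_span (dual_injective (𝔧 := 𝔧)) hg hspan μ

variable (X) in
/-- A weight module is of bounded type if it has, with multiplicities, only finitely many weights
above each height. -/
structure IsBoundedType (H : 𝔧) : Prop where
  iSup_wt : ⨆ μ, wt 𝔧 X μ = ⊤
  finite : ∀ t : ℝ, FiniteDimensional ℂ (heightPart X H (Set.Ici t))

theorem IsBoundedType.of_span {I : Type*} {g : I → X} {w : I → Module.Dual ℂ 𝔧}
    (hg : ∀ i, g i ∈ wt 𝔧 X (w i)) (hspan : Submodule.span ℂ (Set.range g) = ⊤)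
    (hfin : ∀ t : ℝ, {i | t ≤ (w i H).re}.Finite) : IsBoundedType X H := by
  refine ⟨iSup_wt_of_span hg hspan, fun t => ?_⟩
  rw [heightPart_eq_span hg hspan]
  exact FiniteDimensional.span_of_finite ℂ ((hfin t).image g)

theorem IsBoundedType.of_injective (hY : IsBoundedType Y H) (f : X →ₗ⁅ℂ, 𝔞⁆ Y)
    (hf : Function.Injective f) : IsBoundedType X H := by
  refine ⟨iSup_wt_of_injective f hf hY.iSup_wt, fun t => ?_⟩
  have h1 : heightPart X H (Set.Ici t) ≤ (heightPart Y H (Set.Ici t)).comap (f : X →ₗ[ℂ] Y) :=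
    heightPart_le fun μ hμ v hv => wt_le_heightPart hμ (mem_wt.2 fun x => by
      change ⁅(x : 𝔞), f v⁆ = μ x • f v
      rw [← f.map_lie, mem_wt.1 hv, map_smul])
  have := hY.finite t
  exact Module.Finite.of_injective ((f : X →ₗ[ℂ] Y).restrict (p := heightPart X H (Set.Ici t))
    (q := heightPart Y H (Set.Ici t)) fun v hv => h1 hv) fun a b hab =>
    Subtype.ext (hf (congrArg Subtype.val hab))

theorem IsBoundedType.finite_wt (hX : IsBoundedType X H) (μ : Module.Dual ℂ 𝔧) :
    FiniteDimensional ℂ (wt 𝔧 X μ) := by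
  have := hX.finite (μ H).re
  exact Submodule.finiteDimensional_of_le (fun v hv => wt_le_heightPart (H := H) Set.self_mem_Ici hv)

/-- The weights of the components of a vector are bounded below in height. -/
theorem IsBoundedType.exists_mem_heightPart (hX : IsBoundedType X H) (v : X) :
    ∃ t : ℝ, v ∈ heightPart X H (Set.Ici t) := by
  have hmono : ∀ {s t : ℝ}, s ≤ t → heightPart X H (Set.Ici t) ≤ heightPart X H (Set.Ici s) :=
    fun hst => heightPart_le fun μ hμ v hv => wt_le_heightPart (le_trans hst hμ) hv
  refine wt_induction (𝔧 := 𝔧) hX.iSup_wt (p := fun v => ∃ t : ℝ, v ∈ heightPart X H (Set.Ici t))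
    ⟨0, zero_mem _⟩ ?_ (fun μ v hv => ⟨(μ H).re, wt_le_heightPart Set.self_mem_Ici hv⟩) v
  rintro x y ⟨s, hs⟩ ⟨t, ht⟩
  exact ⟨min s t, add_mem (hmono (min_le_left s t) hs) (hmono (min_le_right s t) ht)⟩

/-- A family of weight vectors of negative height that spans the opposite nilradical. -/
structure IsLowering {m : ℕ} (H : 𝔧) (y : Fin m → 𝔞) (η : Fin m → Module.Dual ℂ 𝔧) : Prop where
  mem : ∀ i, y i ∈ wt 𝔧 𝔞 (η i)
  neg : ∀ i, (η i H).re < 0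
  span : Submodule.span ℂ (Set.range y) = heightPart 𝔞 H (Set.Iio 0)

namespace IsStandard

variable (hD : IsStandard 𝔧 P 𝔩 𝔲 H)
include hD

/-- A finitely generated module of bounded type belongs to `𝒪^𝔭`: local finiteness holds because the
positive root vectors and `𝔩` do not lower the height. -/
theorem isInO (hX : IsBoundedType X H)
    (hfg : ∃ s : Finset X, LieSubmodule.lieSpan ℂ 𝔞 (s : Set X) = ⊤) : IsInO 𝔧 P 𝔩 X := by
  have key : ∀ A : Set (Module.Dual ℂ 𝔧), ∀ f : Module.Dual ℂ 𝔧 → Module.Dual ℂ 𝔧,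
      (∀ α ∈ A, 0 ≤ (f α H).re) → IsLocallyFinite (⨆ α ∈ A, wt 𝔧 𝔞 (f α)) X := by
    intro A f hA v
    obtain ⟨t, ht⟩ := hX.exists_mem_heightPart v
    refine ⟨_, ht, hX.finite t, fun x hx w hw => ?_⟩
    have h1 : ⨆ α ∈ A, wt 𝔧 𝔞 (f α) ≤ (heightPart X H (Set.Ici t)).comap
        ((toEnd ℂ 𝔞 X : 𝔞 →ₗ[ℂ] Module.End ℂ X).flip w) :=
      iSup₂_le fun α hα x hx => lie_mem_heightPart hx (fun s hs => by
        have := hA α hα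
        rw [Set.mem_Ici] at hs ⊢
        linarith) hw
    exact h1 hx
  refine ⟨hfg, hX.iSup_wt, key P id hD.pos_re, key _ _ fun α hα => ?_⟩
  rw [LinearMap.neg_apply, (hD.root_levi.1 hα.2).2, neg_zero, Complex.zero_re]

/-- The triangular decomposition `𝔞 = 𝔲₋ + 𝔩 + 𝔲₊`. -/
theorem height_decomposition {x : 𝔞} : ∃ a ∈ heightPart 𝔞 H (Set.Iio 0), ∃ b ∈ 𝔩, ∃ c ∈ 𝔲,
    a + (b + c) = x := by
  refine wt_induction (𝔧 := 𝔧) hD.split.iSup_wt (p := fun x => ∃ a ∈ heightPart 𝔞 H (Set.Iio 0),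
    ∃ b ∈ 𝔩, ∃ c ∈ 𝔲, a + (b + c) = x) ⟨0, zero_mem _, 0, zero_mem _, 0, zero_mem _, by simp⟩ ?_ ?_ x
  · rintro x y ⟨a, ha, b, hb, c, hc, rfl⟩ ⟨a', ha', b', hb', c', hc', rfl⟩
    exact ⟨a + a', add_mem ha ha', b + b', add_mem hb hb', c + c', add_mem hc hc', by abel⟩
  · intro α x hx
    rcases lt_trichotomy (α H).re 0 with h | h | h
    · exact ⟨x, wt_le_heightPart h hx, 0, zero_mem _, 0, zero_mem _, by simp⟩
    · refine ⟨0, zero_mem _, x, ?_, 0, zero_mem _, by simp⟩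
      by_cases hα : α ∈ roots 𝔧 ⊤
      · exact hD.wt_le_levi (Complex.ext h (hD.im_eq_zero α hα)) hx
      · by_cases hα0 : α = 0
        · exact hD.wt_le_levi (by rw [hα0]; rfl) hx
        · have : wt 𝔧 𝔞 α = ⊥ := by
            by_contra hne
            exact hα (mem_roots_top.2 ⟨hα0, hne⟩)
          rw [this, Submodule.mem_bot] at hx
          rw [hx]
          exact zero_mem _
    · refine ⟨0, zero_mem _, 0, zero_mem _, x, ?_, by simp⟩
      rw [hD.nil_eq]
      exact Submodule.mem_iSup_of_mem α (Submodule.mem_iSup_of_mem h hx)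

theorem sup_eq_top : heightPart 𝔞 H (Set.Iio 0) ⊔ (𝔩.toSubmodule ⊔ 𝔲) = ⊤ := by
  rw [eq_top_iff]
  rintro x -
  obtain ⟨a, ha, b, hb, c, hc, rfl⟩ := hD.height_decomposition (x := x)
  exact Submodule.add_mem_sup ha (Submodule.add_mem_sup hb hc)

theorem levi_le {N : Submodule ℂ 𝔞} (h : ∀ α : Module.Dual ℂ 𝔧, α H = 0 → wt 𝔧 𝔞 α ≤ N) :
    𝔩.toSubmodule ≤ N := by
  intro x hx
  have h1 : (⟨x, hx⟩ : 𝔩) ∈ N.comap 𝔩.toSubmodule.subtype := by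
    have : (⊤ : Submodule ℂ 𝔩) ≤ N.comap 𝔩.toSubmodule.subtype := by
      rw [← hD.levi_eq_span, ← Submodule.span_union, Submodule.span_le]
      rintro z (⟨α, hα, hz⟩ | hz | ⟨α, hα, hz⟩)
      · exact h (-α) (by rw [LinearMap.neg_apply, (hD.root_levi.1 hα.2).2, neg_zero]) hz
      · refine h 0 rfl ?_
        rw [hD.split.wt_zero]
        exact hz
      · exact h α (hD.root_levi.1 hα.2).2 hz
    exact this trivial
  exact h1

theorem lie_levi_mem_heightPart {x : 𝔞} (hx : x ∈ 𝔩) {T : Set ℝ} {v : X}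
    (hv : v ∈ heightPart X H T) : ⁅x, v⁆ ∈ heightPart X H T := by
  have h1 : 𝔩.toSubmodule ≤ (heightPart X H T).comap
        ((toEnd ℂ 𝔞 X : 𝔞 →ₗ[ℂ] Module.End ℂ X).flip v) :=
    hD.levi_le fun α hα x hx => lie_mem_heightPart hx (fun s hs => by
      rwa [hα, Complex.zero_re, zero_add]) hv
  exact h1 hx

theorem lie_nil_mem_heightPart {x : 𝔞} (hx : x ∈ 𝔲) {T T' : Set ℝ} (hT : ∀ t ∈ T, ∀ s, t < s → s ∈ T')
    {v : X} (hv : v ∈ heightPart X H T) : ⁅x, v⁆ ∈ heightPart X H T' := by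
  have h1 : 𝔲 ≤ (heightPart X H T').comap
        ((toEnd ℂ 𝔞 X : 𝔞 →ₗ[ℂ] Module.End ℂ X).flip v) := by
    rw [hD.nil_eq]
    exact iSup₂_le fun α (hα : 0 < (α H).re) x hx =>
      lie_mem_heightPart hx (fun s hs => hT s hs _ (by linarith)) hv
  exact h1 hx

end IsStandard

section Lowering

variable {m : ℕ} {y : Fin m → 𝔞} {η : Fin m → Module.Dual ℂ 𝔧}

/-- Operators that raise weights by `η i` move weight vectors by the corresponding sums. -/
theorem omon_apply_mem_wt {T : Fin m → Module.End ℂ X}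
    (hT : ∀ i (μ : Module.Dual ℂ 𝔧), ∀ v ∈ wt 𝔧 X μ, T i v ∈ wt 𝔧 X (η i + μ)) (a : Fin m → ℕ)
    {μ : Module.Dual ℂ 𝔧} {v : X} (hv : v ∈ wt 𝔧 X μ) :
    omon T a v ∈ wt 𝔧 X (∑ i, a i • η i + μ) := by
  have h1 : ∀ w : List (Fin m), (w.map T).prod v ∈ wt 𝔧 X ((w.map η).sum + μ) := by
    intro w
    induction w with
    | nil => simpa using hv
    | cons i w ih =>
      simp only [List.map_cons, List.prod_cons, List.sum_cons, Module.End.mul_apply]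
      rw [add_assoc]
      exact hT i _ _ ih
  have h2 : ((sortedWord a).map η).sum = ∑ i, a i • η i := by
    simp [sortedWord, List.map_flatten, List.sum_flatten, List.map_ofFn, Function.comp_def,
      List.sum_ofFn]
  rw [← prod_sortedWord, ← h2]
  exact h1 _

theorem omon_mem_wt (hy : ∀ i, y i ∈ wt 𝔧 𝔞 (η i)) (a : Fin m → ℕ) {μ : Module.Dual ℂ 𝔧} {v : X}
    (hv : v ∈ wt 𝔧 X μ) :
    omon (fun i => toEnd ℂ 𝔞 X (y i)) a v ∈ wt 𝔧 X (∑ i, a i • η i + μ) :=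
  omon_apply_mem_wt (fun i _ _ hv => lie_mem_wt (hy i) hv) a hv

theorem height_omon (a : Fin m → ℕ) (μ : Module.Dual ℂ 𝔧) :
    ((∑ i, a i • η i + μ) H).re = (μ H).re - ∑ i, a i * (-(η i H).re) := by
  simp [LinearMap.sum_apply, Complex.add_re, Finset.sum_neg_distrib]
  ring

theorem height_le (hη : ∀ i, (η i H).re < 0) (a : Fin m → ℕ) (μ : Module.Dual ℂ 𝔧) :
    ((∑ i, a i • η i + μ) H).re ≤ (μ H).re := by
  rw [height_omon, sub_le_self_iff]
  exact Finset.sum_nonneg fun i _ => mul_nonneg (Nat.cast_nonneg _) (neg_nonneg.2 (hη i).le)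

theorem finite_setOf_le_height (hη : ∀ i, (η i H).re < 0) {B : Type*} {ω : B → Module.Dual ℂ 𝔧}
    (hfin : ∀ t : ℝ, {β | t ≤ (ω β H).re}.Finite) (t : ℝ) :
    {p : (Fin m → ℕ) × B | t ≤ ((∑ i, p.1 i • η i + ω p.2) H).re}.Finite := by
  refine ((hfin t).biUnion (t := fun β => (fun a => (a, β)) ''
    {a : Fin m → ℕ | ∑ i, a i * (-(η i H).re) ≤ (ω β H).re - t}) fun β _ =>
      (finite_setOf_sum_le (fun i => neg_pos.2 (hη i)) _).image _).subset ?_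
  rintro ⟨a, β⟩ (h : t ≤ _)
  have h1 := h.trans (height_le hη a (ω β))
  rw [height_omon] at h
  exact Set.mem_biUnion (show β ∈ {β | t ≤ (ω β H).re} from h1) ⟨a, by
    change ∑ i, (a i : ℝ) * (-(η i H).re) ≤ (ω β H).re - t
    linarith, rfl⟩

theorem IsLowering.height_le (hy : IsLowering H y η) (a : Fin m → ℕ) (μ : Module.Dual ℂ 𝔧) :
    ((∑ i, a i • η i + μ) H).re ≤ (μ H).re :=
  BGG.height_le hy.neg a μ

theorem IsLowering.eq_zero_of_height_eq (hy : IsLowering H y η) (a : Fin m → ℕ)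
    (μ : Module.Dual ℂ 𝔧) (h : ((∑ i, a i • η i + μ) H).re = (μ H).re) : a = 0 := by
  rw [height_omon, sub_eq_self, Finset.sum_eq_zero_iff_of_nonneg fun i _ =>
    mul_nonneg (Nat.cast_nonneg _) (neg_nonneg.2 (hy.neg i).le)] at h
  ext i
  have h1 := (mul_eq_zero.1 (h i (Finset.mem_univ i))).resolve_right (neg_ne_zero.2 (hy.neg i).ne)
  exact_mod_cast h1

theorem IsLowering.finite (hy : IsLowering H y η) {B : Type*} {ω : B → Module.Dual ℂ 𝔧}
    (hfin : ∀ t : ℝ, {β | t ≤ (ω β H).re}.Finite) (t : ℝ) :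
    {p : (Fin m → ℕ) × B | t ≤ ((∑ i, p.1 i • η i + ω p.2) H).re}.Finite :=
  finite_setOf_le_height hy.neg hfin t

theorem IsLowering.lie_mem_span (hy : IsLowering H y η) (i j : Fin m) :
    ⁅y i, y j⁆ ∈ Submodule.span ℂ (Set.range y) := by
  rw [hy.span]
  refine wt_le_heightPart ?_ (lie_mem_wt (hy.mem i) (hy.mem j))
  rw [LinearMap.add_apply, Complex.add_re]
  exact add_neg (hy.neg i) (hy.neg j)

/-- A subspace spanned by all ordered monomials applied to some vectors is stable under the lowering
operators. -/
theorem IsLowering.lie_mem_span_omon (hy : IsLowering H y η) {J : Type*} (g : J → X) {x : 𝔞}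
    (hx : x ∈ heightPart 𝔞 H (Set.Iio 0)) {v : X}
    (hv : v ∈ Submodule.span ℂ (Set.range fun p : (Fin m → ℕ) × J =>
      omon (fun i => toEnd ℂ 𝔞 X (y i)) p.1 (g p.2))) :
    ⁅x, v⁆ ∈ Submodule.span ℂ (Set.range fun p : (Fin m → ℕ) × J =>
      omon (fun i => toEnd ℂ 𝔞 X (y i)) p.1 (g p.2)) := by
  set N := Submodule.span ℂ (Set.range fun p : (Fin m → ℕ) × J =>
      omon (fun i => toEnd ℂ 𝔞 X (y i)) p.1 (g p.2))
  have hcomm : ∀ i j, toEnd ℂ 𝔞 X (y i) * toEnd ℂ 𝔞 X (y j) - toEnd ℂ 𝔞 X (y j) * toEnd ℂ 𝔞 X (y i) ∈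
      Submodule.span ℂ (Set.range fun i => toEnd ℂ 𝔞 X (y i)) := by
    intro i j
    rw [← LieRing.of_associative_ring_bracket, ← LieHom.map_lie]
    have h1 := Submodule.mem_map_of_mem (f := (toEnd ℂ 𝔞 X : 𝔞 →ₗ[ℂ] Module.End ℂ X))
      (hy.lie_mem_span i j)
    rw [Submodule.map_span, ← Set.range_comp] at h1
    exact h1
  have h2 : ∀ t ∈ Submodule.span ℂ (Set.range (omon fun i => toEnd ℂ 𝔞 X (y i))), ∀ j, t (g j) ∈ N := by
    intro t ht j
    induction ht using Submodule.span_induction with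
    | mem t ht =>
      obtain ⟨a, rfl⟩ := ht
      exact Submodule.subset_span ⟨(a, j), rfl⟩
    | zero => exact N.zero_mem
    | add s t _ _ hs ht => exact N.add_mem hs ht
    | smul c t _ ht => exact N.smul_mem c ht
  have h3 : ∀ i, ∀ w ∈ N, ⁅y i, w⁆ ∈ N := by
    intro i w hw
    induction hw using Submodule.span_induction with
    | mem w hw =>
      obtain ⟨⟨a, j⟩, rfl⟩ := hw
      exact h2 _ (mul_mem_span_omon hcomm i (Submodule.subset_span ⟨a, rfl⟩)) j
    | zero => rw [lie_zero]; exact N.zero_mem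
    | add s t _ _ hs ht => rw [lie_add]; exact N.add_mem hs ht
    | smul c t _ ht => rw [lie_smul]; exact N.smul_mem c ht
  rw [← hy.span] at hx
  exact lie_mem_of_mem_span (by rintro _ ⟨i, rfl⟩ w hw; exact h3 i w hw) x hx v hv

/-- The submodule generated by a subspace that is stable under `𝔩 + 𝔲` is spanned by the ordered
monomials in the lowering operators applied to that subspace. -/
theorem IsLowering.lieSpan_le (hy : IsLowering H y η) (hD : IsStandard 𝔧 P 𝔩 𝔲 H) {J : Type*}
    {g : J → X} (h𝔩 : ∀ x ∈ 𝔩, ∀ v ∈ Submodule.span ℂ (Set.range g),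
      ⁅x, v⁆ ∈ Submodule.span ℂ (Set.range g))
    (h𝔲 : ∀ x ∈ 𝔲, ∀ v ∈ Submodule.span ℂ (Set.range g), ⁅x, v⁆ ∈ Submodule.span ℂ (Set.range g)) :
    (LieSubmodule.lieSpan ℂ 𝔞 (Submodule.span ℂ (Set.range g) : Set X)).toSubmodule ≤
      Submodule.span ℂ (Set.range fun p : (Fin m → ℕ) × J =>
        omon (fun i => toEnd ℂ 𝔞 X (y i)) p.1 (g p.2)) := by
  refine lieSpan_le_of_stable hD.sup_eq_top (fun x hx v hv => ?_) (Submodule.span_mono ?_)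
    fun x hx v hv => hy.lie_mem_span_omon g hx hv
  · obtain ⟨b, hb, c, hc, rfl⟩ := Submodule.mem_sup.1 hx
    rw [add_lie]
    exact add_mem (h𝔩 b hb v hv) (h𝔲 c hc v hv)
  · rintro _ ⟨j, rfl⟩
    refine ⟨(0, j), ?_⟩
    simp only [omon_zero, Module.End.one_apply]

/-- A generalized Verma module is spanned by the ordered monomials in the lowering operators applied
to a spanning family of `F`. -/
theorem IsLowering.span_genVerma (hy : IsLowering H y η) (hD : IsStandard 𝔧 P 𝔩 𝔲 H)
    {F : Type*} [AddCommGroup F] [Module ℂ F] [LieRingModule 𝔩 F] [LieModule ℂ 𝔩 F]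
    {J : Type*} {g : J → F} (hg : Submodule.span ℂ (Set.range g) = ⊤) :
    Submodule.span ℂ (Set.range fun p : (Fin m → ℕ) × J =>
      omon (fun i => toEnd ℂ 𝔞 (GenVerma 𝔩 𝔲 F) (y i)) p.1 (GenVerma.of 𝔩 𝔲 F (g p.2))) = ⊤ := by
  have hof : Submodule.span ℂ (Set.range fun j => GenVerma.of 𝔩 𝔲 F (g j)) =
      (GenVerma.of 𝔩 𝔲 F).range := by
    rw [← Submodule.map_top, ← hg, Submodule.map_span, ← Set.range_comp]
    rfl
  have h1 := hy.lieSpan_le hD (g := fun j => GenVerma.of 𝔩 𝔲 F (g j)) (by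
      rw [hof]
      rintro x hx _ ⟨f, rfl⟩
      exact ⟨⁅(⟨x, hx⟩ : 𝔩), f⁆, (GenVerma.lie_of (⟨x, hx⟩ : 𝔩) f).symm⟩) (by
      rw [hof]
      rintro x hx _ ⟨f, rfl⟩
      rw [GenVerma.lie_of_nil hx f]
      exact zero_mem _)
  rw [hof] at h1
  rw [eq_top_iff]
  refine le_trans (fun v _ => ?_) h1
  have h2 : LieSubmodule.lieSpan ℂ 𝔞 ((GenVerma.of 𝔩 𝔲 F).range : Set (GenVerma 𝔩 𝔲 F)) = ⊤ :=
    GenVerma.lieSubmodule_eq_top fun f => LieSubmodule.subset_lieSpan ⟨f, rfl⟩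
  rw [h2]
  trivial

end Lowering

end Heights

/-! ### The filtration of a module by heights -/

section Filtration

open LieModule LieAlgebra

attribute [local instance] LieRing.ofAssociativeRing

universe u

variable {𝔞 : Type u} [LieRing 𝔞] [LieAlgebra ℂ 𝔞]
variable {𝔧 : LieSubalgebra ℂ 𝔞} {P : Set (Module.Dual ℂ 𝔧)} {𝔩 : LieSubalgebra ℂ 𝔞}
  {𝔲 : Submodule ℂ 𝔞} {H : 𝔧}

theorem injective_of_linearIndependent {I X Y : Type*} [AddCommGroup X] [Module ℂ X]
    [AddCommGroup Y] [Module ℂ Y] {g : I → X} (f : X →ₗ[ℂ] Y)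
    (hspan : Submodule.span ℂ (Set.range g) = ⊤) (hind : LinearIndependent ℂ fun i => f (g i)) :
    Function.Injective f := by
  rw [← LinearMap.ker_eq_bot, LinearMap.ker_eq_bot']
  intro x hx
  have h1 : x ∈ Submodule.span ℂ (Set.range g) := hspan ▸ Submodule.mem_top
  rw [← Finsupp.range_linearCombination] at h1
  obtain ⟨c, rfl⟩ := h1
  rw [Finsupp.apply_linearCombination] at hx
  rw [(linearIndependent_iff.1 hind) c hx, map_zero]

variable (S : Type*) [AddCommGroup S] [Module ℂ S] [LieRingModule 𝔞 S] [LieModule ℂ 𝔞 S] in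
/-- Additivity of multiplicities when the quotient of `X` by `Y` is given as the common image of `X` and
`Z` in a module `Q`. -/
theorem jhMult_add_of_range_eq [IsIrreducible ℂ 𝔞 S] {X Y Z Q : Type*} [AddCommGroup X]
    [Module ℂ X] [LieRingModule 𝔞 X] [LieModule ℂ 𝔞 X] [AddCommGroup Y] [Module ℂ Y]
    [LieRingModule 𝔞 Y] [LieModule ℂ 𝔞 Y] [AddCommGroup Z] [Module ℂ Z] [LieRingModule 𝔞 Z]
    [LieModule ℂ 𝔞 Z] [AddCommGroup Q] [Module ℂ Q] [LieRingModule 𝔞 Q] [LieModule ℂ 𝔞 Q]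
    (i : Y →ₗ⁅ℂ, 𝔞⁆ X) (f : X →ₗ⁅ℂ, 𝔞⁆ Q) (g : Z →ₗ⁅ℂ, 𝔞⁆ Q) (hi : Function.Injective i)
    (hg : Function.Injective g) (hfg : ∀ q, (∃ x, f x = q) ↔ ∃ z, g z = q)
    (hif : ∀ x, f x = 0 ↔ ∃ y, i y = x) :
    jhMult 𝔞 X S = jhMult 𝔞 Y S + jhMult 𝔞 Z S := by
  have h : ∀ x, ∃ z, g z = f x := fun x => (hfg _).1 ⟨x, rfl⟩
  choose p hp using h
  let p' : X →ₗ⁅ℂ, 𝔞⁆ Z :=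
    { toFun := p
      map_add' := fun a b => hg (by rw [map_add, hp, hp, hp, map_add])
      map_smul' := fun c a => hg (by rw [map_smul, hp, hp, map_smul]; rfl)
      map_lie' := fun {x a} => hg (by
        rw [g.map_lie, hp, hp, f.map_lie]) }
  refine jhMult_add S i p' hi (fun z => ?_) fun x => ?_
  · obtain ⟨x, hx⟩ := (hfg (g z)).2 ⟨z, rfl⟩
    exact ⟨x, hg ((hp x).trans hx)⟩
  · rw [← hif, ← hp]
    exact ⟨fun h => (congrArg g h).trans (map_zero g), fun h => hg (h.trans (map_zero g).symm)⟩

section Level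

variable {V V' : Type*} [AddCommGroup V] [Module ℂ V] [LieRingModule 𝔩 V] [LieModule ℂ 𝔩 V]
  [AddCommGroup V'] [Module ℂ V'] [LieRingModule 𝔩 V'] [LieModule ℂ 𝔩 V']

theorem lwt_eq_span_of_span (h : 𝔧 ≤ 𝔩) {I : Type*} {g : I → V} {w : I → Module.Dual ℂ 𝔧}
    (hg : ∀ i, g i ∈ lwt 𝔧 𝔩 V (w i)) (hspan : Submodule.span ℂ (Set.range g) = ⊤)
    (μ : Module.Dual ℂ 𝔧) : lwt 𝔧 𝔩 V μ = Submodule.span ℂ (g '' {i | w i = μ}) :=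
  simEig_eq_span (lwt_injective h) hg hspan μ

theorem lwt_eq_bot_of_span (h : 𝔧 ≤ 𝔩) {I : Type*} {g : I → V} {w : I → Module.Dual ℂ 𝔧}
    (hg : ∀ i, g i ∈ lwt 𝔧 𝔩 V (w i)) (hspan : Submodule.span ℂ (Set.range g) = ⊤)
    {μ : Module.Dual ℂ 𝔧} (hμ : ∀ i, w i ≠ μ) : lwt 𝔧 𝔩 V μ = ⊥ := by
  rw [lwt_eq_span_of_span h hg hspan, Submodule.span_eq_bot]
  rintro _ ⟨i, hi, rfl⟩
  exact absurd hi (hμ i)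

/-- Finite dimensional modules with weight bases of the same weights are isomorphic. -/
theorem IsStandard.exists_equiv_of_basis (hD : IsStandard 𝔧 P 𝔩 𝔲 H) [FiniteDimensional ℂ 𝔞]
    {I : Type*} [Finite I] (b : Module.Basis I ℂ V) (b' : Module.Basis I ℂ V')
    {w : I → Module.Dual ℂ 𝔧} (hb : ∀ i, b i ∈ lwt 𝔧 𝔩 V (w i))
    (hb' : ∀ i, b' i ∈ lwt 𝔧 𝔩 V' (w i)) : Nonempty (V ≃ₗ⁅ℂ, 𝔩⁆ V') := by
  have := Module.Finite.of_basis b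
  have := Module.Finite.of_basis b'
  refine hD.exists_equiv_of_finrank_eq (iSup_simEig_of_span hb b.span_eq)
    (iSup_simEig_of_span hb' b'.span_eq) fun μ => ?_
  exact (finrank_simEig_of_basis (lwt_injective hD.toral_le) b hb μ).trans
    (finrank_simEig_of_basis (lwt_injective hD.toral_le) b' hb' μ).symm

variable (V) in
/-- The sum of the weight spaces of an `𝔩`-module whose weights have height `c`. It is a submodule,
since `H` is central in `𝔩`. -/
def level (hD : IsStandard 𝔧 P 𝔩 𝔲 H) (c : ℝ) : LieSubmodule ℂ 𝔩 V where
  __ := ⨆ μ ∈ {μ : Module.Dual ℂ 𝔧 | (μ H).re = c}, lwt 𝔧 𝔩 V μ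
  lie_mem {x v} hv := by
    let L : Submodule ℂ V := ⨆ μ ∈ {μ : Module.Dual ℂ 𝔧 | (μ H).re = c}, lwt 𝔧 𝔩 V μ
    have h1 : 𝔩.toSubmodule ≤ (L.comap ((toEnd ℂ 𝔩 V : 𝔩 →ₗ[ℂ] Module.End ℂ V).flip v)).map
        𝔩.toSubmodule.subtype := by
      refine hD.levi_le fun α hα x hx => ⟨⟨x, hD.wt_le_levi hα hx⟩, ?_, rfl⟩
      have h2 : L ≤ L.comap (toEnd ℂ 𝔩 V ⟨x, hD.wt_le_levi hα hx⟩) :=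
        iSup₂_le fun μ hμ v hv => Submodule.mem_iSup_of_mem (α + μ) (Submodule.mem_iSup_of_mem (by
          change ((α + μ) H).re = c
          rw [LinearMap.add_apply, hα, zero_add]; exact hμ)
            (lie_mem_lwt (x := ⟨x, hD.wt_le_levi hα hx⟩) hx hv))
      exact h2 hv
    obtain ⟨x', hx', hxx'⟩ := h1 x.2
    rw [← Subtype.ext hxx']
    exact hx'

variable {hD : IsStandard 𝔧 P 𝔩 𝔲 H}

theorem mem_level_of_mem_lwt {μ : Module.Dual ℂ 𝔧} {v : V} (hv : v ∈ lwt 𝔧 𝔩 V μ) :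
    v ∈ level V hD (μ H).re :=
  Submodule.mem_iSup_of_mem μ (Submodule.mem_iSup_of_mem rfl hv)

theorem level_toSubmodule (c : ℝ) : (level V hD c).toSubmodule =
    ⨆ μ ∈ {μ : Module.Dual ℂ 𝔧 | (μ H).re = c}, lwt 𝔧 𝔩 V μ := rfl

theorem level_eq_span {I : Type*} {g : I → V} {w : I → Module.Dual ℂ 𝔧}
    (hg : ∀ i, g i ∈ lwt 𝔧 𝔩 V (w i)) (hspan : Submodule.span ℂ (Set.range g) = ⊤) (c : ℝ) :
    (level V hD c).toSubmodule = Submodule.span ℂ (g '' {i | (w i H).re = c}) :=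
  iSup_simEig_eq_span (lwt_injective hD.toral_le) hg hspan _

theorem mem_lwt_level {c : ℝ} {μ : Module.Dual ℂ 𝔧} {v : level V hD c} :
    v ∈ lwt 𝔧 𝔩 (level V hD c) μ ↔ (v : V) ∈ lwt 𝔧 𝔩 V μ := by
  rw [mem_lwt, mem_lwt]
  exact forall₂_congr fun x hx => Subtype.ext_iff

variable (hD) in
/-- Weight vectors that form a basis of the level `c`. -/
theorem exists_basis_level {c : ℝ} {J : Type*} {g : J → V} (hind : LinearIndependent ℂ g)
    (hspan : (level V hD c).toSubmodule = Submodule.span ℂ (Set.range g)) :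
    ∃ b : Module.Basis J ℂ (level V hD c), ∀ j, (b j : V) = g j := by
  let e : Submodule.span ℂ (Set.range g) ≃ₗ[ℂ] level V hD c :=
    LinearEquiv.ofEq _ (level V hD c).toSubmodule hspan.symm
  refine ⟨(Module.Basis.span hind).map e, fun j => ?_⟩
  rw [Module.Basis.map_apply]
  exact congrArg Subtype.val (Module.Basis.span_apply hind j)

/-- A simple highest weight module of highest weight `δ` maps only to the level that contains the weight
`δ`. -/
theorem finrank_hom_level [FiniteDimensional ℂ 𝔞] (c : ℝ) (δ : Module.Dual ℂ 𝔧) :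
    Module.finrank ℂ (SimpleHW 𝔧 P 𝔩 δ →ₗ⁅ℂ, 𝔩⁆ level V hD c) =
      if (δ H).re = c then Module.finrank ℂ (SimpleHW 𝔧 P 𝔩 δ →ₗ⁅ℂ, 𝔩⁆ V) else 0 := by
  split_ifs with h
  · let F : (SimpleHW 𝔧 P 𝔩 δ →ₗ⁅ℂ, 𝔩⁆ level V hD c) →ₗ[ℂ] (SimpleHW 𝔧 P 𝔩 δ →ₗ⁅ℂ, 𝔩⁆ V) :=
      { toFun := fun f => (level V hD c).incl.comp f
        map_add' := fun _ _ => rfl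
        map_smul' := fun _ _ => rfl }
    refine (LinearEquiv.ofBijective F ⟨fun f g hfg => ?_, fun f => ?_⟩).finrank_eq
    · exact LieModuleHom.ext fun x => Subtype.ext (congrArg (fun k => k x) hfg)
    · have h1 : ∀ x, f x ∈ level V hD c := by
        intro x
        have : x ∈ ((level V hD c).comap f).toSubmodule := by
          rw [SimpleHW.mem_of_gen_mem (N := ((level V hD c).comap f).toSubmodule)
            (fun x v hv => LieSubmodule.lie_mem _ hv)]
          · trivial
          · have := mem_level_of_mem_lwt (hD := hD) ((hD.isSingular_gen δ).map f).1
            rw [h] at this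
            exact this
        exact this
      exact ⟨f.codRestrict _ h1, LieModuleHom.ext fun x => rfl⟩
  · have : Subsingleton (SimpleHW 𝔧 P 𝔩 δ →ₗ⁅ℂ, 𝔩⁆ level V hD c) := by
      have h0 : ∀ f : SimpleHW 𝔧 P 𝔩 δ →ₗ⁅ℂ, 𝔩⁆ level V hD c, f = 0 := by
        intro f
        refine SimpleHW.hom_ext (Subtype.ext ?_)
        have h1 := mem_lwt_level.1 ((hD.isSingular_gen δ).map f).1
        exact eq_zero_of_mem_iSup_simEig (lwt_injective hD.toral_le) (k := δ)
          (Ω := {μ : Module.Dual ℂ 𝔧 | (μ H).re = c}) h h1 (f (SimpleHW.gen 𝔧 P 𝔩 δ)).2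
      exact ⟨fun f g => (h0 f).trans (h0 g).symm⟩
    exact Module.finrank_zero_of_subsingleton

theorem lwt_eq_wt (h : 𝔧 ≤ 𝔩) {X : Type*} [AddCommGroup X] [Module ℂ X] [LieRingModule 𝔞 X]
    [LieModule ℂ 𝔞 X] (μ : Module.Dual ℂ 𝔧) : lwt 𝔧 𝔩 X μ = wt 𝔧 X μ := by
  ext v
  rw [mem_lwt, mem_wt]
  exact ⟨fun hv x => hv ⟨x, h x.2⟩ x.2, fun hv x hx => hv ⟨x, hx⟩⟩

end Level

end Filtration

/-! ### The subquotients of the height filtration -/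

section Subquotients

open LieModule LieAlgebra

attribute [local instance] LieRing.ofAssociativeRing

universe u

variable {𝔞 : Type u} [LieRing 𝔞] [LieAlgebra ℂ 𝔞]
variable {𝔧 : LieSubalgebra ℂ 𝔞} {P : Set (Module.Dual ℂ 𝔧)} {𝔩 : LieSubalgebra ℂ 𝔞}
  {𝔲 : Submodule ℂ 𝔞} {H : 𝔧}
variable {X : Type*} [AddCommGroup X] [Module ℂ X] [LieRingModule 𝔞 X] [LieModule ℂ 𝔞 X]

/-- Additivity of multiplicities for a subquotient `N₂ / N₁`, identified inside a quotient `Q` of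
the ambient module. -/
theorem jhMult_add_of_map_eq (S : Type*) [AddCommGroup S] [Module ℂ S] [LieRingModule 𝔞 S]
    [LieModule ℂ 𝔞 S] [IsIrreducible ℂ 𝔞 S] {Q Z : Type*} [AddCommGroup Q] [Module ℂ Q]
    [LieRingModule 𝔞 Q] [LieModule ℂ 𝔞 Q] [AddCommGroup Z] [Module ℂ Z] [LieRingModule 𝔞 Z]
    [LieModule ℂ 𝔞 Z] {N₁ N₂ : LieSubmodule ℂ 𝔞 X} (hle : N₁ ≤ N₂) (q : X →ₗ⁅ℂ, 𝔞⁆ Q)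
    (g : Z →ₗ⁅ℂ, 𝔞⁆ Q) (hker : ∀ x, q x = 0 ↔ x ∈ N₁) (hg : Function.Injective g)
    (hrange : (g : Z →ₗ[ℂ] Q).range = N₂.toSubmodule.map (q : X →ₗ[ℂ] Q)) :
    jhMult 𝔞 N₂ S = jhMult 𝔞 N₁ S + jhMult 𝔞 Z S := by
  refine jhMult_add_of_range_eq S (LieSubmodule.inclusion hle) (q.comp N₂.incl) g
    (LieSubmodule.inclusion_injective hle) hg (fun z => ?_) fun x => ?_
  · have h1 : z ∈ (g : Z →ₗ[ℂ] Q).range ↔ z ∈ N₂.toSubmodule.map (q : X →ₗ[ℂ] Q) := by rw [hrange]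
    rw [LinearMap.mem_range, Submodule.mem_map] at h1
    refine Iff.trans ?_ h1.symm
    exact ⟨fun ⟨x, hx⟩ => ⟨x.1, x.2, hx⟩, fun ⟨x, hx, hxz⟩ => ⟨⟨x, hx⟩, hxz⟩⟩
  · refine (hker x.1).trans ⟨fun h => ⟨⟨x.1, h⟩, rfl⟩, ?_⟩
    rintro ⟨y', rfl⟩
    exact y'.2

/-- The ordered monomials in the family `y` applied to the vectors `n β`. -/
def monomials {m : ℕ} {B : Type*} (y : Fin m → 𝔞) (n : B → X) (p : (Fin m → ℕ) × B) : X :=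
  omon (fun i => toEnd ℂ 𝔞 X (y i)) p.1 (n p.2)

/-- `X` is free over the enveloping algebra of the span of the lowering family `y`, on weight
vectors `n β` of weight `ω β` of which only finitely many lie above each height. -/
structure IsLoweringFree {m : ℕ} {B : Type*} (H : 𝔧) (y : Fin m → 𝔞) (η : Fin m → Module.Dual ℂ 𝔧)
    (n : B → X) (ω : B → Module.Dual ℂ 𝔧) : Prop where
  lowering : IsLowering H y η
  mem : ∀ β, n β ∈ wt 𝔧 X (ω β)
  ind : LinearIndependent ℂ (monomials y n)
  span : Submodule.span ℂ (Set.range (monomials y n)) = ⊤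
  finite : ∀ t : ℝ, {β | t ≤ (ω β H).re}.Finite

variable (X) in
/-- The submodule generated by the weight spaces of height in `T`. -/
def heightSpan (H : 𝔧) (T : Set ℝ) : LieSubmodule ℂ 𝔞 X :=
  LieSubmodule.lieSpan ℂ 𝔞 (heightPart X H T : Set X)

variable {m : ℕ} {B : Type*} {y : Fin m → 𝔞} {η : Fin m → Module.Dual ℂ 𝔧}
  {n : B → X} {ω : B → Module.Dual ℂ 𝔧}

theorem monomials_zero (β : B) : monomials y n (0, β) = n β := by
  simp only [monomials, omon_zero, Module.End.one_apply]

theorem map_monomials {Y : Type*} [AddCommGroup Y] [Module ℂ Y] [LieRingModule 𝔞 Y]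
    [LieModule ℂ 𝔞 Y] (f : X →ₗ⁅ℂ, 𝔞⁆ Y) (p : (Fin m → ℕ) × B) :
    f (monomials y n p) = monomials y (fun β => f (n β)) p := by
  have h : ∀ w : List (Fin m), ∀ v, f ((w.map fun i => toEnd ℂ 𝔞 X (y i)).prod v) =
      (w.map fun i => toEnd ℂ 𝔞 Y (y i)).prod (f v) := by
    intro w v
    induction w with
    | nil => rfl
    | cons i w ih =>
      simp only [List.map_cons, List.prod_cons, Module.End.mul_apply, toEnd_apply_apply] at ih ⊢
      rw [f.map_lie, ih]
  simp only [monomials]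
  rw [← prod_sortedWord, ← prod_sortedWord]
  exact h _ _

theorem IsLowering.lie_mem_span_monomials (hy : IsLowering H y η) (n : B → X) {x : 𝔞}
    (hx : x ∈ heightPart 𝔞 H (Set.Iio 0)) {v : X}
    (hv : v ∈ Submodule.span ℂ (Set.range (monomials y n))) :
    ⁅x, v⁆ ∈ Submodule.span ℂ (Set.range (monomials y n)) :=
  hy.lie_mem_span_omon n hx hv

namespace IsLoweringFree

variable (hX : IsLoweringFree H y η n ω)
include hX

theorem monomials_mem (p : (Fin m → ℕ) × B) :
    monomials y n p ∈ wt 𝔧 X (∑ i, p.1 i • η i + ω p.2) :=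
  omon_mem_wt hX.lowering.mem p.1 (hX.mem p.2)

theorem isBoundedType : IsBoundedType X H :=
  IsBoundedType.of_span hX.monomials_mem hX.span (hX.lowering.finite hX.finite)

variable (hD : IsStandard 𝔧 P 𝔩 𝔲 H)
include hD

/-- In a free module, the submodule generated by the weight spaces of height in an upper set `T` is
freely generated by the generators of height in `T`. -/
theorem heightSpan_toSubmodule {T : Set ℝ} (hT : IsUpperSet T) :
    (heightSpan X H T).toSubmodule =
      Submodule.span ℂ (monomials y n '' {p | (ω p.2 H).re ∈ T}) := by
  have hZ : Submodule.span ℂ (monomials y n '' {p | (ω p.2 H).re ∈ T}) =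
      Submodule.span ℂ (Set.range (monomials y fun j : {β // (ω β H).re ∈ T} => n j.1)) := by
    congr 1
    ext x
    constructor
    · rintro ⟨⟨a, β⟩, hβ, rfl⟩
      exact ⟨(a, ⟨β, hβ⟩), rfl⟩
    · rintro ⟨⟨a, β⟩, rfl⟩
      exact ⟨(a, β.1), β.2, rfl⟩
  refine le_antisymm ?_ ?_
  · refine lieSpan_le_of_stable hD.sup_eq_top (fun x hx v hv => ?_) ?_ fun x hx v hv => ?_
    · obtain ⟨b, hb, c, hc, rfl⟩ := Submodule.mem_sup.1 hx
      rw [add_lie]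
      exact add_mem (hD.lie_levi_mem_heightPart hb hv)
        (hD.lie_nil_mem_heightPart hc (fun t ht s hs => hT hs.le ht) hv)
    · rw [heightPart_eq_span hX.monomials_mem hX.span]
      exact Submodule.span_mono (Set.image_mono fun p hp => hT (hX.lowering.height_le p.1 _) hp)
    · rw [hZ] at hv ⊢
      exact hX.lowering.lie_mem_span_monomials _ hx hv
  · rw [Submodule.span_le]
    rintro _ ⟨⟨a, β⟩, hβ, rfl⟩
    have h1 : n β ∈ heightSpan X H T := LieSubmodule.subset_lieSpan (wt_le_heightPart hβ (hX.mem β))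
    have h2 : ∀ w : List (Fin m), (w.map fun i => toEnd ℂ 𝔞 X (y i)).prod (n β) ∈
        heightSpan X H T := by
      intro w
      induction w with
      | nil => exact h1
      | cons i w ih =>
        simp only [List.map_cons, List.prod_cons, Module.End.mul_apply]
        exact LieSubmodule.lie_mem _ ih
    change (omon (fun i => toEnd ℂ 𝔞 X (y i)) a) (n β) ∈ heightSpan X H T
    rw [← prod_sortedWord]
    exact h2 _

section Quotient

variable {c : ℝ} {Q : Type*} [AddCommGroup Q] [Module ℂ Q] [LieRingModule 𝔞 Q] [LieModule ℂ 𝔞 Q]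
  {q : X →ₗ⁅ℂ, 𝔞⁆ Q} (hq : Function.Surjective q)
  (hker : ∀ x, q x = 0 ↔ x ∈ heightSpan X H (Set.Ioi c))

include hker in
theorem quotient_monomials_eq_zero {p : (Fin m → ℕ) × B} (hp : c < (ω p.2 H).re) :
    q (monomials y n p) = 0 := by
  rw [hker, ← LieSubmodule.mem_toSubmodule, hX.heightSpan_toSubmodule hD (isUpperSet_Ioi c)]
  exact Submodule.subset_span ⟨p, hp, rfl⟩

omit hD in
include hq in
theorem quotient_span : Submodule.span ℂ (Set.range fun p => q (monomials y n p)) = ⊤ := by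
  have h1 : (⊤ : Submodule ℂ X).map (q : X →ₗ[ℂ] Q) = ⊤ := by
    rw [Submodule.map_top, LinearMap.range_eq_top]
    exact hq
  rw [← h1, ← hX.span, Submodule.map_span, ← Set.range_comp]
  rfl

omit hD in
theorem quotient_mem (q : X →ₗ⁅ℂ, 𝔞⁆ Q) (p : (Fin m → ℕ) × B) :
    q (monomials y n p) ∈ wt 𝔧 Q (∑ i, p.1 i • η i + ω p.2) := by
  rw [mem_wt]
  intro x
  rw [← q.map_lie, mem_wt.1 (hX.monomials_mem p), map_smul]

include hker in
/-- Modulo the generators of height above `c`, the monomials in the generators of height `c` remain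
linearly independent. -/
theorem quotient_linearIndependent : LinearIndependent ℂ
    fun p : (Fin m → ℕ) × {β // (ω β H).re = c} => q (monomials y n (p.1, p.2.1)) := by
  have hinj : Function.Injective fun p : (Fin m → ℕ) × {β // (ω β H).re = c} => (p.1, p.2.1) :=
    fun a b h => Prod.ext (Prod.mk.inj h).1 (Subtype.ext (Prod.mk.inj h).2)
  refine (hX.ind.comp _ hinj).map (f := (q : X →ₗ[ℂ] Q)) ?_
  have h1 : (q : X →ₗ[ℂ] Q).ker =
      Submodule.span ℂ (monomials y n '' {p | (ω p.2 H).re ∈ Set.Ioi c}) := by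
    rw [← hX.heightSpan_toSubmodule hD (isUpperSet_Ioi c)]
    ext x
    exact hker x
  rw [h1, Set.range_comp]
  refine hX.ind.disjoint_span_image (Set.disjoint_left.2 ?_)
  rintro _ ⟨p, rfl⟩ (hp : c < (ω p.2.1 H).re)
  exact hp.ne' p.2.2

include hq hker in
/-- A weight of height `c` in the quotient can only come from a generator of height `c`. -/
theorem quotient_level : (level Q hD c).toSubmodule =
    Submodule.span ℂ (Set.range fun j : {β // (ω β H).re = c} => q (n j.1)) := by
  have hlow := hX.lowering
  rw [level_eq_span (fun p => (lwt_eq_wt (X := Q) hD.toral_le _).symm ▸ hX.quotient_mem q p)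
    (hX.quotient_span hq)]
  refine le_antisymm ?_ ?_
  · rw [Submodule.span_le]
    rintro _ ⟨⟨a, β⟩, hp, rfl⟩
    change ((∑ i, a i • η i + ω β) H).re = c at hp
    change q (monomials y n (a, β)) ∈ _
    rcases lt_or_ge c (ω β H).re with h | h
    · rw [hX.quotient_monomials_eq_zero hD hker h]
      exact zero_mem _
    · have h2 : (ω β H).re = c := le_antisymm h (hp ▸ hlow.height_le a (ω β))
      have h3 : a = 0 := hlow.eq_zero_of_height_eq a (ω β) (hp.trans h2.symm)
      subst h3
      rw [monomials_zero]
      exact Submodule.subset_span ⟨⟨β, h2⟩, rfl⟩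
  · refine Submodule.span_mono ?_
    rintro _ ⟨j, rfl⟩
    refine ⟨(0, j.1), ?_, ?_⟩
    · change ((∑ i, (0 : Fin m → ℕ) i • η i + ω j.1) H).re = c
      simpa using j.2
    · change q (monomials y n (0, j.1)) = q (n j.1)
      rw [monomials_zero]

include hq hker in
theorem quotient_heightPart : heightPart Q H (Set.Ioi c) = ⊥ := by
  rw [heightPart_eq_span (hX.quotient_mem q) (hX.quotient_span hq), Submodule.span_eq_bot]
  rintro _ ⟨p, hp, rfl⟩
  exact hX.quotient_monomials_eq_zero hD hker (lt_of_lt_of_le hp (hX.lowering.height_le _ _))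

variable [FiniteDimensional ℂ 𝔞] {V : Type*} [AddCommGroup V] [Module ℂ V]
  [LieRingModule 𝔩 V] [LieModule ℂ 𝔩 V] (v : Module.Basis B ℂ V)
  (hv : ∀ β, v β ∈ lwt 𝔧 𝔩 V (ω β))

include hq hker v hv in
/-- The level `c` of the quotient is isomorphic to the level `c` of any `𝔩`-module `V` with a basis of
the same weights as the generators, because finite dimensional modules are determined by their
weight multiplicities. -/
theorem exists_level_equiv : ∃ _ : level V hD c ≃ₗ⁅ℂ, 𝔩⁆ level Q hD c,
    ∃ b : Module.Basis {β // (ω β H).re = c} ℂ (level Q hD c), ∀ j, (b j : Q) = q (n j.1) := by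
  have : Finite {β // (ω β H).re = c} :=
    ((hX.finite c).subset fun β (hβ : (ω β H).re = c) => hβ.ge).to_subtype
  have hind : LinearIndependent ℂ fun j : {β // (ω β H).re = c} => q (n j.1) := by
    have := (hX.quotient_linearIndependent hD hker).comp
      (fun j : {β // (ω β H).re = c} => ((0 : Fin m → ℕ), j)) fun a b h => (Prod.mk.inj h).2
    have h0 : (fun j : {β // (ω β H).re = c} => q (n j.1)) =
        (fun p : (Fin m → ℕ) × {β // (ω β H).re = c} => q (monomials y n (p.1, p.2.1))) ∘
          fun j => ((0 : Fin m → ℕ), j) := by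
      funext j
      rw [Function.comp_apply, monomials_zero]
    rw [h0]
    exact this
  obtain ⟨b', hb'⟩ := exists_basis_level hD hind (hX.quotient_level hD hq hker)
  have hlevelV : (level V hD c).toSubmodule =
      Submodule.span ℂ (Set.range fun j : {β // (ω β H).re = c} => v j.1) := by
    rw [level_eq_span hv v.span_eq, Set.image_eq_range]
    rfl
  obtain ⟨b, hb⟩ := exists_basis_level hD
    (v.linearIndependent.comp (fun j : {β // (ω β H).re = c} => j.1) Subtype.val_injective) hlevelV
  obtain ⟨e⟩ := hD.exists_equiv_of_basis b b' (w := fun j => ω j.1)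
    (fun j => by rw [mem_lwt_level, hb]; exact hv j.1)
    (fun j => by
      rw [mem_lwt_level, hb', lwt_eq_wt hD.toral_le, mem_wt]
      intro x
      rw [← q.map_lie, mem_wt.1 (hX.mem j.1), map_smul])
  exact ⟨e, b', hb'⟩

include hq hker v hv in
/-- The generalized Verma module induced from the level `c` embeds into the quotient: its canonical
spanning family is mapped to a linearly independent one. -/
theorem exists_genVerma_hom : ∃ g : GenVerma 𝔩 𝔲 (level V hD c) →ₗ⁅ℂ, 𝔞⁆ Q,
    Function.Injective g ∧ (g : GenVerma 𝔩 𝔲 (level V hD c) →ₗ[ℂ] Q).range =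
      (heightSpan X H (Set.Ici c)).toSubmodule.map (q : X →ₗ[ℂ] Q) := by
  obtain ⟨e, b, hb⟩ := hX.exists_level_equiv hD hq hker v hv
  obtain ⟨g, hg⟩ := GenVerma.exists_lift (𝔩 := 𝔩) (𝔲 := 𝔲) (F := level V hD c) (X := Q)
    ((level Q hD c).incl.comp e.toLieModuleHom : level V hD c →ₗ[ℂ] Q)
    (fun x f => LieModuleHom.map_lie _ x f) (fun z hz f => by
      have h1 := hD.lie_nil_mem_heightPart (X := Q) (H := H) hz (T := {c}) (T' := Set.Ioi c)
        (fun t ht s hs => by rw [Set.mem_singleton_iff.1 ht] at hs; exact hs)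
        (v := (e f : Q)) (by
          have h2 : (e f : Q) ∈ (level Q hD c).toSubmodule := (e f).2
          simp only [level_toSubmodule, lwt_eq_wt hD.toral_le] at h2
          exact h2)
      rw [hX.quotient_heightPart hD hq hker, Submodule.mem_bot] at h1
      exact h1)
  set f : {β // (ω β H).re = c} → GenVerma 𝔩 𝔲 (level V hD c) :=
    fun j => GenVerma.of 𝔩 𝔲 (level V hD c) (e.symm (b j)) with hf
  have hspan : Submodule.span ℂ (Set.range (monomials y f)) = ⊤ :=
    hX.lowering.span_genVerma hD (F := level V hD c) (g := fun j => e.symm (b j)) (by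
    have h1 : (⊤ : Submodule ℂ (level Q hD c)).map (e.symm.toLinearEquiv : level Q hD c →ₗ[ℂ]
        level V hD c) = ⊤ := by
      rw [Submodule.map_top, LinearEquiv.range]
    rw [← h1, ← b.span_eq, Submodule.map_span, ← Set.range_comp]
    rfl)
  have hgf : ∀ j, g (f j) = q (n j.1) := fun j => by
    rw [hf, hg]
    change (e (e.symm (b j)) : Q) = _
    rw [LieModuleEquiv.apply_symm_apply, hb]
  have hgM : ∀ p : (Fin m → ℕ) × {β // (ω β H).re = c},
      g (monomials y f p) = q (monomials y n (p.1, p.2.1)) := by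
    intro p
    rw [map_monomials, map_monomials]
    simp only [monomials, hgf]
  refine ⟨g, injective_of_linearIndependent (g := monomials y f)
    (g : GenVerma 𝔩 𝔲 (level V hD c) →ₗ[ℂ] Q) hspan
    (by
      have h1 := hX.quotient_linearIndependent hD hker
      rw [← funext hgM] at h1
      exact h1), ?_⟩
  rw [hX.heightSpan_toSubmodule hD (isUpperSet_Ici c), Submodule.map_span, ← Submodule.map_top,
    ← hspan, Submodule.map_span, ← Set.range_comp]
  refine le_antisymm (Submodule.span_mono ?_) (Submodule.span_le.2 ?_)
  · rintro _ ⟨p, rfl⟩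
    exact ⟨monomials y n (p.1, p.2.1), ⟨(p.1, p.2.1), p.2.2.ge, rfl⟩, (hgM p).symm⟩
  · rintro _ ⟨_, ⟨⟨a, β⟩, hp, rfl⟩, rfl⟩
    change c ≤ (ω β H).re at hp
    change q (monomials y n (a, β)) ∈ _
    rcases hp.lt_or_eq with h | h
    · rw [hX.quotient_monomials_eq_zero hD hker h]
      exact zero_mem _
    · exact Submodule.subset_span ⟨(a, ⟨β, h.symm⟩), hgM (a, ⟨β, h.symm⟩)⟩

include hq hker v hv in
theorem jhMult_heightSpan_of_quotient (S : Type*) [AddCommGroup S] [Module ℂ S]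
    [LieRingModule 𝔞 S] [LieModule ℂ 𝔞 S] [IsIrreducible ℂ 𝔞 S] :
    jhMult 𝔞 (heightSpan X H (Set.Ici c)) S = jhMult 𝔞 (heightSpan X H (Set.Ioi c)) S +
      jhMult 𝔞 (GenVerma 𝔩 𝔲 (level V hD c)) S := by
  obtain ⟨g, hginj, hrange⟩ := hX.exists_genVerma_hom hD hq hker v hv
  have hle : heightSpan X H (Set.Ioi c) ≤ heightSpan X H (Set.Ici c) :=
    LieSubmodule.lieSpan_mono (heightPart_le fun μ hμ v hv =>
      wt_le_heightPart (Set.Ioi_subset_Ici_self hμ) hv)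
  exact jhMult_add_of_map_eq S hle q g hker hginj hrange

end Quotient

/-- The subquotient of the height filtration at height `c` is a generalized Verma module, induced
from the level `c` of any `𝔩`-module with a basis of weight vectors of weights `ω`. -/
theorem jhMult_heightSpan [FiniteDimensional ℂ 𝔞] {V : Type*} [AddCommGroup V] [Module ℂ V]
    [LieRingModule 𝔩 V] [LieModule ℂ 𝔩 V] (v : Module.Basis B ℂ V)
    (hv : ∀ β, v β ∈ lwt 𝔧 𝔩 V (ω β)) (S : Type*) [AddCommGroup S] [Module ℂ S]
    [LieRingModule 𝔞 S] [LieModule ℂ 𝔞 S] [IsIrreducible ℂ 𝔞 S] (c : ℝ) :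
    jhMult 𝔞 (heightSpan X H (Set.Ici c)) S = jhMult 𝔞 (heightSpan X H (Set.Ioi c)) S +
      jhMult 𝔞 (GenVerma 𝔩 𝔲 (level V hD c)) S :=
  hX.jhMult_heightSpan_of_quotient hD (LieSubmodule.Quotient.surjective_mk' _)
    (fun _ => LieSubmodule.Quotient.mk_eq_zero _) v hv S

end IsLoweringFree

end Subquotients

/-! ### The identity in the Grothendieck group for free modules -/

section FreeModules

open LieModule LieAlgebra

attribute [local instance] LieRing.ofAssociativeRing

universe u

variable {𝔞 : Type u} [LieRing 𝔞] [LieAlgebra ℂ 𝔞]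
variable {𝔧 : LieSubalgebra ℂ 𝔞} {P : Set (Module.Dual ℂ 𝔧)} {𝔩 : LieSubalgebra ℂ 𝔞}
  {𝔲 : Submodule ℂ 𝔞} {H : 𝔧}
variable {X : Type*} [AddCommGroup X] [Module ℂ X] [LieRingModule 𝔞 X] [LieModule ℂ 𝔞 X]
variable {m : ℕ} {B : Type*} {y : Fin m → 𝔞} {η : Fin m → Module.Dual ℂ 𝔧}
  {n : B → X} {ω : B → Module.Dual ℂ 𝔧}

theorem IsStandard.iSup_lwt_simpleHW [FiniteDimensional ℂ 𝔞] (hD : IsStandard 𝔧 P 𝔩 𝔲 H)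
    (δ : Module.Dual ℂ 𝔧) : ⨆ μ, lwt 𝔧 𝔩 (SimpleHW 𝔧 P 𝔩 δ) μ = ⊤ := by
  rw [eq_top_iff, ← hD.span_sup_eq_top (hD.isSingular_gen δ) SimpleHW.lieSpan_gen]
  refine sup_le ?_ (iSup₂_le fun μ _ => le_iSup (fun μ => lwt 𝔧 𝔩 (SimpleHW 𝔧 P 𝔩 δ) μ) μ)
  rw [Submodule.span_le, Set.singleton_subset_iff]
  exact Submodule.mem_iSup_of_mem δ (hD.isSingular_gen δ).1

section InducedModules

variable (hD : IsStandard 𝔧 P 𝔩 𝔲 H) (hy : IsLowering H y η) {F : Type*} [AddCommGroup F]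
  [Module ℂ F] [LieRingModule 𝔩 F] [LieModule ℂ 𝔩 F]
include hD

theorem IsStandard.of_mem_wt {μ : Module.Dual ℂ 𝔧} {f : F}
    (hf : f ∈ lwt 𝔧 𝔩 F μ) : GenVerma.of 𝔩 𝔲 F f ∈ wt 𝔧 (GenVerma 𝔩 𝔲 F) μ :=
  mem_wt.2 fun x => (GenVerma.lie_of (⟨x, hD.toral_le x.2⟩ : 𝔩) f).trans
    ((congrArg (GenVerma.of 𝔩 𝔲 F) (mem_lwt.1 hf ⟨x, hD.toral_le x.2⟩ x.2)).trans
      (map_smul (GenVerma.of 𝔩 𝔲 F) (μ x) f))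

include hy

theorem IsStandard.monomials_of_mem_wt {I : Type*} {b : I → F} {w : I → Module.Dual ℂ 𝔧}
    (hb : ∀ i, b i ∈ lwt 𝔧 𝔩 F (w i)) (p : (Fin m → ℕ) × I) :
    monomials y (fun i => GenVerma.of 𝔩 𝔲 F (b i)) p ∈
      wt 𝔧 (GenVerma 𝔩 𝔲 F) (∑ i, p.1 i • η i + w p.2) :=
  omon_mem_wt hy.mem p.1 (hD.of_mem_wt (hb p.2))

theorem IsStandard.span_monomials_of {I : Type*} {b : I → F}
    (hb : Submodule.span ℂ (Set.range b) = ⊤) :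
    Submodule.span ℂ (Set.range (monomials y fun i => GenVerma.of 𝔩 𝔲 F (b i))) = ⊤ :=
  hy.span_genVerma hD hb

theorem IsStandard.iSup_wt_genVerma (hF : ⨆ μ, lwt 𝔧 𝔩 F μ = ⊤) :
    ⨆ μ, wt 𝔧 (GenVerma 𝔩 𝔲 F) μ = ⊤ := by
  obtain ⟨s, b, w, hb⟩ := exists_basis_simEig hF
  exact iSup_wt_of_span (hD.monomials_of_mem_wt hy hb) (hD.span_monomials_of hy b.span_eq)

/-- The weights of a generalized Verma module do not lie above those of `F`. -/
theorem IsStandard.wt_genVerma_eq_bot (hF : ⨆ μ, lwt 𝔧 𝔩 F μ = ⊤) {μ : Module.Dual ℂ 𝔧}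
    (hμ : ∀ ν, lwt 𝔧 𝔩 F ν ≠ ⊥ → (ν H).re < (μ H).re) : wt 𝔧 (GenVerma 𝔩 𝔲 F) μ = ⊥ := by
  obtain ⟨s, b, w, hb⟩ := exists_basis_simEig hF
  rw [wt_eq_span (hD.monomials_of_mem_wt hy hb) (hD.span_monomials_of hy b.span_eq),
    Submodule.span_eq_bot]
  rintro _ ⟨p, hp, rfl⟩
  exfalso
  have hle := hy.height_le p.1 (w p.2)
  rw [hp] at hle
  exact (hμ (w p.2) ((Submodule.ne_bot_iff _).2 ⟨b p.2, hb p.2, b.ne_zero p.2⟩)).not_ge hle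

theorem IsStandard.isInO_genVerma [FiniteDimensional ℂ F] (hF : ⨆ μ, lwt 𝔧 𝔩 F μ = ⊤) :
    IsInO 𝔧 P 𝔩 (GenVerma 𝔩 𝔲 F) := by
  obtain ⟨s, b, w, hb⟩ := exists_basis_simEig hF
  have hs := Module.Finite.finite_basis b
  refine hD.isInO (IsBoundedType.of_span (hD.monomials_of_mem_wt hy hb)
    (hD.span_monomials_of hy b.span_eq) (hy.finite fun t => Set.toFinite _)) ?_
  obtain ⟨k⟩ := nonempty_fintype s
  classical
  refine ⟨Finset.univ.image fun i => GenVerma.of 𝔩 𝔲 F (b i),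
    GenVerma.lieSubmodule_eq_top fun f => ?_⟩
  have h3 : (⊤ : Submodule ℂ F) ≤ (LieSubmodule.lieSpan ℂ 𝔞
      ((Finset.univ.image fun i => GenVerma.of 𝔩 𝔲 F (b i) : Finset _) :
        Set (GenVerma 𝔩 𝔲 F))).toSubmodule.comap (GenVerma.of 𝔩 𝔲 F) := by
    rw [← b.span_eq, Submodule.span_le]
    rintro _ ⟨i, rfl⟩
    exact LieSubmodule.subset_lieSpan (by simp)
  exact h3 trivial

end InducedModules

/-- The weights of a simple highest weight module do not lie above its highest weight. -/
theorem IsStandard.height_le_of_lwt_ne_bot [FiniteDimensional ℂ 𝔞] (hD : IsStandard 𝔧 P 𝔩 𝔲 H)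
    {δ ν : Module.Dual ℂ 𝔧} (hν : lwt 𝔧 𝔩 (SimpleHW 𝔧 P 𝔩 δ) ν ≠ ⊥) :
    (ν H).re ≤ (δ H).re := by
  rcases hD.lwt_ne_bot_of_singular (hD.isSingular_gen δ) SimpleHW.lieSpan_gen hν with h1 | h1
  · rw [h1]
  · obtain ⟨t, -, ht, hsum⟩ := h1
    have h2 : 0 ≤ (t.sum H).re := by
      clear hsum
      induction t using Multiset.induction with
      | empty => simp
      | cons a t ih =>
        rw [Multiset.sum_cons, LinearMap.add_apply, Complex.add_re]
        exact add_nonneg (hD.pos_re a (ht a (Multiset.mem_cons_self a t)))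
          (ih fun α hα => ht α (Multiset.mem_cons_of_mem hα))
    rw [hsum, LinearMap.sub_apply, Complex.sub_re] at h2
    linarith

/-- A simple module does not occur in a weight module that lacks one of its weights. -/
theorem jhMult_eq_zero_of_wt_eq_bot {S : Type*} [AddCommGroup S] [Module ℂ S] [LieRingModule 𝔞 S]
    [LieModule ℂ 𝔞 S] (hX : ⨆ μ, wt 𝔧 X μ = ⊤) {μ : Module.Dual ℂ 𝔧} (hS : wt 𝔧 S μ ≠ ⊥)
    (h : wt 𝔧 X μ = ⊥) : jhMult 𝔞 X S = 0 := by
  have h1 : FiniteDimensional ℂ (wt 𝔧 X μ) := by rw [h]; infer_instance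
  have h2 := jhMult_le_finrank hX hS
  rw [h, finrank_bot, Nat.cast_zero] at h2
  exact le_antisymm h2 bot_le

/-- A simple module with a weight `μ` occurs only in submodules that contain all of `X_μ`. -/
theorem jhMult_eq_of_wt_le {S : Type*} [AddCommGroup S] [Module ℂ S] [LieRingModule 𝔞 S]
    [LieModule ℂ 𝔞 S] [IsIrreducible ℂ 𝔞 S] (hX : ⨆ μ, wt 𝔧 X μ = ⊤) {μ : Module.Dual ℂ 𝔧}
    (hS : wt 𝔧 S μ ≠ ⊥) {N : LieSubmodule ℂ 𝔞 X} (h : ∀ x ∈ wt 𝔧 X μ, x ∈ N) :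
    jhMult 𝔞 X S = jhMult 𝔞 N S := by
  have hsurj := LieSubmodule.Quotient.surjective_mk' N
  have hQ : ⨆ μ, wt 𝔧 (X ⧸ N) μ = ⊤ :=
    iSup_wt_of_surjective (LieSubmodule.Quotient.mk' N) hsurj hX
  have h0 : wt 𝔧 (X ⧸ N) μ = ⊥ := by
    rw [Submodule.eq_bot_iff]
    intro z hz
    rw [wt_eq_simEig] at hz
    simp only [wt_eq_simEig] at hX
    obtain ⟨x, hx, rfl⟩ := exists_lift_simEig (T := fun x : 𝔧 => toEnd ℂ 𝔞 X x) dual_injective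
      (q := (LieSubmodule.Quotient.mk' N : X →ₗ[ℂ] X ⧸ N))
      (fun x v => (LieSubmodule.Quotient.mk' N).map_lie _ v) hsurj hX hz
    rw [← wt_eq_simEig] at hx
    exact (LieSubmodule.Quotient.mk_eq_zero N).2 (h x hx)
  rw [jhMult_add S N.incl (LieSubmodule.Quotient.mk' N) Subtype.val_injective hsurj fun x =>
    (LieSubmodule.Quotient.mk_eq_zero N).trans ⟨fun hx => ⟨⟨x, hx⟩, rfl⟩, by
      rintro ⟨y', rfl⟩
      exact y'.2⟩, jhMult_eq_zero_of_wt_eq_bot hQ hS h0, add_zero]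

theorem exists_finset_lieSpan_eq_top {N : LieSubmodule ℂ 𝔞 X} {s : Finset X}
    (h : N = LieSubmodule.lieSpan ℂ 𝔞 (s : Set X)) :
    ∃ t : Finset N, LieSubmodule.lieSpan ℂ 𝔞 (t : Set N) = ⊤ := by
  classical
  subst h
  refine ⟨s.preimage Subtype.val Subtype.val_injective.injOn, ?_⟩
  rw [Finset.coe_preimage]
  exact lieSpan_coe_preimage _

namespace IsLoweringFree

variable (hX : IsLoweringFree H y η n ω) (hD : IsStandard 𝔧 P 𝔩 𝔲 H)
include hX hD

variable [FiniteDimensional ℂ 𝔞] {V : Type*} [AddCommGroup V] [Module ℂ V]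
    [LieRingModule 𝔩 V] [LieModule ℂ 𝔩 V] (v : Module.Basis B ℂ V)
    (hv : ∀ β, v β ∈ lwt 𝔧 𝔩 V (ω β))
include v hv

/-- The space of homomorphisms is finite dimensional, because evaluation at the highest weight vector
embeds it into a finite dimensional weight space. -/
theorem finite_hom (δ : Module.Dual ℂ 𝔧) : Module.Finite ℂ (SimpleHW 𝔧 P 𝔩 δ →ₗ⁅ℂ, 𝔩⁆ V) := by
  obtain ⟨e, he⟩ := hD.exists_eval_injective δ V
  have : Module.Finite ℂ (lwt 𝔧 𝔩 V δ) := by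
    rw [lwt_eq_span_of_span hD.toral_le hv v.span_eq]
    refine FiniteDimensional.span_of_finite ℂ (Set.Finite.image _ ?_)
    exact (hX.finite (δ H).re).subset fun β (hβ : ω β = δ) => by
      change (δ H).re ≤ (ω β H).re
      rw [hβ]
  exact Module.Finite.of_injective e he

theorem finite_level (c : ℝ) : FiniteDimensional ℂ (level V hD c) := by
  have h : FiniteDimensional ℂ (level V hD c).toSubmodule := by
    rw [level_eq_span hv v.span_eq]
    refine FiniteDimensional.span_of_finite ℂ (Set.Finite.image _ ?_)
    exact (hX.finite c).subset fun β (hβ : (ω β H).re = c) => hβ.ge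
  exact h

omit hX in
theorem exists_weight_of_finrank_ne_zero {δ : Module.Dual ℂ 𝔧}
    (h : Module.finrank ℂ (SimpleHW 𝔧 P 𝔩 δ →ₗ⁅ℂ, 𝔩⁆ V) ≠ 0) : ∃ β, ω β = δ := by
  by_contra! hcon
  have h0 := lwt_eq_bot_of_span hD.toral_le hv v.span_eq hcon
  have : Subsingleton (SimpleHW 𝔧 P 𝔩 δ →ₗ⁅ℂ, 𝔩⁆ V) := by
    have : Subsingleton (lwt 𝔧 𝔩 V δ) := by rw [h0]; infer_instance
    obtain ⟨e, he⟩ := hD.exists_eval_injective δ V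
    exact he.subsingleton
  exact h Module.finrank_zero_of_subsingleton

/-- The multiplicities in a step of the height filtration, by induction on the number of
generators: the generators of least height `c` contribute the generalized Verma module induced from
the level `c` of `V`. -/
theorem hasSum_heightSpan (S : Type*) [AddCommGroup S] [Module ℂ S]
    [LieRingModule 𝔞 S] [LieModule ℂ 𝔞 S] [IsIrreducible ℂ 𝔞 S] {T : Set ℝ} (hT : IsUpperSet T)
    (hfin : {β | (ω β H).re ∈ T}.Finite) :
    HasSum (fun δ : dominant 𝔧 P 𝔩 => ((open Classical in if (δ.1 H).re ∈ T then
      Module.finrank ℂ (SimpleHW 𝔧 P 𝔩 δ.1 →ₗ⁅ℂ, 𝔩⁆ V) else 0 : ℕ) : ℕ∞) *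
        jhMult 𝔞 (GenVerma 𝔩 𝔲 (SimpleHW 𝔧 P 𝔩 δ.1)) S) (jhMult 𝔞 (heightSpan X H T) S) := by
  classical
  have hS : Nontrivial S := nontrivial_of_isIrreducible ℂ 𝔞 S
  induction hcard : hfin.toFinset.card using Nat.strong_induction_on generalizing T with
  | _ k ih =>
  rcases hfin.toFinset.eq_empty_or_nonempty with he | hne
  · have hempty : ∀ β, (ω β H).re ∉ T := fun β hβ => by
      have : β ∈ hfin.toFinset := hfin.mem_toFinset.2 hβ
      rw [he] at this
      exact absurd this (Finset.notMem_empty β)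
    have h1 : Subsingleton (heightSpan X H T) := by
      have h2 : (heightSpan X H T).toSubmodule = ⊥ := by
        rw [hX.heightSpan_toSubmodule hD hT, Submodule.span_eq_bot]
        rintro _ ⟨p, hp, rfl⟩
        exact absurd hp (hempty p.2)
      exact (Submodule.subsingleton_iff_eq_bot (p := (heightSpan X H T).toSubmodule)).2 h2
    rw [jhMult_eq_zero_of_subsingleton]
    convert hasSum_zero with δ
    split_ifs with hδ
    · by_cases h3 : Module.finrank ℂ (SimpleHW 𝔧 P 𝔩 δ.1 →ₗ⁅ℂ, 𝔩⁆ V) = 0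
      · rw [h3, Nat.cast_zero, zero_mul]
      · obtain ⟨β, hβ⟩ := exists_weight_of_finrank_ne_zero hD v hv h3
        exact absurd (hβ ▸ hδ) (hempty β)
    · rw [Nat.cast_zero, zero_mul]
  · obtain ⟨β₀, hβ₀, hmin⟩ := Finset.exists_min_image hfin.toFinset (fun β => (ω β H).re) hne
    rw [Set.Finite.mem_toFinset] at hβ₀
    set c := (ω β₀ H).re with hc
    have hmin' : ∀ β, (ω β H).re ∈ T → c ≤ (ω β H).re := fun β hβ =>
      hmin β (hfin.mem_toFinset.2 hβ)
    have hT1 : heightSpan X H T = heightSpan X H (Set.Ici c) := by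
      rw [← LieSubmodule.toSubmodule_inj, hX.heightSpan_toSubmodule hD hT,
        hX.heightSpan_toSubmodule hD (isUpperSet_Ici c)]
      congr 2
      ext p
      exact ⟨fun hp => hmin' _ hp, fun hp => hT hp hβ₀⟩
    have hfin' : {β | (ω β H).re ∈ Set.Ioi c}.Finite := (hX.finite c).subset
      fun β (hβ : c < (ω β H).re) => hβ.le
    have hlt : hfin'.toFinset.card < k := by
      rw [← hcard]
      refine Finset.card_lt_card (Finset.ssubset_iff_of_subset (fun β hβ => ?_) |>.2
        ⟨β₀, hfin.mem_toFinset.2 hβ₀, fun h => ?_⟩)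
      · rw [Set.Finite.mem_toFinset] at hβ ⊢
        exact hT (le_of_lt hβ) hβ₀
      · rw [Set.Finite.mem_toFinset] at h
        exact lt_irrefl c h
    have h1 := ih _ hlt (isUpperSet_Ioi c) hfin' rfl
    have := hX.finite_level hD v hv c
    have h2 := hD.hasSum_jhMult S (iSup_lwt_of_injective hD.toral_le (level V hD c).incl
      Subtype.val_injective (iSup_simEig_of_span hv v.span_eq))
    rw [hT1, hX.jhMult_heightSpan hD v hv S c]
    convert h1.add h2 using 2 with δ
    rw [← add_mul, ← Nat.cast_add, finrank_hom_level]
    congr 2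
    rcases lt_trichotomy c (δ.1 H).re with h | h | h
    · rw [if_pos (hT h.le hβ₀), if_pos (Set.mem_Ioi.2 h), if_neg h.ne', add_zero]
    · rw [if_pos (h ▸ hβ₀), if_neg (by rw [← h]; exact lt_irrefl c), if_pos h.symm, zero_add]
    · rw [if_neg (show ¬(δ.1 H).re ∈ Set.Ioi c from fun hh => lt_asymm h hh), if_neg h.ne, add_zero]
      split_ifs with hδ
      · by_contra h3
        obtain ⟨β, hβ⟩ := exists_weight_of_finrank_ne_zero hD v hv h3
        rw [← hβ] at hδ h
        exact absurd (hmin' β hδ) (not_le.2 h)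
      · rfl

/-- A simple module that maps nontrivially to `V` is finite dimensional, being contained in a level of
`V`. -/
theorem isInO_genVerma {δ : Module.Dual ℂ 𝔧}
    (h : Module.finrank ℂ (SimpleHW 𝔧 P 𝔩 δ →ₗ⁅ℂ, 𝔩⁆ V) ≠ 0) :
    IsInO 𝔧 P 𝔩 (GenVerma 𝔩 𝔲 (SimpleHW 𝔧 P 𝔩 δ)) := by
  have h1 : Module.finrank ℂ (SimpleHW 𝔧 P 𝔩 δ →ₗ⁅ℂ, 𝔩⁆ level V hD (δ H).re) ≠ 0 := by
    rwa [finrank_hom_level, if_pos rfl]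
  have := hX.finite_level hD v hv (δ H).re
  have : Nontrivial (SimpleHW 𝔧 P 𝔩 δ →ₗ⁅ℂ, 𝔩⁆ level V hD (δ H).re) :=
    Module.nontrivial_of_finrank_pos (Nat.pos_of_ne_zero h1)
  obtain ⟨f, hf⟩ := exists_ne (0 : SimpleHW 𝔧 P 𝔩 δ →ₗ⁅ℂ, 𝔩⁆ level V hD (δ H).re)
  have := hD.simpleHW_isIrreducible δ
  have : FiniteDimensional ℂ (SimpleHW 𝔧 P 𝔩 δ) :=
    Module.Finite.of_injective (f : SimpleHW 𝔧 P 𝔩 δ →ₗ[ℂ] level V hD (δ H).re)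
      (injective_of_ne_zero hf)
  exact hD.isInO_genVerma hX.lowering (hD.iSup_lwt_simpleHW δ)

/-- The identity in the Grothendieck group for a free module `X` and an `𝔩`-module `V` with a basis of
the same weights as the generators of `X`. The submodules generated by the weight spaces of height at
least `-k` exhaust `X`; a simple object with a weight `μ` occurs only in the one generated by the
weight spaces of height at least that of `μ`. -/
theorem grothendieckIdentity : GrothendieckIdentity 𝔧 P 𝔩 X
    (fun δ : dominant 𝔧 P 𝔩 => Module.finrank ℂ (SimpleHW 𝔧 P 𝔩 δ.1 →ₗ⁅ℂ, 𝔩⁆ V))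
    (fun δ : dominant 𝔧 P 𝔩 => GenVerma 𝔩 𝔲 (SimpleHW 𝔧 P 𝔩 δ.1)) := by
  have hbt := hX.isBoundedType
  have hwt : ∀ (S : Type u) [AddCommGroup S] [Module ℂ S] [LieRingModule 𝔞 S] [LieModule ℂ 𝔞 S],
      IsIrreducible ℂ 𝔞 S → IsInO 𝔧 P 𝔩 S → ∃ μ, wt 𝔧 S μ ≠ ⊥ := by
    intro S _ _ _ _ hS hO
    by_contra! hcon
    have h1 := hO.weight_module
    simp only [hcon, iSup_bot] at h1
    have := nontrivial_of_isIrreducible ℂ 𝔞 S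
    exact bot_ne_top h1
  refine ⟨?_, fun δ hδ => hX.isInO_genVerma hD v hv hδ, ?_, ?_⟩
  · refine ⟨fun k => heightSpan X H (Set.Ici (-(k : ℝ))), fun k l hkl => ?_, ?_, fun k => ?_⟩
    · refine LieSubmodule.lieSpan_mono (heightPart_le fun μ hμ v hv => wt_le_heightPart ?_ hv)
      have : (k : ℝ) ≤ l := by exact_mod_cast hkl
      rw [Set.mem_Ici] at hμ ⊢
      linarith
    · rw [eq_top_iff]
      rintro x -
      obtain ⟨t, ht⟩ := hbt.exists_mem_heightPart x
      obtain ⟨k, hk⟩ := exists_nat_ge (-t)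
      refine LieSubmodule.mem_iSup_of_mem k (LieSubmodule.subset_lieSpan ?_)
      have h2 : heightPart X H (Set.Ici t) ≤ heightPart X H (Set.Ici (-(k : ℝ))) :=
        heightPart_le fun μ hμ v hv => wt_le_heightPart (by
          rw [Set.mem_Ici] at hμ ⊢
          linarith) hv
      exact h2 ht
    · refine hD.isInO (hbt.of_injective (heightSpan X H (Set.Ici (-(k : ℝ)))).incl
        Subtype.val_injective) ?_
      have := hbt.finite (-(k : ℝ))
      obtain ⟨s, hs⟩ := (Submodule.fg_iff_finiteDimensional
        (heightPart X H (Set.Ici (-(k : ℝ))))).2 this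
      have h3 : LieSubmodule.lieSpan ℂ 𝔞 (s : Set X) = heightSpan X H (Set.Ici (-(k : ℝ))) := by
        refine le_antisymm (LieSubmodule.lieSpan_mono ?_) ?_
        · rw [← hs]
          exact Submodule.subset_span
        · rw [heightSpan, LieSubmodule.lieSpan_le, ← hs]
          exact Submodule.span_le.2 (LieSubmodule.subset_lieSpan (L := 𝔞) (R := ℂ) (s := (s : Set X)))
      exact exists_finset_lieSpan_eq_top h3.symm
  · intro S _ _ _ _ hS hO
    obtain ⟨μ, hμ⟩ := hwt S hS hO
    have := hbt.finite_wt μ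
    exact ne_top_of_le_ne_top (ENat.natCast_ne_top _) (jhMult_le_finrank hbt.iSup_wt hμ)
  · intro S _ _ _ _ hS hO
    obtain ⟨μ, hμ⟩ := hwt S hS hO
    have h1 := hX.hasSum_heightSpan hD v hv S (isUpperSet_Ici (μ H).re) (hX.finite (μ H).re)
    have h2 : jhMult 𝔞 X S = jhMult 𝔞 (heightSpan X H (Set.Ici (μ H).re)) S :=
      jhMult_eq_of_wt_le hbt.iSup_wt hμ fun x hx =>
        LieSubmodule.subset_lieSpan (wt_le_heightPart Set.self_mem_Ici hx)
    rw [h2]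
    convert h1 using 2 with δ
    split_ifs with hδ
    · rfl
    · have h3 : jhMult 𝔞 (GenVerma 𝔩 𝔲 (SimpleHW 𝔧 P 𝔩 δ.1)) S = 0 :=
        jhMult_eq_zero_of_wt_eq_bot (hD.iSup_wt_genVerma hX.lowering (hD.iSup_lwt_simpleHW δ.1)) hμ
          (hD.wt_genVerma_eq_bot hX.lowering (hD.iSup_lwt_simpleHW δ.1) fun ν hν =>
            (hD.height_le_of_lwt_ne_bot hν).trans_lt (not_le.1 hδ))
      rw [h3, mul_zero, mul_zero]

end IsLoweringFree

end FreeModules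

/-! ### The parabolic subalgebra of a hyperbolic element is standard -/

section Hyperbolic

open LieModule LieAlgebra

attribute [local instance] LieRing.ofAssociativeRing

universe u

section Weights

variable {𝔞 : Type u} [LieRing 𝔞] [LieAlgebra ℂ 𝔞] {𝔧 : LieSubalgebra ℂ 𝔞} {H : 𝔧}
variable {X Y : Type*} [AddCommGroup X] [Module ℂ X] [LieRingModule 𝔞 X] [LieModule ℂ 𝔞 X]
  [AddCommGroup Y] [Module ℂ Y] [LieRingModule 𝔞 Y] [LieModule ℂ 𝔞 Y]

theorem mem_of_mem_heightPart {T : Set ℝ} {μ : Module.Dual ℂ 𝔧} {v : X} (hv : v ∈ wt 𝔧 X μ)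
    (h : v ∈ heightPart X H T) (h0 : v ≠ 0) : (μ H).re ∈ T := by
  by_contra hμ
  simp only [heightPart, wt_eq_simEig] at hv h
  exact h0 (eq_zero_of_mem_iSup_simEig (dual_injective (𝔧 := 𝔧))
    (Ω := {μ : Module.Dual ℂ 𝔧 | (μ H).re ∈ T}) hμ hv h)

/-- The parts of given heights are compatible with injections, because submodules of weight modules are
sums of weight spaces. -/
theorem comap_heightPart (f : X →ₗ⁅ℂ, 𝔞⁆ Y) (hf : Function.Injective f)
    (hY : ⨆ μ, wt 𝔧 Y μ = ⊤) (T : Set ℝ) :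
    (heightPart Y H T).comap (f : X →ₗ[ℂ] Y) = heightPart X H T := by
  have hmap : ∀ {μ : Module.Dual ℂ 𝔧} {v : X}, v ∈ wt 𝔧 X μ → f v ∈ wt 𝔧 Y μ := fun hv => by
    rw [mem_wt] at hv ⊢
    intro x
    rw [← f.map_lie, hv, map_smul]
  refine le_antisymm (fun v hv => ?_)
    (heightPart_le fun μ hμ v hv => wt_le_heightPart hμ (hmap hv))
  obtain ⟨s, w, hw, rfl⟩ := exists_sum_of_iSup_eq_top (iSup_wt_of_injective f hf hY) v
  have hstab : ∀ x : 𝔧, ∀ v ∈ heightPart Y H T, toEnd ℂ 𝔞 Y x v ∈ heightPart Y H T := by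
    intro x v hv
    have h1 : heightPart Y H T ≤ (heightPart Y H T).comap (toEnd ℂ 𝔞 Y x) :=
      heightPart_le fun μ hμ v hv => by
        change ⁅(x : 𝔞), v⁆ ∈ heightPart Y H T
        rw [mem_wt.1 hv]
        exact Submodule.smul_mem _ _ (wt_le_heightPart hμ hv)
    exact h1 hv
  have hcomp := mem_of_sum_mem (T := fun x : 𝔧 => toEnd ℂ 𝔞 Y x) (dual_injective (𝔧 := 𝔧)) hstab s
    (fun k => f (w k)) (fun k _ => wt_eq_simEig (𝔧 := 𝔧) (X := Y) k ▸ hmap (hw k)) (by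
      rw [← map_sum f]; exact hv)
  refine Submodule.sum_mem _ fun k hk => ?_
  by_cases h0 : w k = 0
  · rw [h0]
    exact Submodule.zero_mem _
  · exact wt_le_heightPart (mem_of_mem_heightPart (hmap (hw k)) (hcomp k hk)
      fun h => h0 (hf (h.trans (map_zero f).symm))) (hw k)

/-- The eigenspaces of `H` lie in the parts of `X` of the corresponding height. -/
theorem eigenspace_le_heightPart (hX : ⨆ μ, wt 𝔧 X μ = ⊤)
    (hH : ∀ x : 𝔧, ⁅(x : 𝔞), (H : 𝔞)⁆ = 0) {T : Set ℝ} {c : ℂ} (hc : c.re ∈ T) {v : X}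
    (hv : ⁅(H : 𝔞), v⁆ = c • v) : v ∈ heightPart X H T := by
  obtain ⟨s, w, hw, rfl⟩ := exists_sum_of_iSup_eq_top hX v
  have hcomp := mem_of_sum_mem (T := fun x : 𝔧 => toEnd ℂ 𝔞 X x) (dual_injective (𝔧 := 𝔧))
    (N := (toEnd ℂ 𝔞 X H).eigenspace c) (fun x v hv => by
      rw [Module.End.mem_eigenspace_iff, toEnd_apply_apply] at hv ⊢
      change ⁅(H : 𝔞), ⁅(x : 𝔞), v⁆⁆ = c • ⁅(x : 𝔞), v⁆
      rw [← lie_smul, ← hv, leibniz_lie (x : 𝔞), hH, zero_lie, zero_add]) s w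
    (fun k _ => wt_eq_simEig (𝔧 := 𝔧) (X := X) k ▸ hw k)
    (Module.End.mem_eigenspace_iff.2 hv)
  refine Submodule.sum_mem _ fun k hk => ?_
  by_cases h0 : w k = 0
  · rw [h0]
    exact Submodule.zero_mem _
  · have h1 := Module.End.mem_eigenspace_iff.1 (hcomp k hk)
    rw [toEnd_apply_apply, mem_wt.1 (hw k)] at h1
    refine wt_le_heightPart ?_ (hw k)
    rwa [smul_left_injective ℂ h0 h1]

end Weights

theorem exists_matrix_rep (L W : Type*) [LieRing L] [LieAlgebra ℂ L] [AddCommGroup W] [Module ℂ W]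
    [LieRingModule L W] [LieModule ℂ L W] [FiniteDimensional ℂ W] [hW : IsFaithful ℂ L W] :
    ∃ (n : ℕ) (ρ : L →ₗ⁅ℂ⁆ Matrix (Fin n) (Fin n) ℂ), Function.Injective ρ := by
  let e : Module.End ℂ W ≃ₗ⁅ℂ⁆ Matrix _ _ ℂ :=
    (LinearMap.toMatrixAlgEquiv (Module.finBasis ℂ W)).toLieEquiv
  exact ⟨_, e.toLieHom.comp (toEnd ℂ L W), e.injective.comp hW.injective_toEnd⟩

/-- A Cartan subalgebra of a semisimple Lie algebra acts diagonally. -/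
theorem iSup_wt_cartan {𝔤 : Type u} [LieRing 𝔤] [LieAlgebra ℂ 𝔤] [FiniteDimensional ℂ 𝔤]
    [IsKilling ℂ 𝔤] (𝔧 : LieSubalgebra ℂ 𝔤) [𝔧.IsCartanSubalgebra] : ⨆ μ, wt 𝔧 𝔤 μ = ⊤ := by
  have h := congrArg LieSubmodule.toSubmodule (iSup_genWeightSpace_eq_top' ℂ 𝔧 𝔤)
  rw [LieSubmodule.iSup_toSubmodule, LieSubmodule.top_toSubmodule] at h
  rw [eq_top_iff, ← h]
  refine iSup_le fun χ v hv => Submodule.mem_iSup_of_mem (Weight.toLinear ℂ 𝔧 𝔤 χ) (mem_wt.2 fun x => ?_)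
  exact IsKilling.lie_eq_smul_of_mem_rootSpace hv x

variable {𝔤 : Type u} [LieRing 𝔤] [LieAlgebra ℂ 𝔤] {𝔤' : LieSubalgebra ℂ 𝔤}
  {𝔧' : LieSubalgebra ℂ 𝔤'} {𝔧 : LieSubalgebra ℂ 𝔤}

theorem iSup_wt_restrict (hjj : ∀ x ∈ 𝔧', (x : 𝔤) ∈ 𝔧) {X : Type*} [AddCommGroup X] [Module ℂ X]
    [LieRingModule 𝔤 X] [LieModule ℂ 𝔤 X] (hX : ⨆ μ, wt 𝔧 X μ = ⊤) : ⨆ μ, wt 𝔧' X μ = ⊤ := by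
  let j : 𝔧' →ₗ[ℂ] 𝔧 :=
    { toFun := fun x => ⟨((x : 𝔤') : 𝔤), hjj x x.2⟩
      map_add' := fun _ _ => rfl
      map_smul' := fun _ _ => rfl }
  rw [eq_top_iff, ← hX]
  exact iSup_le fun μ v hv => Submodule.mem_iSup_of_mem (μ ∘ₗ j) (mem_wt.2 fun x =>
    mem_wt.1 hv (j x))

/-- For a hyperbolic element, the sums of eigenspaces are the sums of weight spaces. -/
theorem heightPart_eq_iSup_eigenspace {H : 𝔧'} (hH : IsHyperbolic ((H : 𝔤') : 𝔤))
    (hX : ⨆ μ, wt 𝔧' 𝔤 μ = ⊤) (habel : ∀ x : 𝔧', ⁅(x : 𝔤'), (H : 𝔤')⁆ = 0) (T : Set ℝ) :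
    heightPart 𝔤 H T = ⨆ (c : ℝ) (_ : c ∈ T), (ad ℂ 𝔤 ((H : 𝔤') : 𝔤)).eigenspace (c : ℂ) := by
  apply le_antisymm
  · refine heightPart_le fun μ hμ v hv => ?_
    by_cases h0 : v = 0
    · rw [h0]
      exact Submodule.zero_mem _
    · have h1 : v ∈ (ad ℂ 𝔤 ((H : 𝔤') : 𝔤)).eigenspace (μ H) :=
        Module.End.mem_eigenspace_iff.2 (mem_wt.1 hv H)
      have h2 := hH.2 _ (Module.End.hasEigenvalue_of_hasEigenvector ⟨h1, h0⟩)
      refine Submodule.mem_iSup_of_mem (μ H).re (Submodule.mem_iSup_of_mem hμ ?_)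
      rwa [show (((μ H).re : ℝ) : ℂ) = μ H from Complex.ext rfl (by simp [h2])]
  · refine iSup₂_le fun c hc v hv => eigenspace_le_heightPart hX habel (c := (c : ℂ)) ?_
      (Module.End.mem_eigenspace_iff.1 hv)
    simpa using hc

variable [FiniteDimensional ℂ 𝔤] [LieAlgebra.IsSemisimple ℂ 𝔤]

theorem cartan_lie (hj : 𝔧.IsCartanSubalgebra) {x y : 𝔤} (hx : x ∈ 𝔧) (hy : y ∈ 𝔧) :
    ⁅x, y⁆ = 0 := by
  have hab : IsLieAbelian 𝔧 := inferInstance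
  exact congrArg Subtype.val (hab.trivial ⟨x, hx⟩ ⟨y, hy⟩)

theorem iSup_wt_of_semisimple (hj : 𝔧.IsCartanSubalgebra) : ⨆ μ, wt 𝔧 𝔤 μ = ⊤ :=
  iSup_wt_cartan 𝔧

/-- The parabolic subalgebra `𝔭 ∩ 𝔤'` of `𝔤'` is standard. The opposite root vectors exist because
the adjoint representation of `𝔤'` on `𝔤` is completely reducible and faithful. -/
theorem isStandard_of_isHyperbolic (hred : IsReductiveSubalgebra 𝔤') {H : 𝔧'} (hH : IsHyperbolic ((H : 𝔤') : 𝔤))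
    (hj' : 𝔧'.IsCartanSubalgebra) (hj : 𝔧.IsCartanSubalgebra) (hjj : ∀ x ∈ 𝔧', (x : 𝔤) ∈ 𝔧)
    {P' : Set (Module.Dual ℂ 𝔧')} (hP' : IsPositiveSystem 𝔧' P')
    (hPstd' : ∀ α ∈ P', wt 𝔧' 𝔤' α ≤ parabolic' 𝔤' H) :
    IsStandard 𝔧' P' (levi' 𝔤' H) (nilPlus' 𝔤' H) H := by
  have hX : ⨆ μ, wt 𝔧' 𝔤 μ = ⊤ := iSup_wt_restrict hjj (iSup_wt_of_semisimple hj)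
  have habel : ∀ x y : 𝔧', ⁅(x : 𝔤'), (y : 𝔤')⁆ = 0 := fun x y =>
    Subtype.ext (cartan_lie hj (hjj x x.2) (hjj y y.2))
  let i : 𝔤' →ₗ⁅ℂ, 𝔤'⁆ 𝔤 := 𝔤'.incl'
  have hi : Function.Injective i := Subtype.val_injective
  have hX' : ⨆ μ, wt 𝔧' 𝔤' μ = ⊤ := iSup_wt_of_injective i hi hX
  have h0 : wt 𝔧' 𝔤' 0 = 𝔧'.toSubmodule := by
    ext x
    rw [mem_wt]
    constructor
    · intro hx
      have : x ∈ 𝔧'.normalizer := (LieSubalgebra.mem_normalizer_iff' 𝔧' x).2 fun y hy => by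
        have := hx ⟨y, hy⟩
        rw [LinearMap.zero_apply, zero_smul] at this
        change ⁅y, x⁆ = 0 at this
        rw [this]
        exact 𝔧'.zero_mem
      rwa [hj'.self_normalizing] at this
    · intro hx y
      rw [LinearMap.zero_apply, zero_smul]
      exact habel y ⟨x, hx⟩
  have hcl : ComplementedLattice (LieSubmodule ℂ 𝔤' 𝔤) := hred
  have hfaith : IsFaithful ℂ 𝔤' 𝔤 := by
    rw [isFaithful_iff']
    intro x hx
    have := (isFaithful_iff' ℂ 𝔤 𝔤).1 inferInstance (x : 𝔤) hx
    exact Subtype.ext this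
  have hev : ∀ {α : Module.Dual ℂ 𝔧'}, α ∈ roots 𝔧' ⊤ → ∃ v ∈ wt 𝔧' 𝔤' α, v ≠ 0 := fun hα =>
    (Submodule.ne_bot_iff _).1 (mem_roots_top.1 hα).2
  refine ⟨⟨hX', h0, fun α hα e he he0 => exists_opposite_root_vector (W := 𝔤) hX hX' h0 hα he he0⟩,
    fun x => ?_, ?_, fun α hα => ?_, hP', fun α hα => ?_, ?_⟩
  · change (x : 𝔤) ∈ levi ((H : 𝔤') : 𝔤) ↔ _
    rw [mem_levi]
    exact ⟨fun h => Subtype.ext h, fun h => congrArg Subtype.val h⟩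
  · refine Eq.trans ?_ (comap_heightPart (H := H) i hi hX (Set.Ioi 0))
    rw [heightPart_eq_iSup_eigenspace hH hX fun x => habel x H]
    rfl
  · obtain ⟨v, hv, hv0⟩ := hev hα
    have h1 : (v : 𝔤) ∈ (ad ℂ 𝔤 ((H : 𝔤') : 𝔤)).eigenspace (α H) :=
      Module.End.mem_eigenspace_iff.2 (congrArg Subtype.val (mem_wt.1 hv H))
    exact hH.2 _ (Module.End.hasEigenvalue_of_hasEigenvector ⟨h1, fun h => hv0 (Subtype.ext h)⟩)
  · obtain ⟨v, hv, hv0⟩ := hev (hP'.subset hα)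
    refine mem_of_mem_heightPart (T := Set.Ici 0) hv ?_ hv0
    rw [← comap_heightPart (H := H) i hi hX (Set.Ici 0)]
    have h1 : parabolic ((H : 𝔤') : 𝔤) ≤ heightPart 𝔤 H (Set.Ici 0) := by
      refine sup_le (fun x hx => ?_) ?_
      · refine eigenspace_le_heightPart hX (fun x => habel x H) (c := 0) (by simp) ?_
        rw [zero_smul]
        exact mem_levi.1 hx
      · refine iSup₂_le fun c hc x hx => ?_
        refine eigenspace_le_heightPart hX (fun x => habel x H) (c := c) (by simpa using hc.le) ?_
        exact Module.End.mem_eigenspace_iff.1 hx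
    exact h1 (hPstd' α hα hv)
  · exact exists_matrix_rep 𝔤' 𝔤

end Hyperbolic

/-! ### Restricting a generalized Verma module to the subalgebra -/

section Restriction

open LieModule LieAlgebra

attribute [local instance] LieRing.ofAssociativeRing

universe u

section Linear

theorem exists_finBasis_simEig {ι κ X : Type*} [AddCommGroup X] [Module ℂ X]
    [FiniteDimensional ℂ X] {T : ι → Module.End ℂ X} {χ : κ → ι → ℂ}
    (h : ⨆ k, simEig T (χ k) = ⊤) :
    ∃ (m : ℕ) (b : Module.Basis (Fin m) ℂ X) (w : Fin m → κ), ∀ i, b i ∈ simEig T (χ (w i)) := by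
  obtain ⟨s, b, w, hb⟩ := exists_basis_simEig h
  have := Module.Finite.finite_basis b
  let e := Finite.equivFin s
  exact ⟨_, b.reindex e, w ∘ e.symm, fun i => by
    rw [Module.Basis.reindex_apply]
    exact hb (e.symm i)⟩

/-- A basis of the kernel of `q`, together with a lift of a basis of the target of `q`. -/
theorem append_of_ker {K M V Q : Type*} [Field K] [AddCommGroup M] [Module K M] [AddCommGroup V]
    [Module K V] [AddCommGroup Q] [Module K Q] {j : M →ₗ[K] V} (hj : Function.Injective j)
    {q : M →ₗ[K] Q} {r s : ℕ} {y : Fin r → M} (hy : LinearIndependent K y)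
    (hspan : Submodule.span K (Set.range y) = q.ker) {z : Fin s → M}
    (hz : LinearIndependent K fun i => q (z i))
    (hzspan : Submodule.span K (Set.range fun i => q (z i)) = ⊤) :
    LinearIndependent K (Fin.append (fun i => j (y i)) fun i => j (z i)) ∧
      Submodule.span K (Set.range (Fin.append (fun i => j (y i)) fun i => j (z i))) = j.range := by
  have hcomp : (Fin.append (fun i => j (y i)) fun i => j (z i)) = j ∘ Fin.append y z := by
    ext i
    induction i using Fin.addCases <;> simp
  have hz' : LinearIndependent K (q ∘ z) := hz
  rw [hcomp]
  constructor
  · refine (linearIndependent_append hy (LinearIndependent.of_comp q hz') ?_).map' j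
      (LinearMap.ker_eq_bot.2 hj)
    rw [hspan]
    exact (Submodule.range_ker_disjoint hz').symm
  · rw [Set.range_comp, ← Submodule.map_span, span_range_append, LinearMap.range_eq_map, hspan]
    congr 1
    rw [eq_top_iff]
    rintro v -
    have hv : q v ∈ (Submodule.span K (Set.range z)).map q := by
      rw [Submodule.map_span, ← Set.range_comp]
      exact hzspan ▸ Submodule.mem_top
    obtain ⟨u, hu, huv⟩ := hv
    rw [← sub_add_cancel v u]
    exact Submodule.add_mem_sup (by rw [LinearMap.mem_ker, map_sub, huv, sub_self]) hu

end Linear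

section Weights

variable {𝔞 : Type u} [LieRing 𝔞] [LieAlgebra ℂ 𝔞] {𝔧 : LieSubalgebra ℂ 𝔞} {H : 𝔧}
variable {X : Type*} [AddCommGroup X] [Module ℂ X] [LieRingModule 𝔞 X] [LieModule ℂ 𝔞 X]

theorem heightPart_sup (T T' : Set ℝ) :
    heightPart X H T ⊔ heightPart X H T' = heightPart X H (T ∪ T') :=
  iSup_union.symm

theorem heightPart_univ (hX : ⨆ μ, wt 𝔧 X μ = ⊤) : heightPart X H Set.univ = ⊤ := by
  rw [eq_top_iff, ← hX]
  exact iSup_le fun μ v hv => wt_le_heightPart (Set.mem_univ _) hv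

theorem disjoint_heightPart {T T' : Set ℝ} (h : Disjoint T T') :
    Disjoint (heightPart X H T) (heightPart X H T') := by
  simp only [heightPart, wt_eq_simEig]
  exact disjoint_iSup_simEig (dual_injective (𝔧 := 𝔧))
    (Set.disjoint_left.2 fun μ hμ hμ' => Set.disjoint_left.1 h hμ hμ')

end Weights

variable {𝔤 : Type u} [LieRing 𝔤] [LieAlgebra ℂ 𝔤] {𝔤' : LieSubalgebra ℂ 𝔤}
  {𝔧' : LieSubalgebra ℂ 𝔤'} {H : 𝔧'}

theorem lie_mem_wt_restrict {X : Type*} [AddCommGroup X] [Module ℂ X] [LieRingModule 𝔤 X]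
    [LieModule ℂ 𝔤 X] {α μ : Module.Dual ℂ 𝔧'} {e : 𝔤} {v : X} (he : e ∈ wt 𝔧' 𝔤 α)
    (hv : v ∈ wt 𝔧' X μ) : ⁅e, v⁆ ∈ wt 𝔧' X (α + μ) := by
  rw [mem_wt] at he hv ⊢
  intro x
  have h1 : ⁅((x : 𝔤') : 𝔤), e⁆ = α x • e := he x
  have h2 : ⁅((x : 𝔤') : 𝔤), v⁆ = μ x • v := hv x
  change ⁅((x : 𝔤') : 𝔤), ⁅e, v⁆⁆ = _
  rw [leibniz_lie, h1, h2, smul_lie, lie_smul, LinearMap.add_apply, add_smul]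

theorem lie_mem_heightPart_restrict {T T' T'' : Set ℝ} (hT : ∀ s ∈ T, ∀ t ∈ T', s + t ∈ T'')
    {x y : 𝔤} (hx : x ∈ heightPart 𝔤 H T) (hy : y ∈ heightPart 𝔤 H T') :
    ⁅x, y⁆ ∈ heightPart 𝔤 H T'' := by
  have h1 : heightPart 𝔤 H T ≤ (heightPart 𝔤 H T'').comap
      ((toEnd ℂ 𝔤 𝔤 : 𝔤 →ₗ[ℂ] Module.End ℂ 𝔤).flip y) := heightPart_le fun μ hμ x hx => by
    have h2 : heightPart 𝔤 H T' ≤ (heightPart 𝔤 H T'').comap (toEnd ℂ 𝔤 𝔤 x) :=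
      heightPart_le fun ν hν y hy => wt_le_heightPart (by
        rw [LinearMap.add_apply, Complex.add_re]
        exact hT _ hμ _ hν) (lie_mem_wt_restrict hx hy)
    exact h2 hy
  exact h1 hx

/-- A simple module with a weight vector is a weight module. -/
theorem iSup_lwt_of_isIrreducible {𝔧 𝔩 : LieSubalgebra ℂ 𝔤} (h𝔧 : ⨆ μ, wt 𝔧 𝔤 μ = ⊤) (hle : 𝔧 ≤ 𝔩)
    {F : Type*} [AddCommGroup F] [Module ℂ F] [LieRingModule 𝔩 F] [LieModule ℂ 𝔩 F]
    [IsIrreducible ℂ 𝔩 F] {μ : Module.Dual ℂ 𝔧} {v : F} (hv : v ∈ lwt 𝔧 𝔩 F μ) (hv0 : v ≠ 0) :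
    ⨆ μ, lwt 𝔧 𝔩 F μ = ⊤ := by
  let T : {x : 𝔩 // (x : 𝔤) ∈ 𝔧} → Module.End ℂ 𝔤 := fun x => ad ℂ 𝔤 ((x : 𝔩) : 𝔤)
  have h𝔩 : ⨆ μ, lwt 𝔧 𝔩 𝔩 μ = ⊤ := by
    refine iSup_simEig_of_injective (lwt_injective hle) (q := 𝔩.toSubmodule.subtype) (T' := T)
      (fun _ _ => rfl) Subtype.val_injective ?_
    rw [eq_top_iff, ← h𝔧]
    exact iSup_mono fun μ x hx => mem_simEig.2 fun y => mem_wt.1 hx ⟨y.1, y.2⟩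
  let N : LieSubmodule ℂ 𝔩 F :=
    { (⨆ μ, lwt 𝔧 𝔩 F μ : Submodule ℂ F) with
      lie_mem := fun {x w} hw => by
        have h1 : ⨆ μ, lwt 𝔧 𝔩 F μ ≤ (⨆ μ, lwt 𝔧 𝔩 F μ).comap (toEnd ℂ 𝔩 F x) := by
          refine iSup_le fun μ w hw => ?_
          have h2 : (⨆ α, lwt 𝔧 𝔩 𝔩 α) ≤ (⨆ μ, lwt 𝔧 𝔩 F μ).comap
              ((toEnd ℂ 𝔩 F : 𝔩 →ₗ[ℂ] Module.End ℂ F).flip w) :=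
            iSup_le fun α x hx => Submodule.mem_iSup_of_mem (α + μ) (mem_lwt.2 fun y hy => by
              change ⁅y, ⁅x, w⁆⁆ = (α + μ) _ • ⁅x, w⁆
              rw [leibniz_lie, mem_lwt.1 hx y hy, mem_lwt.1 hw y hy, smul_lie, lie_smul,
                LinearMap.add_apply, add_smul])
          exact h2 (h𝔩 ▸ Submodule.mem_top : x ∈ _)
        exact h1 hw }
  have hN : N ≠ ⊥ := fun h => hv0 ((LieSubmodule.mem_bot (R := ℂ) (L := 𝔩) v).1
    (h ▸ (show v ∈ N from Submodule.mem_iSup_of_mem μ hv)))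
  have h3 := (IsSimpleOrder.eq_bot_or_eq_top N).resolve_left hN
  exact congrArg LieSubmodule.toSubmodule h3

/-- A weight module for `𝔧` is a weight module for the smaller subalgebra `𝔧'`. -/
theorem iSup_lwt_pullback {𝔧 : LieSubalgebra ℂ 𝔤} (hjj : ∀ x ∈ 𝔧', (x : 𝔤) ∈ 𝔧) {F : Type*} [AddCommGroup F] [Module ℂ F]
    [LieRingModule (levi ((H : 𝔤') : 𝔤)) F] [LieModule ℂ (levi ((H : 𝔤') : 𝔤)) F]
    (hF : ⨆ μ, lwt 𝔧 (levi ((H : 𝔤') : 𝔤)) F μ = ⊤) :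
    ⨆ μ, lwt 𝔧' (levi' 𝔤' H) (Pullback (leviIncl 𝔤' H) F) μ = ⊤ := by
  let j : 𝔧' →ₗ[ℂ] 𝔧 :=
    { toFun := fun x => ⟨((x : 𝔤') : 𝔤), hjj x x.2⟩
      map_add' := fun _ _ => rfl
      map_smul' := fun _ _ => rfl }
  rw [eq_top_iff]
  rintro v -
  have hv : ∀ v ∈ ⨆ μ, lwt 𝔧 (levi ((H : 𝔤') : 𝔤)) F μ, (show Pullback (leviIncl 𝔤' H) F from v) ∈
      ⨆ μ, lwt 𝔧' (levi' 𝔤' H) (Pullback (leviIncl 𝔤' H) F) μ := fun v hv => by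
    induction hv using Submodule.iSup_induction' with
    | mem μ v hv =>
      exact Submodule.mem_iSup_of_mem (μ ∘ₗ j) (mem_lwt.2 fun x hx =>
        mem_lwt.1 hv ⟨((x : 𝔤') : 𝔤), x.2⟩ (hjj _ hx))
    | zero => exact Submodule.zero_mem _
    | add x y _ _ hx hy => exact Submodule.add_mem _ hx hy
  exact hv v (hF ▸ Submodule.mem_top)

section Decomposition

variable (hH : IsHyperbolic ((H : 𝔤') : 𝔤)) (hX : ⨆ μ, wt 𝔧' 𝔤 μ = ⊤)
  (habel : ∀ x : 𝔧', ⁅(x : 𝔤'), (H : 𝔤')⁆ = 0)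
include hH hX habel

theorem nilPlus_eq : nilPlus ((H : 𝔤') : 𝔤) = heightPart 𝔤 H (Set.Ioi 0) :=
  (heightPart_eq_iSup_eigenspace hH hX habel _).symm

theorem nilMinus_eq : nilMinus ((H : 𝔤') : 𝔤) = heightPart 𝔤 H (Set.Iio 0) :=
  (heightPart_eq_iSup_eigenspace hH hX habel _).symm

theorem levi_eq : (levi ((H : 𝔤') : 𝔤)).toSubmodule = heightPart 𝔤 H {0} := by
  rw [heightPart_eq_iSup_eigenspace hH hX habel]
  simp only [Set.mem_singleton_iff, iSup_iSup_eq_left, Complex.ofReal_zero]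
  rfl

theorem disjoint_levi_nilPlus :
    Disjoint (levi ((H : 𝔤') : 𝔤)).toSubmodule (nilPlus ((H : 𝔤') : 𝔤)) := by
  rw [levi_eq hH hX habel, nilPlus_eq hH hX habel]
  exact disjoint_heightPart (by simp)

theorem isCompl_nilMinus : IsCompl (nilMinus ((H : 𝔤') : 𝔤))
    ((levi ((H : 𝔤') : 𝔤)).toSubmodule ⊔ nilPlus ((H : 𝔤') : 𝔤)) := by
  rw [levi_eq hH hX habel, nilPlus_eq hH hX habel, nilMinus_eq hH hX habel, heightPart_sup]
  have h1 : ({0} ∪ Set.Ioi 0 : Set ℝ) = Set.Ici 0 := by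
    rw [Set.union_comm, Set.Ioi_union_left]
  rw [h1]
  refine ⟨disjoint_heightPart (Set.disjoint_left.2 fun x hx hx' => absurd (Set.mem_Ici.1 hx') (not_le.2 hx)), ?_⟩
  rw [codisjoint_iff, heightPart_sup, Set.Iio_union_Ici, heightPart_univ hX]

theorem lie_mem_nilPlus {x z : 𝔤} (hx : x ∈ levi ((H : 𝔤') : 𝔤)) (hz : z ∈ nilPlus ((H : 𝔤') : 𝔤)) :
    ⁅x, z⁆ ∈ nilPlus ((H : 𝔤') : 𝔤) := by
  have hx' : x ∈ (levi ((H : 𝔤') : 𝔤)).toSubmodule := hx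
  rw [levi_eq hH hX habel] at hx'
  rw [nilPlus_eq hH hX habel] at hz ⊢
  refine lie_mem_heightPart_restrict (fun s hs t ht => ?_) hx' hz
  rw [Set.mem_singleton_iff.1 hs, zero_add]
  exact ht

theorem nilPlus_lie_mem_nilPlus {x z : 𝔤} (hx : x ∈ nilPlus ((H : 𝔤') : 𝔤))
    (hz : z ∈ nilPlus ((H : 𝔤') : 𝔤)) : ⁅x, z⁆ ∈ nilPlus ((H : 𝔤') : 𝔤) := by
  rw [nilPlus_eq hH hX habel] at hx hz ⊢
  exact lie_mem_heightPart_restrict (fun s hs t ht => add_pos hs ht) hx hz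

end Decomposition

end Restriction

/-! ### Freeness over the opposite nilradical of the subalgebra -/

section Free

open LieModule LieAlgebra

attribute [local instance] LieRing.ofAssociativeRing

universe u

variable {𝔤 : Type u} [LieRing 𝔤] [LieAlgebra ℂ 𝔤] {𝔤' : LieSubalgebra ℂ 𝔤}
  {𝔧' : LieSubalgebra ℂ 𝔤'} {H : 𝔧'}

theorem toral_le_levi' (habel : ∀ x : 𝔧', ⁅(x : 𝔤'), (H : 𝔤')⁆ = 0) : 𝔧' ≤ levi' 𝔤' H := fun x hx => by
  change (x : 𝔤) ∈ levi ((H : 𝔤') : 𝔤)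
  rw [mem_levi, ← lie_skew, neg_eq_zero]
  exact congrArg Subtype.val (habel ⟨x, hx⟩)

/-- The kernel of the projection `𝔲₋ → 𝔲₋ / (𝔲₋ ∩ 𝔤')`, as an `𝔩'`-module. -/
abbrev nilKernel (𝔤' : LieSubalgebra ℂ 𝔤) (H : 𝔤') :
    LieSubmodule ℂ (levi' 𝔤' H) (nilMinusModule 𝔤' H) :=
  (subModule 𝔤' H).comap (nilMinusModule 𝔤' H).incl

section Decomposition

variable [FiniteDimensional ℂ 𝔤] (hH : IsHyperbolic ((H : 𝔤') : 𝔤)) (hX : ⨆ μ, wt 𝔧' 𝔤 μ = ⊤)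
  (habel : ∀ x : 𝔧', ⁅(x : 𝔤'), (H : 𝔤')⁆ = 0)
include hH hX habel

theorem iSup_lwt_nilMinus : ⨆ μ, lwt 𝔧' (levi' 𝔤' H) (nilMinusModule 𝔤' H) μ = ⊤ := by
  refine iSup_lwt_of_injective (toral_le_levi' habel) (nilMinusModule 𝔤' H).incl
    Subtype.val_injective ?_
  simp only [lwt_eq_wt (toral_le_levi' habel)]
  exact hX

theorem mem_wt_of_mem_lwt_nilMinus {μ : Module.Dual ℂ 𝔧'} {v : nilMinusModule 𝔤' H}
    (hv : v ∈ lwt 𝔧' (levi' 𝔤' H) (nilMinusModule 𝔤' H) μ) : (v : 𝔤) ∈ wt 𝔧' 𝔤 μ := by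
  rw [← lwt_eq_wt (toral_le_levi' habel)]
  exact map_mem_lwt (nilMinusModule 𝔤' H).incl hv

theorem height_neg_of_mem_lwt_nilMinus {μ : Module.Dual ℂ 𝔧'} {v : nilMinusModule 𝔤' H}
    (hv : v ∈ lwt 𝔧' (levi' 𝔤' H) (nilMinusModule 𝔤' H) μ) (hv0 : v ≠ 0) : (μ H).re < 0 := by
  refine mem_of_mem_heightPart (T := Set.Iio 0) (mem_wt_of_mem_lwt_nilMinus hH hX habel hv) ?_
    fun h => hv0 (Subtype.ext h)
  rw [← nilMinus_eq hH hX habel]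
  exact v.2

/-- A weight basis of `𝔲₋ ∩ 𝔤'` is a lowering family for `𝔤'`. -/
theorem exists_isLowering : ∃ (m : ℕ) (k : Module.Basis (Fin m) ℂ (nilKernel 𝔤' H))
    (η : Fin m → Module.Dual ℂ 𝔧'), IsLowering H (fun i => (⟨(k i : nilMinusModule 𝔤' H), (k i).2⟩ : 𝔤')) η := by
  obtain ⟨m, k, η, hk⟩ := exists_finBasis_simEig (iSup_lwt_of_injective (toral_le_levi' habel)
    (nilKernel 𝔤' H).incl Subtype.val_injective (iSup_lwt_nilMinus hH hX habel))
  have hk' : ∀ i, (k i : nilMinusModule 𝔤' H) ∈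
      lwt 𝔧' (levi' 𝔤' H) (nilMinusModule 𝔤' H) (η i) := fun i =>
    map_mem_lwt (nilKernel 𝔤' H).incl (hk i)
  refine ⟨m, k, η, fun i => ?_, fun i => ?_, ?_⟩
  · exact mem_wt.2 fun x => Subtype.ext (mem_wt.1 (mem_wt_of_mem_lwt_nilMinus hH hX habel (hk' i)) x)
  · exact height_neg_of_mem_lwt_nilMinus hH hX habel (hk' i) fun h => k.ne_zero i (Subtype.ext h)
  · let φ : nilKernel 𝔤' H →ₗ[ℂ] 𝔤' :=
      { toFun := fun v => ⟨(v : nilMinusModule 𝔤' H), v.2⟩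
        map_add' := fun _ _ => rfl
        map_smul' := fun _ _ => rfl }
    have h1 : Submodule.span ℂ (Set.range fun i => φ (k i)) = φ.range := by
      rw [LinearMap.range_eq_map, ← k.span_eq, Submodule.map_span, ← Set.range_comp]
      rfl
    have h2 : φ.range = (nilMinus ((H : 𝔤') : 𝔤)).comap 𝔤'.toSubmodule.subtype := by
      ext x
      constructor
      · rintro ⟨v, rfl⟩
        exact (v : nilMinusModule 𝔤' H).2
      · intro hx
        exact ⟨⟨⟨x, hx⟩, x.2⟩, rfl⟩
    refine h1.trans (h2.trans ?_)
    rw [nilMinus_eq hH hX habel]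
    exact comap_heightPart (H := H) 𝔤'.incl' Subtype.val_injective hX (Set.Iio 0)

/-- Weight vectors of `𝔲₋` that lift a weight basis of `𝔲₋ / (𝔲₋ ∩ 𝔤')`. -/
theorem exists_basis_nilQuotient : ∃ (r : ℕ) (q : Module.Basis (Fin r) ℂ (NilQuotient 𝔤' H))
    (θ : Fin r → Module.Dual ℂ 𝔧') (z : Fin r → nilMinusModule 𝔤' H),
    (∀ i, q i ∈ lwt 𝔧' (levi' 𝔤' H) (NilQuotient 𝔤' H) (θ i)) ∧
    (∀ i, z i ∈ lwt 𝔧' (levi' 𝔤' H) (nilMinusModule 𝔤' H) (θ i)) ∧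
    ∀ i, LieSubmodule.Quotient.mk' (nilKernel 𝔤' H) (z i) = q i := by
  have hM := iSup_lwt_nilMinus hH hX habel
  have hsurj := LieSubmodule.Quotient.surjective_mk' (nilKernel 𝔤' H)
  obtain ⟨r, q, θ, hq⟩ := exists_finBasis_simEig
    (iSup_lwt_of_surjective (LieSubmodule.Quotient.mk' (nilKernel 𝔤' H)) hsurj hM)
  let p : nilMinusModule 𝔤' H →ₗ[ℂ] NilQuotient 𝔤' H := LieSubmodule.Quotient.mk' (nilKernel 𝔤' H)
  have hz : ∀ i, ∃ z ∈ lwt 𝔧' (levi' 𝔤' H) (nilMinusModule 𝔤' H) (θ i), p z = q i := fun i =>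
    exists_lift_simEig (lwt_injective (toral_le_levi' habel)) (q := p)
      (fun x v => LieModuleHom.map_lie (LieSubmodule.Quotient.mk' (nilKernel 𝔤' H)) x.1 v)
      hsurj hM (hq i)
  choose z hz hzq using hz
  exact ⟨r, q, θ, z, hq, hz, hzq⟩

/-- The restriction of `U(𝔤) ⊗_{U(𝔭)} F` to `𝔤'` is free over the enveloping algebra of
`𝔲₋ ∩ 𝔤'`. By the Poincaré–Birkhoff–Witt theorem, a basis is given by ordered monomials in weight
vectors of `𝔲₋` that lift a basis of `𝔲₋ / (𝔲₋ ∩ 𝔤')`, applied to a basis of `F`. -/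
theorem exists_isLoweringFree [IsFaithful ℂ 𝔤 𝔤] {F : Type*} [AddCommGroup F] [Module ℂ F]
    [LieRingModule (levi ((H : 𝔤') : 𝔤)) F] [LieModule ℂ (levi ((H : 𝔤') : 𝔤)) F]
    {J : Type*} [Finite J] {f : J → F} (hf : LinearIndependent ℂ f)
    (hfspan : Submodule.span ℂ (Set.range f) = ⊤) {w : J → Module.Dual ℂ 𝔧'}
    (hw : ∀ j, (show Pullback (leviIncl 𝔤' H) F from f j) ∈
      lwt 𝔧' (levi' 𝔤' H) (Pullback (leviIncl 𝔤' H) F) (w j)) :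
    ∃ (m r : ℕ) (y : Fin m → 𝔤') (η : Fin m → Module.Dual ℂ 𝔧')
      (q : Module.Basis (Fin r) ℂ (NilQuotient 𝔤' H)) (θ : Fin r → Module.Dual ℂ 𝔧')
      (n : (Fin r → ℕ) × J → GenVerma (levi ((H : 𝔤') : 𝔤)) (nilPlus ((H : 𝔤') : 𝔤)) F),
      (∀ i, q i ∈ lwt 𝔧' (levi' 𝔤' H) (NilQuotient 𝔤' H) (θ i)) ∧
      IsLoweringFree H y η n fun p => ∑ i, p.1 i • θ i + w p.2 := by
  obtain ⟨m, k, η, hy⟩ := exists_isLowering hH hX habel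
  obtain ⟨r, q, θ, z, hq, hz, hzq⟩ := exists_basis_nilQuotient hH hX habel
  set y : Fin m → 𝔤' := fun i => ⟨(k i : nilMinusModule 𝔤' H), (k i).2⟩
  set X := GenVerma (levi ((H : 𝔤') : 𝔤)) (nilPlus ((H : 𝔤') : 𝔤)) F
  let p : nilMinusModule 𝔤' H →ₗ[ℂ] NilQuotient 𝔤' H := LieSubmodule.Quotient.mk' (nilKernel 𝔤' H)
  have hp : ∀ i, p (z i) = q i := hzq
  have hker : p.ker = (nilKernel 𝔤' H).toSubmodule := by
    ext v
    exact LieSubmodule.Quotient.mk_eq_zero (nilKernel 𝔤' H)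
  obtain ⟨hY, hYspan⟩ := append_of_ker (j := (nilMinusModule 𝔤' H).toSubmodule.subtype)
    Subtype.val_injective (q := p) (y := fun i => (k i : nilMinusModule 𝔤' H)) (z := z)
    (k.linearIndependent.map' (nilKernel 𝔤' H).toSubmodule.subtype (Submodule.ker_subtype _))
    (by
      rw [hker, ← Submodule.range_subtype (nilKernel 𝔤' H).toSubmodule, LinearMap.range_eq_map,
        ← k.span_eq, Submodule.map_span, ← Set.range_comp]
      rfl)
    (by simp only [hp]; exact q.linearIndependent) (by simp only [hp]; exact q.span_eq)
  -- `Y` is a basis of `𝔲₋` that begins with a basis of `𝔲₋ ∩ 𝔤'`, so that the ordered monomials in `Y`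
  -- are products of monomials in `y` and monomials in `z`.
  set Y : Fin (m + r) → 𝔤 := Fin.append
    (fun i => (nilMinusModule 𝔤' H).toSubmodule.subtype (k i : nilMinusModule 𝔤' H))
    fun i => (nilMinusModule 𝔤' H).toSubmodule.subtype (z i) with hYdef
  rw [Submodule.range_subtype] at hYspan
  have hYspan' : Submodule.span ℂ (Set.range Y) = nilMinus ((H : 𝔤') : 𝔤) := hYspan
  have hc := isCompl_nilMinus hH hX habel
  rw [← hYspan'] at hc
  obtain ⟨N, ρ, hρ⟩ := exists_matrix_rep 𝔤 𝔤
  obtain ⟨M, hM⟩ := GenVerma.exists_coords_of_isCompl (F := F)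
    (fun x hx z hz => lie_mem_nilPlus hH hX habel hx hz)
    (fun x hx z hz => nilPlus_lie_mem_nilPlus hH hX habel hx hz)
    (disjoint_levi_nilPlus hH hX habel) hY hc ρ hρ
  let n : (Fin r → ℕ) × J → X := fun β =>
    omon (fun i => toEnd ℂ 𝔤 X (z i : 𝔤)) β.1 (GenVerma.of _ _ F (f β.2))
  have hYT : (fun i => toEnd ℂ 𝔤 X (Y i)) =
      Fin.append (fun i => toEnd ℂ 𝔤' X (y i)) fun i => toEnd ℂ 𝔤 X (z i : 𝔤) := by
    funext i
    induction i using Fin.addCases with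
    | left i => rw [hYdef, Fin.append_left, Fin.append_left]; rfl
    | right i => rw [hYdef, Fin.append_right, Fin.append_right]; rfl
  have hmon : ∀ a b j, monomials y n (a, (b, j)) =
      omon (fun i => toEnd ℂ 𝔤 X (Y i)) (Fin.append a b) (GenVerma.of _ _ F (f j)) := by
    intro a b j
    rw [hYT, omon_append]
    rfl
  have hneg : ∀ i, (θ i H).re < 0 := fun i =>
    height_neg_of_mem_lwt_nilMinus hH hX habel (hz i) fun h => q.ne_zero i (by rw [← hp, h, map_zero])
  refine ⟨m, r, y, η, q, θ, n, hq, hy, fun β => ?_, ?_, ?_, ?_⟩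
  · refine omon_apply_mem_wt (fun i μ v hv => lie_mem_wt_restrict
      (mem_wt_of_mem_lwt_nilMinus hH hX habel (hz i)) hv) β.1 (mem_wt.2 fun x => ?_)
    have h1 := mem_lwt.1 (hw β.2) ⟨x, toral_le_levi' habel x.2⟩ x.2
    exact (GenVerma.lie_of (leviIncl 𝔤' H ⟨x, toral_le_levi' habel x.2⟩) (f β.2)).trans
      ((congrArg (GenVerma.of _ _ F) h1).trans (map_smul (GenVerma.of _ _ F) _ _))
  · have h1 := (GenVerma.linearIndependent_omon hM hf).comp
      (fun p : (Fin m → ℕ) × (Fin r → ℕ) × J => (Fin.append p.1 p.2.1, p.2.2)) ?_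
    · convert h1 using 1
      funext p
      exact hmon p.1 p.2.1 p.2.2
    · rintro ⟨a, b, j⟩ ⟨a', b', j'⟩ h
      obtain ⟨h1, h2⟩ := Prod.mk.inj h
      have ha : a = a' := funext fun i => by simpa using congrFun h1 (Fin.castAdd r i)
      have hb : b = b' := funext fun i => by simpa using congrFun h1 (Fin.natAdd m i)
      rw [ha, hb, show j = j' from h2]
  · rw [eq_top_iff]
    let b := Module.finBasis ℂ ((levi ((H : 𝔤') : 𝔤)).toSubmodule ⊔ nilPlus ((H : 𝔤') : 𝔤) : Submodule ℂ 𝔤)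
    have hb : Submodule.span ℂ (Set.range fun i => (b i : 𝔤)) =
        (levi ((H : 𝔤') : 𝔤)).toSubmodule ⊔ nilPlus ((H : 𝔤') : 𝔤) := by
      conv_rhs => rw [← Submodule.range_subtype ((levi ((H : 𝔤') : 𝔤)).toSubmodule ⊔ nilPlus ((H : 𝔤') : 𝔤)),
        LinearMap.range_eq_map, ← b.span_eq, Submodule.map_span, ← Set.range_comp]
      rfl
    rw [← GenVerma.span_omon (y := Y) (z := fun i => (b i : 𝔤)) (F := F)
      (by rw [span_range_append, hb, hc.sup_eq_top]) fun i => (b i).2, Submodule.span_le]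
    rintro _ ⟨⟨c, v⟩, rfl⟩
    have hv : v ∈ Submodule.span ℂ (Set.range f) := hfspan ▸ Submodule.mem_top
    have h2 : Submodule.span ℂ (Set.range f) ≤ (Submodule.span ℂ (Set.range (monomials y n))).comap
        (omon (fun i => toEnd ℂ 𝔤 X (Y i)) c ∘ₗ GenVerma.of _ _ F) := by
      rw [Submodule.span_le]
      rintro _ ⟨j, rfl⟩
      refine Submodule.subset_span
        ⟨(fun i => c (Fin.castAdd r i), fun i => c (Fin.natAdd m i), j), ?_⟩
      rw [hmon, Fin.append_castAdd_natAdd]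
      rfl
    exact h2 hv
  · exact finite_setOf_le_height hneg fun t => Set.toFinite _

end Decomposition

end Free

/-! ### Weights of the symmetric algebra -/

section Symmetric

open LieModule LieAlgebra

variable {L : Type*} [LieRing L] [LieAlgebra ℂ L] {Q : Type*} [AddCommGroup Q] [Module ℂ Q]
  [LieRingModule L Q] [LieModule ℂ L Q] {r : ℕ}

/-- Monomials in eigenvectors are eigenvectors for the derivation extending the action. -/
theorem sym_lie_prod {x : L} {q : Fin r → Q} {c : Fin r → ℂ} (hq : ∀ i, ⁅x, q i⁆ = c i • q i)
    (b : Fin r → ℕ) :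
    ⁅x, ∏ i, SymmetricAlgebra.ι ℂ Q (q i) ^ b i⁆ =
      (∑ i, b i * c i) • ∏ i, SymmetricAlgebra.ι ℂ Q (q i) ^ b i := by
  set D := symDer (toEnd ℂ L Q x)
  have hmul : ∀ {s t : SymmetricAlgebra ℂ Q} {α β : ℂ}, D s = α • s → D t = β • t →
      D (s * t) = (α + β) • (s * t) := by
    intro s t α β hs ht
    rw [Derivation.leibniz, hs, ht, smul_eq_mul, smul_eq_mul, mul_smul_comm, mul_smul_comm,
      mul_comm t s, ← add_smul, add_comm]
  have hpow : ∀ i (n : ℕ), D (SymmetricAlgebra.ι ℂ Q (q i) ^ n) =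
      (n * c i) • SymmetricAlgebra.ι ℂ Q (q i) ^ n := by
    intro i n
    induction n with
    | zero => simp
    | succ n ih =>
      rw [pow_succ, hmul ih (β := c i) (by rw [symDer_ι, toEnd_apply_apply, hq, map_smul])]
      congr 1
      push_cast
      ring
  change D _ = _
  induction (Finset.univ : Finset (Fin r)) using Finset.induction_on with
  | empty => simp
  | insert i s hi ih =>
    rw [Finset.prod_insert hi, Finset.sum_insert hi]
    exact hmul (hpow i _) ih

theorem exists_basis_symmetricAlgebra (q : Module.Basis (Fin r) ℂ Q) :
    ∃ S : Module.Basis (Fin r → ℕ) ℂ (SymmetricAlgebra ℂ Q), ∀ b,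
      S b = ∏ i, SymmetricAlgebra.ι ℂ Q (q i) ^ b i := by
  refine ⟨q.symmetricAlgebra.reindex Finsupp.equivFunOnFinite, fun b => ?_⟩
  rw [Module.Basis.reindex_apply, Module.Basis.symmetricAlgebra, Module.Basis.map_apply,
    MvPolynomial.coe_basisMonomials]
  change (SymmetricAlgebra.equivMvPolynomial q).symm (MvPolynomial.monomial _ 1) = _
  rw [MvPolynomial.monomial_eq, Finsupp.prod_fintype _ _ fun i => pow_zero _]
  simp [map_prod]

variable {𝔞 : Type*} [LieRing 𝔞] [LieAlgebra ℂ 𝔞] {𝔧 𝔩 : LieSubalgebra ℂ 𝔞}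
  {F N : Type*} [AddCommGroup F] [Module ℂ F] [LieRingModule 𝔩 F] [LieModule ℂ 𝔩 F]
  [AddCommGroup N] [Module ℂ N] [LieRingModule 𝔩 N] [LieModule ℂ 𝔩 N]

/-- Weight bases of `F` and `N` give a weight basis of `F ⊗ S(N)`. -/
theorem exists_basis_tensor_symmetricAlgebra {J : Type*} (f : Module.Basis J ℂ F)
    {w : J → Module.Dual ℂ 𝔧} (hf : ∀ j, f j ∈ lwt 𝔧 𝔩 F (w j)) (q : Module.Basis (Fin r) ℂ N)
    {θ : Fin r → Module.Dual ℂ 𝔧} (hq : ∀ i, q i ∈ lwt 𝔧 𝔩 N (θ i)) :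
    ∃ v : Module.Basis ((Fin r → ℕ) × J) ℂ (F ⊗[ℂ] SymmetricAlgebra ℂ N),
      ∀ p, v p ∈ lwt 𝔧 𝔩 (F ⊗[ℂ] SymmetricAlgebra ℂ N) (∑ i, p.1 i • θ i + w p.2) := by
  obtain ⟨S, hS⟩ := exists_basis_symmetricAlgebra q
  refine ⟨(f.tensorProduct S).reindex (Equiv.prodComm _ _), fun p => mem_lwt.2 fun x hx => ?_⟩
  have h1 : ((f.tensorProduct S).reindex (Equiv.prodComm _ _)) p = f p.2 ⊗ₜ S p.1 := by
    rw [Module.Basis.reindex_apply, Module.Basis.tensorProduct_apply]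
    rfl
  rw [h1, TensorProduct.LieModule.lie_tmul_right, mem_lwt.1 (hf p.2) x hx, hS,
    sym_lie_prod (fun i => mem_lwt.1 (hq i) x hx), ← TensorProduct.smul_tmul',
    TensorProduct.tmul_smul, ← add_smul, add_comm]
  congr 1
  simp

end Symmetric

end BGG

end

open BGG in
theorem theorem3p8
    {𝔤 : Type*} [LieRing 𝔤] [LieAlgebra ℂ 𝔤] [FiniteDimensional ℂ 𝔤]
    [LieAlgebra.IsSemisimple ℂ 𝔤]
    -- the reductive subalgebra and the hyperbolic element that defines `𝔭 = 𝔩 + 𝔲₊`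
    (𝔤' : LieSubalgebra ℂ 𝔤) (hred : IsReductiveSubalgebra 𝔤')
    (H : 𝔤') (hH : IsHyperbolic (H : 𝔤))
    -- Cartan subalgebras with `H ∈ 𝔧' ⊆ 𝔧`
    (𝔧' : LieSubalgebra ℂ 𝔤') (hj' : 𝔧'.IsCartanSubalgebra) (hHj' : H ∈ 𝔧')
    (𝔧 : LieSubalgebra ℂ 𝔤) (hj : 𝔧.IsCartanSubalgebra) (hjj : ∀ x ∈ 𝔧', (x : 𝔤) ∈ 𝔧)
    -- positive systems for which `𝔭` and `𝔭' = 𝔭 ∩ 𝔤'` are standard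
    (P : Set (Module.Dual ℂ 𝔧)) (hP : IsPositiveSystem 𝔧 P)
    (hPstd : ∀ α ∈ P, wt 𝔧 𝔤 α ≤ parabolic (H : 𝔤))
    (P' : Set (Module.Dual ℂ 𝔧')) (hP' : IsPositiveSystem 𝔧' P')
    (hPstd' : ∀ α ∈ P', wt 𝔧' 𝔤' α ≤ parabolic' 𝔤' H)
    -- `λ ∈ Λ⁺(𝔩)` and the finite dimensional simple `𝔩`-module `F = F_λ` with highest weight `λ`
    (lam : Module.Dual ℂ 𝔧) (hlam : lam ∈ dominant 𝔧 P (levi (H : 𝔤)))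
    (F : Type*) [AddCommGroup F] [Module ℂ F] [FiniteDimensional ℂ F]
    [LieRingModule (levi (H : 𝔤)) F] [LieModule ℂ (levi (H : 𝔤)) F]
    (hFsimple : LieModule.IsIrreducible ℂ (levi (H : 𝔤)) F)
    (hFlam : HasHighestWeight 𝔧 P (levi (H : 𝔤)) lam F) :
    (∀ δ ∈ dominant 𝔧' P' (levi' 𝔤' H),
      FiniteDimensional ℂ (BranchingHom 𝔤' H 𝔧' P' δ F)) ∧
    GrothendieckIdentity 𝔧' P' (levi' 𝔤' H)
      (GenVerma (levi (H : 𝔤)) (nilPlus (H : 𝔤)) F)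
      (fun δ : dominant 𝔧' P' (levi' 𝔤' H) => mult 𝔤' H 𝔧' P' δ F)
      (fun δ : dominant 𝔧' P' (levi' 𝔤' H) =>
        GenVerma (levi' 𝔤' H) (nilPlus' 𝔤' H) (SimpleHW 𝔧' P' (levi' 𝔤' H) δ)) := by
  obtain ⟨H, rfl⟩ : ∃ H' : 𝔧', (H' : 𝔤') = H := ⟨⟨H, hHj'⟩, rfl⟩
  have hX : ⨆ μ, wt 𝔧' 𝔤 μ = ⊤ := iSup_wt_restrict hjj (iSup_wt_of_semisimple hj)
  have habel : ∀ x : 𝔧', ⁅(x : 𝔤'), (H : 𝔤')⁆ = 0 := fun x =>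
    Subtype.ext (cartan_lie hj (hjj x x.2) (hjj H H.2))
  have hD := isStandard_of_isHyperbolic hred hH hj' hj hjj hP' hPstd'
  obtain ⟨v₀, hv₀, hv₀wt, -⟩ := hFlam
  have hle : 𝔧 ≤ levi ((H : 𝔤') : 𝔤) := fun x hx => mem_levi.2 (cartan_lie hj (hjj H H.2) hx)
  have hF : ⨆ μ, lwt 𝔧' (levi' 𝔤' H) (Pullback (leviIncl 𝔤' H) F) μ = ⊤ :=
    iSup_lwt_pullback hjj
      (iSup_lwt_of_isIrreducible (iSup_wt_of_semisimple hj) hle (mem_lwt.2 hv₀wt) hv₀)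
  have hfd : FiniteDimensional ℂ (Pullback (leviIncl 𝔤' H) F) := ‹FiniteDimensional ℂ F›
  obtain ⟨N, f, w, hf⟩ := exists_finBasis_simEig hF
  let g : Fin N → F := f
  have hg : LinearIndependent ℂ g := f.linearIndependent
  obtain ⟨m, r, y, η, q, θ, n, hq, hfree⟩ :=
    exists_isLoweringFree hH hX habel hg f.span_eq hf
  obtain ⟨v, hv⟩ := exists_basis_tensor_symmetricAlgebra f hf q hq
  exact ⟨fun δ _ => hfree.finite_hom hD v hv δ, hfree.grothendieckIdentity hD v hv⟩
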